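/- Let $m\ge 1$ and let $q_0,\dots,q_{m-1}\in\mathbb C(z)$ be rational functions such that the equation $$L:\quad y^{(m)}=\sum_{i=0}^{m-1}q_i\,y^{(i)}$$ is Fuchsian, i.e. every point of the Riemann sphere (including $\infty$) is an ordinary point or a regular singular point of $L$. Let $S\subset\mathbb C$ be the finite set of poles of the $q_i$ (the singular points of $L$ in $\mathbb C$), and assume $S\neq\emptyset$. Assume that $L$ is generic: for every $t\in S$ there is a basis $y_1,\dots,y_m$ of the space of solutions near $t$ (branches on a disc around $t$ cut along a ray from $t$) such that $y_2,\dots,y_m$ extend holomorphically to $t$ and $y_1$ does not. For $n\ge 0$ let $q_{0,n},\dots,q_{m-1,n}\in\mathbb C(z)$ be the rational functions, obtained by successive differentiation of $L$, with $y^{(n)}=\sum_{i=0}^{m-1}q_{i,n}\,y^{(i)}$ for all solutions $y$ of $L$. Let $A_L\subset\mathbb C$ be the union of the perpendicular bisectors of the segments joining two different points of $S$. Then for every connected component $U$ of $\mathbb C\setminus A_L$ there are subsets $E_0,\dots,E_{m-1}$ of $U$, each with only finitely many points in any compact subset of $U$, such that: (1) for all $j\ne k$ in $\{0,\dots,m-1\}$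 such that $q_{j,n}\not\equiv 0$ for infinitely many $n$, one has $q_{j,n}\not\equiv 0$ for all large $n$, and as $n\to\infty$ the fractions $q_{k,n}/q_{j,n}$ converge uniformly on the compact subsets of $U\setminus E_j$, either to a finite function (on each such compact set the fractions have no poles for $n$ large) or to the constant $\infty$; (2) every point of $U$ lies outside $E_j$ for at least one $j$ such that $q_{j,n}\not\equiv 0$ for infinitely many $n$. -/

import Mathlib

open Filter Topology

noncomputable section

namespace FuchsianODE

/-- The value at `z` of a rational function `r` in one complex variable
(meaningful when `z` is not a pole of `r`). -/
def value (r : RatFunc ℂ) (z : ℂ) : ℂ := r.eval (RingHom.id ℂ) z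

/-- `z` is a pole of the rational function `r` (`r.num` and `r.denom` are coprime). -/
def IsPole (r : RatFunc ℂ) (z : ℂ) : Prop := r.denom.eval z = 0

/-- The derivative `d/dz` on the field `ℂ(z)` of rational functions. -/
def ratDeriv (r : RatFunc ℂ) : RatFunc ℂ :=
  (algebraMap (Polynomial ℂ) (RatFunc ℂ)
      (r.num.derivative * r.denom - r.num * r.denom.derivative)) /
    (algebraMap (Polynomial ℂ) (RatFunc ℂ) r.denom) ^ 2

/- Throughout, `q : Fin m → RatFunc ℂ` encodes the linear differential equation
`y^(m) = ∑ i < m, q i * y^(i)`. -/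

/-- The set of singular points in `ℂ` of `y^(m) = ∑ i < m, q i * y^(i)`:
the poles of the coefficients. -/
def singularPoints {m : ℕ} (q : Fin m → RatFunc ℂ) : Set ℂ :=
  {t | ∃ i, IsPole (q i) t}

/-- The equation is Fuchsian: every point of the Riemann sphere is an ordinary point or a
regular singular point. At a finite point `t` this says that `(z - t)^(m - i) * q i` has no
pole at `t`, at `∞` that `z^(m - i) * q i` is bounded near `∞`. -/
def IsFuchsian {m : ℕ} (q : Fin m → RatFunc ℂ) : Prop :=
  (∀ (t : ℂ) (i : Fin m), (q i).denom.rootMultiplicity t ≤ m - (i : ℕ)) ∧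
    ∀ i : Fin m, q i = 0 ∨ (q i).intDegree ≤ ((i : ℕ) : ℤ) - (m : ℤ)

/-- `y` is a holomorphic solution of the equation on the open set `Ω`
(which is to contain no singular point). -/
def IsSolutionOn {m : ℕ} (q : Fin m → RatFunc ℂ) (y : ℂ → ℂ) (Ω : Set ℂ) : Prop :=
  DifferentiableOn ℂ y Ω ∧
    ∀ z ∈ Ω, iteratedDeriv m y z = ∑ i : Fin m, value (q i) z * iteratedDeriv (i : ℕ) y z

/-- The family `Y` is a basis of the `ℂ`-vector space of solutions on `Ω`. -/
def IsSolutionBasisOn {m : ℕ} (q : Fin m → RatFunc ℂ) (Y : Fin m → ℂ → ℂ) (Ω : Set ℂ) : Prop :=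
  (∀ a, IsSolutionOn q (Y a) Ω) ∧
    (LinearIndependent ℂ fun a => Set.domRestrict Ω (Y a)) ∧
    ∀ y, IsSolutionOn q y Ω → ∃ c : Fin m → ℂ, ∀ z ∈ Ω, y z = ∑ a, c a * Y a z

/-- The disc of radius `r` around `t`, cut along the horizontal segment from `t` to the left:
a simply connected domain, on which the multivalued solutions near `t` have branches. -/
def slitDisc (t : ℂ) (r : ℝ) : Set ℂ :=
  {z | z ∈ Metric.ball t r ∧ z - t ∈ Complex.slitPlane}

/-- A function `y` given on a slit disc around `t` extends holomorphically to `t`. -/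
def ExtendsTo (y : ℂ → ℂ) (t : ℂ) : Prop :=
  ∃ g : ℂ → ℂ, AnalyticAt ℂ g t ∧ ∀ᶠ z in 𝓝 t, z - t ∈ Complex.slitPlane → y z = g z

/-- The equation is generic: at each finite singular point `t` there is a basis of solutions
near `t` all of whose members but one extend holomorphically to `t`, while that one does not. -/
def IsGeneric {m : ℕ} (q : Fin m → RatFunc ℂ) : Prop :=
  ∀ t ∈ singularPoints q, ∃ r : ℝ, 0 < r ∧ Metric.ball t r ∩ singularPoints q = {t} ∧
    ∃ Y : Fin m → ℂ → ℂ, IsSolutionBasisOn q Y (slitDisc t r) ∧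
      ∃ a₀ : Fin m, ¬ ExtendsTo (Y a₀) t ∧ ∀ a, a ≠ a₀ → ExtendsTo (Y a) t

/-- The union of the perpendicular bisectors of the segments that join two different finite
singular points. -/
def bisectors {m : ℕ} (q : Fin m → RatFunc ℂ) : Set ℂ :=
  {z | ∃ s ∈ singularPoints q, ∃ t ∈ singularPoints q, s ≠ t ∧ dist z s = dist z t}

/-- The rational functions `q_{i,n}` with `y^(n) = ∑ i < m, q_{i,n} * y^(i)` for every
solution `y`. They are obtained from `y^(0) = y` by differentiating
`y^(n) = ∑ i < m, q_{i,n} * y^(i)` and replacing `y^(m)` by `∑ i < m, q i * y^(i)`: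
`q_{i,n+1} = q_{i,n}' + q_{i-1,n} + q_{m-1,n} * q i`, where `q_{-1,n} = 0`. -/
def derivCoeff {m : ℕ} (q : Fin m → RatFunc ℂ) : ℕ → Fin m → RatFunc ℂ
  | 0, i => if (i : ℕ) = 0 then 1 else 0
  | n + 1, i =>
      ratDeriv (derivCoeff q n i)
        + (if (i : ℕ) = 0 then 0
            else derivCoeff q n ⟨(i : ℕ) - 1, lt_of_le_of_lt (Nat.sub_le _ _) i.isLt⟩)
        + derivCoeff q n ⟨m - 1, Nat.sub_lt (Nat.zero_lt_of_lt i.isLt) Nat.one_pos⟩ * q i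

/-- The rational functions `F n` converge, uniformly on the compact subsets of `V`, to a
(finite) function: on each compact subset they have no poles from some `n` on, and they
converge uniformly there. -/
def ConvergesOnCompacts (F : ℕ → RatFunc ℂ) (V : Set ℂ) : Prop :=
  ∃ f : ℂ → ℂ, ∀ K ⊆ V, IsCompact K →
    (∀ᶠ n in atTop, ∀ z ∈ K, ¬ IsPole (F n) z) ∧
      TendstoUniformlyOn (fun n z => value (F n) z) f atTop K

/-- The rational functions `F n` converge, uniformly on the compact subsets of `V`, to the
constant `∞` (poles have the value `∞`). -/
def DivergesToInftyOnCompacts (F : ℕ → RatFunc ℂ) (V : Set ℂ) : Prop :=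
  ∀ K ⊆ V, IsCompact K → ∀ C : ℝ,
    ∀ᶠ n in atTop, ∀ z ∈ K, IsPole (F n) z ∨ C ≤ ‖value (F n) z‖

end FuchsianODE

end

/-!
The asymptotics of `q_{j,n}` near a point `z₀` are governed by the singular points closest to `z₀`,
because the `n`-th derivative of a solution grows like `n! / ρ ^ n`, where `ρ` is its radius of
convergence.

*At an ordinary point.* Off the bisectors the finite singular points have distinct distances from
`z₀`, and genericity says that at a singular point `s` there is, modulo solutions holomorphic
at `s`, only one solution. So the solutions at `z₀` whose disc of convergence reaches exactly to
`s` are, modulo solutions that converge on a larger disc, multiples of one solution `e s`; the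
solutions without singularity are polynomials, since the equation is Fuchsian at `∞`
(`exists_forall_iteratedDeriv_eq_zero`). Hence every solution is `∑ s ∈ T, γ s * e s` plus a
polynomial (`exists_level_decomposition`), and Cramer's rule yields
`q_{j,n} = ∑ s ∈ T, (e s)^(n) * b s j` for large `n`, where the holomorphic functions `b s j` do
not depend on `n`. The term of a closer singular point dominates those of the others, uniformly
near `z₀` (`exists_uniform_decay`). The upper bound in this comparison is Cauchy's estimate. The
lower bound needs the form of the singular solution at `s`: it is
`u ^ σ * h + log u * v + k`, `u = w - s`, with holomorphic `h`, `v`, `k`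
(`nonempty_singularData`), and the Taylor coefficients of its leading term `u ^ τ` or
`u ^ τ * log u` at `z₀` are `1 / |u| ^ n` up to a power of `n` (`exists_taylor_lower_bound`).

*At a singular point `t`.* The solutions holomorphic at `t` are decomposed as before. The linear
system for the `q_{j,n}` is completed by the last unit vector, which makes `q_{m-1,n}` itself the
dominating term: since `y^(n)` is `q_{m-1,n}` times a function of moderate growth, up to
derivatives of holomorphic solutions, the lower bound for the singular solution `y` near `t`
carries over to `q_{m-1,n}` (`SingularData.exists_lower_bound_last`).

*Quotients.* In both cases there is a `LocalExpansion` at `z₀`. The quotient `q_{k,n} / q_{j,n}`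
then converges to a quotient of functions `b s i`, or to `∞`, depending on which of the two has the
closer leading singular point `s`; besides `z₀`, only zeros of `b s j` can be exceptional. At `z₀`,
an index `j` for which `b s₀ j` vanishes at `z₀` to minimal order gives finite limits, where `s₀`
is the closest point of `T` (`LocalExpansion.isTameAt`). Finally, convergence and divergence off
the exceptional points are open conditions that exclude each other, so a connected `U` sees only
one of them (`IsPreconnected.convergesAt_or_divergesAt`).
-/

noncomputable section

namespace FuchsianODE

/-! ### Values of rational functions -/

section

theorem value_eq (r : RatFunc ℂ) (z : ℂ) : value r z = r.num.eval z / r.denom.eval z := rfl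

theorem not_isPole_div {p d : Polynomial ℂ} {z : ℂ} (hd : d.eval z ≠ 0) :
    ¬ IsPole (algebraMap _ (RatFunc ℂ) p / algebraMap _ (RatFunc ℂ) d) z := by
  intro h
  obtain ⟨c, hc⟩ := RatFunc.denom_div_dvd p d
  apply hd
  rw [hc, Polynomial.eval_mul]
  unfold IsPole at h
  rw [h, zero_mul]

theorem not_isPole_add {x y : RatFunc ℂ} {z : ℂ} (hx : ¬ IsPole x z) (hy : ¬ IsPole y z) :
    ¬ IsPole (x + y) z := by
  intro h
  obtain ⟨c, hc⟩ := RatFunc.denom_add_dvd x y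
  have := congrArg (Polynomial.eval z) hc
  unfold IsPole at *
  rw [Polynomial.eval_mul, Polynomial.eval_mul, h, zero_mul] at this
  exact (mul_ne_zero hx hy) this

theorem not_isPole_mul {x y : RatFunc ℂ} {z : ℂ} (hx : ¬ IsPole x z) (hy : ¬ IsPole y z) :
    ¬ IsPole (x * y) z := by
  intro h
  obtain ⟨c, hc⟩ := RatFunc.denom_mul_dvd x y
  have := congrArg (Polynomial.eval z) hc
  unfold IsPole at *
  rw [Polynomial.eval_mul, Polynomial.eval_mul, h, zero_mul] at this
  exact (mul_ne_zero hx hy) this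

theorem value_add {x y : RatFunc ℂ} {z : ℂ} (hx : ¬ IsPole x z) (hy : ¬ IsPole y z) :
    value (x + y) z = value x z + value y z :=
  RatFunc.eval_add (f := RingHom.id ℂ) (a := z) hx hy

theorem value_mul {x y : RatFunc ℂ} {z : ℂ} (hx : ¬ IsPole x z) (hy : ¬ IsPole y z) :
    value (x * y) z = value x z * value y z :=
  RatFunc.eval_mul (f := RingHom.id ℂ) (a := z) hx hy

theorem not_isPole_zero (z : ℂ) : ¬ IsPole 0 z := by simp [IsPole]

theorem not_isPole_one (z : ℂ) : ¬ IsPole 1 z := by simp [IsPole]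

theorem value_zero (z : ℂ) : value 0 z = 0 := by simp [value]

theorem value_one (z : ℂ) : value 1 z = 1 := by simp [value]

theorem value_algebraMap_div {p d : Polynomial ℂ} {z : ℂ} (hd : d.eval z ≠ 0) :
    value (algebraMap _ (RatFunc ℂ) p / algebraMap _ (RatFunc ℂ) d) z
      = p.eval z / d.eval z := by
  have hd0 : d ≠ 0 := by rintro rfl; simp at hd
  have h1 : ¬ IsPole (algebraMap _ (RatFunc ℂ) d) z := by
    simp [IsPole]
  have h2 := value_mul (not_isPole_div (p := p) hd) h1
  rw [div_mul_cancel₀ _ (RatFunc.algebraMap_ne_zero hd0)] at h2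
  rw [eq_div_iff hd]
  simpa [value] using h2.symm

theorem value_ne_zero_iff {r : RatFunc ℂ} {z : ℂ} (hr : ¬ IsPole r z) :
    value r z ≠ 0 ↔ r.num.eval z ≠ 0 := by
  unfold IsPole at hr
  rw [value_eq]
  simp [hr]

theorem not_isPole_inv {r : RatFunc ℂ} {z : ℂ} (hr : ¬ IsPole r z) (h0 : value r z ≠ 0) :
    ¬ IsPole r⁻¹ z := by
  have h : r⁻¹ = algebraMap _ (RatFunc ℂ) r.denom / algebraMap _ (RatFunc ℂ) r.num := by
    conv_lhs => rw [← RatFunc.num_div_denom r]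
    rw [inv_div]
  rw [h]
  exact not_isPole_div ((value_ne_zero_iff hr).1 h0)

theorem ne_zero_of_value_ne_zero {r : RatFunc ℂ} {z : ℂ} (h0 : value r z ≠ 0) : r ≠ 0 := by
  rintro rfl
  exact h0 (value_zero z)

theorem not_isPole_div_of_value_ne_zero {x y : RatFunc ℂ} {z : ℂ} (hx : ¬ IsPole x z)
    (hy : ¬ IsPole y z) (h0 : value y z ≠ 0) : ¬ IsPole (x / y) z := by
  rw [div_eq_mul_inv]
  exact not_isPole_mul hx (not_isPole_inv hy h0)

theorem value_div {x y : RatFunc ℂ} {z : ℂ} (hx : ¬ IsPole x z)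
    (hy : ¬ IsPole y z) (h0 : value y z ≠ 0) : value (x / y) z = value x z / value y z := by
  have h2 := value_mul (not_isPole_div_of_value_ne_zero hx hy h0) hy
  rw [div_mul_cancel₀ _ (ne_zero_of_value_ne_zero h0)] at h2
  rw [eq_div_iff h0, h2]

theorem isPole_div {x y : RatFunc ℂ} {z : ℂ} (hy : ¬ IsPole y z) (hy0 : y ≠ 0)
    (h0 : value y z = 0) (h1 : value x z ≠ 0) : IsPole (x / y) z := by
  by_contra h
  have h2 := value_mul h hy
  rw [div_mul_cancel₀ _ hy0, h0, mul_zero] at h2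
  exact h1 h2

theorem hasDerivAt_value {r : RatFunc ℂ} {z : ℂ} (hr : ¬ IsPole r z) :
    HasDerivAt (value r) (value (ratDeriv r) z) z := by
  have h1 := (r.num.hasDerivAt z).div (r.denom.hasDerivAt z) hr
  have h2 : value (ratDeriv r) z
      = (r.num.derivative.eval z * r.denom.eval z - r.num.eval z * r.denom.derivative.eval z)
        / (r.denom.eval z) ^ 2 := by
    unfold ratDeriv
    rw [← map_pow, value_algebraMap_div]
    · simp
    · rw [Polynomial.eval_pow]
      exact pow_ne_zero 2 hr
  rw [h2]
  exact h1

theorem not_isPole_ratDeriv {r : RatFunc ℂ} {z : ℂ} (hr : ¬ IsPole r z) :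
    ¬ IsPole (ratDeriv r) z := by
  unfold ratDeriv
  rw [← map_pow]
  refine not_isPole_div ?_
  rw [Polynomial.eval_pow]
  exact pow_ne_zero 2 hr

theorem analyticAt_value {r : RatFunc ℂ} {z : ℂ} (hr : ¬ IsPole r z) :
    AnalyticAt ℂ (value r) z := by
  have h1 : ∀ p : Polynomial ℂ, AnalyticAt ℂ (fun w => p.eval w) z := fun p =>
    p.differentiable.analyticAt z
  exact (h1 _).div (h1 _) hr

theorem finite_isPole (r : RatFunc ℂ) : {z | IsPole r z}.Finite := by
  refine (r.denom.roots.toFinset.finite_toSet).subset fun z hz => ?_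
  have hz' : r.denom.eval z = 0 := hz
  simpa [r.denom_ne_zero] using hz'

theorem eventually_value_ne_zero {r : RatFunc ℂ} (hr : r ≠ 0) (z : ℂ) :
    ∀ᶠ w in 𝓝[≠] z, value r w ≠ 0 := by
  have hfin : ({w | IsPole r w} ∪ {w | r.num.eval w = 0}).Finite := by
    refine (finite_isPole r).union ((r.num.roots.toFinset.finite_toSet).subset fun z hz => ?_)
    simpa [RatFunc.num_ne_zero hr] using hz
  filter_upwards [nhdsNE_le_cofinite z hfin.compl_mem_cofinite] with w hw
  simp only [Set.mem_compl_iff, Set.mem_union, Set.mem_ofPred_eq, not_or] at hw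
  exact (value_ne_zero_iff hw.1).2 hw.2

/-! ### The iterated coefficients -/

variable {m : ℕ} {q : Fin m → RatFunc ℂ}

theorem finite_singularPoints (q : Fin m → RatFunc ℂ) : (singularPoints q).Finite := by
  have : singularPoints q = ⋃ i, {z | IsPole (q i) z} := by
    ext z; simp [singularPoints]
  rw [this]
  exact Set.finite_iUnion fun i => finite_isPole _

theorem not_isPole_of_notMem {z : ℂ} (hz : z ∉ singularPoints q) (i : Fin m) :
    ¬ IsPole (q i) z := fun h => hz ⟨i, h⟩

theorem not_isPole_derivCoeff {z : ℂ} (hz : z ∉ singularPoints q) (n : ℕ) (i : Fin m) :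
    ¬ IsPole (derivCoeff q n i) z := by
  induction n generalizing i with
  | zero =>
    unfold derivCoeff
    split_ifs
    · exact not_isPole_one z
    · exact not_isPole_zero z
  | succ n ih =>
    unfold derivCoeff
    refine not_isPole_add (not_isPole_add (not_isPole_ratDeriv (ih i)) ?_)
      (not_isPole_mul (ih _) (not_isPole_of_notMem hz i))
    split_ifs
    · exact not_isPole_zero z
    · exact ih _

/-- The index shift behind the recursion for `derivCoeff`: the derivative of `y^(i)` is
`y^(i+1)`, and only `y^(m)` has to be replaced by means of the equation. -/
theorem sum_mul_shift {R : Type*} [CommRing R] (hm : 0 < m) (v Y : ℕ → R) :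
    ∑ i : Fin m, v i * Y (i + 1)
      = ∑ i : Fin m, (if (i : ℕ) = 0 then 0 else v (i - 1)) * Y i + v (m - 1) * Y m := by
  obtain ⟨k, rfl⟩ : ∃ k, m = k + 1 := ⟨m - 1, by omega⟩
  rw [Fin.sum_univ_castSucc, Fin.sum_univ_succ (n := k)]
  simp

theorem value_derivCoeff_succ {z : ℂ} (hz : z ∉ singularPoints q) (n : ℕ) (i : Fin m) :
    value (derivCoeff q (n + 1) i) z = value (ratDeriv (derivCoeff q n i)) z
      + (if (i : ℕ) = 0 then 0 else
          value (derivCoeff q n ⟨(i : ℕ) - 1, lt_of_le_of_lt (Nat.sub_le _ _) i.isLt⟩) z)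
      + value (derivCoeff q n ⟨m - 1, Nat.sub_lt (Nat.zero_lt_of_lt i.isLt) Nat.one_pos⟩) z
        * value (q i) z := by
  have hp := not_isPole_derivCoeff (q := q) hz n
  have h2 : ¬ IsPole (if (i : ℕ) = 0 then 0 else derivCoeff q n
      ⟨(i : ℕ) - 1, lt_of_le_of_lt (Nat.sub_le _ _) i.isLt⟩) z := by
    split_ifs
    · exact not_isPole_zero z
    · exact hp _
  have h1 := not_isPole_ratDeriv (hp i)
  conv_lhs => unfold derivCoeff
  rw [value_add (not_isPole_add h1 h2) (not_isPole_mul (hp _) (not_isPole_of_notMem hz i)),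
    value_add h1 h2, value_mul (hp _) (not_isPole_of_notMem hz i)]
  split_ifs
  · simp [value_zero]
  · rfl

theorem AnalyticAt.iteratedDeriv' {y : ℂ → ℂ} {z : ℂ} (hy : AnalyticAt ℂ y z) (n : ℕ) :
    AnalyticAt ℂ (iteratedDeriv n y) z := by
  induction n with
  | zero => simpa using hy
  | succ n ih => rw [iteratedDeriv_succ]; exact ih.deriv

theorem hasDerivAt_iteratedDeriv {y : ℂ → ℂ} {z : ℂ} (hy : AnalyticAt ℂ y z) (n : ℕ) :
    HasDerivAt (iteratedDeriv n y) (iteratedDeriv (n + 1) y z) z := by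
  rw [iteratedDeriv_succ]
  exact (AnalyticAt.iteratedDeriv' hy n).differentiableAt.hasDerivAt

/-- The rational functions `q_{i,n}` do express the `n`-th derivative of a solution. -/
theorem iteratedDeriv_eq_sum_derivCoeff {y : ℂ → ℂ} {z : ℂ} (hz : z ∉ singularPoints q)
    (hm : 0 < m) (hy : AnalyticAt ℂ y z)
    (hode : ∀ᶠ w in 𝓝 z, iteratedDeriv m y w = ∑ i : Fin m, value (q i) w * iteratedDeriv i y w)
    (n : ℕ) : ∀ᶠ w in 𝓝 z, iteratedDeriv n y w
      = ∑ i : Fin m, value (derivCoeff q n i) w * iteratedDeriv i y w := by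
  have hSc : ∀ᶠ w in 𝓝 z, w ∉ singularPoints q :=
    (finite_singularPoints q).isClosed.isOpen_compl.mem_nhds hz
  induction n with
  | zero =>
    refine Eventually.of_forall fun w => ?_
    obtain ⟨k, rfl⟩ : ∃ k, m = k + 1 := ⟨m - 1, by omega⟩
    rw [Fin.sum_univ_succ]
    simp [derivCoeff, value_one, value_zero]
  | succ n ih =>
    filter_upwards [ih.eventually_nhds, hode, hSc, hy.eventually_analyticAt] with w hw how hwS hwy
    have h1 : HasDerivAt (iteratedDeriv n y) (∑ i : Fin m,
        (value (ratDeriv (derivCoeff q n i)) w * iteratedDeriv i y w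
          + value (derivCoeff q n i) w * iteratedDeriv (i + 1) y w)) w := by
      have : HasDerivAt (fun w => ∑ i : Fin m, value (derivCoeff q n i) w * iteratedDeriv i y w)
        (∑ i : Fin m, (value (ratDeriv (derivCoeff q n i)) w * iteratedDeriv i y w
          + value (derivCoeff q n i) w * iteratedDeriv (i + 1) y w)) w :=
        HasDerivAt.fun_sum fun i _ => (hasDerivAt_value (not_isPole_derivCoeff hwS n i)).mul
          (hasDerivAt_iteratedDeriv hwy i)
      exact this.congr_of_eventuallyEq hw
    rw [iteratedDeriv_succ, h1.deriv, Finset.sum_add_distrib]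
    have h2 := sum_mul_shift hm (fun k => if h : k < m then value (derivCoeff q n ⟨k, h⟩) w else 0)
      (fun k => iteratedDeriv k y w)
    simp only [Fin.is_lt, dite_true, Fin.eta] at h2
    rw [h2, how, ← add_assoc, ← Finset.sum_add_distrib, Finset.mul_sum, ← Finset.sum_add_distrib]
    refine Finset.sum_congr rfl fun i _ => ?_
    rw [value_derivCoeff_succ hwS]
    have h3 : (i : ℕ) - 1 < m := by omega
    have h4 : m - 1 < m := by omega
    simp only [h3, h4, dite_true]
    ring

/-! ### The equation with cleared denominators -/

/-- The common denominator of the coefficients. -/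
def commonDenom (q : Fin m → RatFunc ℂ) : Polynomial ℂ := ∏ i, (q i).denom

/-- The coefficient `q i` multiplied by the common denominator. -/
def clearedCoeff (q : Fin m → RatFunc ℂ) (i : Fin m) : Polynomial ℂ :=
  (q i).num * ∏ k ∈ Finset.univ.erase i, (q k).denom

theorem commonDenom_eval_ne_zero {z : ℂ} (hz : z ∉ singularPoints q) :
    (commonDenom q).eval z ≠ 0 := by
  unfold commonDenom
  rw [Polynomial.eval_prod]
  exact Finset.prod_ne_zero_iff.2 fun i _ => not_isPole_of_notMem hz i

theorem clearedCoeff_eval {z : ℂ} (hz : z ∉ singularPoints q) (i : Fin m) :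
    (clearedCoeff q i).eval z = (commonDenom q).eval z * value (q i) z := by
  have h := not_isPole_of_notMem hz i
  unfold IsPole at h
  unfold clearedCoeff commonDenom
  rw [← Finset.mul_prod_erase Finset.univ _ (Finset.mem_univ i), value_eq]
  simp only [Polynomial.eval_mul]
  field_simp

/-- The differential operator of the equation, multiplied by the common denominator:
it preserves holomorphy also at the singular points. -/
def clearedOp (q : Fin m → RatFunc ℂ) (y : ℂ → ℂ) (w : ℂ) : ℂ :=
  (commonDenom q).eval w * iteratedDeriv m y w
    - ∑ i : Fin m, (clearedCoeff q i).eval w * iteratedDeriv i y w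

theorem clearedOp_eq {y : ℂ → ℂ} {z : ℂ} (hz : z ∉ singularPoints q) :
    clearedOp q y z = (commonDenom q).eval z
      * (iteratedDeriv m y z - ∑ i : Fin m, value (q i) z * iteratedDeriv i y z) := by
  unfold clearedOp
  rw [mul_sub, Finset.mul_sum]
  congr 1
  exact Finset.sum_congr rfl fun i _ => by rw [clearedCoeff_eval hz]; ring

theorem clearedOp_eq_zero_iff {y : ℂ → ℂ} {z : ℂ} (hz : z ∉ singularPoints q) :
    clearedOp q y z = 0 ↔
      iteratedDeriv m y z = ∑ i : Fin m, value (q i) z * iteratedDeriv i y z := by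
  rw [clearedOp_eq hz, mul_eq_zero, sub_eq_zero]
  simp [commonDenom_eval_ne_zero hz]

theorem iteratedDeriv_congr_of_eventuallyEq {f g : ℂ → ℂ} {z : ℂ} (h : f =ᶠ[𝓝 z] g) (n : ℕ) :
    iteratedDeriv n f =ᶠ[𝓝 z] iteratedDeriv n g := by
  induction n with
  | zero => simpa using h
  | succ n ih => rw [iteratedDeriv_succ, iteratedDeriv_succ]; exact ih.deriv

theorem clearedOp_congr {f g : ℂ → ℂ} {z : ℂ} (h : f =ᶠ[𝓝 z] g) :
    clearedOp q f =ᶠ[𝓝 z] clearedOp q g := by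
  have h1 := fun n => iteratedDeriv_congr_of_eventuallyEq h n
  have h2 : ∀ᶠ w in 𝓝 z, ∀ i : Fin m, iteratedDeriv i f w = iteratedDeriv i g w :=
    eventually_all.2 fun i => h1 i
  filter_upwards [h1 m, h2] with w hw hw2
  unfold clearedOp
  rw [hw]
  simp only [hw2]

theorem analyticAt_polynomial (p : Polynomial ℂ) (z : ℂ) : AnalyticAt ℂ (fun w => p.eval w) z :=
  p.differentiable.analyticAt z

theorem AnalyticAt.clearedOp {y : ℂ → ℂ} {z : ℂ} (hy : AnalyticAt ℂ y z) :
    AnalyticAt ℂ (clearedOp q y) z := by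
  unfold FuchsianODE.clearedOp
  refine ((analyticAt_polynomial _ z).mul (AnalyticAt.iteratedDeriv' hy m)).sub ?_
  exact Finset.analyticAt_fun_sum _ fun i _ =>
    (analyticAt_polynomial _ z).mul (AnalyticAt.iteratedDeriv' hy i)

theorem iteratedDeriv_sum_mul {ι : Type*} (s : Finset ι) {c : ι → ℂ} {f : ι → ℂ → ℂ} {z : ℂ}
    (hf : ∀ i ∈ s, AnalyticAt ℂ (f i) z) (n : ℕ) :
    ∀ᶠ w in 𝓝 z, iteratedDeriv n (fun w => ∑ i ∈ s, c i * f i w) w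
      = ∑ i ∈ s, c i * iteratedDeriv n (f i) w := by
  have hs : ∀ᶠ w in 𝓝 z, ∀ i ∈ s, AnalyticAt ℂ (f i) w :=
    (Finset.eventually_all s).2 fun i hi => (hf i hi).eventually_analyticAt
  induction n with
  | zero => simp
  | succ n ih =>
    filter_upwards [ih.eventually_nhds, hs] with w hw hws
    have h1 : HasDerivAt (fun w => ∑ i ∈ s, c i * iteratedDeriv n (f i) w)
        (∑ i ∈ s, c i * iteratedDeriv (n + 1) (f i) w) w :=
      HasDerivAt.fun_sum fun i hi => (hasDerivAt_iteratedDeriv (hws i hi) n).const_mul _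
    rw [iteratedDeriv_succ, Filter.EventuallyEq.deriv_eq hw, h1.deriv]

theorem clearedOp_sum {ι : Type*} (s : Finset ι) {c : ι → ℂ} {f : ι → ℂ → ℂ} {z : ℂ}
    (hf : ∀ i ∈ s, AnalyticAt ℂ (f i) z) :
    clearedOp q (fun w => ∑ i ∈ s, c i * f i w) z = ∑ i ∈ s, c i * clearedOp q (f i) z := by
  have h1 := fun n => (iteratedDeriv_sum_mul (c := c) s hf n).self_of_nhds
  unfold clearedOp
  simp only [h1]
  simp only [mul_sub, Finset.sum_sub_distrib, Finset.mul_sum]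
  congr 1
  · exact Finset.sum_congr rfl fun i _ => by ring
  · rw [Finset.sum_comm]
    exact Finset.sum_congr rfl fun i _ => Finset.sum_congr rfl fun j _ => by ring

/-- `y` is holomorphic at `z` and satisfies the equation near `z`; the point `z` may be singular,
in which case the equation is imposed in the form with cleared denominators. -/
def IsSolAt (q : Fin m → RatFunc ℂ) (y : ℂ → ℂ) (z : ℂ) : Prop :=
  AnalyticAt ℂ y z ∧ ∀ᶠ w in 𝓝 z, clearedOp q y w = 0

theorem IsSolAt.congr {f g : ℂ → ℂ} {z : ℂ} (hf : IsSolAt q f z) (h : f =ᶠ[𝓝 z] g) :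
    IsSolAt q g z := by
  refine ⟨hf.1.congr h, ?_⟩
  filter_upwards [hf.2, clearedOp_congr (q := q) h] with w h1 h2
  rw [← h2, h1]

theorem IsSolAt.sum {ι : Type*} (s : Finset ι) {c : ι → ℂ} {f : ι → ℂ → ℂ} {z : ℂ}
    (hf : ∀ i ∈ s, IsSolAt q (f i) z) : IsSolAt q (fun w => ∑ i ∈ s, c i * f i w) z := by
  refine ⟨Finset.analyticAt_fun_sum _ fun i hi => analyticAt_const.mul (hf i hi).1, ?_⟩
  have h1 : ∀ᶠ w in 𝓝 z, ∀ i ∈ s, AnalyticAt ℂ (f i) w ∧ clearedOp q (f i) w = 0 :=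
    (Finset.eventually_all s).2 fun i hi => (hf i hi).1.eventually_analyticAt.and (hf i hi).2
  filter_upwards [h1] with w hw
  rw [clearedOp_sum s fun i hi => (hw i hi).1]
  exact Finset.sum_eq_zero fun i hi => by rw [(hw i hi).2, mul_zero]

theorem IsSolAt.sub_smul {f g : ℂ → ℂ} {z : ℂ} (hf : IsSolAt q f z) (hg : IsSolAt q g z) (c : ℂ) :
    IsSolAt q (fun w => f w - c * g w) z := by
  have h := IsSolAt.sum (q := q) (z := z) (Finset.univ : Finset (Fin 2)) (c := ![1, -c])
    (f := ![f, g]) (by simp [hf, hg])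
  refine h.congr (Eventually.of_forall fun w => ?_)
  simp [Fin.sum_univ_two, sub_eq_add_neg]

theorem IsSolAt.eventually_ode {y : ℂ → ℂ} {z : ℂ} (hz : z ∉ singularPoints q)
    (hy : IsSolAt q y z) : ∀ᶠ w in 𝓝 z,
      iteratedDeriv m y w = ∑ i : Fin m, value (q i) w * iteratedDeriv i y w := by
  have hSc : ∀ᶠ w in 𝓝 z, w ∉ singularPoints q :=
    (finite_singularPoints q).isClosed.isOpen_compl.mem_nhds hz
  filter_upwards [hy.2, hSc] with w h1 h2
  exact (clearedOp_eq_zero_iff h2).1 h1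

theorem IsSolAt.iteratedDeriv_eq {y : ℂ → ℂ} {z : ℂ} (hz : z ∉ singularPoints q) (hm : 0 < m)
    (hy : IsSolAt q y z) (n : ℕ) : iteratedDeriv n y z
      = ∑ i : Fin m, value (derivCoeff q n i) z * iteratedDeriv i y z :=
  (iteratedDeriv_eq_sum_derivCoeff hz hm hy.1 (hy.eventually_ode hz) n).self_of_nhds

theorem IsSolAt.of_isSolutionOn {y : ℂ → ℂ} {Ω : Set ℂ} (hΩ : IsOpen Ω)
    (hS : Disjoint Ω (singularPoints q)) (hy : IsSolutionOn q y Ω) {z : ℂ} (hz : z ∈ Ω) :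
    IsSolAt q y z := by
  refine ⟨hy.1.analyticAt (hΩ.mem_nhds hz), ?_⟩
  filter_upwards [hΩ.mem_nhds hz] with w hw
  exact (clearedOp_eq_zero_iff (Set.disjoint_left.1 hS hw)).2 (hy.2 w hw)

/-- The equation propagates along a connected domain of holomorphy. -/
theorem isSolAt_of_preconnected {y : ℂ → ℂ} {Ω : Set ℂ} (hc : IsPreconnected Ω)
    (hy : AnalyticOnNhd ℂ y Ω) {z₀ : ℂ} (hz₀ : z₀ ∈ Ω) (h0 : IsSolAt q y z₀) {z : ℂ}
    (hz : z ∈ Ω) (hΩ : IsOpen Ω) : IsSolAt q y z := by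
  have h1 : AnalyticOnNhd ℂ (clearedOp q y) Ω := fun w hw => AnalyticAt.clearedOp (hy w hw)
  have h2 := h1.eqOn_zero_of_preconnected_of_eventuallyEq_zero hc hz₀ h0.2
  refine ⟨hy z hz, ?_⟩
  filter_upwards [hΩ.mem_nhds hz] with w hw
  exact h2 hw

theorem eventually_eq_zero_of_iteratedDeriv {y : ℂ → ℂ} {z : ℂ} (hy : AnalyticAt ℂ y z)
    (h : ∀ n, iteratedDeriv n y z = 0) : ∀ᶠ w in 𝓝 z, y w = 0 := by
  obtain ⟨r, hr, hb⟩ := Metric.eventually_nhds_iff_ball.1 hy.eventually_analyticAt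
  filter_upwards [Metric.ball_mem_nhds z hr] with w hw
  have h1 := Complex.hasSum_taylorSeries_on_ball
    (fun v hv => (hb v hv).differentiableAt.differentiableWithinAt) hw
  simp only [h, smul_zero] at h1
  exact h1.unique hasSum_zero

/-- At an ordinary point a solution is determined by its first `m` derivatives. -/
theorem IsSolAt.eventually_eq_zero {y : ℂ → ℂ} {z : ℂ} (hz : z ∉ singularPoints q) (hm : 0 < m)
    (hy : IsSolAt q y z) (h : ∀ i : Fin m, iteratedDeriv i y z = 0) : ∀ᶠ w in 𝓝 z, y w = 0 :=
  eventually_eq_zero_of_iteratedDeriv hy.1 fun n => by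
    rw [hy.iteratedDeriv_eq hz hm n]
    simp [h]

end

/-! ### Power series and existence of solutions near ordinary points -/

section

theorem summable_powerSeries {c : ℕ → ℂ} {C K : ℝ} (hc : ∀ n, ‖c n‖ ≤ C * K ^ n) {u : ℂ}
    (hK : 0 ≤ K) (hu : K * ‖u‖ < 1) : Summable fun n => ‖c n * u ^ n‖ := by
  have h0 : Summable fun n : ℕ => C * (K * ‖u‖) ^ n :=
    (summable_geometric_of_lt_one (by positivity) hu).mul_left C
  refine h0.of_nonneg_of_le (fun n => norm_nonneg _) fun n => ?_
  rw [norm_mul, norm_pow, mul_pow, ← mul_assoc]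
  exact mul_le_mul_of_nonneg_right (hc n) (by positivity)

theorem hasDerivAt_powerSeries {c : ℕ → ℂ} {C K : ℝ} (hc : ∀ n, ‖c n‖ ≤ C * K ^ n) {z w : ℂ}
    (hK : 0 < K) (hw : K * ‖w - z‖ < 1) :
    HasDerivAt (fun w => ∑' n, c n * (w - z) ^ n)
      (∑' n : ℕ, ((n : ℂ) + 1) * c (n + 1) * (w - z) ^ n) w := by
  obtain ⟨ρ, h1, h2⟩ : ∃ ρ, ‖w - z‖ < ρ ∧ ρ < K⁻¹ :=
    exists_between (by rwa [← one_div, lt_div_iff₀' hK])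
  have hρ : 0 < ρ := (norm_nonneg _).trans_lt h1
  have hKρ : K * ρ < 1 := by
    calc K * ρ < K * K⁻¹ := by gcongr
      _ = 1 := mul_inv_cancel₀ hK.ne'
  have hC : 0 ≤ C := by simpa using (norm_nonneg _).trans (hc 0)
  have hsum : Summable fun n : ℕ => C * (K * ρ) ^ n :=
    (summable_geometric_of_lt_one (by positivity) hKρ).mul_left C
  have hle : ∀ (n : ℕ), ∀ v ∈ Metric.ball z ρ, ‖c n * (v - z) ^ n‖ ≤ C * (K * ρ) ^ n := by
    intro n v hv
    have hv' : ‖v - z‖ ≤ ρ := by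
      rw [Metric.mem_ball, dist_eq_norm] at hv; exact hv.le
    rw [norm_mul, norm_pow, mul_pow, ← mul_assoc]
    exact mul_le_mul (hc n) (by gcongr) (by positivity) (by positivity)
  have hdiff : ∀ n : ℕ, DifferentiableOn ℂ (fun v => c n * (v - z) ^ n) (Metric.ball z ρ) := by
    intro n
    fun_prop
  have hwb : w ∈ Metric.ball z ρ := by rwa [Metric.mem_ball, dist_eq_norm]
  have hd := (Complex.differentiableOn_tsum_of_summable_norm hsum hdiff Metric.isOpen_ball hle)
    |>.differentiableAt (Metric.isOpen_ball.mem_nhds hwb) |>.hasDerivAt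
  have hs := Complex.hasSum_deriv_of_summable_norm hsum hdiff Metric.isOpen_ball hle hwb
  have hderiv : ∀ n : ℕ, deriv (fun v => c n * (v - z) ^ n) w
      = c n * (n * (w - z) ^ (n - 1)) := by
    intro n
    simp
  simp only [hderiv] at hs
  have e : ∑' n : ℕ, ((n : ℂ) + 1) * c (n + 1) * (w - z) ^ n
      = deriv (fun w => ∑' n, c n * (w - z) ^ n) w := by
    rw [← hs.tsum_eq, hs.summable.tsum_eq_zero_add]
    simp only [Nat.cast_zero, zero_mul, mul_zero, zero_add, Nat.cast_add, Nat.cast_one,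
      Nat.add_sub_cancel]
    exact tsum_congr fun n => by ring
  rw [e]
  exact hd

/-- Taylor coefficients of a holomorphic function are geometrically bounded, and the series
converges to the function on the corresponding disc. -/
theorem exists_taylor_bound {f : ℂ → ℂ} {z : ℂ} (hf : AnalyticAt ℂ f z) :
    ∃ C K : ℝ, 0 < C ∧ 0 < K ∧ (∀ n : ℕ, ‖(n.factorial : ℂ)⁻¹ * iteratedDeriv n f z‖ ≤ C * K ^ n) ∧
      ∀ w, K * ‖w - z‖ < 1 →
        HasSum (fun n : ℕ => (n.factorial : ℂ)⁻¹ * iteratedDeriv n f z * (w - z) ^ n) (f w) := by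
  obtain ⟨r, hr, hb⟩ := Metric.eventually_nhds_iff_ball.1 hf.eventually_analyticAt
  have hd : DifferentiableOn ℂ f (Metric.ball z r) :=
    fun v hv => (hb v hv).differentiableAt.differentiableWithinAt
  have hr2 : Metric.closedBall z (r / 2) ⊆ Metric.ball z r :=
    Metric.closedBall_subset_ball (by linarith)
  obtain ⟨C, hC⟩ := (isCompact_closedBall z (r / 2)).exists_bound_of_continuousOn
    (hd.continuousOn.mono hr2)
  refine ⟨max C 1, (r / 2)⁻¹, by positivity, by positivity, fun n => ?_, fun w hw => ?_⟩
  · have h1 := Complex.norm_iteratedDeriv_le_of_forall_mem_sphere_norm_le (f := f) (c := z)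
      (R := r / 2) (C := max C 1) n (by positivity)
      ((hd.mono hr2).diffContOnCl_ball subset_rfl) fun v hv =>
        (hC v (Metric.sphere_subset_closedBall hv)).trans (le_max_left _ _)
    have h2 : (0 : ℝ) < n.factorial := by positivity
    rw [norm_mul, norm_inv, Complex.norm_natCast, inv_mul_le_iff₀ h2, inv_pow]
    calc _ ≤ _ := h1
      _ = _ := by rw [mul_div_assoc, div_eq_mul_inv]
  · have hw' : w ∈ Metric.ball z r := by
      rw [Metric.mem_ball, dist_eq_norm]
      rw [inv_mul_lt_iff₀ (by positivity)] at hw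
      linarith
    have h1 := Complex.hasSum_taylorSeries_on_ball hd hw'
    refine h1.congr_fun fun n => ?_
    simp only [smul_eq_mul]
    ring

variable {m : ℕ} {q : Fin m → RatFunc ℂ}

/-- Taylor coefficients of the solution of `Y' = A Y` with `A = ∑ a k (w - z)^k`,
`Y z = c₀`. -/
def systemCoeff (a : ℕ → Matrix (Fin m) (Fin m) ℂ) (c₀ : Fin m → ℂ) : ℕ → Fin m → ℂ
  | 0 => c₀
  | n + 1 => fun i => ((n : ℂ) + 1)⁻¹ *
      ∑ k : Fin (n + 1), ∑ j, a k i j * systemCoeff a c₀ (n - k) j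
  decreasing_by omega

theorem norm_systemCoeff_le {a : ℕ → Matrix (Fin m) (Fin m) ℂ} {c₀ : Fin m → ℂ} {C K D : ℝ}
    (hC : 0 < C) (hK : 0 < K) (ha : ∀ k i j, ‖a k i j‖ ≤ C * K ^ k) (hD : ∀ i, ‖c₀ i‖ ≤ D)
    (n : ℕ) (i : Fin m) : ‖systemCoeff a c₀ n i‖ ≤ D * (K + m * C) ^ n := by
  induction n using Nat.strong_induction_on generalizing i with
  | _ n ih =>
    cases n with
    | zero => simpa [systemCoeff] using hD i
    | succ n =>
      have hD0 : 0 ≤ D := (norm_nonneg _).trans (hD i)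
      have hL : 0 ≤ K + m * C := by positivity
      have hn : ‖((n : ℂ) + 1)⁻¹‖ = ((n : ℝ) + 1)⁻¹ := by
        rw [norm_inv]
        congr 1
        exact_mod_cast Complex.norm_natCast (n + 1)
      rw [systemCoeff, norm_mul, hn, inv_mul_le_iff₀ (by positivity)]
      calc _ ≤ ∑ k : Fin (n + 1), ∑ j : Fin m, C * K ^ (k : ℕ) * (D * (K + m * C) ^ (n - k)) := by
            refine (norm_sum_le _ _).trans (Finset.sum_le_sum fun k _ =>
              (norm_sum_le _ _).trans (Finset.sum_le_sum fun j _ => ?_))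
            rw [norm_mul]
            exact mul_le_mul (ha _ _ _) (ih _ (by omega) _) (norm_nonneg _) (by positivity)
        _ ≤ ∑ k : Fin (n + 1), ∑ j : Fin m, C * (D * (K + m * C) ^ n) := by
            refine Finset.sum_le_sum fun k _ => Finset.sum_le_sum fun j _ => ?_
            rw [mul_assoc]
            refine mul_le_mul_of_nonneg_left ?_ hC.le
            have h1 : K ^ (k : ℕ) ≤ (K + m * C) ^ (k : ℕ) :=
              pow_le_pow_left₀ hK.le (by nlinarith [(Nat.cast_nonneg m : (0 : ℝ) ≤ m)]) _
            calc K ^ (k : ℕ) * (D * (K + m * C) ^ (n - k))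
                ≤ (K + m * C) ^ (k : ℕ) * (D * (K + m * C) ^ (n - k)) := by gcongr
              _ = D * (K + m * C) ^ n := by
                rw [mul_left_comm, ← pow_add, Nat.add_sub_cancel' (by omega)]
        _ = (n + 1) * (D * ((K + m * C) ^ n * (m * C))) := by
            simp only [Finset.sum_const, Finset.card_univ, Fintype.card_fin, nsmul_eq_mul]
            push_cast
            ring
        _ ≤ (n + 1) * (D * (K + m * C) ^ (n + 1)) := by
            rw [pow_succ]
            gcongr
            linarith

/-- Linear systems with holomorphic coefficients have solutions on a disc that does not depend on
the initial values. -/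
theorem exists_system_solution {A : Fin m → Fin m → ℂ → ℂ} {z : ℂ}
    (hA : ∀ i j, AnalyticAt ℂ (A i j) z) :
    ∃ ρ > 0, ∀ c₀ : Fin m → ℂ, ∃ Y : Fin m → ℂ → ℂ, (∀ i, Y i z = c₀ i) ∧
      ∀ w ∈ Metric.ball z ρ, ∀ i, HasDerivAt (Y i) (∑ j, A i j w * Y j w) w := by
  choose C K hC hK hb hs using fun i j => exists_taylor_bound (hA i j)
  obtain ⟨C', hC'⟩ : ∃ C', ∀ i j, C i j ≤ C' := by
    obtain ⟨M, hM⟩ := (Set.finite_range fun p : Fin m × Fin m => C p.1 p.2).bddAbove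
    exact ⟨M, fun i j => hM ⟨(i, j), rfl⟩⟩
  obtain ⟨K', hK'⟩ : ∃ K', ∀ i j, K i j ≤ K' := by
    obtain ⟨M, hM⟩ := (Set.finite_range fun p : Fin m × Fin m => K p.1 p.2).bddAbove
    exact ⟨M, fun i j => hM ⟨(i, j), rfl⟩⟩
  set C₁ := max C' 1
  set K₁ := max K' 1
  have hC₁ : 0 < C₁ := by positivity
  have hK₁ : 0 < K₁ := by positivity
  let a : ℕ → Matrix (Fin m) (Fin m) ℂ :=
    fun k i j => (k.factorial : ℂ)⁻¹ * iteratedDeriv k (A i j) z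
  have ha : ∀ k i j, ‖a k i j‖ ≤ C₁ * K₁ ^ k := fun k i j => (hb i j k).trans (by
    have h1 := hK i j
    have h2 := (hC' i j).trans (le_max_left _ (1 : ℝ))
    have h3 := (hK' i j).trans (le_max_left _ (1 : ℝ))
    have h4 := hC i j
    gcongr)
  set L := K₁ + m * C₁ with hL
  have hL0 : 0 < L := by positivity
  have hKL : K₁ ≤ L := by rw [hL]; nlinarith [(Nat.cast_nonneg m : (0 : ℝ) ≤ m)]
  refine ⟨L⁻¹, by positivity, fun c₀ => ?_⟩
  obtain ⟨D, hD⟩ : ∃ D, ∀ i, ‖c₀ i‖ ≤ D := ⟨‖c₀‖, fun i => norm_le_pi_norm c₀ i⟩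
  have hc := norm_systemCoeff_le hC₁ hK₁ ha hD
  refine ⟨fun i w => ∑' n, systemCoeff a c₀ n i * (w - z) ^ n, fun i => ?_, fun w hw i => ?_⟩
  · dsimp only
    rw [tsum_eq_single 0 (by intro n hn; simp [hn])]
    simp [systemCoeff]
  · rw [Metric.mem_ball, dist_eq_norm] at hw
    have hw1 : L * ‖w - z‖ < 1 := by
      calc L * ‖w - z‖ < L * L⁻¹ := by gcongr
        _ = 1 := mul_inv_cancel₀ hL0.ne'
    have hw2 : K₁ * ‖w - z‖ < 1 := lt_of_le_of_lt (by gcongr) hw1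
    convert hasDerivAt_powerSeries (fun n => hc n i) hL0 hw1 using 1
    have h1 : ∀ j, Summable fun n => ‖a n i j * (w - z) ^ n‖ := fun j =>
      summable_powerSeries (fun n => ha n i j) hK₁.le hw2
    have h2 : ∀ j, Summable fun n => ‖systemCoeff a c₀ n j * (w - z) ^ n‖ := fun j =>
      summable_powerSeries (fun n => hc n j) hL0.le hw1
    have h3 : ∀ j, A i j w = ∑' n, a n i j * (w - z) ^ n := fun j =>
      ((hs i j w (lt_of_le_of_lt (by
        have := (hK' i j).trans (le_max_left _ (1 : ℝ)); gcongr) hw2)).tsum_eq).symm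
    have h4 : ∀ j, A i j w * ∑' n, systemCoeff a c₀ n j * (w - z) ^ n
        = ∑' n, ∑ k ∈ Finset.range (n + 1), (a k i j * (w - z) ^ k)
          * (systemCoeff a c₀ (n - k) j * (w - z) ^ (n - k)) := fun j => by
      rw [h3, tsum_mul_tsum_eq_tsum_sum_range_of_summable_norm (h1 j) (h2 j)]
    simp only [h4]
    rw [← Summable.tsum_finsetSum fun j _ =>
      (summable_norm_sum_mul_range_of_summable_norm (h1 j) (h2 j)).of_norm]
    refine tsum_congr fun n => ?_
    rw [systemCoeff, ← mul_assoc, mul_inv_cancel₀ (by exact_mod_cast Nat.succ_ne_zero n), one_mul,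
      Finset.sum_comm, Finset.sum_mul, ← Fin.sum_univ_eq_sum_range
        (fun k => ∑ j, a k i j * (w - z) ^ k
          * (systemCoeff a c₀ (n - k) j * (w - z) ^ (n - k)))]
    refine Finset.sum_congr rfl fun k _ => ?_
    rw [Finset.sum_mul]
    refine Finset.sum_congr rfl fun j _ => ?_
    have : (w - z) ^ n = (w - z) ^ (k : ℕ) * (w - z) ^ (n - k) := by
      rw [← pow_add, Nat.add_sub_cancel' (by omega)]
    rw [this]
    ring

/-- Near an ordinary point there are solutions with arbitrary initial data, all of them
holomorphic on one disc. -/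
theorem exists_local_solution {z : ℂ} (hz : z ∉ singularPoints q) (hm : 0 < m) :
    ∃ ρ > 0, Disjoint (Metric.ball z ρ) (singularPoints q) ∧ ∀ c : Fin m → ℂ, ∃ y : ℂ → ℂ,
      (∀ w ∈ Metric.ball z ρ, IsSolAt q y w) ∧ ∀ i : Fin m, iteratedDeriv i y z = c i := by
  obtain ⟨ρ₀, hρ₀, hb⟩ := Metric.mem_nhds_iff.1
    ((finite_singularPoints q).isClosed.isOpen_compl.mem_nhds hz)
  let A : Fin m → Fin m → ℂ → ℂ := fun i j w =>
    if (i : ℕ) + 1 < m then (if (j : ℕ) = i + 1 then 1 else 0) else value (q j) w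
  have hA : ∀ i j, AnalyticAt ℂ (A i j) z := by
    intro i j
    by_cases h : (i : ℕ) + 1 < m
    · simp only [A, h, if_true]
      exact analyticAt_const
    · simp only [A, h, if_false]
      exact analyticAt_value (not_isPole_of_notMem hz j)
  obtain ⟨ρ₁, hρ₁, hsol⟩ := exists_system_solution hA
  refine ⟨min ρ₀ ρ₁, lt_min hρ₀ hρ₁, ?_, fun c => ?_⟩
  · rw [Set.disjoint_left]
    exact fun w hw => hb (Metric.ball_subset_ball (min_le_left _ _) hw)
  obtain ⟨Y, hY0, hY⟩ := hsol c
  have hball : Metric.ball z (min ρ₀ ρ₁) ⊆ Metric.ball z ρ₁ :=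
    Metric.ball_subset_ball (min_le_right _ _)
  have key : ∀ i : ℕ, ∀ hi : i < m, ∀ w ∈ Metric.ball z ρ₁,
      iteratedDeriv i (Y ⟨0, hm⟩) w = Y ⟨i, hi⟩ w := by
    intro i
    induction i with
    | zero => intro hi w hw; simp
    | succ i ih =>
      intro hi w hw
      have h1 : iteratedDeriv i (Y ⟨0, hm⟩) =ᶠ[𝓝 w] Y ⟨i, by omega⟩ := by
        filter_upwards [Metric.isOpen_ball.mem_nhds hw] with v hv
        exact ih (by omega) v hv
      rw [iteratedDeriv_succ, h1.deriv_eq, (hY w hw _).deriv]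
      rw [Finset.sum_eq_single ⟨i + 1, hi⟩]
      · simp [A, hi]
      · intro j _ hj
        have : (j : ℕ) ≠ i + 1 := fun h => hj (Fin.ext h)
        simp [A, hi, this]
      · simp
  refine ⟨Y ⟨0, hm⟩, fun w hw => ?_, fun i => ?_⟩
  · have hd : DifferentiableOn ℂ (Y ⟨0, hm⟩) (Metric.ball z ρ₁) :=
      fun v hv => (hY v hv _).differentiableAt.differentiableWithinAt
    refine IsSolAt.of_isSolutionOn (Ω := Metric.ball z (min ρ₀ ρ₁)) Metric.isOpen_ball ?_
      ⟨hd.mono hball, fun v hv => ?_⟩ hw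
    · rw [Set.disjoint_left]
      exact fun w hw => hb (Metric.ball_subset_ball (min_le_left _ _) hw)
    · have hm1 : m - 1 < m := by omega
      have h1 : iteratedDeriv (m - 1) (Y ⟨0, hm⟩) =ᶠ[𝓝 v] Y ⟨m - 1, hm1⟩ := by
        filter_upwards [Metric.isOpen_ball.mem_nhds (hball hv)] with v hv
        exact key _ hm1 v hv
      have h2 : iteratedDeriv m (Y ⟨0, hm⟩) v = deriv (iteratedDeriv (m - 1) (Y ⟨0, hm⟩)) v := by
        rw [← iteratedDeriv_succ, Nat.sub_add_cancel hm]
      rw [h2, h1.deriv_eq, (hY v (hball hv) _).deriv]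
      refine Finset.sum_congr rfl fun j _ => ?_
      rw [key j j.2 v (hball hv)]
      simp [A, Nat.sub_add_cancel hm]
  · rw [key i i.2 z (Metric.mem_ball_self hρ₁), hY0]

end

/-! ### Bases of solutions on a connected domain -/

section

variable {m : ℕ} {q : Fin m → RatFunc ℂ}

theorem eqOn_of_eventuallyEq {f g : ℂ → ℂ} {Ω : Set ℂ} (hΩ : IsOpen Ω) (hc : IsPreconnected Ω)
    (hf : DifferentiableOn ℂ f Ω) (hg : DifferentiableOn ℂ g Ω) {z : ℂ} (hz : z ∈ Ω)
    (h : f =ᶠ[𝓝 z] g) : Set.EqOn f g Ω :=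
  (hf.analyticOnNhd hΩ).eqOn_of_preconnected_of_eventuallyEq (hg.analyticOnNhd hΩ) hc hz h

/-- The matrix of the derivatives of order `< m` of the functions `Y a` at `w`. -/
def dataMatrix (Y : Fin m → ℂ → ℂ) (w : ℂ) : Matrix (Fin m) (Fin m) ℂ :=
  Matrix.of fun a i => iteratedDeriv i (Y a) w

theorem isUnit_det_dataMatrix (hm : 0 < m) {Y : Fin m → ℂ → ℂ} {Ω : Set ℂ} (hΩ : IsOpen Ω)
    (hc : IsPreconnected Ω) (hS : Disjoint Ω (singularPoints q))
    (hY : ∀ a, ∀ w ∈ Ω, IsSolAt q (Y a) w)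
    (hind : ∀ c : Fin m → ℂ, (∀ w ∈ Ω, ∑ a, c a * Y a w = 0) → c = 0) {w : ℂ} (hw : w ∈ Ω) :
    IsUnit (dataMatrix Y w).det := by
  rw [isUnit_iff_ne_zero]
  intro hdet
  obtain ⟨c, hc0, hcW⟩ := Matrix.exists_vecMul_eq_zero_iff.2 hdet
  apply hc0
  apply hind
  have hsol : IsSolAt q (fun w => ∑ a, c a * Y a w) w :=
    IsSolAt.sum Finset.univ fun a _ => hY a w hw
  have h0 : ∀ᶠ v in 𝓝 w, (∑ a, c a * Y a v) = 0 := by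
    refine hsol.eventually_eq_zero (Set.disjoint_left.1 hS hw) hm fun i => ?_
    rw [(iteratedDeriv_sum_mul (c := c) Finset.univ (fun a _ => (hY a w hw).1) i).self_of_nhds]
    simpa [Matrix.vecMul, dotProduct, dataMatrix] using congrFun hcW i
  have hd : DifferentiableOn ℂ (fun w => ∑ a, c a * Y a w) Ω := fun v hv =>
    (Finset.analyticAt_fun_sum _ fun a _ =>
      analyticAt_const.mul (hY a v hv).1).differentiableAt.differentiableWithinAt
  exact eqOn_of_eventuallyEq hΩ hc hd (differentiableOn_const 0) hw h0

theorem exists_eventuallyEq_sum_of_isUnit (hm : 0 < m) {Y : Fin m → ℂ → ℂ} {w : ℂ}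
    (hS : w ∉ singularPoints q) (hY : ∀ a, IsSolAt q (Y a) w)
    (hu : IsUnit (dataMatrix Y w).det) {y : ℂ → ℂ} (hy : IsSolAt q y w) :
    ∃ c : Fin m → ℂ, y =ᶠ[𝓝 w] fun v => ∑ a, c a * Y a v := by
  set c := Matrix.vecMul (fun i : Fin m => iteratedDeriv i y w) (dataMatrix Y w)⁻¹ with hc
  refine ⟨c, ?_⟩
  have h1 : Matrix.vecMul c (dataMatrix Y w) = fun i : Fin m => iteratedDeriv i y w := by
    rw [hc, Matrix.vecMul_vecMul, Matrix.nonsing_inv_mul _ hu, Matrix.vecMul_one]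
  have hsol : IsSolAt q (fun w => ∑ a, c a * Y a w) w := IsSolAt.sum Finset.univ fun a _ => hY a
  have h2 := (hy.sub_smul hsol 1).eventually_eq_zero hS hm fun i => by
    have h3 : (fun v => y v - 1 * ∑ a, c a * Y a v)
        = fun v => ∑ j : Fin 2, ![1, -1] j * ![y, fun v => ∑ a, c a * Y a v] j v := by
      ext v; simp [Fin.sum_univ_two, sub_eq_add_neg]
    rw [h3, (iteratedDeriv_sum_mul Finset.univ (by
      intro j _; fin_cases j
      · exact hy.1
      · exact hsol.1) i).self_of_nhds]
    have h4 := congrFun h1 i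
    simp only [Matrix.vecMul, dotProduct, dataMatrix, Matrix.of_apply] at h4
    simp only [Fin.sum_univ_two, Matrix.cons_val_zero, Matrix.cons_val_one]
    rw [(iteratedDeriv_sum_mul (c := c) Finset.univ (fun a _ => (hY a).1) i).self_of_nhds, h4]
    ring
  filter_upwards [h2] with v hv
  rw [one_mul] at hv
  exact sub_eq_zero.1 hv

/-! ### Holomorphic continuation to larger discs -/

theorem exists_patch {ι : Type*} {O : ι → Set ℂ} {F : ι → ℂ → ℂ}
    (h : ∀ i j w, w ∈ O i → w ∈ O j → F i w = F j w) :
    ∃ G : ℂ → ℂ, ∀ i, Set.EqOn G (F i) (O i) := by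
  classical
  refine ⟨fun w => if hw : ∃ i, w ∈ O i then F hw.choose w else 0, fun i w hw => ?_⟩
  have hw' : ∃ i, w ∈ O i := ⟨i, hw⟩
  simp only [hw', dite_true]
  exact h _ _ _ hw'.choose_spec hw

theorem differentiableOn_patch {ι : Type*} {O : ι → Set ℂ} {F : ι → ℂ → ℂ} {G : ℂ → ℂ}
    (hO : ∀ i, IsOpen (O i)) (hF : ∀ i, DifferentiableOn ℂ (F i) (O i))
    (hG : ∀ i, Set.EqOn G (F i) (O i)) : DifferentiableOn ℂ G (⋃ i, O i) := by
  intro w hw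
  obtain ⟨i, hi⟩ := Set.mem_iUnion.1 hw
  have h1 : DifferentiableAt ℂ (F i) w := (hF i).differentiableAt ((hO i).mem_nhds hi)
  have h2 : G =ᶠ[𝓝 w] F i := by
    filter_upwards [(hO i).mem_nhds hi] with v hv using hG i hv
  exact (h1.congr_of_eventuallyEq h2).differentiableWithinAt

/-- A function on a disc that extends across every boundary point extends to a larger disc. The
local extensions are compatible once their radii are halved: of two overlapping half discs, one has its
full disc contain the other centre. -/
theorem exists_extension_of_forall_sphere {F : ℂ → ℂ} {z : ℂ} {ρ : ℝ} (hρ : 0 < ρ)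
    (hF : DifferentiableOn ℂ F (Metric.ball z ρ))
    (h : ∀ p ∈ Metric.sphere z ρ, ∃ ε > 0, ∃ G : ℂ → ℂ,
      DifferentiableOn ℂ G (Metric.ball p ε) ∧
        Set.EqOn G F (Metric.ball p ε ∩ Metric.ball z ρ)) :
    ∃ ρ' > ρ, ∃ G : ℂ → ℂ, DifferentiableOn ℂ G (Metric.ball z ρ') ∧
      Set.EqOn G F (Metric.ball z ρ) := by
  choose ε hε G hG hGF using h
  let O : Option (Metric.sphere z ρ) → Set ℂ := fun o =>
    o.elim (Metric.ball z ρ) fun p => Metric.ball p.1 (ε p.1 p.2 / 2)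
  let F' : Option (Metric.sphere z ρ) → ℂ → ℂ := fun o => o.elim F fun p => G p.1 p.2
  have hhalf : ∀ p (hp : p ∈ Metric.sphere z ρ),
      Metric.ball p (ε p hp / 2) ⊆ Metric.ball p (ε p hp) := fun p hp =>
    Metric.ball_subset_ball (by linarith [hε p hp])
  -- The larger of two overlapping half discs has its full disc contain the other centre,
  -- near which both extensions agree with `F`.
  have key : ∀ (p p' : Metric.sphere z ρ) (w : ℂ), ε p'.1 p'.2 ≤ ε p.1 p.2 →
      w ∈ Metric.ball p.1 (ε p.1 p.2 / 2) → w ∈ Metric.ball p'.1 (ε p'.1 p'.2 / 2) →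
      G p.1 p.2 w = G p'.1 p'.2 w := by
    intro p p' w hle hw hw'
    set V := Metric.ball p.1 (ε p.1 p.2) ∩ Metric.ball p'.1 (ε p'.1 p'.2) with hV
    have hVo : IsOpen V := Metric.isOpen_ball.inter Metric.isOpen_ball
    have hVc : IsPreconnected V :=
      ((convex_ball _ _).inter (convex_ball _ _)).isPreconnected
    have hp'V : p'.1 ∈ V := by
      refine ⟨?_, Metric.mem_ball_self (hε _ _)⟩
      rw [Metric.mem_ball] at hw hw' ⊢
      have := dist_triangle_left p'.1 p.1 w
      linarith
    have hcl : p'.1 ∈ closure (Metric.ball z ρ) := by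
      rw [closure_ball z hρ.ne']
      exact Metric.sphere_subset_closedBall p'.2
    obtain ⟨x, hxV, hxB⟩ := mem_closure_iff.1 hcl V hVo hp'V
    refine eqOn_of_eventuallyEq hVo hVc ((hG _ p.2).mono Set.inter_subset_left)
      ((hG _ p'.2).mono Set.inter_subset_right) hxV ?_ ⟨hhalf _ _ hw, hhalf _ _ hw'⟩
    filter_upwards [hVo.mem_nhds hxV, Metric.isOpen_ball.mem_nhds hxB] with v hv hvB
    rw [hGF _ p.2 ⟨hv.1, hvB⟩, hGF _ p'.2 ⟨hv.2, hvB⟩]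
  obtain ⟨G₀, hG₀⟩ := exists_patch (O := O) (F := F') (by
    rintro (_ | p) (_ | p') w hw hw'
    · rfl
    · exact (hGF _ p'.2 ⟨hhalf _ _ hw', hw⟩).symm
    · exact hGF _ p.2 ⟨hhalf _ _ hw, hw'⟩
    · rcases le_total (ε p'.1 p'.2) (ε p.1 p.2) with hle | hle
      · exact key p p' w hle hw hw'
      · exact (key p' p w hle hw' hw).symm)
  have hO : ∀ o, IsOpen (O o) := by
    rintro (_ | p)
    · exact Metric.isOpen_ball
    · exact Metric.isOpen_ball
  have hd := differentiableOn_patch hO (F := F') (G := G₀) (by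
    rintro (_ | p)
    · exact hF
    · exact (hG _ p.2).mono (hhalf _ _)) hG₀
  have hsub : Metric.closedBall z ρ ⊆ ⋃ o, O o := by
    intro w hw
    rcases (Metric.mem_closedBall.1 hw).lt_or_eq with h1 | h1
    · exact Set.mem_iUnion.2 ⟨none, h1⟩
    · exact Set.mem_iUnion.2 ⟨some ⟨w, h1⟩, Metric.mem_ball_self (half_pos (hε w h1))⟩
  obtain ⟨δ, hδ, hδs⟩ := (isCompact_closedBall z ρ).exists_thickening_subset_open
    (isOpen_iUnion hO) hsub
  rw [thickening_closedBall hδ hρ.le] at hδs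
  exact ⟨δ + ρ, by linarith, G₀, hd.mono hδs, hG₀ none⟩

/-- The germ of `y` at `z` extends to a holomorphic function on the disc of radius `ρ`. -/
def ExtendsToBall (y : ℂ → ℂ) (z : ℂ) (ρ : ℝ) : Prop :=
  ∃ F : ℂ → ℂ, DifferentiableOn ℂ F (Metric.ball z ρ) ∧ F =ᶠ[𝓝 z] y

theorem ExtendsToBall.mono {y : ℂ → ℂ} {z : ℂ} {ρ ρ' : ℝ} (h : ExtendsToBall y z ρ)
    (hle : ρ' ≤ ρ) : ExtendsToBall y z ρ' := by
  obtain ⟨F, hF, hFy⟩ := h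
  exact ⟨F, hF.mono (Metric.ball_subset_ball hle), hFy⟩

/-- Extensions to concentric discs are compatible, so they glue. -/
theorem exists_extension_of_forall_lt {y : ℂ → ℂ} {z : ℂ} {Ω : Set ℂ} {A : Set ℝ}
    (hA : ∀ r ∈ A, 0 < r) (h : ∀ r ∈ A, ExtendsToBall y z r) (hne : A.Nonempty)
    (hΩ : ∀ w ∈ Ω, ∃ r ∈ A, w ∈ Metric.ball z r) :
    ∃ F : ℂ → ℂ, DifferentiableOn ℂ F Ω ∧ F =ᶠ[𝓝 z] y := by
  choose F hF hFy using h
  obtain ⟨G, hG⟩ := exists_patch (ι := A) (O := fun r => Metric.ball z r.1)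
    (F := fun r => F r.1 r.2) (by
      rintro ⟨r, hr⟩ ⟨r', hr'⟩ w hw hw'
      have hmin : w ∈ Metric.ball z (min r r') := by
        rw [Metric.mem_ball]
        exact lt_min hw hw'
      exact eqOn_of_eventuallyEq (Ω := Metric.ball z (min r r')) Metric.isOpen_ball
        (convex_ball _ _).isPreconnected
        ((hF r hr).mono (Metric.ball_subset_ball (min_le_left _ _)))
        ((hF r' hr').mono (Metric.ball_subset_ball (min_le_right _ _)))
        (Metric.mem_ball_self (lt_min (hA r hr) (hA r' hr')))
        ((hFy r hr).trans (hFy r' hr').symm) hmin)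
  have hd := differentiableOn_patch (O := fun r : A => Metric.ball z r.1)
    (fun _ => Metric.isOpen_ball) (fun r => hF r.1 r.2) hG
  refine ⟨G, hd.mono fun w hw => ?_, ?_⟩
  · obtain ⟨r, hr, hwr⟩ := hΩ w hw
    exact Set.mem_iUnion.2 ⟨⟨r, hr⟩, hwr⟩
  · obtain ⟨r, hr⟩ := hne
    have : G =ᶠ[𝓝 z] F r hr := by
      filter_upwards [Metric.ball_mem_nhds z (hA r hr)] with w hw using hG ⟨r, hr⟩ hw
    exact this.trans (hFy r hr)

theorem isSolAt_of_differentiableOn_ball {F y : ℂ → ℂ} {z : ℂ} {ρ : ℝ} (hρ : 0 < ρ)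
    (hy : IsSolAt q y z) (hF : DifferentiableOn ℂ F (Metric.ball z ρ)) (hFy : F =ᶠ[𝓝 z] y)
    {w : ℂ} (hw : w ∈ Metric.ball z ρ) : IsSolAt q F w :=
  isSolAt_of_preconnected (convex_ball z ρ).isPreconnected (hF.analyticOnNhd Metric.isOpen_ball)
    (Metric.mem_ball_self hρ) (hy.congr hFy.symm) hw Metric.isOpen_ball

/-- A solution that is holomorphic on a disc extends across each ordinary boundary point. -/
theorem exists_extension_at_ordinary (hm : 0 < m) {F : ℂ → ℂ} {z p : ℂ} {ρ : ℝ} (hρ : 0 < ρ)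
    (hF : ∀ w ∈ Metric.ball z ρ, IsSolAt q F w) (hp : p ∈ Metric.sphere z ρ)
    (hpS : p ∉ singularPoints q) : ∃ ε > 0, ∃ G : ℂ → ℂ,
      DifferentiableOn ℂ G (Metric.ball p ε) ∧
        Set.EqOn G F (Metric.ball p ε ∩ Metric.ball z ρ) := by
  obtain ⟨ε, hε, hdisj, hsol⟩ := exists_local_solution hpS hm
  choose Y hY hY0 using fun a : Fin m => hsol (Pi.single a 1)
  have hind : ∀ c : Fin m → ℂ, (∀ w ∈ Metric.ball p ε, ∑ a, c a * Y a w = 0) → c = 0 := by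
    intro c hc
    ext i
    have h1 := (iteratedDeriv_sum_mul (c := c) Finset.univ
      (fun a _ => (hY a p (Metric.mem_ball_self hε)).1) i).self_of_nhds
    have h2 : (fun w => ∑ a, c a * Y a w) =ᶠ[𝓝 p] fun _ => 0 := by
      filter_upwards [Metric.ball_mem_nhds p hε] with w hw using hc w hw
    rw [(iteratedDeriv_congr_of_eventuallyEq h2 i).self_of_nhds] at h1
    simp [hY0, Pi.single_apply] at h1
    simpa using h1.symm
  have hcl : p ∈ closure (Metric.ball z ρ) := by
    rw [closure_ball z hρ.ne']
    exact Metric.sphere_subset_closedBall hp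
  obtain ⟨w, hwp, hwz⟩ := mem_closure_iff.1 hcl _ Metric.isOpen_ball (Metric.mem_ball_self hε)
  obtain ⟨c, hc⟩ := exists_eventuallyEq_sum_of_isUnit hm (Set.disjoint_left.1 hdisj hwp)
    (fun a => hY a w hwp) (isUnit_det_dataMatrix hm Metric.isOpen_ball
      (convex_ball _ _).isPreconnected hdisj hY hind hwp) (hF w hwz)
  have hd : DifferentiableOn ℂ (fun v => ∑ a, c a * Y a v) (Metric.ball p ε) := fun v hv =>
    (Finset.analyticAt_fun_sum _ fun a _ =>
      analyticAt_const.mul (hY a v hv).1).differentiableAt.differentiableWithinAt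
  refine ⟨ε, hε, fun v => ∑ a, c a * Y a v, hd, ?_⟩
  exact eqOn_of_eventuallyEq (Metric.isOpen_ball.inter Metric.isOpen_ball)
    ((convex_ball _ _).inter (convex_ball _ _)).isPreconnected (hd.mono Set.inter_subset_left)
    (fun v hv => (hF v hv.2).1.differentiableAt.differentiableWithinAt) ⟨hwp, hwz⟩ hc.symm

/-- A solution holomorphic on a disc extends up to the next singular point. -/
theorem ExtendsToBall.of_forall_singular (hm : 0 < m) {y : ℂ → ℂ} {z : ℂ} {ρ ρ₁ : ℝ} (hρ : 0 < ρ)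
    (hy : IsSolAt q y z) (h : ExtendsToBall y z ρ)
    (hS : ∀ s ∈ singularPoints q, dist s z < ρ ∨ ρ₁ ≤ dist s z) : ExtendsToBall y z ρ₁ := by
  rcases le_total ρ₁ ρ with h1 | h1
  · exact h.mono h1
  set A : Set ℝ := {r | ρ ≤ r ∧ r ≤ ρ₁ ∧ ExtendsToBall y z r} with hA
  have hAne : A.Nonempty := ⟨ρ, le_rfl, h1, h⟩
  have hAb : BddAbove A := ⟨ρ₁, fun r hr => hr.2.1⟩
  set R := sSup A with hR
  have hρR : ρ ≤ R := le_csSup hAb ⟨le_rfl, h1, h⟩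
  have hRρ₁ : R ≤ ρ₁ := csSup_le hAne fun r hr => hr.2.1
  obtain ⟨F, hF, hFy⟩ := exists_extension_of_forall_lt (y := y) (z := z) (Ω := Metric.ball z R)
    (A := A) (fun r hr => hρ.trans_le hr.1) (fun r hr => hr.2.2) hAne fun w hw => by
      obtain ⟨r, hr, hwr⟩ := exists_lt_of_lt_csSup hAne (Metric.mem_ball.1 hw)
      exact ⟨r, hr, hwr⟩
  rcases hRρ₁.eq_or_lt with h2 | h2
  · exact h2 ▸ ⟨F, hF, hFy⟩
  exfalso
  have hR0 : 0 < R := hρ.trans_le hρR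
  obtain ⟨ρ', hρ', G, hG, hGF⟩ := exists_extension_of_forall_sphere hR0 hF fun p hp => by
    refine exists_extension_at_ordinary hm hR0
      (fun w hw => isSolAt_of_differentiableOn_ball hR0 hy hF hFy hw) hp fun hpS => ?_
    rw [Metric.mem_sphere] at hp
    rcases hS p hpS with h3 | h3 <;> linarith
  have hmem : min ρ' ρ₁ ∈ A := by
    refine ⟨le_min (by linarith) h1, min_le_right _ _, G,
      hG.mono (Metric.ball_subset_ball (min_le_left _ _)), ?_⟩
    refine EventuallyEq.trans ?_ hFy
    filter_upwards [Metric.ball_mem_nhds z hR0] with w hw using hGF hw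
  have := le_csSup hAb hmem
  rw [← hR] at this
  rcases min_le_iff.1 this with h3 | h3 <;> linarith

/-- A solution holomorphic on a disc extends past its boundary if it extends across the only
singular point on the boundary. -/
theorem ExtendsToBall.beyond (hm : 0 < m) {y F g : ℂ → ℂ} {z s : ℂ} {ε : ℝ} (hzs : s ≠ z)
    (hy : IsSolAt q y z) (hF : DifferentiableOn ℂ F (Metric.ball z (dist s z)))
    (hFy : F =ᶠ[𝓝 z] y) (hS : ∀ p ∈ singularPoints q, dist p z = dist s z → p = s) (hε : 0 < ε)
    (hg : DifferentiableOn ℂ g (Metric.ball s ε))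
    (hgF : Set.EqOn g F (Metric.ball s ε ∩ Metric.ball z (dist s z))) :
    ∃ ρ > dist s z, ExtendsToBall y z ρ := by
  have hR : 0 < dist s z := dist_pos.2 hzs
  obtain ⟨ρ', hρ', G, hG, hGF⟩ := exists_extension_of_forall_sphere hR hF fun p hp => by
    by_cases hps : p = s
    · subst hps
      exact ⟨ε, hε, g, hg, hgF⟩
    · exact exists_extension_at_ordinary hm hR
        (fun w hw => isSolAt_of_differentiableOn_ball hR hy hF hFy hw) hp
        fun hpS => hps (hS p hpS hp)
  refine ⟨ρ', hρ', G, hG, EventuallyEq.trans ?_ hFy⟩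
  filter_upwards [Metric.ball_mem_nhds z hR] with w hw using hGF hw

end

/-! ### Derivatives of powers and logarithms -/

section

/-- `ℓ` is a holomorphic branch of `log (w - s)` on `O`. -/
def IsLogBranch (ℓ : ℂ → ℂ) (s : ℂ) (O : Set ℂ) : Prop :=
  ∀ w ∈ O, HasDerivAt ℓ (w - s)⁻¹ w ∧ Complex.exp (ℓ w) = w - s

theorem IsLogBranch.ne {ℓ : ℂ → ℂ} {s : ℂ} {O : Set ℂ} (h : IsLogBranch ℓ s O) {w : ℂ}
    (hw : w ∈ O) : w - s ≠ 0 := (h w hw).2 ▸ Complex.exp_ne_zero _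

theorem IsLogBranch.mono {ℓ : ℂ → ℂ} {s : ℂ} {O O' : Set ℂ} (h : IsLogBranch ℓ s O)
    (hO : O' ⊆ O) : IsLogBranch ℓ s O' := fun w hw => h w (hO hw)

theorem exp_sub_one_mul {l u : ℂ} (h : Complex.exp l = u) (τ : ℂ) :
    Complex.exp ((τ - 1) * l) = Complex.exp (τ * l) * u⁻¹ := by
  rw [sub_mul, one_mul, Complex.exp_sub, h, div_eq_mul_inv]

theorem exp_add_nat_mul {l u : ℂ} (h : Complex.exp l = u) (τ : ℂ) (k : ℕ) :
    Complex.exp ((τ + k) * l) = Complex.exp (τ * l) * u ^ k := by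
  rw [add_mul, Complex.exp_add, Complex.exp_nat_mul, h]

theorem exp_sub_nat_mul {l u : ℂ} (h : Complex.exp l = u) (τ : ℂ) (k : ℕ) :
    Complex.exp ((τ - k) * l) = Complex.exp (τ * l) / u ^ k := by
  rw [sub_mul, Complex.exp_sub, Complex.exp_nat_mul, h]

theorem hasDerivAt_exp_mul_log {ℓ : ℂ → ℂ} {s : ℂ} {O : Set ℂ} (hℓ : IsLogBranch ℓ s O) {w : ℂ}
    (hw : w ∈ O) (τ : ℂ) {h h₁ : ℂ → ℂ} {h' h₁' : ℂ} (hh : HasDerivAt h h' w)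
    (hh₁ : HasDerivAt h₁ h₁' w) :
    HasDerivAt (fun w => Complex.exp (τ * ℓ w) * (h w + ℓ w * h₁ w))
      (Complex.exp ((τ - 1) * ℓ w) * ((τ * h w + (w - s) * h' + h₁ w)
        + ℓ w * (τ * h₁ w + (w - s) * h₁'))) w := by
  obtain ⟨h1, h2⟩ := hℓ w hw
  have h3 := ((h1.const_mul τ).cexp).fun_mul (hh.fun_add (h1.fun_mul hh₁))
  refine h3.congr_deriv ?_
  rw [exp_sub_one_mul h2]
  have := hℓ.ne hw
  field_simp
  ring

/-- The functions `exp (τ ℓ) (h + ℓ h₁)` are stable under differentiation, which lowers the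
exponent `τ`; the new holomorphic factors do not depend on the branch `ℓ`. -/
theorem exists_iteratedDeriv_exp_mul_log {B : Set ℂ} (hB : IsOpen B) (s τ : ℂ) {h h₁ : ℂ → ℂ}
    (hh : DifferentiableOn ℂ h B) (hh₁ : DifferentiableOn ℂ h₁ B) (N : ℕ) :
    ∃ k k₁ : ℂ → ℂ, DifferentiableOn ℂ k B ∧ DifferentiableOn ℂ k₁ B ∧
      ∀ (ℓ : ℂ → ℂ) (O : Set ℂ), IsOpen O → O ⊆ B → IsLogBranch ℓ s O → ∀ w ∈ O,
        iteratedDeriv N (fun w => Complex.exp (τ * ℓ w) * (h w + ℓ w * h₁ w)) w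
          = Complex.exp ((τ - N) * ℓ w) * (k w + ℓ w * k₁ w) := by
  induction N with
  | zero => exact ⟨h, h₁, hh, hh₁, fun ℓ O _ _ _ w _ => by simp⟩
  | succ N ih =>
    obtain ⟨k, k₁, hk, hk₁, hrec⟩ := ih
    have hdk := (hk.deriv hB)
    have hdk₁ := (hk₁.deriv hB)
    refine ⟨fun w => (τ - N) * k w + (w - s) * deriv k w + k₁ w,
      fun w => (τ - N) * k₁ w + (w - s) * deriv k₁ w, by fun_prop, by fun_prop,
      fun ℓ O hO hOB hℓ w hw => ?_⟩
    have h1 : iteratedDeriv N (fun w => Complex.exp (τ * ℓ w) * (h w + ℓ w * h₁ w))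
        =ᶠ[𝓝 w] fun w => Complex.exp ((τ - N) * ℓ w) * (k w + ℓ w * k₁ w) := by
      filter_upwards [hO.mem_nhds hw] with v hv using hrec ℓ O hO hOB hℓ v hv
    have h2 := hasDerivAt_exp_mul_log hℓ hw (τ - N)
      (hk.differentiableAt (hB.mem_nhds (hOB hw))).hasDerivAt
      (hk₁.differentiableAt (hB.mem_nhds (hOB hw))).hasDerivAt
    rw [iteratedDeriv_succ, h1.deriv_eq, h2.deriv]
    push_cast
    ring_nf

/-- The model singularity of exponent `β` as a function of `l = log u`: it is `u ^ β`, or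
`u ^ β * log u` if `β` is a natural number. -/
def modelSing (β l : ℂ) : ℂ :=
  open Classical in if ∃ k : ℕ, β = k then Complex.exp (β * l) * l else Complex.exp (β * l)

/-- Derivatives of `exp (β ℓ) (a + ℓ b)`, with coefficients that do not depend on the branch `ℓ`. -/
theorem exists_iteratedDeriv_const_exp_mul_log (β a b : ℂ) : ∃ A B : ℕ → ℂ,
    A 0 = a ∧ B 0 = b ∧ (∀ j, A (j + 1) = (β - j) * A j + B j) ∧ (∀ j, B (j + 1) = (β - j) * B j) ∧
    ∀ (ℓ : ℂ → ℂ) (s : ℂ) (O : Set ℂ), IsOpen O → IsLogBranch ℓ s O → ∀ w ∈ O, ∀ j : ℕ,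
      iteratedDeriv j (fun w => Complex.exp (β * ℓ w) * (a + ℓ w * b)) w
        = Complex.exp ((β - j) * ℓ w) * (A j + ℓ w * B j) := by
  let AB : ℕ → ℂ × ℂ := fun n => Nat.rec (a, b)
    (fun j p => ((β - j) * p.1 + p.2, (β - j) * p.2)) n
  refine ⟨fun n => (AB n).1, fun n => (AB n).2, rfl, rfl, fun j => rfl, fun j => rfl,
    fun ℓ s O hO hℓ w hw j => ?_⟩
  induction j generalizing w with
  | zero => simp [AB]
  | succ j ih =>
    have h1 : iteratedDeriv j (fun w => Complex.exp (β * ℓ w) * (a + ℓ w * b))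
        =ᶠ[𝓝 w] fun w => Complex.exp ((β - j) * ℓ w) * ((AB j).1 + ℓ w * (AB j).2) := by
      filter_upwards [hO.mem_nhds hw] with v hv using ih v hv
    have h2 := hasDerivAt_exp_mul_log hℓ hw (β - j)
      (hasDerivAt_const w (AB j).1) (hasDerivAt_const w (AB j).2)
    rw [iteratedDeriv_succ, h1.deriv_eq, h2.deriv]
    simp only [AB]
    push_cast
    ring_nf

/-- `c` is, from the index `n₀` on, the sequence of the Taylor coefficients of the model
singularity of exponent `β`, normalized by the power `u ^ (β - n)`. -/
def IsModelCoeff (β : ℂ) (c : ℕ → ℂ) (n₀ : ℕ) : Prop :=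
  (∀ n ≥ n₀, c n ≠ 0 ∧ c (n + 1) = c n * (β - n) / (n + 1) ∧ β ≠ n) ∧
    ∀ (ℓ : ℂ → ℂ) (s : ℂ) (O : Set ℂ), IsOpen O → IsLogBranch ℓ s O → ∀ w ∈ O, ∀ n ≥ n₀,
      iteratedDeriv n (fun w => modelSing β (ℓ w)) w
        = n.factorial * c n * Complex.exp ((β - n) * ℓ w)

theorem exists_isModelCoeff (β : ℂ) : ∃ c n₀, IsModelCoeff β c n₀ := by
  have hfac : ∀ n : ℕ, (n.factorial : ℂ) ≠ 0 := fun n => by exact_mod_cast n.factorial_ne_zero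
  by_cases hβ : ∃ k : ℕ, β = k
  · obtain ⟨k, rfl⟩ := hβ
    obtain ⟨A, B, hA0, hB0, hA, hB, hAB⟩ := exists_iteratedDeriv_const_exp_mul_log k 0 1
    have hBne : ∀ j ≤ k, B j ≠ 0 := by
      intro j
      induction j with
      | zero => intro _; rw [hB0]; exact one_ne_zero
      | succ j ih =>
        intro hj
        rw [hB]
        refine mul_ne_zero (sub_ne_zero.2 ?_) (ih (by omega))
        exact_mod_cast (by omega : k ≠ j)
    have hBz : ∀ j ≥ k + 1, B j = 0 := by
      intro j hj
      induction j, hj using Nat.le_induction with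
      | base => rw [hB, sub_self, zero_mul]
      | succ j _ ih => rw [hB, ih, mul_zero]
    have hAne : ∀ j ≥ k + 1, A j ≠ 0 := by
      intro j hj
      induction j, hj using Nat.le_induction with
      | base => rw [hA, sub_self, zero_mul, zero_add]; exact hBne k le_rfl
      | succ j hj ih =>
        rw [hA, hBz j hj, add_zero]
        refine mul_ne_zero (sub_ne_zero.2 ?_) ih
        exact_mod_cast (by omega : k ≠ j)
    refine ⟨fun n => A n / n.factorial, k + 1, fun n hn => ⟨?_, ?_, ?_⟩, ?_⟩
    · exact div_ne_zero (hAne n hn) (hfac n)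
    · have h1 := hfac n
      have h2 : (n : ℂ) + 1 ≠ 0 := by exact_mod_cast Nat.succ_ne_zero n
      simp only [hA, hBz n hn, Nat.factorial_succ]
      push_cast
      field_simp
      ring
    · exact_mod_cast (by omega : k ≠ n)
    · intro ℓ s O hO hℓ w hw n hn
      have h1 : (fun w => modelSing k (ℓ w)) = fun w => Complex.exp (k * ℓ w) * (0 + ℓ w * 1) := by
        ext v; simp [modelSing]
      rw [h1, hAB ℓ s O hO hℓ w hw n, hBz n hn, mul_div_cancel₀ _ (hfac n)]
      ring
  · obtain ⟨A, B, hA0, hB0, hA, hB, hAB⟩ := exists_iteratedDeriv_const_exp_mul_log β 1 0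
    have hne : ∀ n : ℕ, β ≠ n := fun n h => hβ ⟨n, h⟩
    have hBz : ∀ j, B j = 0 := by
      intro j
      induction j with
      | zero => exact hB0
      | succ j ih => rw [hB, ih, mul_zero]
    have hAne : ∀ j, A j ≠ 0 := by
      intro j
      induction j with
      | zero => rw [hA0]; exact one_ne_zero
      | succ j ih =>
        rw [hA, hBz j, add_zero]
        exact mul_ne_zero (sub_ne_zero.2 (hne j)) ih
    refine ⟨fun n => A n / n.factorial, 0, fun n hn => ⟨?_, ?_, hne n⟩, ?_⟩
    · exact div_ne_zero (hAne n) (hfac n)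
    · have h1 := hfac n
      have h2 : (n : ℂ) + 1 ≠ 0 := by exact_mod_cast Nat.succ_ne_zero n
      simp only [hA, hBz n, Nat.factorial_succ]
      push_cast
      field_simp
      ring
    · intro ℓ s O hO hℓ w hw n hn
      have h1 : (fun w => modelSing β (ℓ w)) = fun w => Complex.exp (β * ℓ w) * (1 + ℓ w * 0) := by
        ext v; simp [modelSing, hβ]
      rw [h1, hAB ℓ s O hO hℓ w hw n, hBz n, mul_div_cancel₀ _ (hfac n)]
      ring

/-- The Taylor coefficients of a model singularity decay at most polynomially. -/
theorem IsModelCoeff.exists_le_norm {β : ℂ} {c : ℕ → ℂ} {n₀ : ℕ} (hc : IsModelCoeff β c n₀)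
    {p : ℕ} (hp : ‖β‖ ≤ p) : ∃ κ > 0, ∃ n₁ : ℕ, ∀ n ≥ n₁, κ / (n : ℝ) ^ (p + 1) ≤ ‖c n‖ := by
  set n₁ := max n₀ (p + 1) with hn₁
  have hpos : ∀ n ≥ n₁, 0 < n.descFactorial (p + 1) := fun n hn =>
    Nat.pos_of_ne_zero fun h => by
      rw [Nat.descFactorial_eq_zero_iff_lt] at h
      have := le_max_right n₀ (p + 1)
      omega
  have hmono : ∀ n ≥ n₁, ‖c n₁‖ * n₁.descFactorial (p + 1) ≤ ‖c n‖ * n.descFactorial (p + 1) := by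
    intro n hn
    induction n, hn using Nat.le_induction with
    | base => exact le_rfl
    | succ n hn ih =>
      refine ih.trans ?_
      have h1 : p ≤ n := by have := le_max_right n₀ (p + 1); omega
      rw [(hc.1 n ((le_max_left _ _).trans hn)).2.1, Nat.succ_descFactorial_succ,
        Nat.descFactorial_succ, norm_div, norm_mul]
      have h2 : ‖(n : ℂ) + 1‖ = (n : ℝ) + 1 := by exact_mod_cast Complex.norm_natCast (n + 1)
      have h3 : (n : ℝ) - p ≤ ‖β - n‖ := by
        have := norm_sub_norm_le (n : ℂ) β
        rw [Complex.norm_natCast, norm_sub_rev] at this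
        linarith
      rw [h2]
      push_cast [Nat.cast_sub h1]
      have h4 : (0 : ℝ) < (n : ℝ) + 1 := by positivity
      calc ‖c n‖ * (((n : ℝ) - p) * n.descFactorial p)
          ≤ ‖c n‖ * (‖β - n‖ * n.descFactorial p) := by gcongr
        _ = _ := by field_simp
  refine ⟨‖c n₁‖ * n₁.descFactorial (p + 1), ?_, n₁, fun n hn => ?_⟩
  · have h1 := (hc.1 n₁ (le_max_left _ _)).1
    have h2 := hpos n₁ le_rfl
    positivity
  · have h1 : (n.descFactorial (p + 1) : ℝ) ≤ (n : ℝ) ^ (p + 1) := by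
      exact_mod_cast Nat.descFactorial_le_pow n (p + 1)
    have h2 : (0 : ℝ) < n.descFactorial (p + 1) := by exact_mod_cast hpos n hn
    rw [div_le_iff₀ (h2.trans_le h1)]
    exact (hmono n hn).trans (by gcongr)

/-- The Taylor coefficients of a model singularity dominate those of the next exponent. -/
theorem IsModelCoeff.eventually_norm_succ_le {β : ℂ} {c c' : ℕ → ℂ} {n₀ n₀' : ℕ}
    (hc : IsModelCoeff β c n₀) (hc' : IsModelCoeff (β + 1) c' n₀') {ε : ℝ} (hε : 0 < ε) :
    ∀ᶠ n in atTop, ‖c' n‖ ≤ ε * ‖c n‖ := by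
  -- By the recursions, `c' n / c n * (β + 1 - n)` does not depend on `n`.
  set n₁ := max n₀ n₀' + 1 with hn₁
  have hconst : ∀ n ≥ n₁, c' n * (β + 1 - n) * c n₁ = c' n₁ * (β + 1 - n₁) * c n := by
    intro n hn
    induction n, hn using Nat.le_induction with
    | base => ring
    | succ n hn ih =>
      have h1 : n ≥ n₀ := by have := le_max_left n₀ n₀'; omega
      have h2 : n ≥ n₀' := by have := le_max_right n₀ n₀'; omega
      obtain ⟨_, h3, h4⟩ := hc.1 n h1
      obtain ⟨_, h5, h6⟩ := hc'.1 n h2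
      have h7 : (n : ℂ) + 1 ≠ 0 := by exact_mod_cast Nat.succ_ne_zero n
      rw [h3, h5]
      push_cast
      field_simp
      linear_combination (β - n) * ih
  have hcn : c n₁ ≠ 0 := (hc.1 n₁ (by have := le_max_left n₀ n₀'; omega)).1
  set κ := ‖c' n₁ * (β + 1 - n₁)‖ / ‖c n₁‖ with hκ
  have hlim : Tendsto (fun n : ℕ => (n : ℝ) - ‖β + 1‖) atTop atTop :=
    tendsto_atTop_add_const_right _ _ tendsto_natCast_atTop_atTop
  filter_upwards [eventually_ge_atTop n₁, hlim.eventually_ge_atTop (κ / ε),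
    hlim.eventually_gt_atTop 0] with n hn hn2 hn3
  have h1 : (n : ℝ) - ‖β + 1‖ ≤ ‖β + 1 - n‖ := by
    have := norm_sub_norm_le (n : ℂ) (β + 1)
    rwa [Complex.norm_natCast, norm_sub_rev] at this
  have h2 : ‖c' n‖ * ‖β + 1 - n‖ = κ * ‖c n‖ := by
    have := congrArg norm (hconst n hn)
    rw [norm_mul, norm_mul _ (c n), norm_mul (c' n)] at this
    rw [hκ]
    field_simp
    exact this
  have h3 : κ ≤ ε * ‖β + 1 - n‖ := by
    rw [div_le_iff₀ hε] at hn2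
    nlinarith
  have h4 : 0 < ‖β + 1 - n‖ := hn3.trans_le h1
  have h5 : ‖c' n‖ * ‖β + 1 - n‖ ≤ ε * ‖c n‖ * ‖β + 1 - n‖ := by
    rw [h2]
    calc κ * ‖c n‖ ≤ ε * ‖β + 1 - n‖ * ‖c n‖ := by gcongr
      _ = _ := by ring
  exact le_of_mul_le_mul_right h5 h4

theorem eventually_norm_modelCoeff_le {σ : ℂ} {c : ℕ → ℕ → ℂ} {n₀ : ℕ → ℕ}
    (hc : ∀ k : ℕ, IsModelCoeff (σ + k) (c k) (n₀ k)) (k : ℕ) {ε : ℝ} (hε : 0 < ε) :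
    ∀ᶠ n in atTop, ‖c (k + 1) n‖ ≤ ε * ‖c 0 n‖ := by
  have hstep : ∀ k {ε : ℝ}, 0 < ε → ∀ᶠ n in atTop, ‖c (k + 1) n‖ ≤ ε * ‖c k n‖ := fun k ε hε =>
    (hc k).eventually_norm_succ_le (by
      have := hc (k + 1)
      push_cast at this
      rwa [← add_assoc] at this) hε
  induction k with
  | zero => exact hstep 0 hε
  | succ k ih =>
    filter_upwards [ih, hstep (k + 1) one_pos] with n h1 h2
    linarith

/-! ### Lower bounds for the derivatives at a distance from a singularity -/

theorem norm_iteratedDeriv_le_of_ball {f : ℂ → ℂ} {z : ℂ} {R C : ℝ} (hR : 0 < R)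
    (hf : DifferentiableOn ℂ f (Metric.ball z R)) (hC : ∀ w ∈ Metric.ball z R, ‖f w‖ ≤ C) (n : ℕ) :
    ‖iteratedDeriv n f z‖ ≤ n.factorial * C / R ^ n := by
  have h1 : ∀ r ∈ Set.Ioo 0 R, ‖iteratedDeriv n f z‖ * r ^ n ≤ n.factorial * C := by
    intro r hr
    have hsub : Metric.closedBall z r ⊆ Metric.ball z R := Metric.closedBall_subset_ball hr.2
    have := Complex.norm_iteratedDeriv_le_of_forall_mem_sphere_norm_le (f := f) (c := z) (C := C) n
      hr.1 ((hf.mono hsub).diffContOnCl_ball subset_rfl) fun v hv =>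
        hC v (hsub (Metric.sphere_subset_closedBall hv))
    rwa [le_div_iff₀ (pow_pos hr.1 n)] at this
  rw [le_div_iff₀ (pow_pos hR n)]
  have h2 : Tendsto (fun r : ℝ => ‖iteratedDeriv n f z‖ * r ^ n) (𝓝[<] R)
      (𝓝 (‖iteratedDeriv n f z‖ * R ^ n)) :=
    ((continuous_const.mul (continuous_pow n)).tendsto R).mono_left nhdsWithin_le_nhds
  refine le_of_tendsto h2 ?_
  filter_upwards [Ioo_mem_nhdsLT hR] with r hr using h1 r hr

theorem re_of_exp_eq {l u : ℂ} (h : Complex.exp l = u) : l.re = Real.log ‖u‖ := by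
  rw [← h, Complex.norm_exp, Real.log_exp]

theorem norm_exp_mul_of_exp_eq {l u : ℂ} (h : Complex.exp l = u) (σ : ℂ) :
    ‖Complex.exp (σ * l)‖ = Real.exp (σ.re * Real.log ‖u‖ - σ.im * l.im) := by
  rw [Complex.norm_exp, Complex.mul_re, re_of_exp_eq h]

theorem exists_le_norm_exp_mul (σ : ℂ) {N : ℕ} (hN : σ.re ≤ N) (R Λ : ℝ) : ∃ κ > 0, ∀ l u : ℂ,
    Complex.exp l = u → ‖u‖ ≤ R → |l.im| ≤ Λ → κ * ‖u‖ ^ N ≤ ‖Complex.exp (σ * l)‖ := by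
  refine ⟨Real.exp (-((N - σ.re) * Real.log (max R 1)) - |σ.im| * Λ), Real.exp_pos _,
    fun l u hl hu hΛ => ?_⟩
  have hu0 : 0 < ‖u‖ := by rw [← hl]; exact norm_pos_iff.2 (Complex.exp_ne_zero _)
  rw [norm_exp_mul_of_exp_eq hl]
  have h1 : ‖u‖ ^ N = Real.exp (N * Real.log ‖u‖) := by
    rw [Real.exp_nat_mul, Real.exp_log hu0]
  rw [h1, ← Real.exp_add, Real.exp_le_exp]
  have h2 : Real.log ‖u‖ ≤ Real.log (max R 1) := Real.log_le_log hu0 (hu.trans (le_max_left _ _))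
  have h3 : σ.im * l.im ≤ |σ.im| * Λ := by
    calc σ.im * l.im ≤ |σ.im * l.im| := le_abs_self _
      _ = |σ.im| * |l.im| := abs_mul _ _
      _ ≤ _ := by gcongr
  nlinarith

/-- Functions `exp (τ ℓ) (h + ℓ h₁)` with `1 ≤ Re τ` and bounded `h`, `h₁` are bounded. -/
theorem exists_norm_exp_mul_log_le {τ : ℂ} (hτ : 1 ≤ τ.re) (Λ M : ℝ) : ∃ C, ∀ l u h h₁ : ℂ,
    Complex.exp l = u → ‖u‖ ≤ 1 → |l.im| ≤ Λ → ‖h‖ ≤ M → ‖h₁‖ ≤ M →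
      ‖Complex.exp (τ * l) * (h + l * h₁)‖ ≤ C := by
  refine ⟨Real.exp (|τ.im| * Λ) * (M * (2 + Λ)), fun l u h h₁ hl hu hΛ hh hh₁ => ?_⟩
  have hu0 : 0 < ‖u‖ := by rw [← hl]; exact norm_pos_iff.2 (Complex.exp_ne_zero _)
  have hM : 0 ≤ M := (norm_nonneg _).trans hh
  have hlog : Real.log ‖u‖ ≤ 0 := Real.log_nonpos hu0.le hu
  have h1 : ‖Complex.exp (τ * l)‖ ≤ Real.exp (|τ.im| * Λ) * ‖u‖ := by
    rw [norm_exp_mul_of_exp_eq hl]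
    conv_rhs => rw [← Real.exp_log hu0]
    rw [← Real.exp_add, Real.exp_le_exp]
    have h3 : -(τ.im * l.im) ≤ |τ.im| * Λ := by
      calc -(τ.im * l.im) ≤ |τ.im * l.im| := neg_le_abs _
        _ = |τ.im| * |l.im| := abs_mul _ _
        _ ≤ _ := by gcongr
    nlinarith
  have h2 : ‖l‖ ≤ |Real.log ‖u‖| + Λ := by
    calc ‖l‖ ≤ |l.re| + |l.im| := Complex.norm_le_abs_re_add_abs_im l
      _ ≤ _ := by rw [re_of_exp_eq hl]; gcongr
  have h3 : ‖u‖ * |Real.log ‖u‖| ≤ 1 := by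
    have := (Real.abs_log_mul_self_lt ‖u‖ hu0 hu).le
    rwa [abs_mul, abs_of_pos hu0, mul_comm] at this
  have hΛ0 : 0 ≤ Λ := (abs_nonneg _).trans hΛ
  rw [norm_mul]
  calc ‖Complex.exp (τ * l)‖ * ‖h + l * h₁‖
      ≤ Real.exp (|τ.im| * Λ) * ‖u‖ * (M + (|Real.log ‖u‖| + Λ) * M) := by
        refine mul_le_mul h1 ((norm_add_le _ _).trans ?_) (norm_nonneg _) (by positivity)
        rw [norm_mul]
        gcongr
    _ = Real.exp (|τ.im| * Λ) * (M * (‖u‖ + ‖u‖ * |Real.log ‖u‖| + ‖u‖ * Λ)) := by ring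
    _ ≤ Real.exp (|τ.im| * Λ) * (M * (1 + 1 + 1 * Λ)) := by gcongr
    _ = _ := by ring

theorem differentiableOn_modelSing {ℓ : ℂ → ℂ} {s : ℂ} {O : Set ℂ} (hℓ : IsLogBranch ℓ s O)
    (β : ℂ) : DifferentiableOn ℂ (fun w => modelSing β (ℓ w)) O := by
  have h1 : DifferentiableOn ℂ ℓ O :=
    fun w hw => (hℓ w hw).1.differentiableAt.differentiableWithinAt
  unfold modelSing
  split_ifs <;> fun_prop

theorem iteratedDeriv_iteratedDeriv (f : ℂ → ℂ) (n N : ℕ) :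
    iteratedDeriv n (iteratedDeriv N f) = iteratedDeriv (n + N) f := by
  induction n with
  | zero => simp
  | succ n ih => rw [iteratedDeriv_succ, ih, Nat.succ_add n N, ← iteratedDeriv_succ]

theorem differentiableOn_iteratedDeriv {f : ℂ → ℂ} {O : Set ℂ} (hO : IsOpen O)
    (hf : DifferentiableOn ℂ f O) (n : ℕ) : DifferentiableOn ℂ (iteratedDeriv n f) O := by
  induction n with
  | zero => simpa using hf
  | succ n ih => rw [iteratedDeriv_succ]; exact ih.deriv hO

theorem factorial_sub_div_le {n N : ℕ} (h : 2 * N ≤ n) :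
    ((n - N).factorial : ℝ) / n.factorial ≤ 2 ^ N / (n : ℝ) ^ N := by
  rcases Nat.eq_zero_or_pos n with rfl | hn
  · obtain rfl : N = 0 := by omega
    simp
  have h1 : (n - N).factorial * n.descFactorial N = n.factorial :=
    Nat.factorial_mul_descFactorial (by omega)
  have h2 : ((n + 1 - N : ℕ) : ℝ) ^ N ≤ n.descFactorial N := by
    exact_mod_cast Nat.pow_sub_le_descFactorial n N
  have h3 : (n : ℝ) / 2 ≤ ((n + 1 - N : ℕ) : ℝ) := by
    have : (n : ℝ) ≤ ((2 * (n + 1 - N) : ℕ) : ℝ) := by exact_mod_cast (by omega)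
    push_cast at this
    linarith
  have h4 : ((n : ℝ) / 2) ^ N ≤ n.descFactorial N :=
    (pow_le_pow_left₀ (by positivity) h3 N).trans h2
  have hn' : (0 : ℝ) < n := by exact_mod_cast hn
  have h5 : (0 : ℝ) < n.descFactorial N := lt_of_lt_of_le (by positivity) h4
  rw [← h1]
  push_cast
  have h6 : (0 : ℝ) < (n - N).factorial := by positivity
  rw [div_mul_cancel_left₀ h6.ne', inv_le_comm₀ h5 (by positivity), inv_div, ← div_pow]
  exact h4

/-- If `f` is holomorphic on the disc around `z` with `s` on its boundary, and near `s`, up to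
a term with bounded `N`-th derivative, a combination of model singularities with exponents
`σ + k`, the first one present, then the Taylor coefficients of `f` at `z` are bounded below.
The bound is uniform in all the data except for the exponents and coefficients. -/
theorem exists_taylor_lower_bound (σ : ℂ) {N : ℕ} (hN : ‖σ‖ + 2 ≤ N) (K : ℕ) (e : ℕ → ℂ)
    (he : e 0 ≠ 0) (R C Λ : ℝ) : ∃ n₁ : ℕ, ∀ n ≥ n₁, ∀ (s z : ℂ) (ℓ f : ℂ → ℂ), z ≠ s →
      ‖z - s‖ ≤ R → IsLogBranch ℓ s (Metric.ball z ‖z - s‖) → |(ℓ z).im| ≤ Λ →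
      DifferentiableOn ℂ f (Metric.ball z ‖z - s‖) →
      (∀ w ∈ Metric.ball z ‖z - s‖, ‖iteratedDeriv N (fun w => f w
        - ∑ k ∈ Finset.range (K + 1), e k * modelSing (σ + k) (ℓ w)) w‖ ≤ C) →
      ‖z - s‖ ^ N / (n : ℝ) ^ N ≤ ‖z - s‖ ^ n * ‖iteratedDeriv n f z‖ / n.factorial := by
  obtain ⟨p, rfl⟩ : ∃ p, N = p + 2 := ⟨N - 2, by
    have : (2 : ℝ) ≤ N := by linarith [norm_nonneg σ]
    have : 2 ≤ N := by exact_mod_cast this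
    omega⟩
  have hp : ‖σ‖ ≤ p := by push_cast at hN; linarith
  choose c n₀ hc using fun k : ℕ => exists_isModelCoeff (σ + k)
  obtain ⟨κ₁, hκ₁, n₁, hn₁⟩ := (hc 0).exists_le_norm (p := p) (by simpa using hp)
  obtain ⟨κ₂, hκ₂, hexp⟩ := exists_le_norm_exp_mul σ (N := p + 2) (by
    push_cast; linarith [Complex.re_le_norm σ]) R Λ
  set R' := max R 0 with hR'
  have hR'0 : 0 ≤ R' := le_max_right _ _
  set D := ∑ k ∈ Finset.range K, ‖e (k + 1)‖ * R' ^ (k + 1) with hD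
  have hD0 : 0 ≤ D := Finset.sum_nonneg fun k _ => by positivity
  have he0 : 0 < ‖e 0‖ := norm_pos_iff.2 he
  set ε := ‖e 0‖ / (2 * (D + 1)) with hε
  have hε0 : 0 < ε := by positivity
  have hsmall : ∀ᶠ n in atTop, ∀ k ∈ Finset.range K, ‖c (k + 1) n‖ ≤ ε * ‖c 0 n‖ :=
    (Finset.eventually_all _).2 fun k _ => eventually_norm_modelCoeff_le hc k hε0
  have hn₀ : ∀ᶠ n in atTop, ∀ k ∈ Finset.range (K + 1), n₀ k ≤ n :=
    (Finset.eventually_all _).2 fun k _ => eventually_ge_atTop _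
  have hlarge : ∀ᶠ n : ℕ in atTop, (1 + C * 2 ^ (p + 2)) / (‖e 0‖ / 2 * κ₁ * κ₂) ≤ (n : ℝ) :=
    tendsto_natCast_atTop_atTop.eventually_ge_atTop _
  obtain ⟨n₂, hn₂⟩ := eventually_atTop.1 (hsmall.and (hn₀.and (hlarge.and
    ((eventually_ge_atTop n₁).and ((eventually_ge_atTop (2 * (p + 2))).and
      (eventually_gt_atTop 0))))))
  refine ⟨n₂, fun n hn s z ℓ f hzs hzR hℓ hΛ hf hψ => ?_⟩
  obtain ⟨h1, h2, h3, h4, h5, h6⟩ := hn₂ n hn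
  set u := z - s with hu
  have hu0 : 0 < ‖u‖ := norm_pos_iff.2 (sub_ne_zero.2 hzs)
  have hzb : z ∈ Metric.ball z ‖u‖ := Metric.mem_ball_self hu0
  have hexpz := (hℓ z hzb).2
  have hn0 : (0 : ℝ) < n := by exact_mod_cast h6
  have hfac : (0 : ℝ) < n.factorial := by positivity
  set ψ := fun w => f w - ∑ k ∈ Finset.range (K + 1), e k * modelSing (σ + k) (ℓ w) with hψd
  have hmd : ∀ k, DifferentiableOn ℂ (fun w => modelSing (σ + k) (ℓ w)) (Metric.ball z ‖u‖) :=
    fun k => differentiableOn_modelSing hℓ _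
  have hψdiff : DifferentiableOn ℂ ψ (Metric.ball z ‖u‖) :=
    hf.sub (DifferentiableOn.fun_sum fun k _ => (hmd k).const_mul _)
  have hana : ∀ g : ℂ → ℂ, DifferentiableOn ℂ g (Metric.ball z ‖u‖) → AnalyticAt ℂ g z :=
    fun g hg =>
    hg.analyticAt (Metric.isOpen_ball.mem_nhds hzb)
  have hB : AnalyticAt ℂ (fun w =>
      ∑ k ∈ Finset.range (K + 1), e k * modelSing (σ + k) (ℓ w)) z :=
    hana _ (DifferentiableOn.fun_sum fun k _ => (hmd k).const_mul (e k))
  -- The exact contribution of the model singularities.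
  have hsum : iteratedDeriv n f z = iteratedDeriv n ψ z + ∑ k ∈ Finset.range (K + 1),
      e k * (n.factorial * c k n * Complex.exp ((σ + k - n) * ℓ z)) := by
    have e1 : f = fun w => ∑ i : Fin 2, ![1, 1] i * ![ψ, fun w =>
        ∑ k ∈ Finset.range (K + 1), e k * modelSing (σ + k) (ℓ w)] i w := by
      ext w; simp [Fin.sum_univ_two, hψd]
    conv_lhs => rw [e1]
    rw [(iteratedDeriv_sum_mul Finset.univ (by
      intro j _; fin_cases j
      · exact hana _ hψdiff
      · exact hB) n).self_of_nhds]
    simp only [Fin.sum_univ_two, Matrix.cons_val_zero, Matrix.cons_val_one, one_mul]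
    rw [(iteratedDeriv_sum_mul (c := e) _ (fun k _ => hana _ (hmd k)) n).self_of_nhds]
    congr 1
    exact Finset.sum_congr rfl fun k hk => by
      rw [(hc k).2 ℓ s _ Metric.isOpen_ball hℓ z hzb n (h2 k hk)]
  have hrem : ‖iteratedDeriv n ψ z‖ ≤ n.factorial * (C * 2 ^ (p + 2) / (n : ℝ) ^ (p + 2))
      * ‖u‖ ^ (p + 2) / ‖u‖ ^ n := by
    have e1 := norm_iteratedDeriv_le_of_ball hu0
      (differentiableOn_iteratedDeriv Metric.isOpen_ball hψdiff (p + 2)) hψ (n - (p + 2))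
    rw [iteratedDeriv_iteratedDeriv, Nat.sub_add_cancel (by omega)] at e1
    have e2 := factorial_sub_div_le (n := n) (N := p + 2) h5
    have e3 : ‖u‖ ^ n = ‖u‖ ^ (n - (p + 2)) * ‖u‖ ^ (p + 2) := by
      rw [← pow_add, Nat.sub_add_cancel (by omega)]
    have hC0 : 0 ≤ C := (norm_nonneg _).trans (hψ z hzb)
    refine e1.trans ?_
    rw [e3, mul_div_mul_right _ _ (pow_pos hu0 _).ne']
    rw [div_le_div_iff_of_pos_right (pow_pos hu0 _)]
    rw [div_le_iff₀ hfac] at e2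
    calc _ = C * (n - (p + 2)).factorial := by ring
      _ ≤ C * (2 ^ (p + 2) / (n : ℝ) ^ (p + 2) * n.factorial) := by gcongr
      _ = _ := by ring
  have hterm : ∀ k, ‖e k * (n.factorial * c k n * Complex.exp ((σ + k - n) * ℓ z))‖
      = n.factorial * (‖e k‖ * ‖u‖ ^ k * ‖c k n‖ * ‖Complex.exp (σ * ℓ z)‖) / ‖u‖ ^ n := by
    intro k
    rw [exp_sub_nat_mul hexpz, exp_add_nat_mul hexpz]
    simp only [norm_mul, norm_div, norm_pow, Complex.norm_natCast]
    ring
  set X := ‖Complex.exp (σ * ℓ z)‖ with hX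
  have hX0 : 0 < X := norm_pos_iff.2 (Complex.exp_ne_zero _)
  have hmain : n.factorial * (‖e 0‖ / 2 * ‖c 0 n‖ * X) / ‖u‖ ^ n
      ≤ ‖∑ k ∈ Finset.range (K + 1),
        e k * (n.factorial * c k n * Complex.exp ((σ + k - n) * ℓ z))‖ := by
    rw [Finset.sum_range_succ', add_comm]
    refine le_trans ?_ (norm_sub_le_norm_add _ _)
    rw [hterm 0]
    have e1 : ‖∑ k ∈ Finset.range K, e (k + 1) * (n.factorial * c (k + 1) n
        * Complex.exp ((σ + (k + 1 : ℕ) - n) * ℓ z))‖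
        ≤ n.factorial * (‖e 0‖ / 2 * ‖c 0 n‖ * X) / ‖u‖ ^ n := by
      refine (norm_sum_le _ _).trans ?_
      calc _ ≤ ∑ k ∈ Finset.range K, n.factorial
            * ((‖e (k + 1)‖ * R' ^ (k + 1)) * (ε * ‖c 0 n‖) * X) / ‖u‖ ^ n := by
            refine Finset.sum_le_sum fun k hk => ?_
            rw [hterm]
            have := h1 k hk
            have hu' : ‖u‖ ≤ R' := hzR.trans (le_max_left _ _)
            gcongr
        _ = n.factorial * (D * ε * ‖c 0 n‖ * X) / ‖u‖ ^ n := by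
            rw [hD, ← Finset.sum_div, ← Finset.mul_sum, ← Finset.sum_mul, ← Finset.sum_mul]
            ring
        _ ≤ _ := by
            have : D * ε ≤ ‖e 0‖ / 2 := by
              rw [hε, ← mul_div_assoc, div_le_div_iff₀ (by positivity) (by positivity)]
              nlinarith
            gcongr
    simp only [pow_zero, mul_one]
    have e2 : (n.factorial : ℝ) * (‖e 0‖ * ‖c 0 n‖ * X) / ‖u‖ ^ n
        = n.factorial * (‖e 0‖ / 2 * ‖c 0 n‖ * X) / ‖u‖ ^ n
          + n.factorial * (‖e 0‖ / 2 * ‖c 0 n‖ * X) / ‖u‖ ^ n := by ring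
    rw [e2]
    linarith
  have hlow : n.factorial * ((‖e 0‖ / 2 * ‖c 0 n‖ * X)
      - C * 2 ^ (p + 2) / (n : ℝ) ^ (p + 2) * ‖u‖ ^ (p + 2)) / ‖u‖ ^ n ≤ ‖iteratedDeriv n f z‖ := by
    rw [hsum, add_comm (iteratedDeriv n ψ z)]
    refine le_trans ?_ (norm_sub_le_norm_add _ _)
    calc _ = n.factorial * (‖e 0‖ / 2 * ‖c 0 n‖ * X) / ‖u‖ ^ n
          - n.factorial * (C * 2 ^ (p + 2) / (n : ℝ) ^ (p + 2)) * ‖u‖ ^ (p + 2) / ‖u‖ ^ n := by ring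
      _ ≤ _ := by linarith
  have hX1 := hexp (ℓ z) u hexpz hzR hΛ
  have hc1 := hn₁ n h4
  have hfin : ‖u‖ ^ (p + 2) / (n : ℝ) ^ (p + 2) ≤ (‖e 0‖ / 2 * ‖c 0 n‖ * X)
      - C * 2 ^ (p + 2) / (n : ℝ) ^ (p + 2) * ‖u‖ ^ (p + 2) := by
    have e1 : ‖e 0‖ / 2 * (κ₁ / (n : ℝ) ^ (p + 1)) * (κ₂ * ‖u‖ ^ (p + 2))
        ≤ ‖e 0‖ / 2 * ‖c 0 n‖ * X := by gcongr
    refine le_trans ?_ (sub_le_sub_right e1 _)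
    rw [div_le_iff₀ (by positivity)] at h3
    have e2 : ‖e 0‖ / 2 * (κ₁ / (n : ℝ) ^ (p + 1)) * (κ₂ * ‖u‖ ^ (p + 2))
        - C * 2 ^ (p + 2) / (n : ℝ) ^ (p + 2) * ‖u‖ ^ (p + 2)
        = (n * (‖e 0‖ / 2 * κ₁ * κ₂) - C * 2 ^ (p + 2))
          * (‖u‖ ^ (p + 2) / (n : ℝ) ^ (p + 2)) := by
      field_simp
      ring
    rw [e2]
    have e3 : 0 ≤ ‖u‖ ^ (p + 2) / (n : ℝ) ^ (p + 2) := by positivity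
    nlinarith
  calc ‖u‖ ^ (p + 2) / (n : ℝ) ^ (p + 2) ≤ _ := hfin
    _ = ‖u‖ ^ n * (n.factorial * ((‖e 0‖ / 2 * ‖c 0 n‖ * X)
      - C * 2 ^ (p + 2) / (n : ℝ) ^ (p + 2) * ‖u‖ ^ (p + 2)) / ‖u‖ ^ n) / n.factorial := by
        field_simp
    _ ≤ _ := by gcongr

end

/-! ### A first order equation with a regular singular point -/

section

theorem exists_norm_inv_add_le (σ : ℂ) : ∃ M > 0, ∀ k : ℕ, ‖((k : ℂ) + σ)⁻¹‖ ≤ M := by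
  obtain ⟨k₀, hk₀⟩ := exists_nat_ge (‖σ‖ + 1)
  refine ⟨1 + ∑ k ∈ Finset.range k₀, ‖((k : ℂ) + σ)⁻¹‖, by positivity, fun k => ?_⟩
  by_cases hk : k < k₀
  · have := Finset.single_le_sum (f := fun k : ℕ => ‖((k : ℂ) + σ)⁻¹‖)
      (fun i _ => norm_nonneg _) (Finset.mem_range.2 hk)
    linarith
  · have h1 : (1 : ℝ) ≤ ‖(k : ℂ) + σ‖ := by
      have h2 := norm_sub_norm_le (k : ℂ) (-σ)
      rw [Complex.norm_natCast, norm_neg, sub_neg_eq_add] at h2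
      have h3 : (k₀ : ℝ) ≤ k := by exact_mod_cast not_lt.1 hk
      linarith
    rw [norm_inv]
    have : ‖(k : ℂ) + σ‖⁻¹ ≤ 1 := inv_le_one_of_one_le₀ h1
    have h4 : 0 ≤ ∑ k ∈ Finset.range k₀, ‖((k : ℂ) + σ)⁻¹‖ := by positivity
    linarith

/-- The equation `u G' + σ G = H` has a holomorphic solution, up to a monomial `λ u ^ p` that is
needed in the resonant case `σ = -p` only. -/
theorem exists_solution_euler {H : ℂ → ℂ} {s : ℂ} (hH : AnalyticAt ℂ H s) (σ : ℂ) :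
    ∃ r > 0, ∃ G : ℂ → ℂ, ∃ (lam : ℂ) (p : ℕ), (lam ≠ 0 → σ = -(p : ℂ)) ∧
      DifferentiableOn ℂ G (Metric.ball s r) ∧ ∀ w ∈ Metric.ball s r,
        (w - s) * deriv G w + σ * G w = H w - lam * (w - s) ^ p := by
  obtain ⟨C, K, hC, hK, hb, hs⟩ := exists_taylor_bound hH
  obtain ⟨M, hM, hMb⟩ := exists_norm_inv_add_le σ
  set a : ℕ → ℂ := fun n => (n.factorial : ℂ)⁻¹ * iteratedDeriv n H s with ha
  -- Division by zero in the resonant case drops the resonant term.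
  set c : ℕ → ℂ := fun n => a n * ((n : ℂ) + σ)⁻¹ with hc
  have hcb : ∀ n, ‖c n‖ ≤ (C * M) * K ^ n := fun n => by
    rw [hc, norm_mul]
    calc ‖a n‖ * ‖((n : ℂ) + σ)⁻¹‖ ≤ (C * K ^ n) * M := by
          gcongr
          · exact hb n
          · exact hMb n
      _ = _ := by ring
  have hderiv : ∀ w, K * ‖w - s‖ < 1 → HasDerivAt (fun w => ∑' n, c n * (w - s) ^ n)
      (∑' n : ℕ, ((n : ℂ) + 1) * c (n + 1) * (w - s) ^ n) w :=
    fun w hw => hasDerivAt_powerSeries hcb hK hw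
  have hball : ∀ w ∈ Metric.ball s K⁻¹, K * ‖w - s‖ < 1 := fun w hw => by
    rw [Metric.mem_ball, dist_eq_norm] at hw
    calc K * ‖w - s‖ < K * K⁻¹ := by gcongr
      _ = 1 := mul_inv_cancel₀ hK.ne'
  have hsumc : ∀ w, K * ‖w - s‖ < 1 → Summable fun n => c n * (w - s) ^ n := fun w hw =>
    (summable_powerSeries hcb hK.le hw).of_norm
  have hsumd : ∀ w, K * ‖w - s‖ < 1 → Summable fun n : ℕ => (n : ℂ) * c n * (w - s) ^ n := by
    intro w hw
    have h1 : Summable fun n => a n * (w - s) ^ n := (hs w hw).summable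
    refine (summable_of_isBigO_nat (g := fun n => ‖a n * (w - s) ^ n‖)
      (summable_powerSeries hb hK.le hw) ?_)
    refine Asymptotics.IsBigO.of_bound (1 + ‖σ‖ * M) (Eventually.of_forall fun n => ?_)
    have h2 : ‖(n : ℂ) * ((n : ℂ) + σ)⁻¹‖ ≤ 1 + ‖σ‖ * M := by
      by_cases h0 : (n : ℂ) + σ = 0
      · simp [h0]; positivity
      · have : (n : ℂ) * ((n : ℂ) + σ)⁻¹ = 1 - σ * ((n : ℂ) + σ)⁻¹ := by field_simp; ring
        rw [this]
        refine (norm_sub_le _ _).trans ?_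
        rw [norm_one, norm_mul]
        gcongr
        exact hMb n
    rw [norm_norm]
    calc ‖(n : ℂ) * c n * (w - s) ^ n‖
        = ‖(n : ℂ) * ((n : ℂ) + σ)⁻¹‖ * ‖a n * (w - s) ^ n‖ := by
          rw [← norm_mul, hc]; congr 1; ring
      _ ≤ _ := by gcongr
  have hmain : ∀ w, K * ‖w - s‖ < 1 →
      (w - s) * deriv (fun w => ∑' n, c n * (w - s) ^ n) w + σ * ∑' n, c n * (w - s) ^ n
        = ∑' n : ℕ, ((n : ℂ) + σ) * c n * (w - s) ^ n := by
    intro w hw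
    rw [(hderiv w hw).deriv, ← tsum_mul_left, ← tsum_mul_left]
    have h1 : ∑' n : ℕ, (w - s) * (((n : ℂ) + 1) * c (n + 1) * (w - s) ^ n)
        = ∑' n : ℕ, (n : ℂ) * c n * (w - s) ^ n := by
      rw [(hsumd w hw).tsum_eq_zero_add]
      simp only [Nat.cast_zero, zero_mul, zero_add, Nat.cast_add, Nat.cast_one]
      exact tsum_congr fun n => by ring
    rw [h1, ← (hsumd w hw).tsum_add ((hsumc w hw).mul_left σ)]
    exact tsum_congr fun n => by ring
  have hdiff : DifferentiableOn ℂ (fun w => ∑' n, c n * (w - s) ^ n) (Metric.ball s K⁻¹) :=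
    fun w hw => (hderiv w (hball w hw)).differentiableAt.differentiableWithinAt
  by_cases hres : ∃ p : ℕ, σ = -(p : ℂ)
  · obtain ⟨p, hp⟩ := hres
    refine ⟨K⁻¹, by positivity, _, a p, p, fun _ => hp, hdiff, fun w hw => ?_⟩
    rw [hmain w (hball w hw)]
    have h1 := hs w (hball w hw)
    have h2 := h1.sub (hasSum_ite_eq p (a p * (w - s) ^ p))
    rw [← h2.tsum_eq]
    refine tsum_congr fun n => ?_
    split_ifs with h
    · subst h; rw [hp]; simp [ha]
    · have h3 : (n : ℂ) + σ ≠ 0 := by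
        rw [hp, ← sub_eq_add_neg, sub_ne_zero]
        exact_mod_cast h
      rw [hc]
      simp only [ha]
      field_simp
      simp
  · refine ⟨K⁻¹, by positivity, _, 0, 0, fun h => absurd rfl h, hdiff, fun w hw => ?_⟩
    rw [hmain w (hball w hw), ← (hs w (hball w hw)).tsum_eq, zero_mul, sub_zero]
    refine tsum_congr fun n => ?_
    have h3 : (n : ℂ) + σ ≠ 0 := fun h => hres ⟨n, by linear_combination h⟩
    rw [hc]
    simp only [ha]
    field_simp

/-! ### Taylor expansions, meromorphic families, determinants -/

/-- Taylor's formula with remainders that are holomorphic on the whole disc. -/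
theorem exists_taylor_remainder {h : ℂ → ℂ} {s : ℂ} {r : ℝ} (hr : 0 < r)
    (hh : DifferentiableOn ℂ h (Metric.ball s r)) : ∃ c : ℕ → ℂ,
      (∀ K : ℕ, ∃ k : ℂ → ℂ, DifferentiableOn ℂ k (Metric.ball s r) ∧
        ∀ w, h w = ∑ i ∈ Finset.range K, c i * (w - s) ^ i + (w - s) ^ K * k w) ∧
      ((∀ k, c k = 0) → ∀ w ∈ Metric.ball s r, h w = 0) := by
  let d : ℕ → ℂ → ℂ := fun n => (Function.swap dslope s)^[n] h
  have hd : ∀ n, d (n + 1) = dslope (d n) s := fun n => by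
    simp only [d, Function.iterate_succ', Function.comp]
  have hdd : ∀ n, DifferentiableOn ℂ (d n) (Metric.ball s r) := by
    intro n
    induction n with
    | zero => exact hh
    | succ n ih =>
      rw [hd]
      exact (Complex.differentiableOn_dslope (Metric.ball_mem_nhds s hr)).2 ih
  have hexp : ∀ K w, h w = ∑ i ∈ Finset.range K, d i s * (w - s) ^ i + (w - s) ^ K * d K w := by
    intro K w
    induction K with
    | zero => simp [d]
    | succ K ih =>
      rw [ih, Finset.sum_range_succ, hd]
      have := sub_smul_dslope (d K) s w
      rw [smul_eq_mul] at this
      rw [pow_succ, mul_assoc, this]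
      ring
  refine ⟨fun n => d n s, fun K => ⟨d K, hdd K, hexp K⟩, fun h0 => ?_⟩
  have han : AnalyticAt ℂ h s := hh.analyticAt (Metric.ball_mem_nhds s hr)
  have hz : ∀ᶠ w in 𝓝 s, h w = 0 := by
    by_contra hne
    obtain ⟨n, g, hg, hgs, hgh⟩ := han.exists_eventuallyEq_pow_smul_nonzero_iff.2 hne
    have h1 : ∀ᶠ w in 𝓝[≠] s, g w = (w - s) * d (n + 1) w := by
      filter_upwards [hgh.filter_mono nhdsWithin_le_nhds, self_mem_nhdsWithin] with w hw hws
      have h2 := hexp (n + 1) w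
      simp only [h0, zero_mul, Finset.sum_const_zero, zero_add] at h2
      rw [h2, smul_eq_mul, pow_succ, mul_assoc] at hw
      exact (mul_left_cancel₀ (pow_ne_zero n (sub_ne_zero.2 hws)) hw).symm
    have h3 : Tendsto g (𝓝[≠] s) (𝓝 (g s)) := hg.continuousAt.tendsto.mono_left nhdsWithin_le_nhds
    have h4 : Tendsto (fun w => (w - s) * d (n + 1) w) (𝓝[≠] s) (𝓝 ((s - s) * d (n + 1) s)) := by
      have h5 : ContinuousAt (d (n + 1)) s :=
        ((hdd (n + 1)).differentiableAt (Metric.ball_mem_nhds s hr)).continuousAt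
      exact (((continuous_id.sub continuous_const).continuousAt.mul h5).tendsto).mono_left
        nhdsWithin_le_nhds
    rw [sub_self, zero_mul] at h4
    exact hgs (tendsto_nhds_unique (h3.congr' h1) h4)
  exact fun w hw => eqOn_of_eventuallyEq Metric.isOpen_ball (convex_ball s r).isPreconnected hh
    (differentiableOn_const 0) (Metric.mem_ball_self hr) hz hw

theorem exists_common_pole_order {ι : Type*} [Finite ι] {f : ι → ℂ → ℂ} {s : ℂ}
    (hf : ∀ i, MeromorphicAt (f i) s) (k₀ : ℕ) : ∃ k ≥ k₀, ∃ F : ι → ℂ → ℂ,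
      (∀ i, AnalyticAt ℂ (F i) s) ∧ ∀ i w, w ≠ s → f i w = F i w / (w - s) ^ k := by
  choose n hn using hf
  obtain ⟨M, hM⟩ := (Set.finite_range n).bddAbove
  refine ⟨max M k₀, le_max_right _ _, fun i w => (w - s) ^ max M k₀ * f i w, fun i => ?_,
    fun i w hw => ?_⟩
  · have h1 : n i ≤ max M k₀ := (hM ⟨i, rfl⟩).trans (le_max_left _ _)
    have h2 : (fun w => (w - s) ^ max M k₀ * f i w)
        = fun w => (w - s) ^ (max M k₀ - n i) * ((w - s) ^ n i • f i w) := by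
      ext w
      rw [smul_eq_mul, ← mul_assoc, ← pow_add, Nat.sub_add_cancel h1]
    change AnalyticAt ℂ (fun w => (w - s) ^ max M k₀ * f i w) s
    rw [h2]
    exact (by fun_prop : AnalyticAt ℂ (fun w => (w - s) ^ (max M k₀ - n i)) s).mul (hn i)
  · have := sub_ne_zero.2 hw
    field_simp

theorem hasDerivAt_det {m : ℕ} {B : ℂ → Matrix (Fin m) (Fin m) ℂ}
    {B' : Matrix (Fin m) (Fin m) ℂ} {w : ℂ}
    (hB : ∀ a i, HasDerivAt (fun w => B w a i) (B' a i) w) :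
    HasDerivAt (fun w => (B w).det) (∑ a, ∑ i, B' a i * (B w).adjugate i a) w := by
  have h1 : (fun w => (B w).det)
      = fun w => ∑ τ : Equiv.Perm (Fin m), ((Equiv.Perm.sign τ : ℤ) : ℂ) * ∏ a, B w a (τ a) := by
    ext w
    rw [← Matrix.det_transpose, Matrix.det_apply']
    rfl
  have h2 : ∀ a, ∑ i, B' a i * (B w).adjugate i a = ((B w).updateRow a (B' a)).det := by
    intro a
    rw [← Matrix.cramer_transpose_apply, Matrix.cramer_eq_adjugate_mulVec,
      ← Matrix.adjugate_transpose]
    simp only [Matrix.mulVec, dotProduct, Matrix.transpose_apply]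
    exact Finset.sum_congr rfl fun i _ => mul_comm _ _
  have h3 : ∀ a, ((B w).updateRow a (B' a)).det = ∑ τ : Equiv.Perm (Fin m),
      ((Equiv.Perm.sign τ : ℤ) : ℂ) * ((∏ j ∈ Finset.univ.erase a, B w j (τ j)) * B' a (τ a)) := by
    intro a
    rw [← Matrix.det_transpose, Matrix.det_apply']
    refine Finset.sum_congr rfl fun τ _ => ?_
    rw [← Finset.prod_erase_mul Finset.univ _ (Finset.mem_univ a)]
    simp only [Matrix.transpose_apply, Matrix.updateRow_self]
    congr 2
    refine Finset.prod_congr rfl fun j hj => ?_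
    rw [Matrix.updateRow_ne (Finset.ne_of_mem_erase hj)]
  rw [h1]
  simp only [h2, h3]
  rw [Finset.sum_comm]
  refine HasDerivAt.fun_sum fun τ _ => ?_
  rw [← Finset.mul_sum]
  refine HasDerivAt.const_mul _ ?_
  have := HasDerivAt.fun_finsetProd (u := Finset.univ) (f := fun a w => B w a (τ a))
    (f' := fun a => B' a (τ a)) (x := w) fun a _ => hB a (τ a)
  simpa [smul_eq_mul] using this

end

/-! ### Local frames at a singular point -/

section

variable {m : ℕ} {q : Fin m → RatFunc ℂ}

theorem isOpen_slitDisc (t : ℂ) (r : ℝ) : IsOpen (slitDisc t r) :=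
  Metric.isOpen_ball.inter (Complex.isOpen_slitPlane.preimage (continuous_id.sub continuous_const))

theorem slitDisc_subset_ball (t : ℂ) (r : ℝ) : slitDisc t r ⊆ Metric.ball t r := fun _ h => h.1

theorem slitDisc_mono (t : ℂ) {r r' : ℝ} (h : r ≤ r') : slitDisc t r ⊆ slitDisc t r' :=
  fun _ hw => ⟨Metric.ball_subset_ball h hw.1, hw.2⟩

theorem add_mem_slitDisc (t : ℂ) {r ε : ℝ} (hε : 0 < ε) (hr : ε < r) : t + ε ∈ slitDisc t r := by
  refine ⟨?_, ?_⟩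
  · rw [Metric.mem_ball, dist_eq_norm, add_sub_cancel_left, Complex.norm_real, Real.norm_eq_abs,
      abs_of_pos hε]
    exact hr
  · rw [add_sub_cancel_left]
    exact Complex.ofReal_mem_slitPlane.2 hε

theorem isPreconnected_slitDisc (t : ℂ) {r : ℝ} (hr : 0 < r) : IsPreconnected (slitDisc t r) := by
  have h1 := add_mem_slitDisc t (half_pos hr) (half_lt_self hr)
  have h2 : StarConvex ℝ (t + (r / 2 : ℝ)) (slitDisc t r) := by
    intro w hw a b ha hb hab
    refine ⟨(convex_ball t r) h1.1 hw.1 ha hb hab, ?_⟩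
    have h3 := Complex.starConvex_ofReal_slitPlane (half_pos hr) hw.2 ha hb hab
    have h4 : a • (t + (r / 2 : ℝ)) + b • w - t = a • ((r / 2 : ℝ) : ℂ) + b • (w - t) := by
      simp only [smul_add, smul_sub]
      have : a • t + b • t = t := by rw [← add_smul, hab, one_smul]
      linear_combination this
    rw [h4]
    exact h3
  exact (h2.isPathConnected h1).isConnected.isPreconnected

theorem ne_of_mem_slitDisc {t w : ℂ} {r : ℝ} (h : w ∈ slitDisc t r) : w ≠ t := by
  rintro rfl
  exact Complex.slitPlane_ne_zero h.2 (sub_self _)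

theorem isLogBranch_log (s : ℂ) (r : ℝ) :
    IsLogBranch (fun w => Complex.log (w - s)) s (slitDisc s r) := fun w hw => by
  refine ⟨?_, Complex.exp_log (sub_ne_zero.2 (ne_of_mem_slitDisc hw))⟩
  have := ((hasDerivAt_id w).sub_const s).clog hw.2
  simpa using this

/-- A frame of solutions near the singular point `s`: all `g a` with `a ≠ a₀` are holomorphic
solutions on the disc of radius `r`, and together with the solution `y` on the slit disc, which
does not extend to `s`, they form a basis (the function `g a₀` plays no role). -/
structure IsLocalFrame (q : Fin m → RatFunc ℂ) (s : ℂ) (r : ℝ) (a₀ : Fin m)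
    (g : Fin m → ℂ → ℂ) (y : ℂ → ℂ) : Prop where
  pos : 0 < r
  le_one : r ≤ 1
  inter : Metric.ball s r ∩ singularPoints q = {s}
  sol_g : ∀ a ≠ a₀, ∀ w ∈ Metric.ball s r, IsSolAt q (g a) w
  sol_y : ∀ w ∈ slitDisc s r, IsSolAt q y w
  not_ext : ¬ ExtendsTo y s
  indep : ∀ w ∈ slitDisc s r, IsUnit (dataMatrix (Function.update g a₀ y) w).det

theorem IsLocalFrame.mono {s : ℂ} {r r' : ℝ} {a₀ : Fin m} {g : Fin m → ℂ → ℂ} {y : ℂ → ℂ}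
    (h : IsLocalFrame q s r a₀ g y) (hr' : 0 < r') (hle : r' ≤ r) :
    IsLocalFrame q s r' a₀ g y where
  pos := hr'
  le_one := hle.trans h.le_one
  inter := by
    refine Set.eq_singleton_iff_unique_mem.2 ⟨⟨Metric.mem_ball_self hr', ?_⟩, fun w hw => ?_⟩
    · have : s ∈ Metric.ball s r ∩ singularPoints q := by rw [h.inter]; rfl
      exact this.2
    · have : w ∈ Metric.ball s r ∩ singularPoints q :=
        ⟨Metric.ball_subset_ball hle hw.1, hw.2⟩
      rwa [h.inter] at this
  sol_g := fun a ha w hw => h.sol_g a ha w (Metric.ball_subset_ball hle hw)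
  sol_y := fun w hw => h.sol_y w (slitDisc_mono s hle hw)
  not_ext := h.not_ext
  indep := fun w hw => h.indep w (slitDisc_mono s hle hw)

theorem IsLocalFrame.notMem {s : ℂ} {r : ℝ} {a₀ : Fin m} {g : Fin m → ℂ → ℂ} {y : ℂ → ℂ}
    (h : IsLocalFrame q s r a₀ g y) {w : ℂ} (hw : w ∈ Metric.ball s r) (hws : w ≠ s) :
    w ∉ singularPoints q := fun hS => hws (by
  have : w ∈ Metric.ball s r ∩ singularPoints q := ⟨hw, hS⟩
  rwa [h.inter] at this)

theorem IsLocalFrame.analyticAt_g {s : ℂ} {r : ℝ} {a₀ : Fin m} {g : Fin m → ℂ → ℂ} {y : ℂ → ℂ}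
    (h : IsLocalFrame q s r a₀ g y) {a : Fin m} (ha : a ≠ a₀) {w : ℂ}
    (hw : w ∈ Metric.ball s r) : AnalyticAt ℂ (g a) w := (h.sol_g a ha w hw).1

/-- Genericity in terms of frames: the holomorphic extensions of the members of the given basis
solve the equation on a full disc. -/
theorem exists_isLocalFrame (hm : 0 < m) (hG : IsGeneric q) {s : ℂ} (hs : s ∈ singularPoints q) :
    ∃ r a₀ g y, IsLocalFrame q s r a₀ g y := by
  obtain ⟨r, hr, hinter, Y, ⟨hsol, hlin, -⟩, a₀, hna, hext⟩ := hG s hs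
  have hgex : ∀ a, ∃ g : ℂ → ℂ, a ≠ a₀ → AnalyticAt ℂ g s ∧
      ∀ᶠ z in 𝓝 s, z - s ∈ Complex.slitPlane → Y a z = g z := fun a => by
    by_cases ha : a = a₀
    · exact ⟨0, fun h => absurd ha h⟩
    · obtain ⟨g, hg⟩ := hext a ha
      exact ⟨g, fun _ => hg⟩
  choose g hg using hgex
  have hev : ∀ᶠ z in 𝓝 s, ∀ a, a ≠ a₀ →
      AnalyticAt ℂ (g a) z ∧ (z - s ∈ Complex.slitPlane → Y a z = g a z) := by
    refine eventually_all.2 fun a => ?_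
    by_cases ha : a = a₀
    · exact Eventually.of_forall fun z h => absurd ha h
    · filter_upwards [(hg a ha).1.eventually_analyticAt, (hg a ha).2] with z h1 h2 _
      exact ⟨h1, h2⟩
  obtain ⟨ε, hε, hball⟩ := Metric.eventually_nhds_iff_ball.1 hev
  set r₀ := min (min ε r) 1 with hr₀
  have hr₀0 : 0 < r₀ := by positivity
  have hr₀ε : r₀ ≤ ε := (min_le_left _ _).trans (min_le_left _ _)
  have hr₀r : r₀ ≤ r := (min_le_left _ _).trans (min_le_right _ _)
  have hdisj : Disjoint (slitDisc s r) (singularPoints q) := by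
    rw [Set.disjoint_left]
    intro w hw hwS
    have : w ∈ Metric.ball s r ∩ singularPoints q := ⟨hw.1, hwS⟩
    rw [hinter] at this
    exact ne_of_mem_slitDisc hw this
  have hYsol : ∀ a, ∀ w ∈ slitDisc s r, IsSolAt q (Y a) w := fun a w hw =>
    IsSolAt.of_isSolutionOn (isOpen_slitDisc s r) hdisj (hsol a) hw
  have hgY : ∀ a ≠ a₀, ∀ w ∈ slitDisc s r₀, Y a =ᶠ[𝓝 w] g a := fun a ha w hw => by
    filter_upwards [(isOpen_slitDisc s r₀).mem_nhds hw] with v hv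
    exact (hball v (Metric.ball_subset_ball hr₀ε hv.1) a ha).2 hv.2
  have hw₀ := add_mem_slitDisc s (half_pos hr₀0) (half_lt_self hr₀0)
  have hdata : ∀ w ∈ slitDisc s r₀,
      dataMatrix (Function.update g a₀ (Y a₀)) w = dataMatrix Y w := by
    intro w hw
    ext a i
    simp only [dataMatrix, Matrix.of_apply]
    by_cases ha : a = a₀
    · subst ha; simp
    · rw [Function.update_of_ne ha]
      exact ((iteratedDeriv_congr_of_eventuallyEq (hgY a ha w hw) i).self_of_nhds).symm
  refine ⟨r₀, a₀, g, Y a₀, hr₀0, min_le_right _ _, ?_, fun a ha w hw => ?_, fun w hw => ?_, hna,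
    fun w hw => ?_⟩
  · refine Set.eq_singleton_iff_unique_mem.2 ⟨⟨Metric.mem_ball_self hr₀0, hs⟩, fun w hw => ?_⟩
    have : w ∈ Metric.ball s r ∩ singularPoints q :=
      ⟨Metric.ball_subset_ball hr₀r hw.1, hw.2⟩
    rwa [hinter] at this
  · refine isSolAt_of_preconnected (convex_ball s r₀).isPreconnected
      (fun v hv => (hball v (Metric.ball_subset_ball hr₀ε hv) a ha).1)
      (slitDisc_subset_ball _ _ hw₀) ?_ hw Metric.isOpen_ball
    exact (hYsol a _ (slitDisc_mono s hr₀r hw₀)).congr (hgY a ha _ hw₀)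
  · exact hYsol a₀ w (slitDisc_mono s hr₀r hw)
  · rw [hdata w hw]
    refine isUnit_det_dataMatrix hm (isOpen_slitDisc s r) (isPreconnected_slitDisc s hr) hdisj
      hYsol (fun c hc => ?_) (slitDisc_mono s hr₀r hw)
    rw [Fintype.linearIndependent_iff] at hlin
    ext a
    refine hlin c ?_ a
    ext ⟨w, hw⟩
    simpa using hc w hw

/-- The companion matrix of the equation at `w`, acting on rows from the right. -/
def companion (q : Fin m → RatFunc ℂ) (w : ℂ) : Matrix (Fin m) (Fin m) ℂ :=
  Matrix.of fun l i => if (i : ℕ) + 1 < m then (if (l : ℕ) = i + 1 then 1 else 0)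
    else value (q l) w

theorem IsSolAt.iteratedDeriv_succ_eq {y : ℂ → ℂ} {w : ℂ} (hw : w ∉ singularPoints q)
    (hy : IsSolAt q y w) (i : Fin m) :
    iteratedDeriv (i + 1) y w = ∑ l : Fin m, iteratedDeriv l y w * companion q w l i := by
  by_cases hi : (i : ℕ) + 1 < m
  · rw [Finset.sum_eq_single ⟨i + 1, hi⟩]
    · simp [companion, hi]
    · intro l _ hl
      have : (l : ℕ) ≠ i + 1 := fun h => hl (Fin.ext h)
      simp [companion, hi, this]
    · simp
  · have hi' : (i : ℕ) + 1 = m := by omega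
    rw [hi', (hy.eventually_ode hw).self_of_nhds]
    exact Finset.sum_congr rfl fun l _ => by simp [companion, hi, mul_comm]

/-- The last index `m - 1`. -/
def lastIdx (a₀ : Fin m) : Fin m := ⟨m - 1, Nat.sub_lt (Nat.zero_lt_of_lt a₀.isLt) Nat.one_pos⟩

theorem trace_companion (a₀ : Fin m) (w : ℂ) :
    (companion q w).trace = value (q (lastIdx a₀)) w := by
  unfold Matrix.trace
  rw [Finset.sum_eq_single (lastIdx a₀)]
  · have : ¬ ((lastIdx a₀ : Fin m) : ℕ) + 1 < m := by simp only [lastIdx]; omega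
    simp [companion, this]
  · intro i _ hi
    have h1 : (i : ℕ) + 1 < m := by
      have h2 : (i : ℕ) ≠ m - 1 := fun h => hi (Fin.ext h)
      have := i.isLt
      omega
    simp [companion, h1]
  · simp

/-- The matrix whose rows are the data of the holomorphic solutions `g a`, `a ≠ a₀`, and whose
row `a₀` is the last unit vector. Unlike the matrix of the full basis, it is holomorphic at the
singular point. -/
def frameMatrix (g : Fin m → ℂ → ℂ) (a₀ : Fin m) (w : ℂ) : Matrix (Fin m) (Fin m) ℂ :=
  (dataMatrix g w).updateRow a₀ (Pi.single (lastIdx a₀) 1)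

theorem frameMatrix_self (g : Fin m → ℂ → ℂ) (a₀ i : Fin m) (w : ℂ) :
    frameMatrix g a₀ w a₀ i = if i = lastIdx a₀ then 1 else 0 := by
  simp [frameMatrix, Pi.single_apply]

theorem frameMatrix_of_ne {a a₀ : Fin m} (ha : a ≠ a₀) (g : Fin m → ℂ → ℂ) (i : Fin m) (w : ℂ) :
    frameMatrix g a₀ w a i = iteratedDeriv i (g a) w := by
  simp [frameMatrix, Matrix.updateRow_ne ha, dataMatrix]

theorem differentiableAt_det {B : ℂ → Matrix (Fin m) (Fin m) ℂ} {w : ℂ}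
    (hB : ∀ a i, DifferentiableAt ℂ (fun w => B w a i) w) :
    DifferentiableAt ℂ (fun w => (B w).det) w :=
  (hasDerivAt_det (B' := fun a i => deriv (fun w => B w a i) w)
    fun a i => (hB a i).hasDerivAt).differentiableAt

theorem differentiableAt_adjugate {B : ℂ → Matrix (Fin m) (Fin m) ℂ} {w : ℂ}
    (hB : ∀ a i, DifferentiableAt ℂ (fun w => B w a i) w) (i a : Fin m) :
    DifferentiableAt ℂ (fun w => (B w).adjugate i a) w := by
  simp only [Matrix.adjugate_apply]
  refine differentiableAt_det fun b j => ?_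
  by_cases hb : b = a
  · subst hb
    simp
  · simp only [Matrix.updateRow_ne hb]
    exact hB b j

/-- The determinant of the frame matrix does not vanish identically on any open set: a column of
the inverse of the data matrix solves the adjoint equation, hence vanishes identically if its
last entry does. -/
theorem IsLocalFrame.exists_det_frameMatrix_ne_zero {s : ℂ} {r : ℝ} {a₀ : Fin m}
    {g : Fin m → ℂ → ℂ} {y : ℂ → ℂ} (h : IsLocalFrame q s r a₀ g y) {V : Set ℂ} (hV : IsOpen V)
    (hVs : V ⊆ slitDisc s r) (hne : V.Nonempty) : ∃ w ∈ V, (frameMatrix g a₀ w).det ≠ 0 := by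
  by_contra! hcon
  set Y := Function.update g a₀ y with hY
  set W := dataMatrix Y with hW
  have hYsol : ∀ a, ∀ w ∈ V, IsSolAt q (Y a) w := by
    intro a w hw
    by_cases ha : a = a₀
    · subst ha; rw [hY, Function.update_self]; exact h.sol_y w (hVs hw)
    · rw [hY, Function.update_of_ne ha]
      exact h.sol_g a ha w (hVs hw).1
  have hframe : ∀ w, frameMatrix g a₀ w = (W w).updateRow a₀ (Pi.single (lastIdx a₀) 1) := by
    intro w
    ext a i
    by_cases ha : a = a₀
    · subst ha; simp [frameMatrix]
    · rw [frameMatrix_of_ne ha, Matrix.updateRow_ne ha]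
      simp [hW, dataMatrix, hY, Function.update_of_ne ha]
  let d : Fin m → ℂ → ℂ := fun i w => ((W w).det)⁻¹ * (W w).adjugate i a₀
  have hdet : ∀ w ∈ V, (W w).det ≠ 0 := fun w hw => (h.indep w (hVs hw)).ne_zero
  have hWd : ∀ w ∈ V, ∀ a i, HasDerivAt (fun w => W w a i) (iteratedDeriv (i + 1) (Y a) w) w :=
    fun w hw a i => hasDerivAt_iteratedDeriv (hYsol a w hw).1 i
  have hdd : ∀ i, ∀ w ∈ V, DifferentiableAt ℂ (d i) w := fun i w hw =>
    ((differentiableAt_det fun a i => (hWd w hw a i).differentiableAt).inv (hdet w hw)).mul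
      (differentiableAt_adjugate (fun a i => (hWd w hw a i).differentiableAt) i a₀)
  have hWdv : ∀ w ∈ V, ∀ a, ∑ i, W w a i * d i w = if a = a₀ then 1 else 0 := by
    intro w hw a
    have h1 := congrFun (congrFun (Matrix.mul_adjugate (W w)) a) a₀
    rw [Matrix.mul_apply] at h1
    have h2 : ∑ i, W w a i * d i w = ((W w).det)⁻¹ * ∑ i, W w a i * (W w).adjugate i a₀ := by
      rw [Finset.mul_sum]
      exact Finset.sum_congr rfl fun i _ => by simp only [d]; ring
    rw [h2, h1]
    simp [Matrix.one_apply, hdet w hw]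
  -- The adjoint equation `d' = - A d`.
  have hadj : ∀ w ∈ V, ∀ l, deriv (d l) w + ∑ i, companion q w l i * d i w = 0 := by
    intro w hw
    have h1 : ∀ a, ∑ l, W w a l * (deriv (d l) w + ∑ i, companion q w l i * d i w) = 0 := by
      intro a
      have h2 : HasDerivAt (fun w => ∑ i, W w a i * d i w)
          (∑ i : Fin m, (iteratedDeriv (i + 1) (Y a) w * d i w + W w a i * deriv (d i) w)) w :=
        HasDerivAt.fun_sum fun i _ => (hWd w hw a i).mul (hdd i w hw).hasDerivAt
      have h3 : (fun w => ∑ i, W w a i * d i w) =ᶠ[𝓝 w] fun _ => if a = a₀ then 1 else 0 := by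
        filter_upwards [hV.mem_nhds hw] with v hv using hWdv v hv a
      have h4 := h2.unique ((hasDerivAt_const w _).congr_of_eventuallyEq h3)
      rw [← h4]
      simp only [mul_add, Finset.sum_add_distrib]
      rw [add_comm]
      congr 1
      simp only [Finset.mul_sum]
      rw [Finset.sum_comm]
      refine Finset.sum_congr rfl fun i _ => ?_
      rw [(hYsol a w hw).iteratedDeriv_succ_eq
        (h.notMem (hVs hw).1 (ne_of_mem_slitDisc (hVs hw))) i, Finset.sum_mul]
      exact Finset.sum_congr rfl fun l _ => by simp only [hW, dataMatrix, Matrix.of_apply]; ring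
    have h5 : (W w).mulVec (fun l => deriv (d l) w + ∑ i, companion q w l i * d i w) = 0 := by
      ext a
      exact h1 a
    have h6 := Matrix.eq_zero_of_mulVec_eq_zero (hdet w hw) h5
    exact fun l => congrFun h6 l
  have hzero : ∀ k : ℕ, ∀ l : Fin m, (l : ℕ) + k + 1 = m → ∀ w ∈ V, d l w = 0 := by
    have hbase : ∀ w ∈ V, d (lastIdx a₀) w = 0 := by
      intro w hw
      have h1 := hcon w hw
      rw [hframe, ← Matrix.adjugate_apply] at h1
      simp [d, h1]
    intro k
    induction k with
    | zero =>
      intro l hl w hw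
      have : l = lastIdx a₀ := Fin.ext (by simp only [lastIdx]; omega)
      rw [this]
      exact hbase w hw
    | succ k ih =>
      intro l hl w hw
      have hl1 : (l : ℕ) + 1 < m := by omega
      have h1 := hadj w hw ⟨l + 1, hl1⟩
      have h2 : deriv (d ⟨l + 1, hl1⟩) w = 0 := by
        have : d ⟨l + 1, hl1⟩ =ᶠ[𝓝 w] fun _ => 0 := by
          filter_upwards [hV.mem_nhds hw] with v hv
          exact ih ⟨l + 1, hl1⟩ (by simp only; omega) v hv
        rw [this.deriv_eq, deriv_const]
      rw [h2, zero_add, Finset.sum_eq_single l] at h1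
      · simpa [companion, hl1] using h1
      · intro i _ hi
        by_cases hi1 : (i : ℕ) + 1 < m
        · have : (l : ℕ) ≠ i := fun h => hi (Fin.ext h.symm)
          simp [companion, hi1, this]
        · have : i = lastIdx a₀ := Fin.ext (by simp only [lastIdx]; omega)
          rw [this, hbase w hw, mul_zero]
      · simp
  obtain ⟨w, hw⟩ := hne
  have h1 := hWdv w hw a₀
  rw [Finset.sum_eq_zero fun i _ => by
    rw [hzero (m - 1 - i) i (by have := i.isLt; omega) w hw, mul_zero]] at h1
  simp at h1

theorem IsLocalFrame.differentiableAt_frameMatrix {s : ℂ} {r : ℝ} {a₀ : Fin m}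
    {g : Fin m → ℂ → ℂ} {y : ℂ → ℂ} (h : IsLocalFrame q s r a₀ g y) {w : ℂ}
    (hw : w ∈ Metric.ball s r) (a i : Fin m) :
    DifferentiableAt ℂ (fun w => frameMatrix g a₀ w a i) w := by
  by_cases ha : a = a₀
  · subst ha
    simp only [frameMatrix_self]
    exact differentiableAt_const _
  · simp only [frameMatrix_of_ne ha]
    exact (AnalyticAt.iteratedDeriv' (h.analyticAt_g ha hw) i).differentiableAt

theorem IsLocalFrame.analyticAt_det {s : ℂ} {r : ℝ} {a₀ : Fin m}
    {g : Fin m → ℂ → ℂ} {y : ℂ → ℂ} (h : IsLocalFrame q s r a₀ g y) {w : ℂ}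
    (hw : w ∈ Metric.ball s r) : AnalyticAt ℂ (fun w => (frameMatrix g a₀ w).det) w := by
  have : DifferentiableOn ℂ (fun w => (frameMatrix g a₀ w).det) (Metric.ball s r) := fun v hv =>
    (differentiableAt_det (h.differentiableAt_frameMatrix hv)).differentiableWithinAt
  exact this.analyticAt (Metric.isOpen_ball.mem_nhds hw)

theorem IsLocalFrame.analyticAt_adjugate {s : ℂ} {r : ℝ} {a₀ : Fin m}
    {g : Fin m → ℂ → ℂ} {y : ℂ → ℂ} (h : IsLocalFrame q s r a₀ g y) {w : ℂ}
    (hw : w ∈ Metric.ball s r) (i a : Fin m) :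
    AnalyticAt ℂ (fun w => (frameMatrix g a₀ w).adjugate i a) w := by
  have : DifferentiableOn ℂ (fun w => (frameMatrix g a₀ w).adjugate i a) (Metric.ball s r) :=
    fun v hv => (differentiableAt_adjugate (h.differentiableAt_frameMatrix hv) i a)
      |>.differentiableWithinAt
  exact this.analyticAt (Metric.isOpen_ball.mem_nhds hw)

theorem frameMatrix_inv_apply (g : Fin m → ℂ → ℂ) (a₀ i a : Fin m) (w : ℂ) :
    (frameMatrix g a₀ w)⁻¹ i a
      = ((frameMatrix g a₀ w).det)⁻¹ * (frameMatrix g a₀ w).adjugate i a := by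
  rw [Matrix.inv_def, Ring.inverse_eq_inv']
  rfl

theorem IsLocalFrame.meromorphicAt_inv {s : ℂ} {r : ℝ} {a₀ : Fin m}
    {g : Fin m → ℂ → ℂ} {y : ℂ → ℂ} (h : IsLocalFrame q s r a₀ g y) (i a : Fin m) :
    MeromorphicAt (fun w => (frameMatrix g a₀ w)⁻¹ i a) s := by
  simp only [frameMatrix_inv_apply]
  exact (h.analyticAt_det (Metric.mem_ball_self h.pos)).meromorphicAt.inv.mul
    (h.analyticAt_adjugate (Metric.mem_ball_self h.pos) i a).meromorphicAt

theorem IsLocalFrame.analyticAt_inv {s : ℂ} {r : ℝ} {a₀ : Fin m}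
    {g : Fin m → ℂ → ℂ} {y : ℂ → ℂ} (h : IsLocalFrame q s r a₀ g y) {w : ℂ}
    (hw : w ∈ Metric.ball s r) (hd : (frameMatrix g a₀ w).det ≠ 0) (i a : Fin m) :
    AnalyticAt ℂ (fun w => (frameMatrix g a₀ w)⁻¹ i a) w := by
  simp only [frameMatrix_inv_apply]
  exact ((h.analyticAt_det hw).inv hd).mul (h.analyticAt_adjugate hw i a)

/-- After shrinking the disc, the frame matrix is invertible off the singular point. -/
theorem IsLocalFrame.exists_forall_det_ne_zero {s : ℂ} {r : ℝ} {a₀ : Fin m}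
    {g : Fin m → ℂ → ℂ} {y : ℂ → ℂ} (h : IsLocalFrame q s r a₀ g y) :
    ∃ r' > 0, r' ≤ r ∧ ∀ w ∈ Metric.ball s r', w ≠ s → (frameMatrix g a₀ w).det ≠ 0 := by
  have han := h.analyticAt_det (Metric.mem_ball_self h.pos)
  rcases han.eventually_eq_zero_or_eventually_ne_zero with h0 | h0
  · exfalso
    obtain ⟨ε, hε, hb⟩ := Metric.eventually_nhds_iff_ball.1 h0
    have hmin : 0 < min ε r := lt_min hε h.pos
    obtain ⟨w, hw, hne⟩ := h.exists_det_frameMatrix_ne_zero (isOpen_slitDisc s (min ε r))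
      (slitDisc_mono s (min_le_right _ _))
      ⟨_, add_mem_slitDisc s (half_pos hmin) (half_lt_self hmin)⟩
    exact hne (hb w (Metric.ball_subset_ball (min_le_left _ _) hw.1))
  · rw [eventually_nhdsWithin_iff] at h0
    obtain ⟨ε, hε, hb⟩ := Metric.eventually_nhds_iff_ball.1 h0
    exact ⟨min ε r, lt_min hε h.pos, min_le_right _ _, fun w hw hws =>
      hb w (Metric.ball_subset_ball (min_le_left _ _) hw) hws⟩

end

/-! ### The singular solution in terms of the frame -/

section

variable {m : ℕ} {q : Fin m → RatFunc ℂ}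

theorem meromorphicAt_value (r : RatFunc ℂ) (z : ℂ) : MeromorphicAt (value r) z := by
  have : value r = fun w => r.num.eval w / r.denom.eval w := funext fun w => value_eq r w
  rw [this]
  exact (analyticAt_polynomial _ z).meromorphicAt.div (analyticAt_polynomial _ z).meromorphicAt

theorem meromorphicAt_companion (l i : Fin m) (z : ℂ) :
    MeromorphicAt (fun w => companion q w l i) z := by
  simp only [companion, Matrix.of_apply]
  split_ifs
  · exact MeromorphicAt.const _ _
  · exact MeromorphicAt.const _ _
  · exact meromorphicAt_value _ _

/-- The logarithmic derivative matrix of the frame, restricted to its last row: the coefficients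
`κ` with `C' = C a₀ * κ` for the coordinates `C` of the singular solution. -/
def frameRow (q : Fin m → RatFunc ℂ) (g : Fin m → ℂ → ℂ) (a₀ a : Fin m) (w : ℂ) : ℂ :=
  ∑ i, companion q w (lastIdx a₀) i * (frameMatrix g a₀ w)⁻¹ i a

/-- The coordinates of the data of `y` with respect to the rows of the frame matrix. -/
def frameCoeff (g : Fin m → ℂ → ℂ) (a₀ : Fin m) (y : ℂ → ℂ) (a : Fin m) (w : ℂ) : ℂ :=
  ∑ i : Fin m, iteratedDeriv i y w * (frameMatrix g a₀ w)⁻¹ i a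

variable {s : ℂ} {r : ℝ} {a₀ : Fin m} {g : Fin m → ℂ → ℂ} {y : ℂ → ℂ}

theorem IsLocalFrame.meromorphicAt_frameRow (h : IsLocalFrame q s r a₀ g y) (a : Fin m) :
    MeromorphicAt (frameRow q g a₀ a) s := by
  unfold frameRow
  exact MeromorphicAt.fun_sum fun i _ =>
    (meromorphicAt_companion _ _ _).mul (h.meromorphicAt_inv i a)

theorem IsLocalFrame.hasDerivAt_frameMatrix (h : IsLocalFrame q s r a₀ g y) {w : ℂ}
    (hw : w ∈ Metric.ball s r) (hws : w ≠ s) (a i : Fin m) :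
    HasDerivAt (fun w => frameMatrix g a₀ w a i)
      (∑ l, frameMatrix g a₀ w a l * companion q w l i
        - if a = a₀ then companion q w (lastIdx a₀) i else 0) w := by
  by_cases ha : a = a₀
  · subst ha
    have h0 : (∑ l, frameMatrix g a w a l * companion q w l i
        - if a = a then companion q w (lastIdx a) i else 0) = 0 := by
      simp [frameMatrix_self]
    rw [h0]
    simp only [frameMatrix_self]
    exact hasDerivAt_const w _
  · simp only [frameMatrix_of_ne ha, if_neg ha, sub_zero]
    rw [← (h.sol_g a ha w hw).iteratedDeriv_succ_eq (h.notMem hw hws) i]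
    exact hasDerivAt_iteratedDeriv (h.analyticAt_g ha hw) i

theorem sum_frameCoeff_mul {w : ℂ} (hd : (frameMatrix g a₀ w).det ≠ 0) (i : Fin m) :
    ∑ a, frameCoeff g a₀ y a w * frameMatrix g a₀ w a i = iteratedDeriv i y w := by
  have h1 : (frameMatrix g a₀ w)⁻¹ * frameMatrix g a₀ w = 1 :=
    Matrix.nonsing_inv_mul _ (isUnit_iff_ne_zero.2 hd)
  simp only [frameCoeff, Finset.sum_mul]
  rw [Finset.sum_comm]
  have h2 : ∀ l : Fin m, ∑ a, iteratedDeriv l y w * (frameMatrix g a₀ w)⁻¹ l a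
      * frameMatrix g a₀ w a i = if l = i then iteratedDeriv l y w else 0 := by
    intro l
    have := congrFun (congrFun h1 l) i
    rw [Matrix.mul_apply] at this
    simp only [mul_assoc, ← Finset.mul_sum, this, Matrix.one_apply]
    split_ifs <;> simp
  simp [h2]

theorem IsLocalFrame.differentiableAt_frameCoeff (h : IsLocalFrame q s r a₀ g y) {w : ℂ}
    (hw : w ∈ slitDisc s r) (hd : (frameMatrix g a₀ w).det ≠ 0) (a : Fin m) :
    DifferentiableAt ℂ (frameCoeff g a₀ y a) w := by
  unfold frameCoeff
  exact DifferentiableAt.fun_sum fun i _ =>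
    (AnalyticAt.iteratedDeriv' (h.sol_y w hw).1 i).differentiableAt.mul
      (h.analyticAt_inv hw.1 hd i a).differentiableAt

theorem vecMul_right_injective {B : Matrix (Fin m) (Fin m) ℂ} (hB : B.det ≠ 0) {u v : Fin m → ℂ}
    (h : ∀ i, ∑ a, u a * B a i = ∑ a, v a * B a i) : u = v := by
  have h1 : Matrix.vecMul (u - v) B = 0 := by
    ext i
    simp only [Matrix.vecMul, dotProduct, Pi.sub_apply, sub_mul, Finset.sum_sub_distrib, h i,
      sub_self, Pi.zero_apply]
  exact sub_eq_zero.1 (Matrix.eq_zero_of_vecMul_eq_zero hB h1)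

theorem sum_frameRow_mul {w : ℂ} (hd : (frameMatrix g a₀ w).det ≠ 0) (i : Fin m) :
    ∑ a, frameRow q g a₀ a w * frameMatrix g a₀ w a i = companion q w (lastIdx a₀) i := by
  have h1 : (frameMatrix g a₀ w)⁻¹ * frameMatrix g a₀ w = 1 :=
    Matrix.nonsing_inv_mul _ (isUnit_iff_ne_zero.2 hd)
  simp only [frameRow, Finset.sum_mul]
  rw [Finset.sum_comm]
  have h2 : ∀ l : Fin m, ∑ a, companion q w (lastIdx a₀) l * (frameMatrix g a₀ w)⁻¹ l a
      * frameMatrix g a₀ w a i = if l = i then companion q w (lastIdx a₀) l else 0 := by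
    intro l
    have := congrFun (congrFun h1 l) i
    rw [Matrix.mul_apply] at this
    simp only [mul_assoc, ← Finset.mul_sum, this, Matrix.one_apply]
    split_ifs <;> simp
  simp [h2]

/-- The coordinates of a solution satisfy a system that is driven by one of them. -/
theorem IsLocalFrame.hasDerivAt_frameCoeff (h : IsLocalFrame q s r a₀ g y)
    (hdet : ∀ w ∈ Metric.ball s r, w ≠ s → (frameMatrix g a₀ w).det ≠ 0) {w : ℂ}
    (hw : w ∈ slitDisc s r) (a : Fin m) :
    HasDerivAt (frameCoeff g a₀ y a) (frameCoeff g a₀ y a₀ w * frameRow q g a₀ a w) w := by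
  have hws := ne_of_mem_slitDisc hw
  have hd := hdet w hw.1 hws
  have key : (fun a => deriv (frameCoeff g a₀ y a) w)
      = fun a => frameCoeff g a₀ y a₀ w * frameRow q g a₀ a w := by
    refine vecMul_right_injective hd fun i => ?_
    have h1 : HasDerivAt (fun w => ∑ a, frameCoeff g a₀ y a w * frameMatrix g a₀ w a i)
        (∑ a, (deriv (frameCoeff g a₀ y a) w * frameMatrix g a₀ w a i + frameCoeff g a₀ y a w *
          (∑ l, frameMatrix g a₀ w a l * companion q w l i
            - if a = a₀ then companion q w (lastIdx a₀) i else 0))) w :=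
      HasDerivAt.fun_sum fun a _ =>
        (h.differentiableAt_frameCoeff hw hd a).hasDerivAt.mul
          (h.hasDerivAt_frameMatrix hw.1 hws a i)
    have h2 : (fun w => ∑ a, frameCoeff g a₀ y a w * frameMatrix g a₀ w a i)
        =ᶠ[𝓝 w] iteratedDeriv i y := by
      filter_upwards [(isOpen_slitDisc s r).mem_nhds hw] with v hv
      exact sum_frameCoeff_mul (hdet v hv.1 (ne_of_mem_slitDisc hv)) i
    have h3 := (h1.congr_of_eventuallyEq h2.symm).unique
      (hasDerivAt_iteratedDeriv (h.sol_y w hw).1 i)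
    rw [(h.sol_y w hw).iteratedDeriv_succ_eq (h.notMem hw.1 hws) i] at h3
    have h4 : ∑ a, frameCoeff g a₀ y a w * ∑ l, frameMatrix g a₀ w a l * companion q w l i
        = ∑ l : Fin m, iteratedDeriv l y w * companion q w l i := by
      simp only [Finset.mul_sum]
      rw [Finset.sum_comm]
      refine Finset.sum_congr rfl fun l _ => ?_
      rw [← sum_frameCoeff_mul (y := y) hd l, Finset.sum_mul]
      exact Finset.sum_congr rfl fun a _ => by ring
    simp only [mul_sub, Finset.sum_add_distrib, Finset.sum_sub_distrib, h4] at h3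
    simp only [mul_ite, mul_zero, Finset.sum_ite_eq', Finset.mem_univ, if_true] at h3
    have h5 : ∑ a, frameCoeff g a₀ y a₀ w * frameRow q g a₀ a w * frameMatrix g a₀ w a i
        = frameCoeff g a₀ y a₀ w * companion q w (lastIdx a₀) i := by
      rw [← sum_frameRow_mul (q := q) hd i, Finset.mul_sum]
      exact Finset.sum_congr rfl fun a _ => by ring
    rw [h5]
    linear_combination h3
  rw [← congrFun key a]
  exact (h.differentiableAt_frameCoeff hw hd a).hasDerivAt

theorem IsLocalFrame.hasDerivAt_det_frameMatrix (h : IsLocalFrame q s r a₀ g y) {w : ℂ}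
    (hw : w ∈ Metric.ball s r) (hws : w ≠ s) (hd : (frameMatrix g a₀ w).det ≠ 0) :
    HasDerivAt (fun w => (frameMatrix g a₀ w).det)
      ((frameMatrix g a₀ w).det * (value (q (lastIdx a₀)) w - frameRow q g a₀ a₀ w)) w := by
  convert hasDerivAt_det fun a i => h.hasDerivAt_frameMatrix hw hws a i using 1
  set B := frameMatrix g a₀ w with hB
  have hadj : B.adjugate = B.det • B⁻¹ := by
    ext i a
    rw [Matrix.smul_apply, hB, frameMatrix_inv_apply, smul_eq_mul, mul_inv_cancel_left₀ hd]
  have htr : (B * companion q w * B⁻¹).trace = value (q (lastIdx a₀)) w := by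
    rw [Matrix.trace_mul_cycle, Matrix.nonsing_inv_mul _ (isUnit_iff_ne_zero.2 hd), one_mul,
      trace_companion a₀]
  have hrow : frameRow q g a₀ a₀ w
      = ∑ a, ∑ i, (if a = a₀ then companion q w (lastIdx a₀) i else 0) * B⁻¹ i a := by
    rw [Finset.sum_eq_single a₀]
    · simp [frameRow, hB]
    · intro a _ ha
      simp [ha]
    · simp
  rw [← htr, hrow, hadj]
  simp only [Matrix.trace, Matrix.diag, Matrix.mul_apply, Matrix.smul_apply, smul_eq_mul]
  rw [← Finset.sum_sub_distrib, Finset.mul_sum]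
  refine Finset.sum_congr rfl fun a _ => ?_
  rw [← Finset.sum_sub_distrib, Finset.mul_sum]
  refine Finset.sum_congr rfl fun i _ => ?_
  ring

/-- A rational function with at most a simple pole. -/
theorem exists_value_eq_div {x : RatFunc ℂ} {z : ℂ} (hx : x.denom.rootMultiplicity z ≤ 1) :
    ∃ P : ℂ → ℂ, AnalyticAt ℂ P z ∧ ∀ᶠ w in 𝓝[≠] z, value x w = P w / (w - z) := by
  obtain ⟨d, hd, hdz⟩ := Polynomial.exists_eq_pow_rootMultiplicity_mul_and_not_dvd x.denom
    x.denom_ne_zero z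
  have hdz' : d.eval z ≠ 0 := fun h0 => hdz (Polynomial.dvd_iff_isRoot.2 h0)
  set k := x.denom.rootMultiplicity z with hk
  refine ⟨fun w => x.num.eval w * (w - z) ^ (1 - k) / d.eval w, ?_, ?_⟩
  · exact ((analyticAt_polynomial _ z).mul
      ((analyticAt_id.sub analyticAt_const).pow _)).div (analyticAt_polynomial _ z) hdz'
  · filter_upwards [self_mem_nhdsWithin] with w hw
    have hw' : w - z ≠ 0 := sub_ne_zero.2 hw
    rw [value_eq, hd]
    simp only [Polynomial.eval_mul, Polynomial.eval_pow, Polynomial.eval_sub, Polynomial.eval_X,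
      Polynomial.eval_C]
    have h1 : (w - z) = (w - z) ^ k * (w - z) ^ (1 - k) := by
      rw [← pow_add, Nat.add_sub_cancel' hx, pow_one]
    have h2 : (w - z) ^ (1 - k) ≠ 0 := pow_ne_zero _ hw'
    have h3 : (w - z) ^ k ≠ 0 := pow_ne_zero _ hw'
    by_cases h4 : d.eval w = 0
    · simp [h4]
    · conv_rhs => rw [div_div]; arg 2; arg 2; rw [h1]
      field_simp

/-- The driving coefficient has at most a simple pole at the singular point. -/
theorem IsLocalFrame.exists_frameRow_eq (hF : IsFuchsian q) (h : IsLocalFrame q s r a₀ g y)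
    (hdet : ∀ w ∈ Metric.ball s r, w ≠ s → (frameMatrix g a₀ w).det ≠ 0) :
    ∃ (ρ : ℂ) (η : ℂ → ℂ), AnalyticAt ℂ η s ∧
      ∀ᶠ w in 𝓝[≠] s, frameRow q g a₀ a₀ w = ρ / (w - s) + η w := by
  have hmul : (q (lastIdx a₀)).denom.rootMultiplicity s ≤ 1 := by
    refine (hF.1 s _).trans ?_
    have := a₀.isLt
    simp only [lastIdx]
    omega
  obtain ⟨P, hP, hPv⟩ := exists_value_eq_div hmul
  have hball : ∀ᶠ w in 𝓝[≠] s, w ∈ Metric.ball s r :=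
    nhdsWithin_le_nhds (Metric.ball_mem_nhds s h.pos)
  have hδ := h.analyticAt_det (Metric.mem_ball_self h.pos)
  have hδne : ∃ᶠ w in 𝓝[≠] s, (frameMatrix g a₀ w).det ≠ 0 := by
    refine Eventually.frequently ?_
    filter_upwards [hball, self_mem_nhdsWithin] with w hw hws using hdet w hw hws
  obtain ⟨d, u, hu, hu0, hδu⟩ :=
    hδ.exists_eventuallyEq_pow_smul_nonzero_iff.2 fun h0 => by
      refine hδne ?_
      filter_upwards [nhdsWithin_le_nhds h0] with w hw
      simp [hw]
  refine ⟨P s - d, fun w => dslope P s w - deriv u w / u w, ?_, ?_⟩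
  · refine AnalyticAt.sub ?_ (hu.deriv.div hu hu0)
    rw [Complex.analyticAt_iff_eventually_differentiableAt] at hP ⊢
    obtain ⟨ε, hε, hb⟩ := Metric.eventually_nhds_iff_ball.1 hP
    have : DifferentiableOn ℂ (dslope P s) (Metric.ball s ε) :=
      (Complex.differentiableOn_dslope (Metric.ball_mem_nhds s hε)).2
        fun w hw => (hb w hw).differentiableWithinAt
    filter_upwards [Metric.ball_mem_nhds s hε] with w hw
    exact this.differentiableAt (Metric.isOpen_ball.mem_nhds hw)
  · have hδu' : ∀ᶠ w in 𝓝[≠] s, (fun w => (frameMatrix g a₀ w).det)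
        =ᶠ[𝓝 w] fun w => (w - s) ^ d • u w :=
      nhdsWithin_le_nhds (eventually_eventually_nhds.2 hδu)
    filter_upwards [hball, self_mem_nhdsWithin, hPv, hδu',
      nhdsWithin_le_nhds (hu.eventually_analyticAt),
      nhdsWithin_le_nhds (hu.continuousAt.eventually_ne hu0)] with w hw hws hPw hδw huw hu0w
    have hws' : w - s ≠ 0 := sub_ne_zero.2 hws
    have hd := hdet w hw hws
    have h1 := h.hasDerivAt_det_frameMatrix hw hws hd
    have h2 : HasDerivAt (fun w => (w - s) ^ d • u w)
        ((d * (w - s) ^ (d - 1) * 1) * u w + (w - s) ^ d * deriv u w) w :=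
      (((hasDerivAt_id w).sub_const s).pow d).mul huw.differentiableAt.hasDerivAt
    have h3 := h1.unique (h2.congr_of_eventuallyEq hδw)
    have h4 := hδw.self_of_nhds
    simp only [smul_eq_mul] at h4
    rw [h4, hPw] at h3
    have h5 : (d : ℂ) * (w - s) ^ (d - 1) = d * (w - s) ^ d / (w - s) := by
      rcases d with _ | d
      · simp
      · rw [Nat.add_sub_cancel, pow_succ, ← mul_assoc, mul_div_cancel_right₀ _ hws']
    rw [mul_one, h5] at h3
    have h6 : (w - s) ^ d ≠ 0 := pow_ne_zero _ hws'
    rw [dslope_of_ne _ hws, slope_def_field]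
    field_simp at h3 ⊢
    linear_combination -h3

end

/-! ### The form of the singular solution -/

section

variable {m : ℕ} {q : Fin m → RatFunc ℂ} {s : ℂ} {r : ℝ} {a₀ : Fin m} {g : Fin m → ℂ → ℂ}
  {y : ℂ → ℂ}

theorem exists_ball_of_analyticAt {f : ℂ → ℂ} {s : ℂ} (hf : AnalyticAt ℂ f s) :
    ∃ r > 0, DifferentiableOn ℂ f (Metric.ball s r) := by
  obtain ⟨r, hr, hb⟩ := Metric.eventually_nhds_iff_ball.1 hf.eventually_analyticAt
  exact ⟨r, hr, fun w hw => (hb w hw).differentiableAt.differentiableWithinAt⟩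

/-- The driving coordinate of the singular solution is a power of `w - s` times a holomorphic
function. -/
theorem IsLocalFrame.exists_frameCoeff_self_eq (hF : IsFuchsian q)
    (h : IsLocalFrame q s r a₀ g y)
    (hdet : ∀ w ∈ Metric.ball s r, w ≠ s → (frameMatrix g a₀ w).det ≠ 0) :
    ∃ (ρ : ℂ) (E : ℂ → ℂ) (r₁ : ℝ), 0 < r₁ ∧ r₁ ≤ r ∧ DifferentiableOn ℂ E (Metric.ball s r₁) ∧
      ∀ w ∈ slitDisc s r₁,
        frameCoeff g a₀ y a₀ w = Complex.exp (ρ * Complex.log (w - s)) * E w := by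
  obtain ⟨ρ, η, hη, hev⟩ := h.exists_frameRow_eq hF hdet
  obtain ⟨r₂, hr₂, hη₂⟩ := exists_ball_of_analyticAt hη
  rw [eventually_nhdsWithin_iff] at hev
  obtain ⟨r₃, hr₃, hev₃⟩ := Metric.eventually_nhds_iff_ball.1 hev
  set r₁ := min r (min r₂ r₃)
  have hr₁ : 0 < r₁ := lt_min h.pos (lt_min hr₂ hr₃)
  have h1 : r₁ ≤ r := min_le_left _ _
  have h2 : r₁ ≤ r₂ := (min_le_right _ _).trans (min_le_left _ _)
  have h3 : r₁ ≤ r₃ := (min_le_right _ _).trans (min_le_right _ _)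
  obtain ⟨Θ, hΘ⟩ := (hη₂.mono (Metric.ball_subset_ball h2)).isExactOn_ball
  have hderiv : ∀ w ∈ slitDisc s r₁, HasDerivAt (fun w => frameCoeff g a₀ y a₀ w *
      Complex.exp (-(ρ * Complex.log (w - s)) - Θ w)) 0 w := by
    intro w hw
    have hws := ne_of_mem_slitDisc hw
    have hlog := (isLogBranch_log s r₁ w hw).1
    have hC := h.hasDerivAt_frameCoeff hdet (slitDisc_mono s h1 hw) a₀
    rw [hev₃ w (Metric.ball_subset_ball h3 hw.1) hws] at hC
    refine (hC.mul (((hlog.const_mul ρ).neg.sub (hΘ w hw.1)).cexp)).congr_deriv ?_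
    rw [div_eq_mul_inv]
    ring
  obtain ⟨c, hc⟩ := (isOpen_slitDisc s r₁).exists_is_const_of_deriv_eq_zero
    (isPreconnected_slitDisc s hr₁)
    (fun w hw => (hderiv w hw).differentiableAt.differentiableWithinAt)
    (fun w hw => (hderiv w hw).deriv)
  refine ⟨ρ, fun w => c * Complex.exp (Θ w), r₁, hr₁, h1, fun w hw => ?_, fun w hw => ?_⟩
  · exact ((hΘ w hw).differentiableAt.cexp.const_mul c).differentiableWithinAt
  · rw [← hc w hw, mul_left_comm, mul_assoc, ← Complex.exp_add, ← Complex.exp_add]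
    simp

/-- All coordinates of the singular solution have the form `(w - s)^σ G + λ log (w - s) + c`
with a common exponent `σ`, where logarithms occur only if `σ = -p` for a natural number `p`. -/
theorem IsLocalFrame.exists_frameCoeff_eq (hF : IsFuchsian q) (h : IsLocalFrame q s r a₀ g y)
    (hdet : ∀ w ∈ Metric.ball s r, w ≠ s → (frameMatrix g a₀ w).det ≠ 0) :
    ∃ (σ : ℂ) (p : ℕ) (G : Fin m → ℂ → ℂ) (lam c : Fin m → ℂ) (r₁ : ℝ), 0 < r₁ ∧ r₁ ≤ r ∧
      (∀ a, DifferentiableOn ℂ (G a) (Metric.ball s r₁)) ∧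
      ((lam = 0 ∧ ∀ k : ℤ, σ ≠ k) ∨ σ = -(p : ℂ)) ∧
      ∀ a, ∀ w ∈ slitDisc s r₁, frameCoeff g a₀ y a w
        = Complex.exp (σ * Complex.log (w - s)) * G a w + lam a * Complex.log (w - s) + c a := by
  obtain ⟨ρ, E, r₂, hr₂, hr₂r, hE, hCE⟩ := h.exists_frameCoeff_self_eq hF hdet
  obtain ⟨k₀, hk₀⟩ := exists_nat_ge (‖ρ‖ + 1)
  obtain ⟨k, hk, F, hFan, hFk⟩ := exists_common_pole_order
    (fun a => h.meromorphicAt_frameRow a) k₀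
  set σ : ℂ := ρ - k + 1 with hσ
  have hEan : AnalyticAt ℂ E s := hE.analyticAt (Metric.ball_mem_nhds s hr₂)
  choose ra hra G lam p hlam hG hode using fun a => exists_solution_euler (hEan.mul (hFan a)) σ
  have hne : (Finset.univ : Finset (Fin m)).Nonempty := ⟨a₀, Finset.mem_univ _⟩
  set r₁ := min r₂ (Finset.univ.inf' hne ra)
  have hr₁ : 0 < r₁ := lt_min hr₂ ((Finset.lt_inf'_iff hne).2 fun a _ => hra a)
  have h2 : r₁ ≤ r₂ := min_le_left _ _
  have h3 : ∀ a, r₁ ≤ ra a := fun a =>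
    (min_le_right _ _).trans (Finset.inf'_le _ (Finset.mem_univ a))
  have hderiv : ∀ a, ∀ w ∈ slitDisc s r₁, HasDerivAt (fun w => frameCoeff g a₀ y a w
      - (Complex.exp (σ * Complex.log (w - s)) * G a w + lam a * Complex.log (w - s))) 0 w := by
    intro a w hw
    have hws := ne_of_mem_slitDisc hw
    have hws' : w - s ≠ 0 := sub_ne_zero.2 hws
    have hlog := (isLogBranch_log s r₁ w hw).1
    have hexp := (isLogBranch_log s r₁ w hw).2
    have hC := h.hasDerivAt_frameCoeff hdet (slitDisc_mono s (h2.trans hr₂r) hw) a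
    rw [hCE w (slitDisc_mono s h2 hw), hFk a w hws] at hC
    have hwa : w ∈ Metric.ball s (ra a) := Metric.ball_subset_ball (h3 a) hw.1
    have hGd := ((hG a).differentiableAt (Metric.isOpen_ball.mem_nhds hwa)).hasDerivAt
    refine (hC.sub (((hlog.const_mul σ).cexp.mul hGd).add (hlog.const_mul (lam a)))).congr_deriv ?_
    have hode' := hode a w hwa
    have h4 : Complex.exp (σ * Complex.log (w - s)) * (w - s) ^ k
        = Complex.exp (ρ * Complex.log (w - s)) * (w - s) := by
      have e1 := exp_sub_nat_mul hexp (ρ + 1) k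
      have e2 := exp_add_nat_mul hexp ρ 1
      rw [show ρ + 1 - (k : ℂ) = σ by rw [hσ]; ring, eq_div_iff (pow_ne_zero _ hws')] at e1
      rw [e1]
      simpa using e2
    have h5 : lam a * (Complex.exp (σ * Complex.log (w - s)) * (w - s) ^ p a) = lam a := by
      by_cases hl : lam a = 0
      · simp [hl]
      · have e1 := exp_sub_nat_mul hexp 0 (p a)
        rw [zero_sub, ← hlam a hl, zero_mul, Complex.exp_zero] at e1
        rw [e1, div_mul_cancel₀ _ (pow_ne_zero _ hws'), mul_one]
    have h6 : (w - s) ^ k ≠ 0 := pow_ne_zero _ hws'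
    simp only [Pi.mul_apply] at hode'
    clear_value σ
    generalize Complex.exp (σ * Complex.log (w - s)) = X at h4 h5 ⊢
    generalize Complex.exp (ρ * Complex.log (w - s)) = Z at h4 ⊢
    field_simp
    linear_combination (-(w - s) ^ k * X) * hode' - (E w * F a w) * h4 + (w - s) ^ k * h5
  choose c hc using fun a => (isOpen_slitDisc s r₁).exists_is_const_of_deriv_eq_zero
    (isPreconnected_slitDisc s hr₁)
    (fun w hw => (hderiv a w hw).differentiableAt.differentiableWithinAt)
    (fun w hw => (hderiv a w hw).deriv)
  have hcase : ∃ p' : ℕ, (lam = 0 ∧ ∀ k : ℤ, σ ≠ k) ∨ σ = -(p' : ℂ) := by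
    by_cases hp : ∃ p' : ℕ, σ = -(p' : ℂ)
    · exact hp.imp fun _ => Or.inr
    · push Not at hp
      refine ⟨0, Or.inl ⟨funext fun a => ?_, fun j hj => ?_⟩⟩
      · by_contra hl
        exact hp _ (hlam a hl)
      -- The exponent has nonpositive real part, so it is an integer only if it is some `-p`.
      · have hre : σ.re ≤ 0 := by
          have e1 : ρ.re ≤ ‖ρ‖ := Complex.re_le_norm ρ
          have e2 : (k₀ : ℝ) ≤ k := by exact_mod_cast hk
          simp only [hσ, Complex.add_re, Complex.sub_re, Complex.natCast_re, Complex.one_re]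
          linarith
        rw [hj, Complex.intCast_re] at hre
        have hj0 : j ≤ 0 := by exact_mod_cast hre
        obtain ⟨n, hn⟩ := Int.eq_ofNat_of_zero_le (neg_nonneg.2 hj0)
        refine hp n ?_
        rw [hj, ← Int.cast_natCast, ← hn]
        push_cast
        ring
  obtain ⟨p', hp'⟩ := hcase
  refine ⟨σ, p', G, lam, c, r₁, hr₁, h2.trans hr₂r,
    fun a => (hG a).mono (Metric.ball_subset_ball (h3 a)), hp', fun a w hw => ?_⟩
  rw [← hc a w hw]
  ring

theorem modelSing_of_forall_ne {β : ℂ} (h : ∀ k : ℕ, β ≠ k) (l : ℂ) :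
    modelSing β l = Complex.exp (β * l) := by
  rw [modelSing, if_neg]
  rintro ⟨k, hk⟩
  exact h k hk

theorem modelSing_natCast {l u : ℂ} (h : Complex.exp l = u) (k : ℕ) :
    modelSing k l = u ^ k * l := by
  rw [modelSing, if_pos ⟨k, rfl⟩]
  have := exp_add_nat_mul h 0 k
  rw [zero_add, zero_mul, Complex.exp_zero, one_mul] at this
  rw [this]

/-- Expansion of `u^σ h + v log u` in the model functions, up to terms of high order and
holomorphic terms. -/
theorem exists_model_coeff (hr : 0 < r) {σ : ℂ} {p : ℕ} {h v : ℂ → ℂ}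
    (hh : DifferentiableOn ℂ h (Metric.ball s r)) (hv : DifferentiableOn ℂ v (Metric.ball s r))
    (hσ : ((∀ w, v w = 0) ∧ ∀ k : ℤ, σ ≠ k) ∨ σ = -(p : ℂ)) :
    ∃ (a : ℕ → ℂ) (K₀ : ℕ),
      (∀ K ≥ K₀, ∃ h' v' g' : ℂ → ℂ, DifferentiableOn ℂ h' (Metric.ball s r) ∧
        DifferentiableOn ℂ v' (Metric.ball s r) ∧ DifferentiableOn ℂ g' (Metric.ball s r) ∧
        ∀ w l, Complex.exp l = w - s → Complex.exp (σ * l) * h w + l * v w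
          = ∑ k ∈ Finset.range K, a k * modelSing (σ + k) l
            + Complex.exp ((σ + K) * l) * (h' w + l * v' w) + g' w) ∧
      ((∀ k, a k = 0) → ∃ g' : ℂ → ℂ, DifferentiableOn ℂ g' (Metric.ball s r) ∧
        ∀ w ∈ Metric.ball s r, ∀ l, Complex.exp l = w - s →
          Complex.exp (σ * l) * h w + l * v w = g' w) := by
  obtain ⟨c, hc, hc0⟩ := exists_taylor_remainder hr hh
  obtain ⟨d, hd, hd0⟩ := exists_taylor_remainder hr hv
  rcases hσ with ⟨hv0, hσ⟩ | rfl
  · refine ⟨c, 0, fun K _ => ?_, fun h0 => ⟨0, differentiableOn_const 0, fun w hw l _ => ?_⟩⟩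
    · obtain ⟨k, hk, hhk⟩ := hc K
      refine ⟨k, 0, 0, hk, differentiableOn_const 0, differentiableOn_const 0, fun w l hl => ?_⟩
      have h1 : ∀ i : ℕ, c i * modelSing (σ + i) l = Complex.exp (σ * l) * (c i * (w - s) ^ i) := by
        intro i
        rw [modelSing_of_forall_ne, exp_add_nat_mul hl]
        · ring
        · intro k hk
          refine hσ ((k : ℤ) - (i : ℤ)) ?_
          push_cast
          linear_combination hk
      rw [Finset.sum_congr rfl fun i _ => h1 i, ← Finset.mul_sum, hhk w, hv0 w,
        exp_add_nat_mul hl]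
      simp only [Pi.zero_apply]
      ring
    · rw [hc0 h0 w hw, hv0 w]
      simp
  · let a : ℕ → ℂ := fun k => if k < p then c k else d (k - p)
    obtain ⟨hp, hhp, hhpe⟩ := hc p
    have hsum : ∀ w l, Complex.exp l = w - s → ∀ K, ∑ k ∈ Finset.range (p + K),
        a k * modelSing (-(p : ℂ) + k) l = Complex.exp (-(p : ℂ) * l) *
          ∑ i ∈ Finset.range p, c i * (w - s) ^ i
          + l * ∑ i ∈ Finset.range K, d i * (w - s) ^ i := by
      intro w l hl K
      rw [Finset.sum_range_add, Finset.mul_sum, Finset.mul_sum]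
      congr 1
      · refine Finset.sum_congr rfl fun i hi => ?_
        have hip := Finset.mem_range.1 hi
        rw [modelSing_of_forall_ne, exp_add_nat_mul hl]
        · simp only [a, if_pos hip]
          ring
        · intro k hk
          have : ((i : ℤ) : ℂ) = (k : ℤ) + (p : ℤ) := by push_cast; linear_combination hk
          have h2 : (i : ℤ) = k + p := by exact_mod_cast this
          omega
      · refine Finset.sum_congr rfl fun i _ => ?_
        have : -(p : ℂ) + ((p + i : ℕ) : ℂ) = (i : ℂ) := by push_cast; ring
        rw [this, modelSing_natCast hl]
        simp only [a, if_neg (Nat.not_lt.2 (Nat.le_add_right p i)), Nat.add_sub_cancel_left]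
        ring
    have hexp : ∀ w l, Complex.exp l = w - s →
        Complex.exp (-(p : ℂ) * l) * (w - s) ^ p = 1 := by
      intro w l hl
      rw [← exp_add_nat_mul hl, neg_add_cancel, zero_mul, Complex.exp_zero]
    refine ⟨a, p, fun K hK => ?_, fun h0 => ⟨hp, hhp, fun w hw l hl => ?_⟩⟩
    · obtain ⟨K, rfl⟩ := Nat.exists_eq_add_of_le hK
      obtain ⟨k, hk, hvk⟩ := hd K
      refine ⟨0, k, hp, differentiableOn_const 0, hk, hhp, fun w l hl => ?_⟩
      rw [hsum w l hl, hhpe w, hvk w]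
      have h1 : Complex.exp ((-(p : ℂ) + ((p + K : ℕ) : ℂ)) * l) = (w - s) ^ K := by
        have e1 := exp_add_nat_mul hl 0 K
        rw [zero_mul, Complex.exp_zero, one_mul, zero_add] at e1
        rw [← e1]
        push_cast
        ring_nf
      rw [h1]
      simp only [Pi.zero_apply]
      linear_combination hp w * hexp w l hl
    · have hcp : ∀ i ∈ Finset.range p, c i * (w - s) ^ i = 0 := fun i hi => by
        have := h0 i
        simp only [a, if_pos (Finset.mem_range.1 hi)] at this
        rw [this, zero_mul]
      have hdz : ∀ k, d k = 0 := fun k => by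
        have := h0 (p + k)
        simpa [a] using this
      rw [hd0 hdz w hw, hhpe w, Finset.sum_eq_zero hcp]
      linear_combination hp w * hexp w l hl

/-- The singular part `u^σ h + v log u` of a function that does not extend, written with a
nonzero leading model function and a remainder whose `N`-th derivative is bounded. -/
theorem exists_model_expansion (hr : 0 < r) {σ : ℂ} {p : ℕ} {h v : ℂ → ℂ}
    (hh : DifferentiableOn ℂ h (Metric.ball s r)) (hv : DifferentiableOn ℂ v (Metric.ball s r))
    (hσ : ((∀ w, v w = 0) ∧ ∀ k : ℤ, σ ≠ k) ∨ σ = -(p : ℂ))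
    (hne : ¬ ∃ g' : ℂ → ℂ, DifferentiableOn ℂ g' (Metric.ball s r) ∧
        ∀ w ∈ Metric.ball s r, ∀ l, Complex.exp l = w - s →
          Complex.exp (σ * l) * h w + l * v w = g' w) :
    ∃ (σ' : ℂ) (N K : ℕ) (e : ℕ → ℂ) (h' v' g' : ℂ → ℂ), e 0 ≠ 0 ∧ ‖σ'‖ + 2 ≤ N ∧
      1 ≤ (σ' + (K + 1 : ℕ) - N).re ∧ DifferentiableOn ℂ h' (Metric.ball s r) ∧
      DifferentiableOn ℂ v' (Metric.ball s r) ∧ DifferentiableOn ℂ g' (Metric.ball s r) ∧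
      ∀ w l, Complex.exp l = w - s → Complex.exp (σ * l) * h w + l * v w
          = ∑ k ∈ Finset.range (K + 1), e k * modelSing (σ' + k) l
            + Complex.exp ((σ' + (K + 1 : ℕ)) * l) * (h' w + l * v' w) + g' w := by
  obtain ⟨a, K₀, ha, ha0⟩ := exists_model_coeff hr hh hv hσ
  have hex : ∃ k, a k ≠ 0 := by
    by_contra! h0
    exact hne (ha0 h0)
  classical
  set k₀ := Nat.find hex with hk₀
  have hk₀0 : ∀ k < k₀, a k = 0 := fun k hk => not_not.1 (Nat.find_min hex hk)
  obtain ⟨N, hN⟩ := exists_nat_ge (‖σ + k₀‖ + 2)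
  obtain ⟨K₁, hK₁⟩ := exists_nat_ge (‖σ + k₀‖ + N + 1)
  set K := max K₀ K₁
  obtain ⟨h', v', g', hh', hv', hg', heq⟩ := ha (k₀ + (K + 1)) (by
    have := le_max_left K₀ K₁
    omega)
  refine ⟨σ + k₀, N, K, fun k => a (k₀ + k), h', v', g', Nat.find_spec hex, hN, ?_, hh', hv', hg',
    fun w l hl => ?_⟩
  · have h1 := (abs_le.1 (Complex.abs_re_le_norm (σ + k₀))).1
    have h2 : (K₁ : ℝ) ≤ (K + 1 : ℕ) := by
      have := le_max_right K₀ K₁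
      exact_mod_cast this.trans (Nat.le_succ _)
    rw [Complex.sub_re, Complex.add_re, Complex.natCast_re, Complex.natCast_re]
    linarith
  · rw [heq w l hl, Finset.sum_range_add, Finset.sum_eq_zero fun k hk => by
      rw [hk₀0 k (Finset.mem_range.1 hk), zero_mul], zero_add]
    have h1 : ∀ k : ℕ, σ + ((k₀ + k : ℕ) : ℂ) = σ + k₀ + k := fun k => by push_cast; ring
    simp only [h1]

end

/-! ### Taylor coefficients near a singular point -/

section

variable {m : ℕ} {q : Fin m → RatFunc ℂ} {s : ℂ}

/-- The structure of the solutions near the singular point `s`: a local frame `g`,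
`y` on a disc of radius `r`, the form `y = u^σ h + v log u + k` of the singular solution
(`u = w - s`), and an expansion of its singular part in model functions with exponents `τ`,
`τ + 1`, ... and a nonzero leading coefficient `e 0`. By `le_re`, the remainder of the expansion
has a bounded derivative of order `N`. The coordinates of `y` in the frame grow at most like a power
of `1 / |u|` (`moderate`). -/
structure SingularData (q : Fin m → RatFunc ℂ) (s : ℂ) where
  r : ℝ
  a₀ : Fin m
  g : Fin m → ℂ → ℂ
  y : ℂ → ℂ
  frame : IsLocalFrame q s r a₀ g y
  det_ne : ∀ w ∈ Metric.ball s r, w ≠ s → (frameMatrix g a₀ w).det ≠ 0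
  σ : ℂ
  h : ℂ → ℂ
  v : ℂ → ℂ
  k : ℂ → ℂ
  diff_h : DifferentiableOn ℂ h (Metric.ball s r)
  diff_v : DifferentiableOn ℂ v (Metric.ball s r)
  diff_k : DifferentiableOn ℂ k (Metric.ball s r)
  y_eq : ∀ w ∈ slitDisc s r, y w = Complex.exp (σ * Complex.log (w - s)) * h w
    + Complex.log (w - s) * v w + k w
  τ : ℂ
  N : ℕ
  K : ℕ
  e : ℕ → ℂ
  h' : ℂ → ℂ
  v' : ℂ → ℂ
  k' : ℂ → ℂ
  e_ne : e 0 ≠ 0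
  le_N : ‖τ‖ + 2 ≤ N
  le_re : 1 ≤ (τ + (K + 1 : ℕ) - N).re
  diff_h' : DifferentiableOn ℂ h' (Metric.ball s r)
  diff_v' : DifferentiableOn ℂ v' (Metric.ball s r)
  diff_k' : DifferentiableOn ℂ k' (Metric.ball s r)
  expansion : ∀ w l, Complex.exp l = w - s → Complex.exp (σ * l) * h w + l * v w
    = ∑ k ∈ Finset.range (K + 1), e k * modelSing (τ + k) l
      + Complex.exp ((τ + (K + 1 : ℕ)) * l) * (h' w + l * v' w) + k' w
  moderate : ∃ (M : ℕ) (C : ℝ), ∀ a, ∀ w ∈ slitDisc s r,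
    ‖w - s‖ ^ M * ‖frameCoeff g a₀ y a w‖ ≤ C

theorem SingularData.pos (D : SingularData q s) : 0 < D.r := D.frame.pos

theorem exists_forall_norm_le_of_differentiableOn {f : ℂ → ℂ} {r ρ : ℝ} (hρ : ρ < r)
    (hf : DifferentiableOn ℂ f (Metric.ball s r)) :
    ∃ C, ∀ w ∈ Metric.closedBall s ρ, ‖f w‖ ≤ C :=
  (isCompact_closedBall s ρ).exists_bound_of_continuousOn
    (hf.continuousOn.mono (Metric.closedBall_subset_ball hρ))

theorem abs_im_log_le (u : ℂ) : |(Complex.log u).im| ≤ Real.pi := by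
  rw [Complex.log_im]
  exact Complex.abs_arg_le_pi u

/-- Since `y` does not extend to `s`, its singular part is not holomorphic, which provides the
leading term of the expansion. -/
theorem nonempty_singularData (hF : IsFuchsian q) (hG : IsGeneric q) (hm : 0 < m)
    (hs : s ∈ singularPoints q) : Nonempty (SingularData q s) := by
  obtain ⟨r₀, a₀, g, y, hfr₀⟩ := exists_isLocalFrame hm hG hs
  obtain ⟨r₁, hr₁, hr₁0, hdet₁⟩ := hfr₀.exists_forall_det_ne_zero
  have hfr₁ := hfr₀.mono hr₁ hr₁0
  obtain ⟨σ, p, G, lam, c, r₂, hr₂, hr₂1, hGd, hcase, hC⟩ := hfr₁.exists_frameCoeff_eq hF hdet₁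
  set r := r₂ / 2 with hr
  have hr0 : 0 < r := half_pos hr₂
  have hrr₂ : r < r₂ := half_lt_self hr₂
  have hrr₁ : r ≤ r₁ := hrr₂.le.trans hr₂1
  have hfr := hfr₁.mono hr0 hrr₁
  have hdet : ∀ w ∈ Metric.ball s r, w ≠ s → (frameMatrix g a₀ w).det ≠ 0 := fun w hw =>
    hdet₁ w (Metric.ball_subset_ball hrr₁ hw)
  have hB : ∀ a, DifferentiableOn ℂ (fun w => frameMatrix g a₀ w a ⟨0, hm⟩) (Metric.ball s r) :=
    fun a w hw => (hfr.differentiableAt_frameMatrix hw a _).differentiableWithinAt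
  have hGd' : ∀ a, DifferentiableOn ℂ (G a) (Metric.ball s r) := fun a =>
    (hGd a).mono (Metric.ball_subset_ball hrr₂.le)
  set h : ℂ → ℂ := fun w => ∑ a, G a w * frameMatrix g a₀ w a ⟨0, hm⟩ with hh
  set v : ℂ → ℂ := fun w => ∑ a, lam a * frameMatrix g a₀ w a ⟨0, hm⟩ with hv
  set k : ℂ → ℂ := fun w => ∑ a, c a * frameMatrix g a₀ w a ⟨0, hm⟩ with hk
  have hhd : DifferentiableOn ℂ h (Metric.ball s r) :=
    DifferentiableOn.fun_sum fun a _ => (hGd' a).mul (hB a)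
  have hvd : DifferentiableOn ℂ v (Metric.ball s r) :=
    DifferentiableOn.fun_sum fun a _ => (hB a).const_mul _
  have hkd : DifferentiableOn ℂ k (Metric.ball s r) :=
    DifferentiableOn.fun_sum fun a _ => (hB a).const_mul _
  have hyeq : ∀ w ∈ slitDisc s r, y w = Complex.exp (σ * Complex.log (w - s)) * h w
      + Complex.log (w - s) * v w + k w := by
    intro w hw
    have h1 := sum_frameCoeff_mul (y := y) (hdet w hw.1 (ne_of_mem_slitDisc hw)) ⟨0, hm⟩
    rw [iteratedDeriv_zero] at h1
    rw [← h1, hh, hv, hk, Finset.mul_sum, Finset.mul_sum, ← Finset.sum_add_distrib,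
      ← Finset.sum_add_distrib]
    refine Finset.sum_congr rfl fun a _ => ?_
    rw [hC a w (slitDisc_mono s hrr₂.le hw)]
    ring
  have hσ : ((∀ w, v w = 0) ∧ ∀ k : ℤ, σ ≠ k) ∨ σ = -(p : ℂ) := by
    refine hcase.imp_left fun ⟨h1, h2⟩ => ⟨fun w => ?_, h2⟩
    simp [hv, h1]
  have hne : ¬ ∃ g' : ℂ → ℂ, DifferentiableOn ℂ g' (Metric.ball s r) ∧
      ∀ w ∈ Metric.ball s r, ∀ l, Complex.exp l = w - s →
        Complex.exp (σ * l) * h w + l * v w = g' w := by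
    rintro ⟨g', hg', hgeq⟩
    refine hfr.not_ext ⟨fun w => g' w + k w,
      (hg'.add hkd).analyticAt (Metric.ball_mem_nhds s hr0), ?_⟩
    filter_upwards [Metric.ball_mem_nhds s hr0] with w hw hws
    rw [hyeq w ⟨hw, hws⟩, hgeq w hw _ (isLogBranch_log s r w ⟨hw, hws⟩).2]
  obtain ⟨τ, N, K, e, h', v', k', he, hN, hK, hh', hv', hk', hexp⟩ :=
    exists_model_expansion hr0 hhd hvd hσ hne
  refine ⟨⟨r, a₀, g, y, hfr, hdet, σ, h, v, k, hhd, hvd, hkd, hyeq, τ, N, K, e, h', v', k', he, hN,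
    hK, hh', hv', hk', hexp, ?_⟩⟩
  obtain ⟨M, hM⟩ := exists_nat_ge (‖σ‖ + 1)
  have hbound : ∀ a, ∃ C, ∀ w ∈ slitDisc s r, ‖w - s‖ ^ M * ‖frameCoeff g a₀ y a w‖ ≤ C := by
    intro a
    obtain ⟨CG, hCG⟩ := exists_forall_norm_le_of_differentiableOn hrr₂ (hGd a)
    have hσM : 1 ≤ (σ + M).re := by
      have h1 := (abs_le.1 (Complex.abs_re_le_norm σ)).1
      rw [Complex.add_re, Complex.natCast_re]
      linarith
    have hMM : 1 ≤ ((M : ℂ)).re := by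
      rw [Complex.natCast_re]
      have := norm_nonneg σ
      linarith
    obtain ⟨C₁, hC₁⟩ := exists_norm_exp_mul_log_le hσM Real.pi (max CG 0)
    obtain ⟨C₂, hC₂⟩ := exists_norm_exp_mul_log_le hMM Real.pi (max ‖c a‖ ‖lam a‖)
    refine ⟨C₁ + C₂, fun w hw => ?_⟩
    have hl := (isLogBranch_log s r w hw).2
    simp only at hl
    have hu : ‖w - s‖ ≤ 1 := by
      have h1 : dist w s < r := hw.1
      rw [dist_eq_norm] at h1
      exact h1.le.trans hfr.le_one
    rw [← norm_pow, ← norm_mul, hC a w (slitDisc_mono s hrr₂.le hw)]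
    have h1 : (w - s) ^ M * (Complex.exp (σ * Complex.log (w - s)) * G a w
        + lam a * Complex.log (w - s) + c a)
        = Complex.exp ((σ + M) * Complex.log (w - s)) * (G a w + Complex.log (w - s) * 0)
          + Complex.exp ((M : ℂ) * Complex.log (w - s)) * (c a + Complex.log (w - s) * lam a) := by
      have e1 := exp_add_nat_mul hl 0 M
      rw [zero_add, zero_mul, Complex.exp_zero, one_mul] at e1
      rw [exp_add_nat_mul hl, e1]
      ring
    rw [h1]
    refine (norm_add_le _ _).trans (add_le_add ?_ ?_)
    · exact hC₁ _ _ _ _ hl hu (abs_im_log_le _)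
        ((hCG w (Metric.ball_subset_closedBall hw.1)).trans (le_max_left _ _))
        (by rw [norm_zero]; exact le_max_right _ _)
    · exact hC₂ _ _ _ _ hl hu (abs_im_log_le _) (le_max_left _ _) (le_max_right _ _)
  choose C hCb using hbound
  refine ⟨M, ∑ a, |C a|, fun a w hw => (hCb a w hw).trans ((le_abs_self _).trans ?_)⟩
  exact Finset.single_le_sum (f := fun a => |C a|) (fun a _ => abs_nonneg _) (Finset.mem_univ a)

/-- After subtraction of the model functions, a function with the singular part of the frame has
a bounded derivative of order `N`, uniformly in the domain and in the branch of the logarithm. -/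
theorem SingularData.exists_remainder_bound (D : SingularData q s) {k : ℂ → ℂ}
    (hk : DifferentiableOn ℂ k (Metric.ball s D.r)) (γ : ℂ) (Λ : ℝ) :
    ∃ C, ∀ (O : Set ℂ) (ℓ F : ℂ → ℂ), IsOpen O → O ⊆ Metric.ball s D.r → IsLogBranch ℓ s O →
      (∀ w ∈ O, |(ℓ w).im| ≤ Λ) →
      (∀ w ∈ O, F w = γ * (Complex.exp (D.σ * ℓ w) * D.h w + ℓ w * D.v w) + k w) →
      ∀ w ∈ O, dist w s ≤ D.r / 2 → ‖iteratedDeriv D.N (fun w => F w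
        - ∑ j ∈ Finset.range (D.K + 1), γ * D.e j * modelSing (D.τ + j) (ℓ w)) w‖ ≤ C := by
  have hopen : IsOpen (Metric.ball s D.r) := Metric.isOpen_ball
  obtain ⟨f, f₁, hf, hf₁, hder⟩ := exists_iteratedDeriv_exp_mul_log hopen s
    (D.τ + (D.K + 1 : ℕ)) (D.diff_h'.const_mul γ) (D.diff_v'.const_mul γ) D.N
  have hkk : DifferentiableOn ℂ (fun w => γ * D.k' w + k w) (Metric.ball s D.r) :=
    (D.diff_k'.const_mul γ).add hk
  have hhalf := half_lt_self D.pos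
  obtain ⟨Cf, hCf⟩ := exists_forall_norm_le_of_differentiableOn hhalf hf
  obtain ⟨Cf₁, hCf₁⟩ := exists_forall_norm_le_of_differentiableOn hhalf hf₁
  obtain ⟨Ck, hCk⟩ := exists_forall_norm_le_of_differentiableOn hhalf
    (differentiableOn_iteratedDeriv hopen hkk D.N)
  obtain ⟨C, hC⟩ := exists_norm_exp_mul_log_le D.le_re Λ (max Cf Cf₁)
  refine ⟨C + Ck, fun O ℓ F hO hOs hℓ him hF w hw hws => ?_⟩
  have hexpd : DifferentiableOn ℂ (fun w => Complex.exp ((D.τ + (D.K + 1 : ℕ)) * ℓ w)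
      * (γ * D.h' w + ℓ w * (γ * D.v' w))) O := by
    have hℓd : DifferentiableOn ℂ ℓ O := fun w hw =>
      (hℓ w hw).1.differentiableAt.differentiableWithinAt
    exact (hℓd.const_mul _).cexp.mul (((D.diff_h'.mono hOs).const_mul γ).add
      (hℓd.mul ((D.diff_v'.mono hOs).const_mul γ)))
  have hev : (fun w => F w - ∑ j ∈ Finset.range (D.K + 1), γ * D.e j * modelSing (D.τ + j) (ℓ w))
      =ᶠ[𝓝 w] (fun w => Complex.exp ((D.τ + (D.K + 1 : ℕ)) * ℓ w)
      * (γ * D.h' w + ℓ w * (γ * D.v' w))) + fun w => γ * D.k' w + k w := by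
    filter_upwards [hO.mem_nhds hw] with x hx
    rw [hF x hx, D.expansion x _ (hℓ x hx).2]
    simp only [Pi.add_apply, mul_assoc, ← Finset.mul_sum]
    ring
  rw [(iteratedDeriv_congr_of_eventuallyEq hev D.N).self_of_nhds,
    iteratedDeriv_add ((hexpd.analyticAt (hO.mem_nhds hw)).contDiffAt)
      ((hkk.analyticAt (hopen.mem_nhds (hOs hw))).contDiffAt),
    hder ℓ O hO hOs hℓ w hw]
  have hu : ‖w - s‖ ≤ 1 := by
    rw [← dist_eq_norm]
    exact (hws.trans hhalf.le).trans D.frame.le_one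
  exact (norm_add_le _ _).trans (add_le_add
    (hC _ _ _ _ (hℓ w hw).2 hu (him w hw) ((hCf w hws).trans (le_max_left _ _))
      ((hCf₁ w hws).trans (le_max_right _ _))) (hCk w hws))

/-- The branch of the logarithm on the plane cut along the ray from `s` opposite to `z`. -/
theorem isLogBranch_log_div {z c₀ : ℂ} (hz : z ≠ s) (hc₀ : Complex.exp c₀ = z - s) :
    IsLogBranch (fun w => Complex.log ((w - s) / (z - s)) + c₀) s
      {w | (w - s) / (z - s) ∈ Complex.slitPlane} := fun w hw => by
  have hzs : z - s ≠ 0 := sub_ne_zero.2 hz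
  have hne := Complex.slitPlane_ne_zero hw
  refine ⟨?_, ?_⟩
  · have h1 := ((((hasDerivAt_id w).sub_const s).div_const (z - s)).clog hw).add_const c₀
    refine h1.congr_deriv ?_
    have : w - s ≠ 0 := fun h0 => hne (by rw [h0, zero_div])
    simp only [id]
    field_simp
  · rw [Complex.exp_add, Complex.exp_log hne, hc₀, div_mul_cancel₀ _ hzs]

theorem abs_im_log_div_add_le (u c₀ : ℂ) : |(Complex.log u + c₀).im| ≤ Real.pi + |c₀.im| := by
  rw [Complex.add_im]
  exact (abs_add_le _ _).trans (add_le_add (abs_im_log_le u) le_rfl)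

/-- Discs that have `s` on their boundary and whose centres lie near `z₀` avoid the ray from `s`
opposite to `z₀`. -/
theorem div_mem_slitPlane {z₀ z w : ℂ} (hz₀ : z₀ ≠ s) (hz : dist z z₀ < dist s z₀)
    (hw : w ∈ Metric.ball z ‖z - s‖) : (w - s) / (z₀ - s) ∈ Complex.slitPlane := by
  have hne : z₀ - s ≠ 0 := sub_ne_zero.2 hz₀
  have hpos : 0 < ‖z₀ - s‖ := norm_pos_iff.2 hne
  set a := (z - s) / (z₀ - s) with ha
  set b := (w - s) / (z₀ - s) with hb
  have h1 : ‖b - a‖ < ‖a‖ := by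
    rw [hb, ha, ← sub_div, norm_div, norm_div, sub_sub_sub_cancel_right]
    rw [Metric.mem_ball, dist_eq_norm] at hw
    gcongr
  have h2 : ‖a - 1‖ < 1 := by
    rw [ha, div_sub_one hne, norm_div, div_lt_one hpos, sub_sub_sub_cancel_right]
    rwa [dist_eq_norm, dist_eq_norm, ← norm_neg (s - z₀), neg_sub] at hz
  have h3 : 0 < a.re := by
    have := (abs_le.1 (Complex.abs_re_le_norm (a - 1))).1
    rw [Complex.sub_re, Complex.one_re] at this
    linarith
  by_contra hcon
  rw [Complex.mem_slitPlane_iff, not_or, not_lt, not_not] at hcon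
  have h4 : ‖a‖ ^ 2 ≤ ‖b - a‖ ^ 2 := by
    rw [Complex.sq_norm, Complex.sq_norm, Complex.normSq_apply, Complex.normSq_apply,
      Complex.sub_re, Complex.sub_im, hcon.2]
    nlinarith [hcon.1]
  have := pow_le_pow_left₀ (norm_nonneg _) h1.le 2
  nlinarith [norm_nonneg (b - a), norm_nonneg a]

theorem IsLogBranch.eqOn {ℓ ℓ' : ℂ → ℂ} {O : Set ℂ} (hO : IsOpen O) (hc : IsPreconnected O)
    (hℓ : IsLogBranch ℓ s O) (hℓ' : IsLogBranch ℓ' s O) {z : ℂ} (hz : z ∈ O) (h : ℓ z = ℓ' z) :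
    Set.EqOn ℓ ℓ' O := by
  have hd : ∀ w ∈ O, HasDerivAt (fun w => ℓ w - ℓ' w) 0 w := fun w hw =>
    ((hℓ w hw).1.sub (hℓ' w hw).1).congr_deriv (sub_self _)
  intro w hw
  have := hO.is_const_of_deriv_eq_zero hc
    (fun w hw => (hd w hw).differentiableAt.differentiableWithinAt)
    (fun w hw => (hd w hw).deriv) hw hz
  simp only [h, sub_self] at this
  exact sub_eq_zero.1 this

/-- The Taylor coefficients of the singular solution at points near `s` are not small. -/
theorem SingularData.exists_lower_bound_y (D : SingularData q s) : ∃ n₁ : ℕ, ∀ n ≥ n₁,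
    ∀ z ∈ slitDisc s (D.r / 4),
      ‖z - s‖ ^ D.N / (n : ℝ) ^ D.N ≤ ‖z - s‖ ^ n * ‖iteratedDeriv n D.y z‖ / n.factorial := by
  obtain ⟨C, hC⟩ := D.exists_remainder_bound D.diff_k 1 (Real.pi + Real.pi)
  obtain ⟨n₁, hn₁⟩ := exists_taylor_lower_bound D.τ D.le_N D.K D.e D.e_ne 1 C (Real.pi + Real.pi)
  refine ⟨n₁, fun n hn z hz => ?_⟩
  have hzs := ne_of_mem_slitDisc hz
  have hr := D.pos
  have hdist : ‖z - s‖ < D.r / 4 := by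
    rw [← dist_eq_norm]
    exact hz.1
  have hzs' : 0 < ‖z - s‖ := norm_pos_iff.2 (sub_ne_zero.2 hzs)
  have hzD : z ∈ slitDisc s D.r := slitDisc_mono s (by linarith) hz
  set c₀ := Complex.log (z - s) with hc₀
  have hbr := isLogBranch_log_div hzs (Complex.exp_log (sub_ne_zero.2 hzs))
  set ℓ : ℂ → ℂ := fun w => Complex.log ((w - s) / (z - s)) + c₀ with hℓ
  have hsub : Metric.ball z ‖z - s‖ ⊆ {w | (w - s) / (z - s) ∈ Complex.slitPlane} := fun w hw =>
    div_mem_slitPlane hzs (by rw [dist_self]; exact dist_pos.2 hzs.symm) hw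
  have hbr' := hbr.mono hsub
  have hball : ∀ w ∈ Metric.ball z ‖z - s‖, dist w s ≤ D.r / 2 := fun w hw => by
    have h1 := dist_triangle w z s
    have h2 : dist w z < ‖z - s‖ := hw
    have h3 : dist z s < D.r / 4 := hz.1
    linarith
  have hballr : Metric.ball z ‖z - s‖ ⊆ Metric.ball s D.r := fun w hw => by
    have := hball w hw
    rw [Metric.mem_ball]
    linarith
  have him : ∀ w, |(ℓ w).im| ≤ Real.pi + Real.pi := fun w =>
    (abs_im_log_div_add_le _ _).trans (add_le_add le_rfl (abs_im_log_le _))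
  set F : ℂ → ℂ := fun w => 1 * (Complex.exp (D.σ * ℓ w) * D.h w + ℓ w * D.v w) + D.k w with hF
  have hFd : DifferentiableOn ℂ F (Metric.ball z ‖z - s‖) := by
    have hℓd : DifferentiableOn ℂ ℓ (Metric.ball z ‖z - s‖) := fun w hw =>
      (hbr' w hw).1.differentiableAt.differentiableWithinAt
    exact ((((hℓd.const_mul _).cexp.mul (D.diff_h.mono hballr)).add
      (hℓd.mul (D.diff_v.mono hballr))).const_mul 1).add (D.diff_k.mono hballr)
  have hFy : F =ᶠ[𝓝 z] D.y := by
    obtain ⟨ε, hε, hb⟩ := Metric.isOpen_iff.1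
      (Metric.isOpen_ball.inter (isOpen_slitDisc s D.r)) z
      (⟨Metric.mem_ball_self hzs', hzD⟩ : z ∈ Metric.ball z ‖z - s‖ ∩ slitDisc s D.r)
    have heq := IsLogBranch.eqOn Metric.isOpen_ball (convex_ball z ε).isPreconnected
      (hbr'.mono fun w hw => (hb hw).1) ((isLogBranch_log s D.r).mono fun w hw => (hb hw).2)
      (Metric.mem_ball_self hε) (by
        rw [hℓ]
        simp only
        rw [div_self (sub_ne_zero.2 hzs), Complex.log_one, zero_add])
    filter_upwards [Metric.ball_mem_nhds z hε] with w hw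
    rw [D.y_eq w (hb hw).2, hF]
    simp only
    rw [heq hw, one_mul]
  have h1 := hn₁ n hn s z ℓ F hzs (by
    have := D.frame.le_one
    linarith) hbr' (him z) hFd (fun w hw => by
      have := hC (Metric.ball z ‖z - s‖) ℓ F Metric.isOpen_ball hballr hbr' (fun w _ => him w)
        (fun w _ => rfl) w hw (hball w hw)
      simpa only [one_mul] using this)
  rwa [(iteratedDeriv_congr_of_eventuallyEq hFy n).self_of_nhds] at h1

end

/-! ### Entire solutions -/

section

variable {m : ℕ} {q : Fin m → RatFunc ℂ}

theorem exists_bound_at_infty {x : RatFunc ℂ} {d : ℕ} (h : x = 0 ∨ x.intDegree ≤ -(d : ℤ)) :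
    ∃ R B : ℝ, ∀ z : ℂ, R ≤ ‖z‖ → ‖z ^ d * value x z‖ ≤ B := by
  rcases h with rfl | h
  · exact ⟨0, 0, fun z _ => by rw [value_zero, mul_zero, norm_zero]⟩
  · by_cases hx : x = 0
    · exact ⟨0, 0, fun z _ => by rw [hx, value_zero, mul_zero, norm_zero]⟩
    have hnum : x.num ≠ 0 := RatFunc.num_ne_zero hx
    have hdeg : (x.num * Polynomial.X ^ d).degree ≤ x.denom.degree := by
      rw [Polynomial.degree_eq_natDegree (mul_ne_zero hnum (pow_ne_zero _ Polynomial.X_ne_zero)),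
        Polynomial.degree_eq_natDegree x.denom_ne_zero, Polynomial.natDegree_mul_X_pow _ hnum]
      rw [RatFunc.intDegree] at h
      have : x.num.natDegree + d ≤ x.denom.natDegree := by omega
      exact_mod_cast this
    obtain ⟨c, hc0, hc⟩ := (Polynomial.isBigO_cobounded_of_degree_le hdeg).exists_nonneg
    replace hc := hc.bound
    rw [← comap_norm_atTop] at hc
    obtain ⟨R, hR⟩ := eventually_atTop.1 (eventually_comap.1 hc)
    refine ⟨R, c, fun z hz => ?_⟩
    have h1 := hR _ hz z rfl
    rw [Polynomial.eval_mul, Polynomial.eval_pow, Polynomial.eval_X] at h1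
    rw [value_eq, ← mul_div_assoc, norm_div, mul_comm]
    by_cases h0 : x.denom.eval z = 0
    · rwa [h0, norm_zero, div_zero]
    · rwa [div_le_iff₀ (norm_pos_iff.2 h0)]

/-- An entire solution has polynomial growth, and the exponent depends on the equation only. -/
theorem exists_growth_bound (hF : IsFuchsian q) (hm : 0 < m) : ∃ K : ℕ, ∀ F : ℂ → ℂ,
    Differentiable ℂ F → (∀ z, IsSolAt q F z) → ∃ C, ∀ z, ‖F z‖ ≤ C * (1 + ‖z‖) ^ K := by
  have hq : ∀ i : Fin m, ∃ R B : ℝ, ∀ z : ℂ, R ≤ ‖z‖ → ‖z ^ (m - i) * value (q i) z‖ ≤ B :=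
    fun i => exists_bound_at_infty ((hF.2 i).imp_right fun h => by
      have := i.isLt
      omega)
  choose R B hB using hq
  obtain ⟨R₀, hR₀⟩ := (finite_singularPoints q).isBounded.exists_norm_le
  obtain ⟨R₁, hR₁⟩ : ∃ R₁ : ℝ, 1 ≤ R₁ ∧ R₀ < R₁ ∧ ∀ i, R i ≤ R₁ := by
    refine ⟨1 + |R₀| + ∑ i, |R i|, ?_, ?_, fun i => ?_⟩
    · have := abs_nonneg R₀
      have := Finset.sum_nonneg fun i (_ : i ∈ Finset.univ) => abs_nonneg (R i)
      linarith
    · have := le_abs_self R₀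
      have := Finset.sum_nonneg fun i (_ : i ∈ Finset.univ) => abs_nonneg (R i)
      linarith
    · have := abs_nonneg R₀
      have h1 : |R i| ≤ ∑ i, |R i| := Finset.single_le_sum (f := fun i => |R i|)
        (fun a _ => abs_nonneg _) (Finset.mem_univ i)
      have := le_abs_self (R i)
      linarith
  obtain ⟨h1R, hR₀₁, hRi⟩ := hR₁
  have hR₁0 : 0 < R₁ := by linarith
  obtain ⟨K, hK⟩ := exists_nat_ge ((m : ℝ) + 1 + ∑ i, |B i|)
  refine ⟨K, fun F hFd hFs => ?_⟩
  have hFan : ∀ z, AnalyticAt ℂ F z := fun z => (hFs z).1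
  have hcont : ∀ i, Continuous (iteratedDeriv i F) := fun i =>
    continuous_iff_continuousAt.2 fun z => (AnalyticAt.iteratedDeriv' (hFan z) i).continuousAt
  let Y : ℂ → Fin m → ℂ := fun z i => z ^ (i : ℕ) * iteratedDeriv i F z
  have hYcont : Continuous Y := continuous_pi fun i => (continuous_pow _).mul (hcont i)
  obtain ⟨δ, hδ⟩ := (isCompact_closedBall (0 : ℂ) R₁).exists_bound_of_continuousOn
    hYcont.continuousOn
  have hδ0 : 0 ≤ δ := (norm_nonneg _).trans (hδ 0 (Metric.mem_closedBall_self hR₁0.le))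
  have hY0 : ∀ z, ‖F z‖ ≤ ‖Y z‖ := fun z => by
    have := norm_le_pi_norm (Y z) ⟨0, hm⟩
    simpa [Y] using this
  refine ⟨δ, fun z => ?_⟩
  have h1z : 1 ≤ (1 + ‖z‖) ^ K := one_le_pow₀ (by linarith [norm_nonneg z])
  by_cases hz : ‖z‖ ≤ R₁
  · exact (hY0 z).trans ((hδ z (by simpa using hz)).trans (le_mul_of_one_le_right hδ0 h1z))
  · push Not at hz
    have hz0 : 0 < ‖z‖ := hR₁0.trans hz
    -- In the logarithmic coordinate along the ray through `z` the system has bounded coefficients.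
    set z₁ : ℂ := (R₁ / ‖z‖ : ℝ) * z with hz₁
    have hz₁n : ‖z₁‖ = R₁ := by
      rw [hz₁, norm_mul, Complex.norm_real, Real.norm_of_nonneg (by positivity),
        div_mul_cancel₀ _ hz0.ne']
    set L := Real.log (‖z‖ / R₁) with hL
    have hL0 : 0 ≤ L := Real.log_nonneg ((one_le_div hR₁0).2 hz.le)
    have hexpL : Real.exp L = ‖z‖ / R₁ := Real.exp_log (by positivity)
    have hend : Complex.exp (L : ℂ) * z₁ = z := by
      rw [← Complex.ofReal_exp, hexpL, hz₁, ← mul_assoc, ← Complex.ofReal_mul,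
        div_mul_div_cancel₀ hR₁0.ne', div_self hz0.ne', Complex.ofReal_one, one_mul]
    let c : ℝ → ℂ := fun t => Complex.exp (t : ℂ) * z₁
    have hcn : ∀ t, 0 ≤ t → R₁ ≤ ‖c t‖ := fun t ht => by
      simp only [c, norm_mul, Complex.norm_exp, Complex.ofReal_re, hz₁n]
      exact le_mul_of_one_le_left hR₁0.le (Real.one_le_exp ht)
    let Y' : ℝ → Fin m → ℂ := fun t i => i * Y (c t) i
      + c t ^ ((i : ℕ) + 1) * iteratedDeriv (i + 1) F (c t)
    have hder : ∀ t, HasDerivAt (fun t => Y (c t)) (Y' t) t := by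
      intro t
      refine hasDerivAt_pi.2 fun i => ?_
      have e1 : HasDerivAt (fun u : ℂ => Complex.exp u * z₁) (c t) (t : ℂ) :=
        (Complex.hasDerivAt_exp _).mul_const z₁
      have e2 : HasDerivAt (fun z : ℂ => z ^ (i : ℕ) * iteratedDeriv i F z)
          (i * c t ^ ((i : ℕ) - 1) * iteratedDeriv i F (c t)
            + c t ^ (i : ℕ) * iteratedDeriv (i + 1) F (c t)) (Complex.exp (t : ℂ) * z₁) :=
        (hasDerivAt_pow _ _).mul (hasDerivAt_iteratedDeriv (hFan _) i)
      have e3 := (e2.comp (t : ℂ) e1).comp_ofReal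
      refine e3.congr_deriv ?_
      simp only [Y', Y]
      rcases hi : (i : ℕ) with _ | j
      · simp; ring
      · simp only [Nat.add_sub_cancel]; ring
    have hbound : ∀ t ∈ Set.Ico 0 L, ‖Y' t‖ ≤ (K : ℝ) * ‖Y (c t)‖ + 0 := by
      intro t ht
      rw [add_zero]
      refine (pi_norm_le_iff_of_nonneg (by positivity)).2 fun i => ?_
      have hct := hcn t ht.1
      have e1 : ‖(i : ℂ) * Y (c t) i‖ ≤ m * ‖Y (c t)‖ := by
        rw [norm_mul, Complex.norm_natCast]
        exact mul_le_mul (by exact_mod_cast i.isLt.le) (norm_le_pi_norm _ _) (norm_nonneg _)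
          (by positivity)
      have hBn : 0 ≤ ∑ i, |B i| := Finset.sum_nonneg fun i _ => abs_nonneg _
      have e2 : ‖c t ^ ((i : ℕ) + 1) * iteratedDeriv (i + 1) F (c t)‖
          ≤ (1 + ∑ i, |B i|) * ‖Y (c t)‖ := by
        by_cases hi : (i : ℕ) + 1 < m
        · have e3 := norm_le_pi_norm (Y (c t)) ⟨i + 1, hi⟩
          refine e3.trans (le_mul_of_one_le_left (norm_nonneg _) (by linarith))
        · have hi' : (i : ℕ) + 1 = m := by omega
          have hns : c t ∉ singularPoints q := fun hS => by
            have := hR₀ _ hS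
            linarith
          rw [hi', ((hFs (c t)).eventually_ode hns).self_of_nhds, Finset.mul_sum, add_mul,
            Finset.sum_mul]
          refine (norm_sum_le _ _).trans ((Finset.sum_le_sum fun j _ => ?_).trans
            (le_add_of_nonneg_left (by positivity)))
          have e4 : c t ^ m * (value (q j) (c t) * iteratedDeriv j F (c t))
              = (c t ^ (m - j) * value (q j) (c t)) * Y (c t) j := by
            simp only [Y]
            have : c t ^ m = c t ^ (m - j) * c t ^ (j : ℕ) := by
              rw [← pow_add, Nat.sub_add_cancel j.isLt.le]
            rw [this]
            ring
          rw [e4, norm_mul]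
          exact mul_le_mul ((hB j _ ((hRi j).trans hct)).trans (le_abs_self _))
            (norm_le_pi_norm _ _) (norm_nonneg _) (abs_nonneg _)
      refine (norm_add_le _ _).trans ((add_le_add e1 e2).trans ?_)
      rw [← add_mul]
      exact mul_le_mul_of_nonneg_right (by linarith) (norm_nonneg _)
    have hgr := norm_le_gronwallBound_of_norm_deriv_right_le
      (f := fun t => Y (c t)) (f' := Y') (δ := δ) (K := K) (ε := 0) (a := 0) (b := L)
      (fun t _ => (hder t).continuousAt.continuousWithinAt)
      (fun t _ => (hder t).hasDerivWithinAt)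
      (hδ _ (by simp [c, hz₁n])) hbound L ⟨hL0, le_rfl⟩
    rw [gronwallBound_ε0, sub_zero, Real.exp_nat_mul, hexpL] at hgr
    simp only [c, hend] at hgr
    refine (hY0 z).trans (hgr.trans (mul_le_mul_of_nonneg_left ?_ hδ0))
    refine pow_le_pow_left₀ (by positivity) ?_ K
    exact (div_le_self hz0.le h1R).trans (by linarith)

/-- The derivatives of high order of an entire solution vanish. -/
theorem exists_forall_iteratedDeriv_eq_zero (hF : IsFuchsian q) (hm : 0 < m) : ∃ n₀ : ℕ,
    ∀ (z₀ : ℂ) (y : ℂ → ℂ), IsSolAt q y z₀ → (∀ ρ, ExtendsToBall y z₀ ρ) →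
      ∀ᶠ z in 𝓝 z₀, ∀ n ≥ n₀, iteratedDeriv n y z = 0 := by
  obtain ⟨K, hK⟩ := exists_growth_bound hF hm
  refine ⟨K + 1, fun z₀ y hy hext => ?_⟩
  obtain ⟨F, hFd, hFy⟩ := exists_extension_of_forall_lt (Ω := Set.univ) (A := Set.Ioi 0)
    (fun r hr => hr) (fun r _ => hext r) ⟨1, Set.mem_Ioi.2 one_pos⟩
    (fun w _ => ⟨dist w z₀ + 1, by simp only [Set.mem_Ioi]; positivity,
      by rw [Metric.mem_ball]; linarith⟩)
  have hFs : ∀ z, IsSolAt q F z := fun z =>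
    isSolAt_of_differentiableOn_ball (ρ := dist z z₀ + 1) (by positivity) hy
      (hFd.mono (Set.subset_univ _)) hFy (by rw [Metric.mem_ball]; linarith)
  rw [differentiableOn_univ] at hFd
  obtain ⟨C, hC⟩ := hK F hFd hFs
  have hC0 : 0 ≤ C := by
    have := (norm_nonneg _).trans (hC 0)
    simpa using this
  have hzero : ∀ z, ∀ n ≥ K + 1, iteratedDeriv n F z = 0 := by
    intro z n hn
    have hb : ∀ ρ ≥ 1 + ‖z‖, ‖iteratedDeriv n F z‖ ≤ n.factorial * C * 2 ^ K / ρ := by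
      intro ρ hρ
      have hρ1 : 1 ≤ ρ := by linarith [norm_nonneg z]
      have hρ0 : 0 < ρ := by linarith
      have h1 := norm_iteratedDeriv_le_of_ball (f := F) (z := z) (R := ρ) (C := C * (2 * ρ) ^ K)
        hρ0 hFd.differentiableOn (fun w hw => by
          refine (hC w).trans (mul_le_mul_of_nonneg_left
            (pow_le_pow_left₀ (by positivity) ?_ K) hC0)
          have h2 : ‖w‖ ≤ ‖w - z‖ + ‖z‖ := by simpa using norm_add_le (w - z) z
          rw [Metric.mem_ball, dist_eq_norm] at hw
          linarith) n
      refine h1.trans ?_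
      rw [div_le_div_iff₀ (by positivity) hρ0, mul_pow]
      have h3 : ρ ^ K * ρ ≤ ρ ^ n := by
        rw [← pow_succ]
        exact pow_le_pow_right₀ hρ1 hn
      calc n.factorial * (C * (2 ^ K * ρ ^ K)) * ρ
          = n.factorial * C * 2 ^ K * (ρ ^ K * ρ) := by ring
        _ ≤ n.factorial * C * 2 ^ K * ρ ^ n := by gcongr
    have hlim : Tendsto (fun ρ : ℝ => n.factorial * C * 2 ^ K / ρ) atTop (𝓝 0) :=
      tendsto_const_nhds.div_atTop tendsto_id
    have := ge_of_tendsto hlim ((eventually_ge_atTop (1 + ‖z‖)).mono hb)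
    exact norm_le_zero_iff.1 this
  filter_upwards [hFy.eventually_nhds] with z hz n hn
  rw [← (iteratedDeriv_congr_of_eventuallyEq hz n).self_of_nhds]
  exact hzero z n hn

end

/-! ### The singularities of a solution on its circle of convergence -/

section

variable {m : ℕ} {q : Fin m → RatFunc ℂ} {s z₀ : ℂ}

theorem eq_of_dist_eq (hz₀ : z₀ ∉ bisectors q) {p s : ℂ} (hp : p ∈ singularPoints q)
    (hs : s ∈ singularPoints q) (h : dist p z₀ = dist s z₀) : p = s := by
  by_contra hne
  exact hz₀ ⟨p, hp, s, hs, hne, by rw [dist_comm z₀ p, dist_comm z₀ s, h]⟩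

/-- The singular point `s` does not obstruct the continuation of the germ `y` to discs
around `z₀`. -/
def ExtendsBeyond (y : ℂ → ℂ) (z₀ s : ℂ) : Prop := ∃ ρ > dist s z₀, ExtendsToBall y z₀ ρ

/-- The germ `y` at `z₀` extends to the disc around `z₀` with `s` on its boundary, but not to a
larger disc. -/
def HasLevel (y : ℂ → ℂ) (z₀ s : ℂ) : Prop :=
  ExtendsToBall y z₀ (dist s z₀) ∧ ¬ ExtendsBeyond y z₀ s

theorem exists_pos_forall_mul_mem_slitPlane {u : ℂ} (hu : u ≠ 0) {ε : ℝ} (hε : 0 < ε) :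
    ∃ ζ : ℂ, ζ * u ∈ Complex.slitPlane ∧ ‖ζ - 1‖ < 1 ∧ ‖ζ‖ < ε := by
  set δ := min (ε / 4) (1 / 4) with hδ
  have hδ0 : 0 < δ := lt_min (by linarith) (by norm_num)
  have hδε : δ ≤ ε / 4 := min_le_left _ _
  have hδ1 : δ ≤ 1 / 4 := min_le_right _ _
  have hn : ∀ b : ℝ, |b| ≤ 1 → ‖(δ : ℂ) * (1 + b * Complex.I) - 1‖ < 1
      ∧ ‖(δ : ℂ) * (1 + b * Complex.I)‖ < ε := by
    intro b hb
    have hb2 : b ^ 2 ≤ 1 := (sq_le_one_iff_abs_le_one b).2 hb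
    constructor
    · rw [← sq_lt_one_iff₀ (norm_nonneg _), Complex.sq_norm, Complex.normSq_apply]
      simp only [Complex.sub_re, Complex.mul_re, Complex.ofReal_re, Complex.add_re, Complex.one_re,
        Complex.I_re, mul_zero, Complex.ofReal_im, Complex.I_im, mul_one, sub_self, add_zero,
        Complex.add_im, Complex.one_im, Complex.mul_im, zero_add, Complex.sub_im, zero_mul,
        sub_zero]
      nlinarith [mul_le_mul_of_nonneg_left hb2 (sq_nonneg δ),
        mul_pos hδ0 (by linarith : (0 : ℝ) < 1 - δ)]
    · rw [norm_mul, Complex.norm_real, Real.norm_of_nonneg hδ0.le]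
      have h1 : ‖(1 : ℂ) + b * Complex.I‖ ≤ 2 := by
        refine (norm_add_le _ _).trans ?_
        rw [norm_mul, Complex.norm_I, Complex.norm_real, norm_one, Real.norm_eq_abs]
        linarith
      nlinarith
  by_cases h : u ∈ Complex.slitPlane
  · refine ⟨(δ : ℂ) * (1 + (0 : ℝ) * Complex.I), ?_, (hn 0 (by simp)).1, (hn 0 (by simp)).2⟩
    rw [Complex.mem_slitPlane_iff] at h ⊢
    simp only [Complex.ofReal_zero, zero_mul, add_zero, mul_one, Complex.re_ofReal_mul,
      Complex.im_ofReal_mul]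
    exact h.imp (mul_pos hδ0) (mul_ne_zero hδ0.ne')
  · refine ⟨(δ : ℂ) * (1 + (1 : ℝ) * Complex.I), ?_, (hn 1 (by simp)).1, (hn 1 (by simp)).2⟩
    rw [Complex.mem_slitPlane_iff, not_or, not_lt, not_not] at h
    rw [Complex.mem_slitPlane_iff]
    refine Or.inr ?_
    have hre : u.re ≠ 0 := fun h0 => hu (Complex.ext h0 h.2)
    rw [mul_assoc, Complex.im_ofReal_mul]
    refine mul_ne_zero hδ0.ne' ?_
    simp [h.2, hre]

/-- Near `s`, all solutions on the disc around `z₀` with `s` on its boundary are multiples of the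
singular part of the frame, up to holomorphic functions. The branch of the logarithm does not
depend on the solution. -/
theorem SingularData.exists_form (D : SingularData q s) (hz₀s : z₀ ≠ s) :
    ∃ c₀ : ℂ, Complex.exp c₀ = z₀ - s ∧ ∀ y F : ℂ → ℂ, IsSolAt q y z₀ →
      DifferentiableOn ℂ F (Metric.ball z₀ (dist s z₀)) → F =ᶠ[𝓝 z₀] y →
      ∃ (γ : ℂ) (f : ℂ → ℂ), DifferentiableOn ℂ f (Metric.ball s D.r) ∧
        ∀ w ∈ Metric.ball z₀ (dist s z₀) ∩ Metric.ball s D.r,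
          F w = γ * (Complex.exp (D.σ * (Complex.log ((w - s) / (z₀ - s)) + c₀)) * D.h w
            + (Complex.log ((w - s) / (z₀ - s)) + c₀) * D.v w) + f w := by
  have hm : 0 < m := Nat.zero_lt_of_lt D.a₀.isLt
  have hu : z₀ - s ≠ 0 := sub_ne_zero.2 hz₀s
  have hun : 0 < ‖z₀ - s‖ := norm_pos_iff.2 hu
  have hdist : dist s z₀ = ‖z₀ - s‖ := by rw [dist_comm, dist_eq_norm]
  obtain ⟨ζ, hζ, hζ1, hζr⟩ := exists_pos_forall_mul_mem_slitPlane hu (div_pos D.pos hun)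
  set w₁ : ℂ := s + ζ * (z₀ - s) with hw₁
  have hw₁s : w₁ - s = ζ * (z₀ - s) := by rw [hw₁]; ring
  have hw₁slit : w₁ ∈ slitDisc s D.r := by
    refine ⟨?_, by rw [hw₁s]; exact hζ⟩
    rw [Metric.mem_ball, dist_eq_norm, hw₁s, norm_mul]
    rwa [lt_div_iff₀ hun] at hζr
  have hw₁ball : w₁ ∈ Metric.ball z₀ (dist s z₀) := by
    rw [Metric.mem_ball, dist_eq_norm, hdist]
    have : w₁ - z₀ = (ζ - 1) * (z₀ - s) := by rw [hw₁]; ring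
    rw [this, norm_mul]
    exact mul_lt_of_lt_one_left hun hζ1
  have hw₁ne : w₁ - s ≠ 0 := Complex.slitPlane_ne_zero hw₁slit.2
  set c₀ := Complex.log (w₁ - s) - Complex.log ((w₁ - s) / (z₀ - s)) with hc₀
  have hexp : Complex.exp c₀ = z₀ - s := by
    rw [hc₀, Complex.exp_sub, Complex.exp_log hw₁ne, Complex.exp_log (div_ne_zero hw₁ne hu),
      div_div_cancel₀ hw₁ne]
  have hbr : IsLogBranch (fun w => Complex.log ((w - s) / (z₀ - s)) + c₀) s
      (Metric.ball z₀ (dist s z₀)) := (isLogBranch_log_div hz₀s hexp).mono fun w hw =>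
    div_mem_slitPlane hz₀s (by rw [dist_self]; exact dist_pos.2 hz₀s.symm) (by rwa [← hdist])
  refine ⟨c₀, hexp, fun y F hy hF hFy => ?_⟩
  set ℓ : ℂ → ℂ := fun w => Complex.log ((w - s) / (z₀ - s)) + c₀ with hℓ
  have hd0 : 0 < dist s z₀ := dist_pos.2 hz₀s.symm
  have hw₁S : w₁ ∉ singularPoints q := D.frame.notMem hw₁slit.1 (ne_of_mem_slitDisc hw₁slit)
  obtain ⟨c, hc⟩ := exists_eventuallyEq_sum_of_isUnit hm hw₁S
    (Y := Function.update D.g D.a₀ D.y) (fun a => by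
      by_cases ha : a = D.a₀
      · rw [ha, Function.update_self]
        exact D.frame.sol_y w₁ hw₁slit
      · rw [Function.update_of_ne ha]
        exact D.frame.sol_g a ha w₁ hw₁slit.1)
    (D.frame.indep w₁ hw₁slit) (isSolAt_of_differentiableOn_ball hd0 hy hF hFy hw₁ball)
  let f : ℂ → ℂ := fun w => c D.a₀ * D.k w + ∑ a ∈ Finset.univ.erase D.a₀, c a * D.g a w
  have hf : DifferentiableOn ℂ f (Metric.ball s D.r) :=
    (D.diff_k.const_mul _).add (DifferentiableOn.fun_sum fun a ha =>
      DifferentiableOn.const_mul (fun w hw => (D.frame.analyticAt_g (Finset.ne_of_mem_erase ha)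
        hw).differentiableAt.differentiableWithinAt) _)
  have hopen : IsOpen (Metric.ball z₀ (dist s z₀) ∩ Metric.ball s D.r) :=
    Metric.isOpen_ball.inter Metric.isOpen_ball
  have hℓd : DifferentiableOn ℂ ℓ (Metric.ball z₀ (dist s z₀)) := fun w hw =>
    (hbr w hw).1.differentiableAt.differentiableWithinAt
  refine ⟨c D.a₀, f, hf, ?_⟩
  refine eqOn_of_eventuallyEq hopen
    ((convex_ball _ _).inter (convex_ball _ _)).isPreconnected
    (hF.mono Set.inter_subset_left) ?_ ⟨hw₁ball, hw₁slit.1⟩ ?_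
  · have hℓd' := hℓd.mono (Set.inter_subset_left (t := Metric.ball s D.r))
    have hhd := D.diff_h.mono (Set.inter_subset_right (s := Metric.ball z₀ (dist s z₀)))
    have hvd := D.diff_v.mono (Set.inter_subset_right (s := Metric.ball z₀ (dist s z₀)))
    have hfd := hf.mono (Set.inter_subset_right (s := Metric.ball z₀ (dist s z₀)))
    exact ((((hℓd'.const_mul _).cexp.mul hhd).add (hℓd'.mul hvd)).const_mul _).add hfd
  · obtain ⟨ε, hε, hb⟩ := Metric.isOpen_iff.1
      (Metric.isOpen_ball.inter (isOpen_slitDisc s D.r)) w₁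
      (⟨hw₁ball, hw₁slit⟩ : w₁ ∈ Metric.ball z₀ (dist s z₀) ∩ slitDisc s D.r)
    have heq := IsLogBranch.eqOn Metric.isOpen_ball (convex_ball w₁ ε).isPreconnected
      (hbr.mono fun w hw => (hb hw).1) ((isLogBranch_log s D.r).mono fun w hw => (hb hw).2)
      (Metric.mem_ball_self hε) (by
        change Complex.log ((w₁ - s) / (z₀ - s)) + c₀ = _
        rw [hc₀]
        ring)
    filter_upwards [hc, Metric.ball_mem_nhds w₁ hε] with w hw hwε
    have h1 := heq hwε
    change Complex.log ((w - s) / (z₀ - s)) + c₀ = _ at h1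
    rw [hw, h1, ← Finset.add_sum_erase _ _ (Finset.mem_univ D.a₀), Function.update_self,
      D.y_eq w (hb hwε).2]
    have h2 : ∑ a ∈ Finset.univ.erase D.a₀, c a * Function.update D.g D.a₀ D.y a w
        = ∑ a ∈ Finset.univ.erase D.a₀, c a * D.g a w :=
      Finset.sum_congr rfl fun a ha => by rw [Function.update_of_ne (Finset.ne_of_mem_erase ha)]
    rw [h2]
    simp only [f]
    ring

/-- A solution on the disc around `z₀` with `s` on its boundary that is holomorphic near `s` extends
beyond `s`, since `s` is the only singular point on the circle. -/
theorem extendsBeyond_of_form (hm : 0 < m) (hz₀ : z₀ ∉ bisectors q) (hs : s ∈ singularPoints q)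
    (hz₀s : z₀ ≠ s) {y F f : ℂ → ℂ} {r : ℝ} (hr : 0 < r) (hy : IsSolAt q y z₀)
    (hF : DifferentiableOn ℂ F (Metric.ball z₀ (dist s z₀))) (hFy : F =ᶠ[𝓝 z₀] y)
    (hf : DifferentiableOn ℂ f (Metric.ball s r))
    (h : ∀ w ∈ Metric.ball z₀ (dist s z₀) ∩ Metric.ball s r, F w = f w) :
    ExtendsBeyond y z₀ s :=
  ExtendsToBall.beyond hm hz₀s.symm hy hF hFy (fun _ hp => eq_of_dist_eq hz₀ hp hs) hr hf
    fun w hw => (h w ⟨hw.2, hw.1⟩).symm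

/-- Modulo solutions that extend further, there is at most one solution with a given level. -/
theorem HasLevel.exists_sub_extendsBeyond (hz₀ : z₀ ∉ bisectors q)
    (hs : s ∈ singularPoints q) (hz₀s : z₀ ≠ s) (D : SingularData q s) {y e : ℂ → ℂ}
    (hy : IsSolAt q y z₀) (he : IsSolAt q e z₀) (hys : ExtendsToBall y z₀ (dist s z₀))
    (hes : HasLevel e z₀ s) :
    ∃ c : ℂ, ExtendsBeyond (fun w => y w - c * e w) z₀ s := by
  have hm : 0 < m := Nat.zero_lt_of_lt D.a₀.isLt
  obtain ⟨c₀, -, hform⟩ := D.exists_form hz₀s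
  obtain ⟨F, hF, hFy⟩ := hys
  obtain ⟨E, hE, hEe⟩ := hes.1
  obtain ⟨γ, f, hf, hFf⟩ := hform y F hy hF hFy
  obtain ⟨γ', f', hf', hEf⟩ := hform e E he hE hEe
  have hγ' : γ' ≠ 0 := by
    rintro rfl
    exact hes.2 (extendsBeyond_of_form hm hz₀ hs hz₀s D.pos he hE hEe hf' fun w hw => by
      rw [hEf w hw]; ring)
  refine ⟨γ / γ', extendsBeyond_of_form hm hz₀ hs hz₀s D.pos (hy.sub_smul he _)
    (hF.sub (hE.const_mul (γ / γ'))) ?_ (hf.sub (hf'.const_mul (γ / γ'))) fun w hw => ?_⟩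
  · filter_upwards [hFy, hEe] with w h1 h2
    simp only [Pi.sub_apply, h1, h2]
  · simp only [Pi.sub_apply, hFf w hw, hEf w hw]
    field_simp
    ring

/-- The distances of the other points of a finite set to `z₀` stay away from the distance of `s`. -/
theorem exists_gap {S : Set ℂ} (hS : S.Finite) (z₀ s : ℂ)
    (h : ∀ p ∈ S, dist p z₀ = dist s z₀ → p = s) : ∃ η > 0, ∀ p ∈ S, p ≠ s →
      dist p z₀ ≤ dist s z₀ - η ∨ dist s z₀ + η ≤ dist p z₀ := by
  have hfin : (S \ {s}).Finite := hS.subset Set.sdiff_subset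
  rcases (S \ {s}).eq_empty_or_nonempty with he | hne
  · refine ⟨1, one_pos, fun p hp hps => ?_⟩
    have : p ∈ S \ {s} := ⟨hp, hps⟩
    rw [he] at this
    exact this.elim
  · obtain ⟨p₀, hp₀, hmin⟩ := Set.exists_min_image _ (fun p => |dist p z₀ - dist s z₀|) hfin hne
    refine ⟨|dist p₀ z₀ - dist s z₀|, abs_pos.2 fun h0 => hp₀.2 (h p₀ hp₀.1 (sub_eq_zero.1 h0)),
      fun p hp hps => ?_⟩
    have h1 := hmin p ⟨hp, hps⟩
    rcases le_abs'.1 h1 with h2 | h2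
    · left; linarith
    · right; linarith

theorem dist_add_smul_lt {z w s : ℂ} {ε : ℝ} (hε : 0 < ε) (hws : w ≠ s)
    (h : dist w z ≤ dist s z) : dist w (z + ε * (w - s)) < ‖z + ε * (w - s) - s‖ := by
  rw [dist_eq_norm] at h ⊢
  rw [dist_comm, dist_eq_norm] at h
  have h1 : w - (z + ε * (w - s)) = (w - s) - ((z - s) + ε * (w - s)) := by ring
  have h2 : z + ε * (w - s) - s = (z - s) + ε * (w - s) := by ring
  have h3 : w - z = (w - s) - (z - s) := by ring
  rw [h1, h2]
  rw [h3] at h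
  have hb : 0 < Complex.normSq (w - s) := Complex.normSq_pos.2 (sub_ne_zero.2 hws)
  generalize w - s = b at *
  generalize z - s = a at *
  have h4 := pow_le_pow_left₀ (norm_nonneg _) h 2
  rw [Complex.sq_norm, Complex.sq_norm, Complex.normSq_apply, Complex.normSq_apply] at h4
  rw [Complex.normSq_apply] at hb
  refine lt_of_pow_lt_pow_left₀ 2 (norm_nonneg _) ?_
  rw [Complex.sq_norm, Complex.sq_norm, Complex.normSq_apply, Complex.normSq_apply]
  simp only [Complex.sub_re, Complex.sub_im, Complex.add_re, Complex.add_im, Complex.re_ofReal_mul,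
    Complex.im_ofReal_mul] at h4 ⊢
  nlinarith [mul_pos hε hb]

/-- The Taylor coefficients of a solution with level `s` are not small, uniformly at points
near `z₀`. -/
theorem HasLevel.exists_lower_bound (hz₀ : z₀ ∉ bisectors q)
    (hs : s ∈ singularPoints q) (hz₀s : z₀ ≠ s) (D : SingularData q s) {y : ℂ → ℂ}
    (hy : IsSolAt q y z₀) (hys : HasLevel y z₀ s) : ∃ N n₁ : ℕ, ∀ᶠ z in 𝓝 z₀, ∀ n ≥ n₁,
      ‖z - s‖ ^ N / (n : ℝ) ^ N ≤ ‖z - s‖ ^ n * ‖iteratedDeriv n y z‖ / n.factorial := by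
  have hm : 0 < m := Nat.zero_lt_of_lt D.a₀.isLt
  obtain ⟨c₀, hexp, hform⟩ := D.exists_form hz₀s
  obtain ⟨F, hF, hFy⟩ := hys.1
  obtain ⟨γ, f, hf, hFf⟩ := hform y F hy hF hFy
  have hγ : γ ≠ 0 := by
    rintro rfl
    exact hys.2 (extendsBeyond_of_form hm hz₀ hs hz₀s D.pos hy hF hFy hf fun w hw => by
      rw [hFf w hw]; ring)
  set R₀ := dist s z₀ with hR₀
  have hR₀0 : 0 < R₀ := dist_pos.2 hz₀s.symm
  obtain ⟨η, hη, hgap⟩ := exists_gap (finite_singularPoints q) z₀ s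
    fun p hp => eq_of_dist_eq hz₀ hp hs
  rw [← hR₀] at hgap
  set ρ₀ := min η R₀ / 4 with hρ₀
  have hρ₀0 : 0 < ρ₀ := by positivity
  have hρη : ρ₀ ≤ η / 4 := by
    have := min_le_left η R₀
    rw [hρ₀]; linarith
  have hρR : ρ₀ ≤ R₀ / 4 := by
    have := min_le_right η R₀
    rw [hρ₀]; linarith
  -- Continuation to the discs with `s` on their boundary whose centres are near `z₀`.
  have hext : ∀ z : Metric.ball z₀ ρ₀, ∃ Fz : ℂ → ℂ,
      DifferentiableOn ℂ Fz (Metric.ball z ‖(z : ℂ) - s‖) ∧ Fz =ᶠ[𝓝 (z : ℂ)] F := by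
    rintro ⟨z, hz⟩
    rw [Metric.mem_ball] at hz
    have hsub : Metric.ball z (R₀ - ρ₀) ⊆ Metric.ball z₀ R₀ := fun w hw => by
      rw [Metric.mem_ball] at hw ⊢
      linarith [dist_triangle w z z₀]
    have hFz : IsSolAt q F z := isSolAt_of_differentiableOn_ball hR₀0 hy hF hFy
      (by rw [Metric.mem_ball]; linarith)
    have := ExtendsToBall.of_forall_singular hm (ρ₁ := dist s z) (by linarith) hFz
      ⟨F, hF.mono hsub, EventuallyEq.rfl⟩ (fun p hp => by
        by_cases hps : p = s
        · right; rw [hps]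
        · have h1 := dist_triangle p z z₀
          have h2 := dist_triangle p z₀ z
          have h3 := dist_triangle s z₀ z
          rw [dist_comm z₀ z] at h2 h3
          rcases hgap p hp hps with h4 | h4
          · left; linarith
          · right; linarith)
    obtain ⟨Fz, h1, h2⟩ := this
    rw [dist_comm, dist_eq_norm] at h1
    exact ⟨Fz, h1, h2⟩
  choose Fz hFzd hFzF using hext
  let O : Metric.ball z₀ ρ₀ → Set ℂ := fun z => Metric.ball z ‖(z : ℂ) - s‖
  have hOo : ∀ z, IsOpen (O z) := fun z => Metric.isOpen_ball
  have hnz : ∀ z : Metric.ball z₀ ρ₀, R₀ - ρ₀ < ‖(z : ℂ) - s‖ := by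
    rintro ⟨z, hz⟩
    rw [Metric.mem_ball] at hz
    have h1 := dist_triangle s z z₀
    rw [dist_comm s z, dist_eq_norm z s] at h1
    simp only
    linarith
  have hz₀O : ∀ z : Metric.ball z₀ ρ₀, z₀ ∈ O z := fun z => by
    have h1 := hnz z
    have h2 : dist (z : ℂ) z₀ < ρ₀ := z.2
    change dist z₀ z < _
    rw [dist_comm]
    linarith
  have hzO : ∀ z : Metric.ball z₀ ρ₀, (z : ℂ) ∈ O z := fun z =>
    Metric.mem_ball_self (by linarith [hnz z])
  have hFzeq : ∀ z : Metric.ball z₀ ρ₀, ∀ w ∈ O z ∩ Metric.ball z₀ R₀, Fz z w = F w := fun z =>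
    eqOn_of_eventuallyEq ((hOo z).inter Metric.isOpen_ball)
      ((convex_ball _ _).inter (convex_ball _ _)).isPreconnected
      ((hFzd z).mono Set.inter_subset_left) (hF.mono Set.inter_subset_right)
      ⟨hzO z, by
        have h2 : dist (z : ℂ) z₀ < ρ₀ := z.2
        rw [Metric.mem_ball]
        linarith⟩ (hFzF z)
  have hz₀R : z₀ ∈ Metric.ball z₀ R₀ := Metric.mem_ball_self hR₀0
  have hover : ∀ (z z' : Metric.ball z₀ ρ₀) (w : ℂ), w ∈ O z → w ∈ O z' → Fz z w = Fz z' w := by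
    intro z z' w hw hw'
    refine eqOn_of_eventuallyEq ((hOo z).inter (hOo z'))
      ((convex_ball _ _).inter (convex_ball _ _)).isPreconnected
      ((hFzd z).mono Set.inter_subset_left) ((hFzd z').mono Set.inter_subset_right)
      ⟨hz₀O z, hz₀O z'⟩ ?_ ⟨hw, hw'⟩
    filter_upwards [(hOo z).mem_nhds (hz₀O z), (hOo z').mem_nhds (hz₀O z'),
      Metric.isOpen_ball.mem_nhds hz₀R] with v h1 h2 h3
    rw [hFzeq z v ⟨h1, h3⟩, hFzeq z' v ⟨h2, h3⟩]
  obtain ⟨G, hG⟩ := exists_patch hover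
  have hGd := differentiableOn_patch hOo hFzd hG
  set Ω := ⋃ z, O z with hΩ
  have hΩo : IsOpen Ω := isOpen_iUnion hOo
  set ℓ : ℂ → ℂ := fun w => Complex.log ((w - s) / (z₀ - s)) + c₀ with hℓ
  have hbr : IsLogBranch ℓ s Ω := (isLogBranch_log_div hz₀s hexp).mono fun w hw => by
    obtain ⟨z, hz⟩ := Set.mem_iUnion.1 hw
    refine div_mem_slitPlane hz₀s ?_ hz
    have h2 : dist (z : ℂ) z₀ < ρ₀ := z.2
    linarith
  have him : ∀ w, |(ℓ w).im| ≤ Real.pi + |c₀.im| := fun w => abs_im_log_div_add_le _ _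
  have hℓd : DifferentiableOn ℂ ℓ Ω := fun w hw =>
    (hbr w hw).1.differentiableAt.differentiableWithinAt
  have hGform : ∀ w ∈ Ω ∩ Metric.ball s D.r,
      G w = γ * (Complex.exp (D.σ * ℓ w) * D.h w + ℓ w * D.v w) + f w := by
    rintro w ⟨hw, hwr⟩
    obtain ⟨z, hz⟩ := Set.mem_iUnion.1 hw
    rw [hG z hz]
    have hOΩ : O z ∩ Metric.ball s D.r ⊆ Ω :=
      Set.inter_subset_left.trans (Set.subset_iUnion O z)
    -- The segment from `s` to `z₀` lies in both discs.
    obtain ⟨ε, hε, hε1, hεr⟩ : ∃ ε : ℝ, 0 < ε ∧ ε < 1 ∧ ε * R₀ < D.r := by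
      refine ⟨min (1 / 2) (D.r / (2 * R₀)), by have := D.pos; positivity,
        (min_le_left _ _).trans_lt (by norm_num), ?_⟩
      have h1 : min (1 / 2) (D.r / (2 * R₀)) * R₀ ≤ D.r / (2 * R₀) * R₀ :=
        mul_le_mul_of_nonneg_right (min_le_right _ _) hR₀0.le
      have h2 : D.r / (2 * R₀) * R₀ = D.r / 2 := by field_simp
      linarith [D.pos]
    have hb : ‖z₀ - s‖ = R₀ := by rw [hR₀, dist_comm, dist_eq_norm]
    set p : ℂ := s + ε * (z₀ - s) with hp
    have hpr : p ∈ Metric.ball s D.r := by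
      rw [Metric.mem_ball, dist_eq_norm, hp, add_sub_cancel_left, norm_mul, Complex.norm_real,
        Real.norm_of_nonneg hε.le, hb]
      exact hεr
    have hpball : ∀ x : ℂ, dist z₀ x < ‖x - s‖ → p ∈ Metric.ball x ‖x - s‖ := by
      intro x hx
      rw [dist_eq_norm] at hx
      rw [Metric.mem_ball, dist_eq_norm]
      have h1 : p - x = (1 - ε : ℝ) * (s - x) + (ε : ℝ) * (z₀ - x) := by
        rw [hp]; push_cast; ring
      rw [h1]
      refine (norm_add_le _ _).trans_lt ?_
      rw [norm_mul, norm_mul, Complex.norm_real, Complex.norm_real, Real.norm_of_nonneg hε.le,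
        Real.norm_of_nonneg (by linarith), norm_sub_rev s x]
      nlinarith
    have hpO : p ∈ O z := hpball z (hz₀O z)
    have hpz₀ : p ∈ Metric.ball z₀ R₀ := by
      have := hpball z₀ (by rw [dist_self, hb]; exact hR₀0)
      rwa [hb] at this
    refine eqOn_of_eventuallyEq
      (g := fun w => γ * (Complex.exp (D.σ * ℓ w) * D.h w + ℓ w * D.v w) + f w)
      ((hOo z).inter Metric.isOpen_ball)
      ((convex_ball _ _).inter (convex_ball _ _)).isPreconnected
      ((hFzd z).mono Set.inter_subset_left) ?_ ⟨hpO, hpr⟩ ?_ ⟨hz, hwr⟩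
    · have hℓd' := hℓd.mono hOΩ
      have hhd := D.diff_h.mono (Set.inter_subset_right (s := O z))
      have hvd := D.diff_v.mono (Set.inter_subset_right (s := O z))
      have hfd := hf.mono (Set.inter_subset_right (s := O z))
      exact ((((hℓd'.const_mul _).cexp.mul hhd).add (hℓd'.mul hvd)).const_mul _).add hfd
    · filter_upwards [(hOo z).mem_nhds hpO, Metric.isOpen_ball.mem_nhds hpz₀,
        Metric.isOpen_ball.mem_nhds hpr] with v h1 h2 h3
      rw [hFzeq z v ⟨h1, h2⟩, hFf v ⟨h2, h3⟩]
  -- The remainder is bounded near `s` by its form, and elsewhere by compactness.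
  obtain ⟨C₁, hC₁⟩ := D.exists_remainder_bound hf γ (Real.pi + |c₀.im|)
  set ψ : ℂ → ℂ := fun w => G w
    - ∑ j ∈ Finset.range (D.K + 1), γ * D.e j * modelSing (D.τ + j) (ℓ w) with hψ
  have hψd : DifferentiableOn ℂ ψ Ω := hGd.sub (DifferentiableOn.fun_sum fun j _ =>
    (differentiableOn_modelSing hbr _).const_mul _)
  set ρ₁ := ρ₀ / 2 with hρ₁
  have hρ₁0 : 0 < ρ₁ := half_pos hρ₀0
  let Q : Set (ℂ × ℂ) := (Metric.closedBall z₀ ρ₁ ×ˢ Metric.closedBall s (2 * (R₀ + ρ₀))) ∩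
    {x | dist x.2 x.1 ≤ dist s x.1 ∧ D.r / 2 ≤ dist x.2 s}
  have hQ : IsCompact Q := by
    refine ((isCompact_closedBall _ _).prod (isCompact_closedBall _ _)).inter_right ?_
    exact (isClosed_le (continuous_snd.dist continuous_fst)
      (continuous_const.dist continuous_fst)).inter
      (isClosed_le continuous_const (continuous_snd.dist continuous_const))
  have hQΩ : Prod.snd '' Q ⊆ Ω := by
    rintro _ ⟨⟨z, w⟩, ⟨⟨hz, -⟩, hwz, hws⟩, rfl⟩
    simp only at hz hwz hws ⊢
    rw [Metric.mem_closedBall] at hz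
    have hr := D.pos
    have hpos : 0 < dist w s := by linarith
    set ε := ρ₀ / (4 * dist w s) with hε
    have hε0 : 0 < ε := by positivity
    have hεd : ε * dist w s = ρ₀ / 4 := by rw [hε]; field_simp
    have hz' : z + ε * (w - s) ∈ Metric.ball z₀ ρ₀ := by
      rw [Metric.mem_ball, dist_eq_norm]
      have h1 : z + ε * (w - s) - z₀ = (z - z₀) + ε * (w - s) := by ring
      rw [h1]
      refine (norm_add_le _ _).trans_lt ?_
      rw [norm_mul, Complex.norm_real, Real.norm_of_nonneg hε0.le, ← dist_eq_norm, ← dist_eq_norm,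
        hεd]
      linarith
    refine Set.mem_iUnion.2 ⟨⟨_, hz'⟩, ?_⟩
    exact dist_add_smul_lt hε0 (dist_pos.1 hpos) hwz
  obtain ⟨C₂, hC₂⟩ := (hQ.image continuous_snd).exists_bound_of_continuousOn
    ((differentiableOn_iteratedDeriv hΩo hψd D.N).continuousOn.mono hQΩ)
  obtain ⟨n₁, hn₁⟩ := exists_taylor_lower_bound D.τ D.le_N D.K (fun j => γ * D.e j)
    (mul_ne_zero hγ D.e_ne) (R₀ + ρ₀) (max C₁ C₂) (Real.pi + |c₀.im|)
  refine ⟨D.N, n₁, ?_⟩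
  filter_upwards [Metric.ball_mem_nhds z₀ hρ₁0, hFy.eventually_nhds] with z hz hFyz n hn
  have hz0 : z ∈ Metric.ball z₀ ρ₀ := Metric.ball_subset_ball (by linarith) hz
  have hzn := hnz ⟨z, hz0⟩
  simp only at hzn
  have hzs : z ≠ s := fun h0 => by
    rw [h0, sub_self, norm_zero] at hzn
    linarith
  have hOΩ : Metric.ball z ‖z - s‖ ⊆ Ω := Set.subset_iUnion O ⟨z, hz0⟩
  have hzR : dist z s ≤ R₀ + ρ₀ := by
    rw [Metric.mem_ball] at hz0
    have := dist_triangle z z₀ s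
    rw [dist_comm z₀ s] at this
    linarith
  have h1 := hn₁ n hn s z ℓ G hzs (by rwa [← dist_eq_norm]) (hbr.mono hOΩ) (him z)
    (hGd.mono hOΩ) (fun w hw => by
      rcases le_total (dist w s) (D.r / 2) with hws | hws
      · refine (hC₁ (Ω ∩ Metric.ball s D.r) ℓ G (hΩo.inter Metric.isOpen_ball)
          Set.inter_subset_right (hbr.mono Set.inter_subset_left) (fun w _ => him w) hGform w
          ⟨hOΩ hw, ?_⟩ hws).trans (le_max_left _ _)
        rw [Metric.mem_ball]
        linarith [D.pos]
      · refine (hC₂ w ⟨(z, w), ⟨⟨?_, ?_⟩, ?_, hws⟩, rfl⟩).trans (le_max_right _ _)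
        · exact Metric.ball_subset_closedBall hz
        · rw [Metric.mem_ball, ← dist_eq_norm] at hw
          rw [Metric.mem_closedBall]
          linarith [dist_triangle w z s]
        · rw [Metric.mem_ball, ← dist_eq_norm] at hw
          simp only
          rw [dist_comm s z]
          exact hw.le)
  have hGF : G =ᶠ[𝓝 z] y := by
    have h2 : G =ᶠ[𝓝 z] Fz ⟨z, hz0⟩ := by
      filter_upwards [(hOo ⟨z, hz0⟩).mem_nhds (hzO ⟨z, hz0⟩)] with w hw using hG _ hw
    exact (h2.trans (hFzF ⟨z, hz0⟩)).trans hFyz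
  rwa [(iteratedDeriv_congr_of_eventuallyEq hGF n).self_of_nhds] at h1

/-- Cauchy's estimate, uniformly at points near `z₀`. -/
theorem ExtendsToBall.exists_upper_bound {y : ℂ → ℂ} {ρ ρ' : ℝ} (hρ : 0 < ρ) (hρ' : ρ < ρ')
    (h : ExtendsToBall y z₀ ρ') : ∃ C, ∀ᶠ z in 𝓝 z₀, ∀ n : ℕ,
      ‖iteratedDeriv n y z‖ / n.factorial ≤ C / ρ ^ n := by
  obtain ⟨F, hF, hFy⟩ := h
  obtain ⟨C, hC⟩ := exists_forall_norm_le_of_differentiableOn (ρ := (ρ + ρ') / 2) (by linarith) hF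
  refine ⟨C, ?_⟩
  filter_upwards [Metric.ball_mem_nhds z₀ (ε := (ρ' - ρ) / 2) (by linarith), hFy.eventually_nhds]
    with z hz hFyz n
  rw [Metric.mem_ball] at hz
  have hsub : Metric.ball z ρ ⊆ Metric.closedBall z₀ ((ρ + ρ') / 2) := fun w hw => by
    rw [Metric.mem_ball] at hw
    rw [Metric.mem_closedBall]
    linarith [dist_triangle w z z₀]
  have h1 := norm_iteratedDeriv_le_of_ball hρ
    (hF.mono (hsub.trans (Metric.closedBall_subset_ball (by linarith))))
    (fun w hw => hC w (hsub hw)) n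
  rw [← (iteratedDeriv_congr_of_eventuallyEq hFyz n).self_of_nhds]
  rw [div_le_iff₀ (by positivity)]
  calc ‖iteratedDeriv n F z‖ ≤ _ := h1
    _ = _ := by ring

end

/-! ### Decomposition of solutions by their singularities -/

section

variable {m : ℕ} {q : Fin m → RatFunc ℂ} {z₀ : ℂ}

theorem ExtendsToBall.congr {y y' : ℂ → ℂ} {ρ : ℝ} (h : ExtendsToBall y z₀ ρ)
    (hyy : y =ᶠ[𝓝 z₀] y') : ExtendsToBall y' z₀ ρ := by
  obtain ⟨F, hF, hFy⟩ := h
  exact ⟨F, hF, hFy.trans hyy⟩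

theorem ExtendsToBall.sum_mul {ι : Type*} (T : Finset ι) {c : ι → ℂ} {f : ι → ℂ → ℂ} {ρ : ℝ}
    (h : ∀ i ∈ T, ExtendsToBall (f i) z₀ ρ) :
    ExtendsToBall (fun w => ∑ i ∈ T, c i * f i w) z₀ ρ := by
  classical
  induction T using Finset.induction_on with
  | empty => exact ⟨0, differentiableOn_const 0, by simp; rfl⟩
  | insert i T hi ih =>
    obtain ⟨F, hF, hFy⟩ := ih fun j hj => h j (Finset.mem_insert_of_mem hj)
    obtain ⟨G, hG, hGy⟩ := h i (Finset.mem_insert_self i T)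
    refine ⟨fun w => c i * G w + F w, (hG.const_mul _).add hF, ?_⟩
    filter_upwards [hFy, hGy] with w h1 h2
    rw [Finset.sum_insert hi, h1, h2]

theorem ExtendsToBall.add {f g : ℂ → ℂ} {ρ : ℝ} (hf : ExtendsToBall f z₀ ρ)
    (hg : ExtendsToBall g z₀ ρ) : ExtendsToBall (fun w => f w + g w) z₀ ρ := by
  obtain ⟨F, hF, hFy⟩ := hf
  obtain ⟨G, hG, hGy⟩ := hg
  refine ⟨fun w => F w + G w, hF.add hG, ?_⟩
  filter_upwards [hFy, hGy] with w h1 h2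
  rw [h1, h2]

theorem ExtendsBeyond.mono {y : ℂ → ℂ} {s p : ℂ} (h : ExtendsBeyond y z₀ s)
    (hle : dist p z₀ ≤ dist s z₀) : ExtendsBeyond y z₀ p := by
  obtain ⟨ρ, hρ, hy⟩ := h
  exact ⟨ρ, hle.trans_lt hρ, hy⟩

/-- A solution extends to every disc whose singular points do not obstruct its continuation. -/
theorem extendsToBall_of_forall_extendsBeyond (hm : 0 < m) {y : ℂ → ℂ} (hy : IsSolAt q y z₀)
    (ρ : ℝ) (h : ∀ s ∈ singularPoints q, s ≠ z₀ → dist s z₀ < ρ → ExtendsBeyond y z₀ s) :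
    ExtendsToBall y z₀ ρ := by
  set A := {s | s ∈ singularPoints q ∧ s ≠ z₀ ∧ dist s z₀ < ρ} with hA
  have hfin : A.Finite := (finite_singularPoints q).subset fun s hs => hs.1
  rcases A.eq_empty_or_nonempty with he | hne
  · obtain ⟨ρ₀, hρ₀, hd⟩ := exists_ball_of_analyticAt hy.1
    refine ExtendsToBall.of_forall_singular hm hρ₀ hy ⟨y, hd, EventuallyEq.rfl⟩ fun s hs => ?_
    by_cases hsz : s = z₀
    · left; rwa [hsz, dist_self]
    · right
      by_contra! hlt
      have : s ∈ A := ⟨hs, hsz, hlt⟩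
      rw [he] at this
      exact this
  · obtain ⟨s₁, hs₁, hmax⟩ := Set.exists_max_image A (fun s => dist s z₀) hfin hne
    obtain ⟨ρ₀, hρ₀, hyρ⟩ := h s₁ hs₁.1 hs₁.2.1 hs₁.2.2
    have hρ₀0 : 0 < ρ₀ := dist_nonneg.trans_lt hρ₀
    refine ExtendsToBall.of_forall_singular hm hρ₀0 hy hyρ fun s hs => ?_
    by_cases hsz : s = z₀
    · left; rwa [hsz, dist_self]
    · by_cases hlt : dist s z₀ < ρ
      · exact Or.inl ((hmax s ⟨hs, hsz, hlt⟩).trans_lt hρ₀)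
      · exact Or.inr (not_lt.1 hlt)

/-- Off the bisectors the germs of solutions have a basis, modulo entire solutions, whose members
have pairwise different radii of convergence. -/
theorem exists_level_decomposition (hF : IsFuchsian q) (hG : IsGeneric q) (hm : 0 < m)
    (hz₀ : z₀ ∉ bisectors q) : ∃ (T : Finset ℂ) (e : ℂ → ℂ → ℂ),
      (∀ s ∈ T, s ∈ singularPoints q ∧ s ≠ z₀ ∧ IsSolAt q (e s) z₀ ∧ HasLevel (e s) z₀ s) ∧
      ∀ y, IsSolAt q y z₀ → ∃ γ : ℂ → ℂ,
        ∀ ρ, ExtendsToBall (fun w => y w - ∑ s ∈ T, γ s * e s w) z₀ ρ := by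
  classical
  set S := (finite_singularPoints q).toFinset with hS
  have hmemS : ∀ s, s ∈ S ↔ s ∈ singularPoints q := fun s => Set.Finite.mem_toFinset _
  set T := S.filter fun s => s ≠ z₀ ∧ ∃ e, IsSolAt q e z₀ ∧ HasLevel e z₀ s with hT
  have hTe : ∀ s, ∃ e : ℂ → ℂ, s ∈ T → IsSolAt q e z₀ ∧ HasLevel e z₀ s := fun s => by
    by_cases hs : s ∈ T
    · obtain ⟨e, he⟩ := (Finset.mem_filter.1 hs).2.2
      exact ⟨e, fun _ => he⟩
    · exact ⟨0, fun h => absurd h hs⟩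
  choose e he using hTe
  refine ⟨T, e, fun s hs => ⟨(hmemS s).1 (Finset.mem_filter.1 hs).1, (Finset.mem_filter.1 hs).2.1,
    (he s hs).1, (he s hs).2⟩, ?_⟩
  let bad : (ℂ → ℂ) → Finset ℂ := fun y => S.filter fun s => s ≠ z₀ ∧ ¬ ExtendsBeyond y z₀ s
  have key : ∀ n : ℕ, ∀ y, IsSolAt q y z₀ → (bad y).card ≤ n → ∃ γ : ℂ → ℂ,
      ∀ ρ, ExtendsToBall (fun w => y w - ∑ s ∈ T, γ s * e s w) z₀ ρ := by
    have hgood : ∀ y, IsSolAt q y z₀ → bad y = ∅ → ∃ γ : ℂ → ℂ,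
        ∀ ρ, ExtendsToBall (fun w => y w - ∑ s ∈ T, γ s * e s w) z₀ ρ := by
      intro y hy hbad
      refine ⟨0, fun ρ => ExtendsToBall.congr (y := y)
        (extendsToBall_of_forall_extendsBeyond hm hy ρ fun s hs hsz _ => ?_)
        (Eventually.of_forall fun w => by simp)⟩
      by_contra hb
      have : s ∈ bad y := Finset.mem_filter.2 ⟨(hmemS s).2 hs, hsz, hb⟩
      rw [hbad] at this
      exact absurd this (Finset.notMem_empty s)
    intro n
    induction n with
    | zero => exact fun y hy h0 => hgood y hy (Finset.card_eq_zero.1 (Nat.le_zero.1 h0))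
    | succ n ih =>
      intro y hy hcard
      rcases (bad y).eq_empty_or_nonempty with h0 | hne
      · exact hgood y hy h0
      obtain ⟨s, hs, hmin⟩ := Finset.exists_min_image (bad y) (fun s => dist s z₀) hne
      obtain ⟨hsS, hsz, hsb⟩ := Finset.mem_filter.1 hs
      have hys : ExtendsToBall y z₀ (dist s z₀) :=
        extendsToBall_of_forall_extendsBeyond hm hy _ fun p hp hpz hlt => by
          by_contra hb
          exact absurd (hmin p (Finset.mem_filter.2 ⟨(hmemS p).2 hp, hpz, hb⟩)) (not_le.2 hlt)
      have hsT : s ∈ T := Finset.mem_filter.2 ⟨hsS, hsz, y, hy, hys, hsb⟩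
      have hsS' := (hmemS s).1 hsS
      obtain ⟨D⟩ := nonempty_singularData hF hG hm hsS'
      obtain ⟨c, hc⟩ := HasLevel.exists_sub_extendsBeyond hz₀ hsS' hsz.symm D hy (he s hsT).1
        hys (he s hsT).2
      have hy' := hy.sub_smul (he s hsT).1 c
      have hss : bad (fun w => y w - c * e s w) ⊂ bad y := by
        refine (Finset.ssubset_iff_of_subset fun p hp => ?_).2 ⟨s, hs, fun h => ?_⟩
        · obtain ⟨hpS, hpz, hpb⟩ := Finset.mem_filter.1 hp
          refine Finset.mem_filter.2 ⟨hpS, hpz, fun hb => ?_⟩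
          rcases le_total (dist p z₀) (dist s z₀) with hle | hle
          · exact hpb (hc.mono hle)
          · exact hsb (hb.mono hle)
        · exact (Finset.mem_filter.1 h).2.2 hc
      obtain ⟨γ, hγ⟩ := ih _ hy' (by have := Finset.card_lt_card hss; omega)
      refine ⟨Function.update γ s (γ s + c), fun ρ => (hγ ρ).congr
        (Eventually.of_forall fun w => ?_)⟩
      simp only
      have h1 : ∑ t ∈ T, Function.update γ s (γ s + c) t * e t w
          = ∑ t ∈ T, γ t * e t w + c * e s w := by
        rw [← Finset.add_sum_erase _ _ hsT, ← Finset.add_sum_erase T (fun t => γ t * e t w) hsT,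
          Function.update_self]
        rw [Finset.sum_congr rfl fun t ht => by
          rw [Function.update_of_ne (Finset.ne_of_mem_erase ht)]]
        ring
      rw [h1]
      ring
  exact fun y hy => key _ y hy le_rfl

end

/-! ### Local convergence of quotients -/

section

variable {m : ℕ} {q : Fin m → RatFunc ℂ} {z₀ : ℂ}

/-- The functions `F n` have no poles near `p` for large `n` and converge uniformly near `p`. -/
def ConvergesAt (F : ℕ → RatFunc ℂ) (p : ℂ) : Prop :=
  ∃ V ∈ 𝓝 p, ∃ f : ℂ → ℂ, (∀ᶠ n in atTop, ∀ z ∈ V, ¬ IsPole (F n) z) ∧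
    TendstoUniformlyOn (fun n z => value (F n) z) f atTop V

/-- The functions `F n` converge to `∞` uniformly near `p`. -/
def DivergesAt (F : ℕ → RatFunc ℂ) (p : ℂ) : Prop :=
  ∃ V ∈ 𝓝 p, ∀ C : ℝ, ∀ᶠ n in atTop, ∀ z ∈ V, IsPole (F n) z ∨ C ≤ ‖value (F n) z‖

theorem ConvergesAt.not_divergesAt {F : ℕ → RatFunc ℂ} {p : ℂ} (h : ConvergesAt F p) :
    ¬ DivergesAt F p := by
  rintro ⟨V', hV', hd⟩
  obtain ⟨V, hV, f, hp, hu⟩ := h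
  rw [Metric.tendstoUniformlyOn_iff] at hu
  obtain ⟨n, h1, h2, h3⟩ := (hp.and ((hu 1 one_pos).and (hd (‖f p‖ + 1)))).exists
  have hpV := mem_of_mem_nhds hV
  have h4 := (h3 p (mem_of_mem_nhds hV')).resolve_left (h1 p hpV)
  have h5 := h2 p hpV
  rw [dist_comm, dist_eq_norm] at h5
  have h6 := norm_le_norm_add_norm_sub' (value (F n) p) (f p)
  linarith

theorem ConvergesAt.eventually {F : ℕ → RatFunc ℂ} {p : ℂ} (h : ConvergesAt F p) :
    ∀ᶠ z in 𝓝 p, ConvergesAt F z := by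
  obtain ⟨V, hV, f, hp, hu⟩ := h
  filter_upwards [eventually_mem_nhds_iff.2 hV] with z hz using ⟨V, hz, f, hp, hu⟩

theorem DivergesAt.eventually {F : ℕ → RatFunc ℂ} {p : ℂ} (h : DivergesAt F p) :
    ∀ᶠ z in 𝓝 p, DivergesAt F z := by
  obtain ⟨V, hV, hd⟩ := h
  filter_upwards [eventually_mem_nhds_iff.2 hV] with z hz using ⟨V, hz, hd⟩

theorem eq_zero_of_value_eq_zero {x : RatFunc ℂ} (h : ∀ᶠ z in 𝓝[≠] z₀, value x z = 0) : x = 0 := by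
  by_contra hx
  obtain ⟨z, h1, h2⟩ := (h.and (eventually_value_ne_zero hx z₀)).exists
  exact h2 h1

/-- A rational function that is close to a continuous function off a point has no pole at the
point and is close to the function there. -/
theorem norm_value_sub_le_of_punctured {x : RatFunc ℂ} {f : ℂ → ℂ} {δ : ℝ}
    (hf : ContinuousAt f z₀) (h : ∀ᶠ z in 𝓝[≠] z₀, ‖value x z - f z‖ ≤ δ) :
    ¬ IsPole x z₀ ∧ ‖value x z₀ - f z₀‖ ≤ δ := by
  have hnp : ¬ IsPole x z₀ := by
    intro hp
    have hd0 : x.denom.eval z₀ = 0 := hp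
    have hlim : Tendsto (fun z => ‖x.num.eval z‖) (𝓝[≠] z₀) (𝓝 0) := by
      have hbd : ∀ᶠ z in 𝓝[≠] z₀, ‖x.num.eval z‖ ≤ (δ + (‖f z₀‖ + 1)) * ‖x.denom.eval z‖ := by
        have hev : ∀ᶠ z in 𝓝[≠] z₀, ‖f z‖ < ‖f z₀‖ + 1 :=
          nhdsWithin_le_nhds (hf.norm.eventually_lt_const (by linarith))
        have hnp : ∀ᶠ z in 𝓝[≠] z₀, ¬ IsPole x z := by
          have h2 : ∀ᶠ z in 𝓝 z₀, z ∉ {z | IsPole x z} \ {z₀} :=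
            ((finite_isPole x).subset Set.sdiff_subset).isClosed.isOpen_compl.mem_nhds
              (fun h => h.2 rfl)
          filter_upwards [nhdsWithin_le_nhds h2, self_mem_nhdsWithin] with z h3 h4 h5
          exact h3 ⟨h5, h4⟩
        filter_upwards [h, hev, hnp] with z h1 h2 h3
        have h4 : x.num.eval z = value x z * x.denom.eval z := by
          rw [value_eq, div_mul_cancel₀ _ h3]
        rw [h4, norm_mul]
        refine mul_le_mul_of_nonneg_right ?_ (norm_nonneg _)
        have := norm_le_norm_add_norm_sub' (value x z) (f z)
        linarith
      have hlim2 : Tendsto (fun z => (δ + (‖f z₀‖ + 1)) * ‖x.denom.eval z‖) (𝓝[≠] z₀) (𝓝 0) := by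
        have : Tendsto (fun z => (δ + (‖f z₀‖ + 1)) * ‖x.denom.eval z‖) (𝓝 z₀)
            (𝓝 ((δ + (‖f z₀‖ + 1)) * ‖x.denom.eval z₀‖)) :=
          (continuous_const.mul x.denom.continuous.norm).tendsto z₀
        rw [hd0, norm_zero, mul_zero] at this
        exact this.mono_left nhdsWithin_le_nhds
      exact squeeze_zero' (Eventually.of_forall fun z => norm_nonneg _) hbd hlim2
    have hlim3 : Tendsto (fun z => ‖x.num.eval z‖) (𝓝[≠] z₀) (𝓝 ‖x.num.eval z₀‖) :=
      (x.num.continuous.norm.tendsto z₀).mono_left nhdsWithin_le_nhds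
    have h0 := norm_eq_zero.1 (tendsto_nhds_unique hlim3 hlim)
    obtain ⟨a, b, hab⟩ := x.isCoprime_num_denom
    have := congrArg (Polynomial.eval z₀) hab
    simp [h0, hd0] at this
  refine ⟨hnp, ?_⟩
  have hc : Tendsto (fun z => ‖value x z - f z‖) (𝓝[≠] z₀) (𝓝 ‖value x z₀ - f z₀‖) :=
    ((analyticAt_value hnp).continuousAt.sub hf).norm.tendsto.mono_left nhdsWithin_le_nhds
  exact le_of_tendsto hc h

theorem convergesAt_div {x y : ℕ → RatFunc ℂ} {p : ℂ} {V : Set ℂ} {f : ℂ → ℂ} (hV : V ∈ 𝓝 p)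
    (hx : ∀ n, ∀ z ∈ V, ¬ IsPole (x n) z) (hy : ∀ n, ∀ z ∈ V, ¬ IsPole (y n) z)
    (hne : ∀ᶠ n in atTop, ∀ z ∈ V, value (y n) z ≠ 0)
    (hu : TendstoUniformlyOn (fun n z => value (x n) z / value (y n) z) f atTop V) :
    ConvergesAt (fun n => x n / y n) p := by
  refine ⟨V, hV, f, ?_, hu.congr ?_⟩
  · filter_upwards [hne] with n hn z hz
    exact not_isPole_div_of_value_ne_zero (hx n z hz) (hy n z hz) (hn z hz)
  · filter_upwards [hne] with n hn z hz
    exact (value_div (hx n z hz) (hy n z hz) (hn z hz)).symm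

theorem divergesAt_div {x y : ℕ → RatFunc ℂ} {p : ℂ} {V : Set ℂ} (hV : V ∈ 𝓝 p)
    (hx : ∀ n, ∀ z ∈ V, ¬ IsPole (x n) z) (hy : ∀ n, ∀ z ∈ V, ¬ IsPole (y n) z)
    (hy0 : ∀ᶠ n in atTop, y n ≠ 0)
    (hne : ∀ᶠ n in atTop, ∀ z ∈ V, value (x n) z ≠ 0)
    (hu : ∀ C : ℝ, ∀ᶠ n in atTop, ∀ z ∈ V, C * ‖value (y n) z‖ ≤ ‖value (x n) z‖) :
    DivergesAt (fun n => x n / y n) p := by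
  refine ⟨V, hV, fun C => ?_⟩
  filter_upwards [hy0, hne, hu C] with n h1 h2 h3 z hz
  by_cases h0 : value (y n) z = 0
  · exact Or.inl (isPole_div (hy n z hz) h1 h0 (h2 z hz))
  · right
    rw [value_div (hx n z hz) (hy n z hz) h0, norm_div, le_div_iff₀ (norm_pos_iff.2 h0)]
    exact h3 z hz

end

/-! ### Quotients from a local expansion -/

section

variable {m : ℕ} {q : Fin m → RatFunc ℂ} {z₀ : ℂ}

theorem eventually_eventually_nhds_of_punctured {P : ℂ → Prop} (h : ∀ᶠ z in 𝓝[≠] z₀, P z) :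
    ∀ᶠ p in 𝓝[≠] z₀, ∀ᶠ z in 𝓝 p, P z := by
  rw [eventually_nhdsWithin_iff] at h
  filter_upwards [nhdsWithin_le_nhds (eventually_eventually_nhds.2 h), self_mem_nhdsWithin]
    with p hp hpz
  filter_upwards [hp, isOpen_compl_singleton.mem_nhds hpz] with z h1 h2 using h1 h2

theorem norm_div_sub_div_le {A B a b : ℂ} {c M δ : ℝ} (hc : 0 < c) (hδ : δ ≤ c / 2)
    (hA : ‖A - a‖ ≤ δ) (hB : ‖B - b‖ ≤ δ) (hb : c ≤ ‖b‖) (ha : ‖a‖ ≤ M) (hbM : ‖b‖ ≤ M) :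
    B ≠ 0 ∧ ‖A / B - a / b‖ ≤ 4 * M / c ^ 2 * δ := by
  have hδ0 : 0 ≤ δ := (norm_nonneg _).trans hA
  have hM : 0 ≤ M := (norm_nonneg _).trans ha
  have hBn : c / 2 ≤ ‖B‖ := by
    have := norm_le_norm_add_norm_sub B b
    linarith
  have hB0 : B ≠ 0 := norm_pos_iff.1 (by linarith)
  have hb0 : b ≠ 0 := norm_pos_iff.1 (by linarith)
  refine ⟨hB0, ?_⟩
  have h1 : A / B - a / b = ((A - a) * b + a * (b - B)) / (B * b) := by
    field_simp
    ring
  have h2 : ‖(A - a) * b + a * (b - B)‖ ≤ 2 * M * δ := by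
    refine (norm_add_le _ _).trans ?_
    rw [norm_mul, norm_mul, norm_sub_rev b B]
    nlinarith [mul_le_mul hA hbM (norm_nonneg _) hδ0, mul_le_mul ha hB (norm_nonneg _) hM]
  have h3 : c ^ 2 / 2 ≤ ‖B * b‖ := by
    rw [norm_mul]
    nlinarith [mul_le_mul hBn hb hc.le (norm_nonneg B)]
  rw [h1, norm_div, div_le_iff₀ (norm_pos_iff.2 (mul_ne_zero hB0 hb0))]
  have h4 : 4 * M / c ^ 2 * δ * (c ^ 2 / 2) = 2 * M * δ := by field_simp; ring
  calc _ ≤ 2 * M * δ := h2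
    _ = 4 * M / c ^ 2 * δ * (c ^ 2 / 2) := h4.symm
    _ ≤ _ := by gcongr

/-- An expansion of the coefficients `q_{j,n}` near `z₀` by functions `X s n`, `s ∈ T`, each of
which is dominated, as `n` grows, by those with `s` closer to `z₀`. The coefficients `b s j` do
not depend on `n`; the dominating ones, with `s = s₀`, have the form `(z - z₀)^μ u j`, and a factor
`(z - z₀)^k` clears the poles at `z₀`. -/
structure LocalExpansion (q : Fin m → RatFunc ℂ) (z₀ : ℂ) (T : Finset ℂ) (X : ℂ → ℕ → ℂ → ℂ)
    (b : ℂ → Fin m → ℂ → ℂ) (k n₀ : ℕ) (ε : ℕ → ℝ) (s₀ : ℂ) (μ : ℕ) (u : Fin m → ℂ → ℂ) :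
    Prop where
  mem : s₀ ∈ T
  min : ∀ s ∈ T, dist s₀ z₀ ≤ dist s z₀
  inj : ∀ s ∈ T, ∀ s' ∈ T, dist s z₀ = dist s' z₀ → s = s'
  eps_nonneg : ∀ n, 0 ≤ ε n
  tendsto_eps : Tendsto ε atTop (𝓝 0)
  analytic : ∀ s ∈ T, ∀ j, AnalyticAt ℂ (b s j) z₀
  eq : ∀ᶠ z in 𝓝[≠] z₀, ∀ n ≥ n₀, ∀ j,
    value (derivCoeff q n j) z * (z - z₀) ^ k = ∑ s ∈ T, X s n z * b s j z
  ne : ∀ᶠ z in 𝓝[≠] z₀, ∀ n ≥ n₀, ∀ s ∈ T, X s n z ≠ 0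
  decay : ∀ᶠ z in 𝓝[≠] z₀, ∀ n ≥ n₀, ∀ s ∈ T, ∀ s' ∈ T, dist s z₀ < dist s' z₀ →
    ‖X s' n z‖ ≤ ε n * ‖X s n z‖
  decay_lead : ∀ᶠ z in 𝓝[≠] z₀, ∀ n ≥ n₀, ∀ s ∈ T, s ≠ s₀ →
    ‖X s n z‖ ≤ ε n * (‖z - z₀‖ ^ μ * ‖X s₀ n z‖)
  analytic_lead : ∀ j, AnalyticAt ℂ (u j) z₀
  lead_ne : ∃ j, u j z₀ ≠ 0
  lead_eq : ∀ᶠ z in 𝓝[≠] z₀, ∀ j, b s₀ j z = (z - z₀) ^ μ * u j z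

variable {T : Finset ℂ} {X : ℂ → ℕ → ℂ → ℂ} {b : ℂ → Fin m → ℂ → ℂ} {k n₀ : ℕ} {ε : ℕ → ℝ}
  {s₀ : ℂ} {μ : ℕ} {u : Fin m → ℂ → ℂ}

theorem eventually_norm_le_of_continuousAt {f : ℂ → ℂ} (hf : ContinuousAt f z₀) :
    ∀ᶠ z in 𝓝 z₀, ‖f z‖ ≤ ‖f z₀‖ + 1 :=
  (hf.norm.eventually_lt_const (by linarith : ‖f z₀‖ < ‖f z₀‖ + 1)).mono fun _ h => h.le

/-- If no term with `s'` closer than `s` contributes to the `j`-th coefficient, then it is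
asymptotic to the term of `s`. -/
theorem LocalExpansion.exists_norm_sub_le (h : LocalExpansion q z₀ T X b k n₀ ε s₀ μ u) {j : Fin m}
    {s : ℂ} (hs : s ∈ T)
    (hj : ∀ s' ∈ T, dist s' z₀ < dist s z₀ → ∀ᶠ z in 𝓝[≠] z₀, b s' j z = 0) :
    ∃ M, ∀ᶠ z in 𝓝[≠] z₀, ∀ n ≥ n₀, ‖value (derivCoeff q n j) z * (z - z₀) ^ k
      - X s n z * b s j z‖ ≤ M * ε n * ‖X s n z‖ := by
  classical
  refine ⟨∑ s' ∈ T.erase s, (‖b s' j z₀‖ + 1), ?_⟩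
  have h1 : ∀ᶠ z in 𝓝[≠] z₀, ∀ s' ∈ T, dist s' z₀ < dist s z₀ → b s' j z = 0 :=
    (Finset.eventually_all T).2 fun s' hs' => by
      by_cases hd : dist s' z₀ < dist s z₀
      · filter_upwards [hj s' hs' hd] with z hz _ using hz
      · exact Eventually.of_forall fun z hd' => absurd hd' hd
  have h2 : ∀ᶠ z in 𝓝[≠] z₀, ∀ s' ∈ T, ‖b s' j z‖ ≤ ‖b s' j z₀‖ + 1 :=
    (Finset.eventually_all T).2 fun s' hs' => nhdsWithin_le_nhds
      (eventually_norm_le_of_continuousAt (h.analytic s' hs' j).continuousAt)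
  filter_upwards [h1, h2, h.eq, h.decay] with z hz1 hz2 hz3 hz4 n hn
  rw [hz3 n hn j, ← Finset.add_sum_erase _ _ hs, add_sub_cancel_left, mul_assoc, Finset.sum_mul]
  refine (norm_sum_le _ _).trans (Finset.sum_le_sum fun s' hs' => ?_)
  have hs'T := Finset.mem_of_mem_erase hs'
  have hε := h.eps_nonneg n
  rcases lt_trichotomy (dist s' z₀) (dist s z₀) with hd | hd | hd
  · rw [hz1 s' hs'T hd, mul_zero, norm_zero]
    positivity
  · exact absurd (h.inj s' hs'T s hs hd) (Finset.ne_of_mem_erase hs')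
  · rw [norm_mul, mul_comm]
    exact mul_le_mul (hz2 s' hs'T) (hz4 n hn s hs s' hs'T hd) (norm_nonneg _) (by positivity)

/-- All coefficients are asymptotic to their terms with `s = s₀`, with an error that is small even
compared with the common zero of these terms at `z₀`. -/
theorem LocalExpansion.exists_norm_sub_lead_le (h : LocalExpansion q z₀ T X b k n₀ ε s₀ μ u)
    (j : Fin m) : ∃ M, ∀ᶠ z in 𝓝[≠] z₀, ∀ n ≥ n₀, ‖value (derivCoeff q n j) z * (z - z₀) ^ k
      - X s₀ n z * ((z - z₀) ^ μ * u j z)‖ ≤ M * ε n * (‖z - z₀‖ ^ μ * ‖X s₀ n z‖) := by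
  classical
  refine ⟨∑ s' ∈ T.erase s₀, (‖b s' j z₀‖ + 1), ?_⟩
  have h2 : ∀ᶠ z in 𝓝[≠] z₀, ∀ s' ∈ T, ‖b s' j z‖ ≤ ‖b s' j z₀‖ + 1 :=
    (Finset.eventually_all T).2 fun s' hs' => nhdsWithin_le_nhds
      (eventually_norm_le_of_continuousAt (h.analytic s' hs' j).continuousAt)
  filter_upwards [h2, h.eq, h.decay_lead, h.lead_eq] with z hz2 hz3 hz4 hz5 n hn
  rw [hz3 n hn j, ← hz5 j, ← Finset.add_sum_erase _ _ h.mem, add_sub_cancel_left, mul_assoc,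
    Finset.sum_mul]
  refine (norm_sum_le _ _).trans (Finset.sum_le_sum fun s' hs' => ?_)
  have hs'T := Finset.mem_of_mem_erase hs'
  have hε := h.eps_nonneg n
  rw [norm_mul, mul_comm]
  exact mul_le_mul (hz2 s' hs'T) (hz4 n hn s' hs'T (Finset.ne_of_mem_erase hs')) (norm_nonneg _)
    (by positivity)

theorem eventually_notMem_singularPoints (q : Fin m → RatFunc ℂ) (z₀ : ℂ) :
    ∀ᶠ z in 𝓝[≠] z₀, z ∉ singularPoints q := by
  have h2 : ∀ᶠ z in 𝓝 z₀, z ∉ singularPoints q \ {z₀} :=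
    ((finite_singularPoints q).subset Set.sdiff_subset).isClosed.isOpen_compl.mem_nhds
      (fun h => h.2 rfl)
  filter_upwards [nhdsWithin_le_nhds h2, self_mem_nhdsWithin] with z h3 h4 h5
  exact h3 ⟨h5, h4⟩

theorem norm_div_sub_le {A X a : ℂ} {δ : ℝ} (hX : X ≠ 0) (h : ‖A - X * a‖ ≤ δ * ‖X‖) :
    ‖A / X - a‖ ≤ δ := by
  have h1 : A / X - a = (A - X * a) / X := by field_simp
  rw [h1, norm_div]
  exact (div_le_iff₀ (norm_pos_iff.2 hX)).2 h

theorem LocalExpansion.tendsto_const_mul_eps (h : LocalExpansion q z₀ T X b k n₀ ε s₀ μ u)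
    (M : ℝ) : Tendsto (fun n => M * ε n) atTop (𝓝 0) := by
  simpa using h.tendsto_eps.const_mul M

/-- Near the points `p ≠ z₀`, the quotients by a coefficient with leading term `s` converge, if
the other coefficient has no terms that dominate `s`. -/
theorem LocalExpansion.eventually_convergesAt (h : LocalExpansion q z₀ T X b k n₀ ε s₀ μ u)
    {i j : Fin m} {s : ℂ} (hs : s ∈ T)
    (hj : ∀ s' ∈ T, dist s' z₀ < dist s z₀ → ∀ᶠ z in 𝓝[≠] z₀, b s' j z = 0)
    (hi : ∀ s' ∈ T, dist s' z₀ < dist s z₀ → ∀ᶠ z in 𝓝[≠] z₀, b s' i z = 0)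
    (hne : ∀ᶠ z in 𝓝[≠] z₀, b s j z ≠ 0) :
    ∀ᶠ p in 𝓝[≠] z₀, ConvergesAt (fun n => derivCoeff q n i / derivCoeff q n j) p := by
  obtain ⟨M₁, hM₁⟩ := h.exists_norm_sub_le hs hj
  obtain ⟨M₂, hM₂⟩ := h.exists_norm_sub_le hs hi
  filter_upwards [eventually_eventually_nhds_of_punctured hM₁,
    eventually_eventually_nhds_of_punctured hM₂,
    eventually_eventually_nhds_of_punctured h.ne,
    eventually_eventually_nhds_of_punctured (eventually_notMem_singularPoints q z₀), hne,
    nhdsWithin_le_nhds (h.analytic s hs j).eventually_analyticAt,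
    nhdsWithin_le_nhds (h.analytic s hs i).eventually_analyticAt,
    self_mem_nhdsWithin] with p hp1 hp2 hp3 hp4 hp5 hp6 hp7 hpz
  have hc : 0 < ‖b s j p‖ / 2 := half_pos (norm_pos_iff.2 hp5)
  set M := max (‖b s i p‖ + 1) (‖b s j p‖ + 1)
  have hV : ∀ᶠ z in 𝓝 p, (z ≠ z₀ ∧ z ∉ singularPoints q ∧ (∀ n ≥ n₀, X s n z ≠ 0)) ∧
      ((∀ n ≥ n₀, ‖value (derivCoeff q n j) z * (z - z₀) ^ k
        - X s n z * b s j z‖ ≤ M₁ * ε n * ‖X s n z‖) ∧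
      (∀ n ≥ n₀, ‖value (derivCoeff q n i) z * (z - z₀) ^ k
        - X s n z * b s i z‖ ≤ M₂ * ε n * ‖X s n z‖)) ∧
      ‖b s j p‖ / 2 ≤ ‖b s j z‖ ∧ ‖b s i z‖ ≤ M ∧ ‖b s j z‖ ≤ M := by
    filter_upwards [hp1, hp2, hp3, hp4, isOpen_compl_singleton.mem_nhds hpz,
      hp6.continuousAt.norm.eventually_const_lt (half_lt_self (norm_pos_iff.2 hp5)),
      eventually_norm_le_of_continuousAt hp6.continuousAt,
      eventually_norm_le_of_continuousAt hp7.continuousAt] with z h1 h2 h3 h4 h5 h6 h7 h8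
    exact ⟨⟨h5, h4, fun n hn => h3 n hn s hs⟩, ⟨h1, h2⟩, h6.le, h8.trans (le_max_left _ _),
      h7.trans (le_max_right _ _)⟩
  set δ : ℕ → ℝ := fun n => max (M₁ * ε n) (M₂ * ε n) with hδ
  have hδ0 : Tendsto δ atTop (𝓝 0) := by
    simpa using (h.tendsto_const_mul_eps M₁).max (h.tendsto_const_mul_eps M₂)
  have hkey : ∀ᶠ n in atTop, ∀ z ∈ {z | (z ≠ z₀ ∧ z ∉ singularPoints q ∧
        (∀ n ≥ n₀, X s n z ≠ 0)) ∧
      ((∀ n ≥ n₀, ‖value (derivCoeff q n j) z * (z - z₀) ^ k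
        - X s n z * b s j z‖ ≤ M₁ * ε n * ‖X s n z‖) ∧
      (∀ n ≥ n₀, ‖value (derivCoeff q n i) z * (z - z₀) ^ k
        - X s n z * b s i z‖ ≤ M₂ * ε n * ‖X s n z‖)) ∧
      ‖b s j p‖ / 2 ≤ ‖b s j z‖ ∧ ‖b s i z‖ ≤ M ∧ ‖b s j z‖ ≤ M},
      value (derivCoeff q n j) z ≠ 0 ∧
      ‖value (derivCoeff q n i) z / value (derivCoeff q n j) z - b s i z / b s j z‖
        ≤ 4 * M / (‖b s j p‖ / 2) ^ 2 * δ n := by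
    filter_upwards [eventually_ge_atTop n₀,
      hδ0.eventually_lt_const (half_pos hc)] with n hn hδn z hz
    obtain ⟨⟨hz0, -, hX⟩, ⟨hzj, hzi⟩, hb, hbi, hbj⟩ := hz
    have hXn := hX n hn
    have hzk : (z - z₀) ^ k ≠ 0 := pow_ne_zero _ (sub_ne_zero.2 hz0)
    have h1 := norm_div_sub_div_le hc hδn.le
      ((norm_div_sub_le hXn (hzi n hn)).trans (le_max_right _ _))
      ((norm_div_sub_le hXn (hzj n hn)).trans (le_max_left _ _)) hb hbi hbj
    have h2 : value (derivCoeff q n j) z ≠ 0 := fun h0 => h1.1 (by rw [h0, zero_mul, zero_div])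
    refine ⟨h2, ?_⟩
    have h3 : value (derivCoeff q n i) z * (z - z₀) ^ k / X s n z
        / (value (derivCoeff q n j) z * (z - z₀) ^ k / X s n z)
        = value (derivCoeff q n i) z / value (derivCoeff q n j) z := by
      field_simp
    rw [h3] at h1
    exact h1.2
  refine convergesAt_div hV (fun n z hz => not_isPole_derivCoeff hz.1.2.1 n i)
    (fun n z hz => not_isPole_derivCoeff hz.1.2.1 n j) (f := fun z => b s i z / b s j z)
    (hkey.mono fun n hn z hz => (hn z hz).1) ?_
  rw [Metric.tendstoUniformlyOn_iff]
  intro η hη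
  have hlim : Tendsto (fun n => 4 * M / (‖b s j p‖ / 2) ^ 2 * δ n) atTop (𝓝 0) := by
    simpa using hδ0.const_mul (4 * M / (‖b s j p‖ / 2) ^ 2)
  filter_upwards [hkey, hlim.eventually_lt_const hη] with n hn hnη z hz
  rw [dist_comm, dist_eq_norm]
  exact (hn z hz).2.trans_lt hnη

theorem LocalExpansion.eventually_ne_zero (h : LocalExpansion q z₀ T X b k n₀ ε s₀ μ u)
    {j : Fin m} {s : ℂ} (hs : s ∈ T)
    (hj : ∀ s' ∈ T, dist s' z₀ < dist s z₀ → ∀ᶠ z in 𝓝[≠] z₀, b s' j z = 0)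
    (hne : ∀ᶠ z in 𝓝[≠] z₀, b s j z ≠ 0) : ∀ᶠ n in atTop, derivCoeff q n j ≠ 0 := by
  obtain ⟨M, hM⟩ := h.exists_norm_sub_le hs hj
  obtain ⟨z, h1, h2, h3⟩ := (hM.and (hne.and h.ne)).exists
  filter_upwards [eventually_ge_atTop n₀,
    (h.tendsto_const_mul_eps M).eventually_lt_const (norm_pos_iff.2 h2)] with n hn hε h0
  have h4 := norm_div_sub_le (h3 n hn s hs) (h1 n hn)
  rw [h0, value_zero, zero_mul, zero_div, zero_sub, norm_neg] at h4
  linarith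

/-- Near the points `p ≠ z₀`, the quotients by a coefficient diverge, if the other coefficient has
a leading term that dominates. -/
theorem LocalExpansion.eventually_divergesAt (h : LocalExpansion q z₀ T X b k n₀ ε s₀ μ u)
    {i j : Fin m} {s : ℂ} (hs : s ∈ T)
    (hj : ∀ s' ∈ T, dist s' z₀ < dist s z₀ → ∀ᶠ z in 𝓝[≠] z₀, b s' j z = 0)
    (hjs : ∀ᶠ z in 𝓝[≠] z₀, b s j z = 0) (hj0 : ∀ᶠ n in atTop, derivCoeff q n j ≠ 0)
    (hi : ∀ s' ∈ T, dist s' z₀ < dist s z₀ → ∀ᶠ z in 𝓝[≠] z₀, b s' i z = 0)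
    (hne : ∀ᶠ z in 𝓝[≠] z₀, b s i z ≠ 0) :
    ∀ᶠ p in 𝓝[≠] z₀, DivergesAt (fun n => derivCoeff q n i / derivCoeff q n j) p := by
  obtain ⟨M₁, hM₁⟩ := h.exists_norm_sub_le hs hj
  obtain ⟨M₂, hM₂⟩ := h.exists_norm_sub_le hs hi
  filter_upwards [eventually_eventually_nhds_of_punctured hM₁,
    eventually_eventually_nhds_of_punctured hM₂,
    eventually_eventually_nhds_of_punctured h.ne,
    eventually_eventually_nhds_of_punctured hjs,
    eventually_eventually_nhds_of_punctured (eventually_notMem_singularPoints q z₀), hne,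
    nhdsWithin_le_nhds (h.analytic s hs i).eventually_analyticAt,
    self_mem_nhdsWithin] with p hp1 hp2 hp3 hpj hp4 hp5 hp7 hpz
  have hc : 0 < ‖b s i p‖ / 2 := half_pos (norm_pos_iff.2 hp5)
  have hV : ∀ᶠ z in 𝓝 p, (z ≠ z₀ ∧ z ∉ singularPoints q ∧ (∀ n ≥ n₀, X s n z ≠ 0)) ∧
      ((∀ n ≥ n₀, ‖value (derivCoeff q n j) z * (z - z₀) ^ k‖ ≤ M₁ * ε n * ‖X s n z‖) ∧
      (∀ n ≥ n₀, ‖value (derivCoeff q n i) z * (z - z₀) ^ k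
        - X s n z * b s i z‖ ≤ M₂ * ε n * ‖X s n z‖)) ∧
      ‖b s i p‖ / 2 ≤ ‖b s i z‖ := by
    filter_upwards [hp1, hp2, hp3, hp4, hpj, isOpen_compl_singleton.mem_nhds hpz,
      hp7.continuousAt.norm.eventually_const_lt (half_lt_self (norm_pos_iff.2 hp5))]
      with z h1 h2 h3 h4 hj5 h5 h6
    refine ⟨⟨h5, h4, fun n hn => h3 n hn s hs⟩, ⟨fun n hn => ?_, h2⟩, h6.le⟩
    have := h1 n hn
    rwa [hj5, mul_zero, sub_zero] at this
  have hkey : ∀ C : ℝ, 0 ≤ C → ∀ᶠ n in atTop, ∀ z ∈ {z | (z ≠ z₀ ∧ z ∉ singularPoints q ∧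
        (∀ n ≥ n₀, X s n z ≠ 0)) ∧
      ((∀ n ≥ n₀, ‖value (derivCoeff q n j) z * (z - z₀) ^ k‖ ≤ M₁ * ε n * ‖X s n z‖) ∧
      (∀ n ≥ n₀, ‖value (derivCoeff q n i) z * (z - z₀) ^ k
        - X s n z * b s i z‖ ≤ M₂ * ε n * ‖X s n z‖)) ∧
      ‖b s i p‖ / 2 ≤ ‖b s i z‖},
      value (derivCoeff q n i) z ≠ 0 ∧
      C * ‖value (derivCoeff q n j) z‖ ≤ ‖value (derivCoeff q n i) z‖ := by
    intro C hC
    filter_upwards [eventually_ge_atTop n₀,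
      (h.tendsto_const_mul_eps M₂).eventually_lt_const (half_pos hc),
      (h.tendsto_const_mul_eps (C * M₁)).eventually_lt_const (half_pos hc)] with n hn hn2 hn1 z hz
    obtain ⟨⟨hz0, -, hX⟩, ⟨hzj, hzi⟩, hb⟩ := hz
    have hXp : 0 < ‖X s n z‖ := norm_pos_iff.2 (hX n hn)
    have hzk : 0 < ‖(z - z₀) ^ k‖ := norm_pos_iff.2 (pow_ne_zero _ (sub_ne_zero.2 hz0))
    have h1 : ‖b s i p‖ / 2 / 2 * ‖X s n z‖ ≤ ‖value (derivCoeff q n i) z * (z - z₀) ^ k‖ := by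
      have h2 := norm_le_norm_add_norm_sub (value (derivCoeff q n i) z * (z - z₀) ^ k)
        (X s n z * b s i z)
      have h3 := hzi n hn
      have h4 : ‖b s i p‖ / 2 * ‖X s n z‖ ≤ ‖X s n z * b s i z‖ := by
        rw [norm_mul, mul_comm]
        exact mul_le_mul_of_nonneg_left hb hXp.le
      have h5 := mul_lt_mul_of_pos_right hn2 hXp
      linarith
    have h6 : C * ‖value (derivCoeff q n j) z * (z - z₀) ^ k‖
        ≤ ‖b s i p‖ / 2 / 2 * ‖X s n z‖ := by
      have h7 := mul_le_mul_of_nonneg_left (hzj n hn) hC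
      have h8 := mul_lt_mul_of_pos_right hn1 hXp
      linarith
    have hpos : 0 < ‖b s i p‖ / 2 / 2 * ‖X s n z‖ := mul_pos (half_pos hc) hXp
    constructor
    · intro h0
      rw [h0, zero_mul, norm_zero] at h1
      linarith
    · have h9 := h6.trans h1
      rw [norm_mul, norm_mul, ← mul_assoc] at h9
      exact le_of_mul_le_mul_right h9 hzk
  refine divergesAt_div hV (fun n z hz => not_isPole_derivCoeff hz.1.2.1 n i)
    (fun n z hz => not_isPole_derivCoeff hz.1.2.1 n j) hj0
    ((hkey 0 le_rfl).mono fun n hn z hz => (hn z hz).1) fun C => ?_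
  filter_upwards [hkey (max C 0) (le_max_right _ _)] with n hn z hz
  exact (mul_le_mul_of_nonneg_right (le_max_left _ _) (norm_nonneg _)).trans (hn z hz).2

/-- At `z₀` itself the quotients by a coefficient whose leading term vanishes to minimal order
converge. -/
theorem LocalExpansion.convergesAt_self (h : LocalExpansion q z₀ T X b k n₀ ε s₀ μ u)
    {j : Fin m} (hj : u j z₀ ≠ 0) (i : Fin m) :
    ConvergesAt (fun n => derivCoeff q n i / derivCoeff q n j) z₀ := by
  obtain ⟨M₁, hM₁⟩ := h.exists_norm_sub_lead_le j
  obtain ⟨M₂, hM₂⟩ := h.exists_norm_sub_lead_le i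
  have hc : 0 < ‖u j z₀‖ / 2 := half_pos (norm_pos_iff.2 hj)
  set M := max (‖u i z₀‖ + 1) (‖u j z₀‖ + 1)
  set δ : ℕ → ℝ := fun n => max (M₁ * ε n) (M₂ * ε n) with hδ
  have hδ0 : Tendsto δ atTop (𝓝 0) := by
    simpa using (h.tendsto_const_mul_eps M₁).max (h.tendsto_const_mul_eps M₂)
  set f : ℂ → ℂ := fun z => u i z / u j z with hf
  set D := 4 * M / (‖u j z₀‖ / 2) ^ 2 with hD
  have hδe : ∀ᶠ n in atTop, n₀ ≤ n ∧ δ n ≤ ‖u j z₀‖ / 2 / 2 :=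
    (eventually_ge_atTop n₀).and ((hδ0.eventually_lt_const (half_pos hc)).mono fun _ h => h.le)
  have hev : ∀ᶠ z in 𝓝[≠] z₀, ∀ n, n₀ ≤ n ∧ δ n ≤ ‖u j z₀‖ / 2 / 2 →
      ¬ IsPole (derivCoeff q n i / derivCoeff q n j) z ∧
        ‖value (derivCoeff q n i / derivCoeff q n j) z - f z‖ ≤ D * δ n := by
    filter_upwards [hM₁, hM₂, h.ne, eventually_notMem_singularPoints q z₀, self_mem_nhdsWithin,
      nhdsWithin_le_nhds ((h.analytic_lead j).continuousAt.norm.eventually_const_lt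
        (half_lt_self (norm_pos_iff.2 hj))),
      nhdsWithin_le_nhds (eventually_norm_le_of_continuousAt (h.analytic_lead j).continuousAt),
      nhdsWithin_le_nhds (eventually_norm_le_of_continuousAt (h.analytic_lead i).continuousAt)]
      with z h1 h2 h3 h4 h5 h6 h7 h8 n hn
    have hz0 : z - z₀ ≠ 0 := sub_ne_zero.2 h5
    have hXn : X s₀ n z * (z - z₀) ^ μ ≠ 0 :=
      mul_ne_zero (h3 n hn.1 s₀ h.mem) (pow_ne_zero _ hz0)
    have hzk : (z - z₀) ^ k ≠ 0 := pow_ne_zero _ hz0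
    have e1 := h1 n hn.1
    have e2 := h2 n hn.1
    rw [← norm_pow, ← norm_mul, mul_comm ((z - z₀) ^ μ) (X s₀ n z), ← mul_assoc] at e1 e2
    have h9 := norm_div_sub_div_le hc hn.2
      ((norm_div_sub_le hXn e2).trans (le_max_right _ _))
      ((norm_div_sub_le hXn e1).trans (le_max_left _ _)) h6.le (h8.trans (le_max_left _ _))
      (h7.trans (le_max_right _ _))
    have h10 : value (derivCoeff q n j) z ≠ 0 := fun h0 => h9.1 (by rw [h0, zero_mul, zero_div])
    have hpi := not_isPole_derivCoeff h4 n i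
    have hpj := not_isPole_derivCoeff h4 n j
    refine ⟨not_isPole_div_of_value_ne_zero hpi hpj h10, ?_⟩
    rw [value_div hpi hpj h10]
    have h11 : value (derivCoeff q n i) z * (z - z₀) ^ k / (X s₀ n z * (z - z₀) ^ μ)
        / (value (derivCoeff q n j) z * (z - z₀) ^ k / (X s₀ n z * (z - z₀) ^ μ))
        = value (derivCoeff q n i) z / value (derivCoeff q n j) z :=
      (div_div_div_cancel_right₀ hXn _ _).trans (mul_div_mul_right _ _ hzk)
    rw [h11] at h9
    exact h9.2
  have hfc : ContinuousAt f z₀ :=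
    (h.analytic_lead i).continuousAt.div (h.analytic_lead j).continuousAt hj
  have hself : ∀ n, n₀ ≤ n ∧ δ n ≤ ‖u j z₀‖ / 2 / 2 →
      ¬ IsPole (derivCoeff q n i / derivCoeff q n j) z₀ ∧
        ‖value (derivCoeff q n i / derivCoeff q n j) z₀ - f z₀‖ ≤ D * δ n := fun n hn =>
    norm_value_sub_le_of_punctured hfc (hev.mono fun z hz => (hz n hn).2)
  have hV : ∀ᶠ z in 𝓝 z₀, ∀ n, n₀ ≤ n ∧ δ n ≤ ‖u j z₀‖ / 2 / 2 →
      ¬ IsPole (derivCoeff q n i / derivCoeff q n j) z ∧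
        ‖value (derivCoeff q n i / derivCoeff q n j) z - f z‖ ≤ D * δ n := by
    rw [eventually_nhdsWithin_iff] at hev
    filter_upwards [hev] with z hz
    by_cases hzz : z = z₀
    · rw [hzz]
      exact hself
    · exact hz hzz
  refine ⟨_, hV, f, ?_, ?_⟩
  · filter_upwards [hδe] with n hn z hz using (hz n hn).1
  · rw [Metric.tendstoUniformlyOn_iff]
    intro η hη
    have hlim : Tendsto (fun n => D * δ n) atTop (𝓝 0) := by simpa using hδ0.const_mul D
    filter_upwards [hδe, hlim.eventually_lt_const hη] with n hn hnη z hz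
    rw [dist_comm, dist_eq_norm]
    exact (hz n hn).2.trans_lt hnη

/-- The local form at `z₀` of the convergence of the quotients: no coefficient oscillates between
zero and nonzero, the quotients have limits of one type near the points of a punctured
neighbourhood, and some denominator gives finite limits at `z₀` itself. -/
structure IsTameAt (q : Fin m → RatFunc ℂ) (z₀ : ℂ) : Prop where
  zero_or_ne : ∀ j, (∀ᶠ n in atTop, derivCoeff q n j = 0) ∨ ∀ᶠ n in atTop, derivCoeff q n j ≠ 0
  punctured : ∀ j, (∀ᶠ n in atTop, derivCoeff q n j ≠ 0) → ∀ i,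
    (∀ᶠ p in 𝓝[≠] z₀, ConvergesAt (fun n => derivCoeff q n i / derivCoeff q n j) p) ∨
    ∀ᶠ p in 𝓝[≠] z₀, DivergesAt (fun n => derivCoeff q n i / derivCoeff q n j) p
  self : ∃ j, (∀ᶠ n in atTop, derivCoeff q n j ≠ 0) ∧
    ∀ i, ConvergesAt (fun n => derivCoeff q n i / derivCoeff q n j) z₀

/-- The leading term of a coefficient belongs to the closest `s` that contributes; a coefficient
without leading term vanishes for large `n`. -/
theorem LocalExpansion.exists_lead (h : LocalExpansion q z₀ T X b k n₀ ε s₀ μ u) (j : Fin m) :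
    (∀ᶠ n in atTop, derivCoeff q n j = 0) ∨ ∃ s ∈ T,
      (∀ s' ∈ T, dist s' z₀ < dist s z₀ → ∀ᶠ z in 𝓝[≠] z₀, b s' j z = 0) ∧
      ∀ᶠ z in 𝓝[≠] z₀, b s j z ≠ 0 := by
  classical
  have hdich : ∀ s ∈ T, (∀ᶠ z in 𝓝[≠] z₀, b s j z = 0) ∨ ∀ᶠ z in 𝓝[≠] z₀, b s j z ≠ 0 :=
    fun s hs => (h.analytic s hs j).eventually_eq_zero_or_eventually_ne_zero.imp_left
      fun h0 => nhdsWithin_le_nhds h0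
  set A := T.filter fun s => ¬ ∀ᶠ z in 𝓝[≠] z₀, b s j z = 0 with hA
  rcases A.eq_empty_or_nonempty with he | hne
  · left
    have h1 : ∀ᶠ z in 𝓝[≠] z₀, ∀ s ∈ T, b s j z = 0 :=
      (Finset.eventually_all T).2 fun s hs => by
        by_contra h0
        have : s ∈ A := Finset.mem_filter.2 ⟨hs, h0⟩
        rw [he] at this
        exact absurd this (Finset.notMem_empty s)
    filter_upwards [eventually_ge_atTop n₀] with n hn
    refine eq_zero_of_value_eq_zero (z₀ := z₀) ?_
    filter_upwards [h1, h.eq, self_mem_nhdsWithin] with z h2 h3 h4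
    have h5 := h3 n hn j
    rw [Finset.sum_eq_zero fun s hs => by rw [h2 s hs, mul_zero]] at h5
    exact (mul_eq_zero.1 h5).resolve_right (pow_ne_zero _ (sub_ne_zero.2 h4))
  · right
    obtain ⟨s, hs, hmin⟩ := Finset.exists_min_image A (fun s => dist s z₀) hne
    obtain ⟨hsT, hs0⟩ := Finset.mem_filter.1 hs
    refine ⟨s, hsT, fun s' hs' hd => ?_, (hdich s hsT).resolve_left hs0⟩
    by_contra h0
    exact absurd (hmin s' (Finset.mem_filter.2 ⟨hs', h0⟩)) (not_le.2 hd)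

theorem LocalExpansion.isTameAt (h : LocalExpansion q z₀ T X b k n₀ ε s₀ μ u) : IsTameAt q z₀ where
  zero_or_ne := fun j => (h.exists_lead j).imp_right fun ⟨_, hs, h1, h2⟩ =>
    h.eventually_ne_zero hs h1 h2
  punctured := by
    intro j hj0 i
    rcases h.exists_lead j with h0 | ⟨s, hs, hj, hne⟩
    · obtain ⟨n, h1, h2⟩ := (h0.and hj0).exists
      exact absurd h1 h2
    · by_cases hi : ∀ s' ∈ T, dist s' z₀ < dist s z₀ → ∀ᶠ z in 𝓝[≠] z₀, b s' i z = 0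
      · exact Or.inl (h.eventually_convergesAt hs hj hi hne)
      · right
        classical
        push Not at hi
        set A := T.filter fun s' => ¬ ∀ᶠ z in 𝓝[≠] z₀, b s' i z = 0 with hA
        obtain ⟨s₁, hs₁T, hs₁d, hs₁0⟩ := hi
        have hne' : A.Nonempty := ⟨s₁, Finset.mem_filter.2 ⟨hs₁T, by simpa using hs₁0⟩⟩
        obtain ⟨s', hs', hmin⟩ := Finset.exists_min_image A (fun s => dist s z₀) hne'
        obtain ⟨hs'T, hs'0⟩ := Finset.mem_filter.1 hs'
        have hd : dist s' z₀ < dist s z₀ :=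
          (hmin s₁ (Finset.mem_filter.2 ⟨hs₁T, by simpa using hs₁0⟩)).trans_lt hs₁d
        refine h.eventually_divergesAt hs'T (fun t ht htd => hj t ht (htd.trans hd))
          (hj s' hs'T hd) hj0 (fun t ht htd => ?_) ?_
        · by_contra h0
          exact absurd (hmin t (Finset.mem_filter.2 ⟨ht, h0⟩)) (not_le.2 htd)
        · exact ((h.analytic s' hs'T i).eventually_eq_zero_or_eventually_ne_zero.resolve_left
            fun h0 => hs'0 (nhdsWithin_le_nhds h0))
  self := by
    obtain ⟨j, hj⟩ := h.lead_ne
    refine ⟨j, h.eventually_ne_zero h.mem (fun s' hs' hd => absurd (h.min s' hs') (not_le.2 hd)) ?_,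
      h.convergesAt_self hj⟩
    filter_upwards [h.lead_eq, self_mem_nhdsWithin,
      nhdsWithin_le_nhds ((h.analytic_lead j).continuousAt.eventually_ne hj)] with z h1 h2 h3
    rw [h1 j]
    exact mul_ne_zero (pow_ne_zero _ (sub_ne_zero.2 h2)) h3

end

/-! ### The expansion at an ordinary point -/

section

variable {m : ℕ} {q : Fin m → RatFunc ℂ} {z₀ : ℂ}

/-- The `n`-th Taylor coefficient of a solution with level `s` exceeds `1 / R ^ n` for each `R`
larger than the distance to `s`: the factors of polynomial size are absorbed by increasing the radius. -/
theorem HasLevel.exists_geometric_lower_bound (hz₀ : z₀ ∉ bisectors q) {s : ℂ}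
    (hs : s ∈ singularPoints q) (hz₀s : z₀ ≠ s) (D : SingularData q s) {y : ℂ → ℂ}
    (hy : IsSolAt q y z₀) (hys : HasLevel y z₀ s) {R : ℝ} (hR : dist s z₀ < R) :
    ∃ n₁ : ℕ, ∀ᶠ z in 𝓝 z₀, ∀ n ≥ n₁, 1 / R ^ n ≤ ‖iteratedDeriv n y z‖ / n.factorial := by
  obtain ⟨N, n₁, hlow⟩ := hys.exists_lower_bound hz₀ hs hz₀s D hy
  set d := dist s z₀ with hd
  have hd0 : 0 < d := dist_pos.2 hz₀s.symm
  set R₁ := (d + R) / 2 with hR₁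
  have hdR₁ : d < R₁ := by rw [hR₁]; linarith
  have hR₁R : R₁ < R := by rw [hR₁]; linarith
  have hR₁0 : 0 < R₁ := hd0.trans hdR₁
  have hR0 : 0 < R := hR₁0.trans hR₁R
  have hlim : Tendsto (fun n : ℕ => (n : ℝ) ^ N * (R₁ / R) ^ n) atTop (𝓝 0) :=
    tendsto_pow_const_mul_const_pow_of_abs_lt_one N (by
      rw [abs_of_pos (by positivity), div_lt_one hR0]
      exact hR₁R)
  obtain ⟨n₂, hn₂⟩ := eventually_atTop.1
    (hlim.eventually_lt_const (by positivity : (0 : ℝ) < (d / 2) ^ N))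
  refine ⟨max (max n₁ n₂) 1, ?_⟩
  have hcont : Tendsto (fun z => ‖z - s‖) (𝓝 z₀) (𝓝 d) := by
    have : Continuous fun z : ℂ => ‖z - s‖ := by fun_prop
    have h1 := this.tendsto z₀
    rwa [← dist_eq_norm, dist_comm] at h1
  filter_upwards [hlow, hcont.eventually_lt_const hdR₁,
    hcont.eventually_const_lt (half_lt_self hd0)] with z h1 h2 h3 n hn
  have hn1 : n₁ ≤ n := (le_max_left _ _).trans ((le_max_left _ _).trans hn)
  have hn2 : n₂ ≤ n := (le_max_right _ _).trans ((le_max_left _ _).trans hn)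
  have hn0 : 0 < (n : ℝ) := by
    have : 1 ≤ n := (le_max_right _ _).trans hn
    exact_mod_cast this
  have h4 := h1 n hn1
  have hr0 : 0 < ‖z - s‖ := by linarith
  have h5 : (d / 2) ^ N ≤ ‖z - s‖ ^ N := pow_le_pow_left₀ (by positivity) h3.le N
  have h6 : ‖z - s‖ ^ n ≤ R₁ ^ n := pow_le_pow_left₀ hr0.le h2.le n
  have h7 := hn₂ n hn2
  rw [div_pow, mul_div_assoc', div_lt_iff₀ (by positivity)] at h7
  rw [div_le_div_iff₀ (by positivity) (by positivity), one_mul]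
  rw [div_le_div_iff₀ (by positivity) (by positivity)] at h4
  set Y := ‖iteratedDeriv n y z‖
  have hY : 0 ≤ Y := norm_nonneg _
  have hf : (0 : ℝ) < n.factorial := by exact_mod_cast n.factorial_pos
  have h8 : (d / 2) ^ N * n.factorial ≤ R₁ ^ n * Y * n ^ N := by
    calc (d / 2) ^ N * n.factorial ≤ ‖z - s‖ ^ N * n.factorial := by gcongr
      _ ≤ ‖z - s‖ ^ n * Y * n ^ N := h4
      _ ≤ R₁ ^ n * Y * n ^ N := by gcongr
  have h9 : (n : ℝ) ^ N * R₁ ^ n * Y ≤ (d / 2) ^ N * R ^ n * Y :=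
    mul_le_mul_of_nonneg_right h7.le hY
  have h10 : (d / 2) ^ N * n.factorial ≤ (d / 2) ^ N * (Y * R ^ n) := by linarith
  exact le_of_mul_le_mul_left h10 (by positivity)

/-- A solution with larger radius of convergence is dominated by one with a smaller radius. -/
theorem exists_decay (hz₀ : z₀ ∉ bisectors q) {s s' : ℂ}
    (hs : s ∈ singularPoints q) (hz₀s : z₀ ≠ s) (D : SingularData q s) {y y' : ℂ → ℂ}
    (hy : IsSolAt q y z₀) (hys : HasLevel y z₀ s) (hys' : HasLevel y' z₀ s')
    (hd : dist s z₀ < dist s' z₀) : ∃ (ε : ℕ → ℝ) (n₁ : ℕ), (∀ n, 0 ≤ ε n) ∧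
      Tendsto ε atTop (𝓝 0) ∧ ∀ᶠ z in 𝓝 z₀, ∀ n ≥ n₁,
        ‖iteratedDeriv n y' z‖ ≤ ε n * ‖iteratedDeriv n y z‖ := by
  have hd0 : 0 < dist s z₀ := dist_pos.2 hz₀s.symm
  set R := dist s z₀ + (dist s' z₀ - dist s z₀) / 3 with hR
  set ρ := dist s z₀ + 2 * (dist s' z₀ - dist s z₀) / 3 with hρ
  have h1 : dist s z₀ < R := by rw [hR]; linarith
  have h2 : R < ρ := by rw [hR, hρ]; linarith
  have h3 : ρ < dist s' z₀ := by rw [hρ]; linarith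
  have hR0 : 0 < R := hd0.trans h1
  have hρ0 : 0 < ρ := hR0.trans h2
  obtain ⟨n₁, hlow⟩ := hys.exists_geometric_lower_bound hz₀ hs hz₀s D hy h1
  obtain ⟨C, hup⟩ := hys'.1.exists_upper_bound hρ0 h3
  refine ⟨fun n => |C| * (R / ρ) ^ n, n₁, fun n => by positivity, ?_, ?_⟩
  · have := (tendsto_pow_atTop_nhds_zero_of_lt_one (by positivity : 0 ≤ R / ρ)
      ((div_lt_one hρ0).2 h2)).const_mul |C|
    simpa using this
  · filter_upwards [hlow, hup] with z hz1 hz2 n hn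
    have e1 := hz1 n hn
    have e2 := hz2 n
    have hf : (0 : ℝ) < n.factorial := by exact_mod_cast n.factorial_pos
    rw [div_le_iff₀ hf] at e2
    rw [le_div_iff₀ hf, div_mul_eq_mul_div, one_mul, div_le_iff₀ (by positivity)] at e1
    refine e2.trans ?_
    have e3 : C / ρ ^ n * n.factorial ≤ |C| / ρ ^ n * n.factorial := by
      gcongr
      exact le_abs_self C
    refine e3.trans ?_
    calc |C| / ρ ^ n * n.factorial
        ≤ |C| / ρ ^ n * (‖iteratedDeriv n y z‖ * R ^ n) := by gcongr
      _ = |C| * (R / ρ) ^ n * ‖iteratedDeriv n y z‖ := by rw [div_pow]; ring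

/-- The domination of `exists_decay` with the same rate for finitely many solutions. -/
theorem exists_uniform_decay (hF : IsFuchsian q) (hG : IsGeneric q) (hm : 0 < m)
    (hz₀ : z₀ ∉ bisectors q) {T : Finset ℂ} {e : ℂ → ℂ → ℂ}
    (hT : ∀ s ∈ T, s ∈ singularPoints q ∧ s ≠ z₀ ∧ IsSolAt q (e s) z₀ ∧ HasLevel (e s) z₀ s) :
    ∃ (ε : ℕ → ℝ) (n₁ : ℕ), (∀ n, 0 ≤ ε n) ∧ Tendsto ε atTop (𝓝 0) ∧
      (∀ᶠ z in 𝓝 z₀, ∀ n ≥ n₁, ∀ s ∈ T, iteratedDeriv n (e s) z ≠ 0) ∧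
      ∀ᶠ z in 𝓝 z₀, ∀ n ≥ n₁, ∀ s ∈ T, ∀ s' ∈ T, dist s z₀ < dist s' z₀ →
        ‖iteratedDeriv n (e s') z‖ ≤ ε n * ‖iteratedDeriv n (e s) z‖ := by
  classical
  have h1 : ∀ x : ℂ × ℂ, ∃ (ε : ℕ → ℝ) (n₁ : ℕ), (∀ n, 0 ≤ ε n) ∧ Tendsto ε atTop (𝓝 0) ∧
      (x.1 ∈ T → x.2 ∈ T → dist x.1 z₀ < dist x.2 z₀ → ∀ᶠ z in 𝓝 z₀, ∀ n ≥ n₁,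
        ‖iteratedDeriv n (e x.2) z‖ ≤ ε n * ‖iteratedDeriv n (e x.1) z‖) := by
    rintro ⟨s, s'⟩
    by_cases h : s ∈ T ∧ s' ∈ T ∧ dist s z₀ < dist s' z₀
    · obtain ⟨hs, hs', hd⟩ := h
      obtain ⟨D⟩ := nonempty_singularData hF hG hm (hT s hs).1
      obtain ⟨ε, n₁, h1, h2, h3⟩ := exists_decay hz₀ (hT s hs).1 (hT s hs).2.1.symm D
        (hT s hs).2.2.1 (hT s hs).2.2.2 (hT s' hs').2.2.2 hd
      exact ⟨ε, n₁, h1, h2, fun _ _ _ => h3⟩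
    · exact ⟨0, 0, fun n => le_rfl, tendsto_const_nhds, fun h1 h2 h3 => absurd ⟨h1, h2, h3⟩ h⟩
  choose ε n₁ hε0 hεt hε using h1
  have h2 : ∀ s : ℂ, ∃ n₂ : ℕ, s ∈ T → ∀ᶠ z in 𝓝 z₀, ∀ n ≥ n₂, iteratedDeriv n (e s) z ≠ 0 := by
    intro s
    by_cases hs : s ∈ T
    · obtain ⟨D⟩ := nonempty_singularData hF hG hm (hT s hs).1
      obtain ⟨n₂, hn₂⟩ := (hT s hs).2.2.2.exists_geometric_lower_bound hz₀ (hT s hs).1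
        (hT s hs).2.1.symm D (hT s hs).2.2.1 (lt_add_one _)
      refine ⟨n₂, fun _ => hn₂.mono fun z hz n hn h0 => ?_⟩
      have := hz n hn
      rw [h0, norm_zero, zero_div] at this
      have hpos : 0 < 1 / (dist s z₀ + 1) ^ n := by positivity
      linarith
    · exact ⟨0, fun h => absurd h hs⟩
  choose n₂ hn₂ using h2
  refine ⟨fun n => ∑ x ∈ T ×ˢ T, ε x n, (∑ x ∈ T ×ˢ T, n₁ x) + ∑ s ∈ T, n₂ s,
    fun n => Finset.sum_nonneg fun x _ => hε0 x n, ?_, ?_, ?_⟩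
  · have := tendsto_finsetSum (T ×ˢ T) fun x _ => hεt x
    simpa using this
  · have : ∀ᶠ z in 𝓝 z₀, ∀ s ∈ T, ∀ n ≥ n₂ s, iteratedDeriv n (e s) z ≠ 0 :=
      (Finset.eventually_all T).2 fun s hs => hn₂ s hs
    filter_upwards [this] with z hz n hn s hs
    refine hz s hs n (le_trans ?_ hn)
    exact (Finset.single_le_sum (fun s _ => Nat.zero_le (n₂ s)) hs).trans (Nat.le_add_left _ _)
  · have : ∀ᶠ z in 𝓝 z₀, ∀ x ∈ T ×ˢ T, dist x.1 z₀ < dist x.2 z₀ → ∀ n ≥ n₁ x,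
        ‖iteratedDeriv n (e x.2) z‖ ≤ ε x n * ‖iteratedDeriv n (e x.1) z‖ :=
      (Finset.eventually_all _).2 fun x hx => by
        obtain ⟨hx1, hx2⟩ := Finset.mem_product.1 hx
        by_cases hd : dist x.1 z₀ < dist x.2 z₀
        · filter_upwards [hε x hx1 hx2 hd] with z hz _ using hz
        · exact Eventually.of_forall fun z h => absurd h hd
    filter_upwards [this] with z hz n hn s hs s' hs' hd
    have hx : (s, s') ∈ T ×ˢ T := Finset.mk_mem_product hs hs'
    refine (hz (s, s') hx hd n (le_trans ?_ hn)).trans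
      (mul_le_mul_of_nonneg_right ?_ (norm_nonneg _))
    · exact (Finset.single_le_sum (fun x _ => Nat.zero_le (n₁ x)) hx).trans (Nat.le_add_right _ _)
    · exact Finset.single_le_sum (f := fun x => ε x n) (fun x _ => hε0 x n) hx

theorem analyticAt_matrix_inv {B : ℂ → Matrix (Fin m) (Fin m) ℂ} {z : ℂ}
    (hB : ∀ a i, AnalyticAt ℂ (fun w => B w a i) z) (hd : (B z).det ≠ 0) (i a : Fin m) :
    AnalyticAt ℂ (fun w => (B w)⁻¹ i a) z := by
  have hev : ∀ᶠ w in 𝓝 z, ∀ a i, DifferentiableAt ℂ (fun w => B w a i) w :=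
    eventually_all.2 fun a => eventually_all.2 fun i =>
      (hB a i).eventually_analyticAt.mono fun w hw => hw.differentiableAt
  have hdet : AnalyticAt ℂ (fun w => (B w).det) z :=
    Complex.analyticAt_iff_eventually_differentiableAt.2
      (hev.mono fun w hw => differentiableAt_det hw)
  have hadj : AnalyticAt ℂ (fun w => (B w).adjugate i a) z :=
    Complex.analyticAt_iff_eventually_differentiableAt.2
      (hev.mono fun w hw => differentiableAt_adjugate hw i a)
  have h1 : (fun w => (B w)⁻¹ i a) = fun w => ((B w).det)⁻¹ * (B w).adjugate i a := by
    ext w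
    rw [Matrix.inv_def, Ring.inverse_eq_inv']
    rfl
  rw [h1]
  exact (hdet.inv hd).mul hadj

theorem eq_sum_inv_mul {B : Matrix (Fin m) (Fin m) ℂ} (hB : B.det ≠ 0) {x v : Fin m → ℂ}
    (h : ∀ a, ∑ i, x i * B a i = v a) (i : Fin m) : x i = ∑ a, B⁻¹ i a * v a := by
  have h1 : B.mulVec x = v := by
    ext a
    rw [← h a]
    simp only [Matrix.mulVec, dotProduct]
    exact Finset.sum_congr rfl fun i _ => mul_comm (B a i) (x i)
  have h2 : B⁻¹.mulVec v = x := by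
    rw [← h1, Matrix.mulVec_mulVec, Matrix.nonsing_inv_mul _ (isUnit_iff_ne_zero.2 hB),
      Matrix.one_mulVec]
  rw [← h2]
  rfl

/-- The derivatives of high order of a solution are combinations of those of the solutions with
a level. -/
theorem eventually_iteratedDeriv_eq_sum {n₀ : ℕ}
    (hn₀ : ∀ (z₀ : ℂ) (y : ℂ → ℂ), IsSolAt q y z₀ → (∀ ρ, ExtendsToBall y z₀ ρ) →
      ∀ᶠ z in 𝓝 z₀, ∀ n ≥ n₀, iteratedDeriv n y z = 0)
    {T : Finset ℂ} {e : ℂ → ℂ → ℂ} (he : ∀ s ∈ T, IsSolAt q (e s) z₀) {y : ℂ → ℂ}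
    (hy : IsSolAt q y z₀) {γ : ℂ → ℂ}
    (hγ : ∀ ρ, ExtendsToBall (fun w => y w - ∑ s ∈ T, γ s * e s w) z₀ ρ) :
    ∀ᶠ z in 𝓝 z₀, ∀ n ≥ n₀, iteratedDeriv n y z = ∑ s ∈ T, γ s * iteratedDeriv n (e s) z := by
  have hsum : IsSolAt q (fun w => ∑ s ∈ T, γ s * e s w) z₀ := IsSolAt.sum T he
  have hsol : IsSolAt q (fun w => y w - ∑ s ∈ T, γ s * e s w) z₀ := by
    have := hy.sub_smul hsum 1
    simpa only [one_mul] using this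
  have h2 : ∀ᶠ z in 𝓝 z₀, ∀ s ∈ T, AnalyticAt ℂ (e s) z :=
    (Finset.eventually_all T).2 fun s hs => (he s hs).1.eventually_analyticAt
  filter_upwards [hn₀ z₀ _ hsol hγ, hy.1.eventually_analyticAt, h2] with z h1 h3 h4 n hn
  have h5 := h1 n hn
  have hsa : AnalyticAt ℂ (fun w => ∑ s ∈ T, γ s * e s w) z :=
    Finset.analyticAt_fun_sum T fun s hs => analyticAt_const.mul (h4 s hs)
  have h6 : (fun w => y w - ∑ s ∈ T, γ s * e s w) = y - fun w => ∑ s ∈ T, γ s * e s w := rfl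
  rw [h6, iteratedDeriv_sub h3.contDiffAt hsa.contDiffAt,
    (iteratedDeriv_sum_mul T h4 n).self_of_nhds] at h5
  exact sub_eq_zero.1 h5

/-- At an ordinary point the expansion has the terms `(e s)^(n)` of the solutions with a level, no
poles, and a coefficient of the closest term that does not vanish at the point. -/
theorem isTameAt_of_notMem (hS : (singularPoints q).Nonempty) (hF : IsFuchsian q)
    (hG : IsGeneric q) (hm : 0 < m) (hz₀ : z₀ ∉ bisectors q) (hz₀S : z₀ ∉ singularPoints q) :
    IsTameAt q z₀ := by
  classical
  obtain ⟨T, e, hT, hdec⟩ := exists_level_decomposition hF hG hm hz₀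
  obtain ⟨n₂, hn₂⟩ := exists_forall_iteratedDeriv_eq_zero hF hm
  obtain ⟨ρ, hρ, hρS, hsol⟩ := exists_local_solution hz₀S hm
  choose Y hYsol hYdata using fun a : Fin m => hsol (Pi.single a 1)
  have hz₀ρ : z₀ ∈ Metric.ball z₀ ρ := Metric.mem_ball_self hρ
  have hW1 : dataMatrix Y z₀ = 1 := by
    ext a i
    simp only [dataMatrix, Matrix.of_apply, hYdata a i, Pi.single_apply, Matrix.one_apply,
      eq_comm]
  choose γ hγ using fun a => hdec (Y a) (hYsol a z₀ hz₀ρ)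
  have hYn := fun a => eventually_iteratedDeriv_eq_sum hn₂ (fun s hs => (hT s hs).2.2.1)
    (hYsol a z₀ hz₀ρ) (hγ a)
  have hWan : ∀ a i, AnalyticAt ℂ (fun w => dataMatrix Y w a i) z₀ := fun a i =>
    AnalyticAt.iteratedDeriv' (hYsol a z₀ hz₀ρ).1 i
  have hdet0 : (dataMatrix Y z₀).det ≠ 0 := by rw [hW1, Matrix.det_one]; exact one_ne_zero
  have hWinv := analyticAt_matrix_inv hWan hdet0
  have hdet : ∀ᶠ z in 𝓝 z₀, (dataMatrix Y z).det ≠ 0 := by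
    have hc : ContinuousAt (fun z => (dataMatrix Y z).det) z₀ :=
      (differentiableAt_det fun a i => (hWan a i).differentiableAt).continuousAt
    exact hc.eventually_ne hdet0
  -- Cramer's rule gives the coefficients.
  have heq : ∀ᶠ z in 𝓝 z₀, ∀ n ≥ n₂, ∀ j, value (derivCoeff q n j) z
      = ∑ s ∈ T, iteratedDeriv n (e s) z * ∑ a, (dataMatrix Y z)⁻¹ j a * γ a s := by
    filter_upwards [hdet, eventually_all.2 hYn, Metric.ball_mem_nhds z₀ hρ] with z h1 h2 h3 n hn j
    have hzS : z ∉ singularPoints q := Set.disjoint_left.1 hρS h3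
    have h4 : ∀ a, ∑ i, value (derivCoeff q n i) z * dataMatrix Y z a i = iteratedDeriv n (Y a) z :=
      fun a => ((hYsol a z h3).iteratedDeriv_eq hzS hm n).symm
    rw [eq_sum_inv_mul h1 h4 j]
    simp only [h2 _ n hn, Finset.mul_sum]
    rw [Finset.sum_comm]
    exact Finset.sum_congr rfl fun s _ => Finset.sum_congr rfl fun a _ => by ring
  have hTne : T.Nonempty := by
    by_contra hTe
    rw [Finset.not_nonempty_iff_eq_empty] at hTe
    have hzero : ∀ n ≥ n₂, ∀ j, derivCoeff q n j = 0 := fun n hn j => by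
      refine eq_zero_of_value_eq_zero (z₀ := z₀) (nhdsWithin_le_nhds ?_)
      filter_upwards [heq] with z hz
      rw [hz n hn j, hTe, Finset.sum_empty]
    obtain ⟨s, hs⟩ := hS
    obtain ⟨D⟩ := nonempty_singularData hF hG hm hs
    obtain ⟨n₁, hn₁⟩ := D.exists_lower_bound_y
    have hr := D.pos
    have hz := add_mem_slitDisc s (ε := D.r / 8) (r := D.r / 4) (by linarith) (by linarith)
    set z : ℂ := s + (D.r / 8 : ℝ)
    set n := max (max n₁ n₂) 1
    have hz' : z ∈ slitDisc s D.r := slitDisc_mono s (by linarith) hz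
    have h1 := hn₁ n ((le_max_left _ _).trans (le_max_left _ _)) z hz
    rw [(D.frame.sol_y z hz').iteratedDeriv_eq
      (D.frame.notMem hz'.1 (ne_of_mem_slitDisc hz')) hm n] at h1
    simp only [hzero n ((le_max_right _ _).trans (le_max_left _ _)), value_zero, zero_mul,
      Finset.sum_const_zero, norm_zero, mul_zero, zero_div] at h1
    have hzn : 0 < ‖z - s‖ := norm_pos_iff.2 (sub_ne_zero.2 (ne_of_mem_slitDisc hz))
    have hn0 : 0 < (n : ℝ) := by
      have : 1 ≤ n := le_max_right _ _
      exact_mod_cast this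
    have : 0 < ‖z - s‖ ^ D.N / (n : ℝ) ^ D.N := by positivity
    linarith
  obtain ⟨s₀, hs₀, hmin⟩ := Finset.exists_min_image T (fun s => dist s z₀) hTne
  have hinj : ∀ s ∈ T, ∀ s' ∈ T, dist s z₀ = dist s' z₀ → s = s' := fun s hs s' hs' =>
    eq_of_dist_eq hz₀ (hT s hs).1 (hT s' hs').1
  have hlt : ∀ s ∈ T, s ≠ s₀ → dist s₀ z₀ < dist s z₀ := fun s hs hne =>
    lt_of_le_of_ne (hmin s hs) fun h => hne (hinj s hs s₀ hs₀ h.symm)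
  have hγ0 : ∃ a, γ a s₀ ≠ 0 := by
    by_contra! h0
    -- Otherwise all solutions would extend beyond `s₀`.
    obtain ⟨R, hR, hRT⟩ : ∃ R > dist s₀ z₀, ∀ s ∈ T.erase s₀, R ≤ dist s z₀ := by
      rcases (T.erase s₀).eq_empty_or_nonempty with h | h
      · exact ⟨dist s₀ z₀ + 1, lt_add_one _, by simp [h]⟩
      · obtain ⟨s₁, hs₁, hm₁⟩ := Finset.exists_min_image _ (fun s => dist s z₀) h
        exact ⟨dist s₁ z₀, hlt s₁ (Finset.mem_of_mem_erase hs₁) (Finset.ne_of_mem_erase hs₁), hm₁⟩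
    have hYext : ∀ a, ExtendsToBall (Y a) z₀ R := fun a => by
      refine ((hγ a R).add (ExtendsToBall.sum_mul (c := γ a) (f := e) (T.erase s₀)
        fun s hs => (hT s (Finset.mem_of_mem_erase hs)).2.2.2.1.mono (hRT s hs))).congr
        (Eventually.of_forall fun w => ?_)
      simp only
      rw [← Finset.add_sum_erase _ _ hs₀, h0 a]
      ring
    obtain ⟨c, hc⟩ := exists_eventuallyEq_sum_of_isUnit hm hz₀S (fun a => hYsol a z₀ hz₀ρ)
      (isUnit_iff_ne_zero.2 hdet0) (hT s₀ hs₀).2.2.1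
    exact (hT s₀ hs₀).2.2.2.2 ⟨R, hR, (ExtendsToBall.sum_mul Finset.univ
      fun a _ => hYext a).congr hc.symm⟩
  obtain ⟨ε, n₁, hε0, hεt, hne, hdecay⟩ := exists_uniform_decay hF hG hm hz₀ hT
  have hb : ∀ s, ∀ j, AnalyticAt ℂ (fun z => ∑ a, (dataMatrix Y z)⁻¹ j a * γ a s) z₀ :=
    fun s j => Finset.analyticAt_fun_sum _ fun a _ => (hWinv j a).mul analyticAt_const
  refine LocalExpansion.isTameAt (T := T) (X := fun s n z => iteratedDeriv n (e s) z)
    (b := fun s j z => ∑ a, (dataMatrix Y z)⁻¹ j a * γ a s) (k := 0) (n₀ := max n₁ n₂) (ε := ε)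
    (s₀ := s₀) (μ := 0) (u := fun j z => ∑ a, (dataMatrix Y z)⁻¹ j a * γ a s₀)
    { mem := hs₀
      min := hmin
      inj := hinj
      eps_nonneg := hε0
      tendsto_eps := hεt
      analytic := fun s _ j => hb s j
      eq := ?_
      ne := ?_
      decay := ?_
      decay_lead := ?_
      analytic_lead := hb s₀
      lead_ne := ?_
      lead_eq := ?_ }
  · filter_upwards [nhdsWithin_le_nhds heq] with z hz n hn j
    rw [pow_zero, mul_one]
    exact hz n ((le_max_right _ _).trans hn) j
  · filter_upwards [nhdsWithin_le_nhds hne] with z hz n hn s hs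
    exact hz n ((le_max_left _ _).trans hn) s hs
  · filter_upwards [nhdsWithin_le_nhds hdecay] with z hz n hn
    exact hz n ((le_max_left _ _).trans hn)
  · filter_upwards [nhdsWithin_le_nhds hdecay] with z hz n hn s hs hss
    rw [pow_zero, one_mul]
    exact hz n ((le_max_left _ _).trans hn) s₀ hs₀ s hs (hlt s hs hss)
  · obtain ⟨a, ha⟩ := hγ0
    refine ⟨a, ?_⟩
    simpa [hW1, Matrix.one_apply] using ha
  · exact Eventually.of_forall fun z j => by rw [pow_zero, one_mul]

end

/-! ### The expansion at a singular point -/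

section

variable {m : ℕ} {q : Fin m → RatFunc ℂ} {t : ℂ}

/-- Finitely many holomorphic germs, not all zero, divided by the highest common power of the
local coordinate. -/
theorem exists_common_zero_order {ι : Type*} [Finite ι] {F : ι → ℂ → ℂ}
    (hF : ∀ j, AnalyticAt ℂ (F j) t) (hne : ∃ j, ¬ ∀ᶠ z in 𝓝 t, F j z = 0) :
    ∃ (μ : ℕ) (u : ι → ℂ → ℂ), (∀ j, AnalyticAt ℂ (u j) t) ∧ (∃ j, u j t ≠ 0) ∧
      ∀ᶠ z in 𝓝 t, ∀ j, F j z = (z - t) ^ μ * u j z := by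
  obtain ⟨j₁, hj₁⟩ := hne
  have : Nonempty ι := ⟨j₁⟩
  obtain ⟨j₀, hj₀⟩ := Finite.exists_min fun j => analyticOrderAt (F j) t
  have htop : analyticOrderAt (F j₀) t ≠ ⊤ := fun h => by
    have h1 := hj₀ j₁
    rw [h, top_le_iff] at h1
    exact hj₁ (analyticOrderAt_eq_top.1 h1)
  obtain ⟨μ, hμ⟩ := ENat.ne_top_iff_exists.1 htop
  have h1 : ∀ j, ∃ g : ℂ → ℂ, AnalyticAt ℂ g t ∧ ∀ᶠ z in 𝓝 t, F j z = (z - t) ^ μ • g z :=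
    fun j => (natCast_le_analyticOrderAt (hF j)).1 (hμ ▸ hj₀ j)
  obtain ⟨g₀, hg₀, hg₀t, hg₀F⟩ := ((hF j₀).analyticOrderAt_eq_natCast).1 hμ.symm
  choose u hu huF using h1
  refine ⟨μ, u, hu, ⟨j₀, ?_⟩, (eventually_all.2 huF).mono fun z hz j => by
    rw [hz j, smul_eq_mul]⟩
  have h2 : ∀ᶠ z in 𝓝[≠] t, u j₀ z = g₀ z := by
    filter_upwards [nhdsWithin_le_nhds (huF j₀), nhdsWithin_le_nhds hg₀F, self_mem_nhdsWithin]
      with z h3 h4 h5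
    rw [h3, smul_eq_mul, smul_eq_mul] at h4
    exact mul_left_cancel₀ (pow_ne_zero _ (sub_ne_zero.2 h5)) h4
  have h3 : u j₀ t = g₀ t := tendsto_nhds_unique_of_eventuallyEq
    ((hu j₀).continuousAt.tendsto.mono_left nhdsWithin_le_nhds)
    (hg₀.continuousAt.tendsto.mono_left nhdsWithin_le_nhds) h2
  rw [h3]
  exact hg₀t

theorem pow_div_le_of_le_half {u ρ : ℝ} (hu : 0 ≤ u) (hρ : 0 < ρ) (hle : u ≤ ρ / 2) {L n : ℕ}
    (hn : L ≤ n) : (u / ρ) ^ n ≤ u ^ L * ((2 / ρ) ^ L * (1 / 2) ^ n) := by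
  have h1 : u / ρ ≤ 1 / 2 := by rw [div_le_iff₀ hρ]; linarith
  obtain ⟨d, rfl⟩ := Nat.exists_eq_add_of_le hn
  calc (u / ρ) ^ (L + d) = (u / ρ) ^ L * (u / ρ) ^ d := pow_add _ _ _
    _ ≤ (u / ρ) ^ L * (1 / 2) ^ d := by gcongr
    _ = u ^ L * ((2 / ρ) ^ L * (1 / 2) ^ (L + d)) := by
      rw [pow_add, div_pow, div_pow, div_pow, div_pow]
      field_simp
      rw [one_pow, mul_one]

theorem tendsto_const_mul_pow_mul_half_pow (c : ℝ) (N : ℕ) :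
    Tendsto (fun n : ℕ => c * ((n : ℝ) ^ N * (1 / 2) ^ n)) atTop (𝓝 0) := by
  have h := tendsto_pow_const_mul_const_pow_of_abs_lt_one N
    (by rw [abs_of_pos (by norm_num)]; norm_num : |(1 / 2 : ℝ)| < 1)
  simpa using h.const_mul c

namespace SingularData

variable (D : SingularData q t)

theorem extendsToBall_g {a : Fin m} (ha : a ≠ D.a₀) : ExtendsToBall (D.g a) t D.r :=
  ⟨D.g a, fun _ hw => (D.frame.analyticAt_g ha hw).differentiableAt.differentiableWithinAt,
    EventuallyEq.rfl⟩

/-- The linear system for the coefficients `q_{i,n}`: the frame consists of solutions, except for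
its row `a₀`. -/
theorem sum_value_mul_frameMatrix (hm : 0 < m) {w : ℂ} (hw : w ∈ Metric.ball t D.r) (hwt : w ≠ t)
    (n : ℕ) (a : Fin m) :
    ∑ i, value (derivCoeff q n i) w * frameMatrix D.g D.a₀ w a i
      = if a = D.a₀ then value (derivCoeff q n (lastIdx D.a₀)) w
        else iteratedDeriv n (D.g a) w := by
  split_ifs with ha
  · rw [ha]
    simp [frameMatrix_self]
  · simp only [frameMatrix_of_ne ha]
    exact ((D.frame.sol_g a ha w hw).iteratedDeriv_eq (D.frame.notMem hw hwt) hm n).symm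

/-- The derivatives of the singular solution in terms of `q_{m-1,n}` and the holomorphic
solutions. -/
theorem iteratedDeriv_y_eq (hm : 0 < m) {w : ℂ} (hw : w ∈ slitDisc t D.r) (n : ℕ) :
    iteratedDeriv n D.y w = ∑ a, frameCoeff D.g D.a₀ D.y a w *
      if a = D.a₀ then value (derivCoeff q n (lastIdx D.a₀)) w else iteratedDeriv n (D.g a) w := by
  have hwt := ne_of_mem_slitDisc hw
  rw [(D.frame.sol_y w hw).iteratedDeriv_eq (D.frame.notMem hw.1 hwt) hm n]
  simp only [← D.sum_value_mul_frameMatrix hm hw.1 hwt n,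
    ← sum_frameCoeff_mul (y := D.y) (D.det_ne w hw.1 hwt), Finset.mul_sum]
  rw [Finset.sum_comm]
  exact Finset.sum_congr rfl fun a _ => Finset.sum_congr rfl fun i _ => by ring

/-- Up to the slit and a moderate factor, `q_{m-1,n}` is at least as large as the `n`-th
derivative of the singular solution. -/
theorem exists_lower_bound_last_slitDisc (hm : 0 < m) : ∃ (L N n₁ : ℕ) (c δ : ℝ), 0 < c ∧ 0 < δ ∧
    δ ≤ D.r ∧ ∀ n ≥ n₁, ∀ z ∈ slitDisc t δ, c * ‖z - t‖ ^ L / (n : ℝ) ^ N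
      ≤ ‖z - t‖ ^ n * ‖value (derivCoeff q n (lastIdx D.a₀)) z‖ / n.factorial := by
  obtain ⟨n₁, hlow⟩ := D.exists_lower_bound_y
  obtain ⟨M, C, hC⟩ := D.moderate
  have hr := D.pos
  obtain ⟨ρ, hρ⟩ : ∃ ρ, ρ = D.r / 2 := ⟨_, rfl⟩
  have hρ0 : 0 < ρ := hρ ▸ half_pos hr
  have hup : ∀ a, ∃ A, a ≠ D.a₀ → ∀ᶠ z in 𝓝 t, ∀ n : ℕ,
      ‖iteratedDeriv n (D.g a) z‖ / n.factorial ≤ A / ρ ^ n := fun a => by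
    by_cases ha : a = D.a₀
    · exact ⟨0, fun h => absurd ha h⟩
    · obtain ⟨A, hA⟩ := (D.extendsToBall_g ha).exists_upper_bound hρ0 (hρ ▸ half_lt_self hr)
      exact ⟨A, fun _ => hA⟩
  choose A hA using hup
  have hA' : ∀ᶠ z in 𝓝 t, ∀ a, a ≠ D.a₀ → ∀ n : ℕ,
      ‖iteratedDeriv n (D.g a) z‖ / n.factorial ≤ A a / ρ ^ n := eventually_all.2 fun a => by
    by_cases ha : a = D.a₀
    · exact Eventually.of_forall fun z h => absurd ha h
    · exact (hA a ha).mono fun z hz _ => hz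
  obtain ⟨δ₁, hδ₁, hball⟩ := Metric.eventually_nhds_iff_ball.1 hA'
  set C' := |C| + 1 with hC'
  have hC'0 : 0 < C' := by positivity
  set A' := ∑ a, |A a| with hA'
  have hA'0 : 0 ≤ A' := Finset.sum_nonneg fun a _ => abs_nonneg _
  set L := D.N + M with hL
  obtain ⟨n₂, hn₂⟩ := eventually_atTop.1 ((tendsto_const_mul_pow_mul_half_pow
    (C' * A' * (2 / ρ) ^ L) D.N).eventually_lt_const (by norm_num : (0 : ℝ) < 1 / 2))
  refine ⟨L, D.N, max (max n₁ n₂) (max L 1), 1 / (2 * C'), min δ₁ (D.r / 4), by positivity,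
    lt_min hδ₁ (by linarith), (min_le_right _ _).trans (by linarith), fun n hn z hz => ?_⟩
  have hn1 : n₁ ≤ n := (le_max_left _ _).trans ((le_max_left _ _).trans hn)
  have hn2 : n₂ ≤ n := (le_max_right _ _).trans ((le_max_left _ _).trans hn)
  have hnL : L ≤ n := (le_max_left _ _).trans ((le_max_right _ _).trans hn)
  have hn0 : 0 < (n : ℝ) := by
    have : 1 ≤ n := (le_max_right _ _).trans ((le_max_right _ _).trans hn)
    exact_mod_cast this
  have hf : (0 : ℝ) < n.factorial := by exact_mod_cast n.factorial_pos
  have hz4 : z ∈ slitDisc t (D.r / 4) := slitDisc_mono t (min_le_right _ _) hz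
  have hzr : z ∈ slitDisc t D.r := slitDisc_mono t (by linarith) hz4
  have hz1 : z ∈ Metric.ball t δ₁ := Metric.ball_subset_ball (min_le_left _ _) hz.1
  set u := ‖z - t‖ with hu
  have hu0 : 0 < u := norm_pos_iff.2 (sub_ne_zero.2 (ne_of_mem_slitDisc hz))
  have hu4 : u ≤ ρ / 2 := by
    have h1 : dist z t < D.r / 4 := hz4.1
    rw [dist_eq_norm] at h1
    rw [hρ]
    linarith
  set Q := ‖value (derivCoeff q n (lastIdx D.a₀)) z‖ with hQ
  have hQ0 : 0 ≤ Q := norm_nonneg _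
  have h1 := hlow n hn1 z hz4
  -- The contribution of the holomorphic solutions is small.
  have h2 : u ^ M * ‖iteratedDeriv n D.y z‖ ≤ C' * (Q + A' / ρ ^ n * n.factorial) := by
    rw [D.iteratedDeriv_y_eq hm hzr n]
    calc u ^ M * ‖∑ a, frameCoeff D.g D.a₀ D.y a z * (if a = D.a₀ then
          value (derivCoeff q n (lastIdx D.a₀)) z else iteratedDeriv n (D.g a) z)‖
        ≤ u ^ M * ∑ a, ‖frameCoeff D.g D.a₀ D.y a z‖ * ‖(if a = D.a₀ then
          value (derivCoeff q n (lastIdx D.a₀)) z else iteratedDeriv n (D.g a) z)‖ := by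
          gcongr
          refine (norm_sum_le _ _).trans (le_of_eq ?_)
          simp only [norm_mul]
      _ = ∑ a, (u ^ M * ‖frameCoeff D.g D.a₀ D.y a z‖) * ‖(if a = D.a₀ then
          value (derivCoeff q n (lastIdx D.a₀)) z else iteratedDeriv n (D.g a) z)‖ := by
          rw [Finset.mul_sum]
          simp only [mul_assoc]
      _ ≤ ∑ a, C' * ((if a = D.a₀ then Q else 0) + |A a| / ρ ^ n * n.factorial) := by
          refine Finset.sum_le_sum fun a _ => mul_le_mul ?_ ?_ (norm_nonneg _) hC'0.le
          · exact (hC a z hzr).trans ((le_abs_self C).trans (by rw [hC']; linarith))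
          · have hpos : 0 ≤ |A a| / ρ ^ n * n.factorial := by positivity
            split_ifs with ha
            · linarith
            · have h3 := hball z hz1 a ha n
              rw [div_le_iff₀ hf] at h3
              rw [zero_add]
              refine h3.trans ?_
              gcongr
              exact le_abs_self _
      _ = C' * (Q + A' / ρ ^ n * n.factorial) := by
          rw [← Finset.mul_sum, Finset.sum_add_distrib, Finset.sum_ite_eq' Finset.univ D.a₀,
            if_pos (Finset.mem_univ _), ← Finset.sum_mul, ← Finset.sum_div]
  have h3 := pow_div_le_of_le_half hu0.le hρ0 hu4 hnL
  have h4 := hn₂ n hn2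
  have h5 : C' * A' * (u / ρ) ^ n ≤ u ^ L / (n : ℝ) ^ D.N / 2 := by
    calc C' * A' * (u / ρ) ^ n ≤ C' * A' * (u ^ L * ((2 / ρ) ^ L * (1 / 2) ^ n)) := by gcongr
      _ = u ^ L / (n : ℝ) ^ D.N * (C' * A' * (2 / ρ) ^ L * ((n : ℝ) ^ D.N * (1 / 2) ^ n)) := by
          field_simp
      _ ≤ u ^ L / (n : ℝ) ^ D.N * (1 / 2) := by gcongr
      _ = _ := by ring
  have h6 : u ^ L / (n : ℝ) ^ D.N ≤ C' * (u ^ n * Q / n.factorial) + C' * A' * (u / ρ) ^ n := by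
    calc u ^ L / (n : ℝ) ^ D.N = u ^ M * (u ^ D.N / (n : ℝ) ^ D.N) := by
          rw [hL, pow_add]; ring
      _ ≤ u ^ M * (u ^ n * ‖iteratedDeriv n D.y z‖ / n.factorial) := by gcongr
      _ = u ^ n / n.factorial * (u ^ M * ‖iteratedDeriv n D.y z‖) := by ring
      _ ≤ u ^ n / n.factorial * (C' * (Q + A' / ρ ^ n * n.factorial)) := by gcongr
      _ = C' * (u ^ n * Q / n.factorial) + C' * A' * (u / ρ) ^ n := by
          have e1 : (n.factorial : ℝ) * (n.factorial : ℝ)⁻¹ = 1 := mul_inv_cancel₀ hf.ne'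
          rw [div_pow, div_eq_mul_inv _ (n.factorial : ℝ), div_eq_mul_inv _ (n.factorial : ℝ)]
          linear_combination C' * A' * u ^ n / ρ ^ n * e1
  have h7 : u ^ L / (n : ℝ) ^ D.N / 2 ≤ C' * (u ^ n * Q / n.factorial) := by linarith
  calc 1 / (2 * C') * u ^ L / (n : ℝ) ^ D.N = u ^ L / (n : ℝ) ^ D.N / 2 / C' := by
        field_simp
    _ ≤ u ^ n * Q / n.factorial := by
        rw [div_le_iff₀ hC'0, mul_comm _ C']
        exact h7

theorem tendsto_add_mul_I (z : ℂ) :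
    Tendsto (fun η : ℝ => z + (η : ℂ) * Complex.I) (𝓝[>] 0) (𝓝 z) := by
  have h : Continuous fun η : ℝ => z + (η : ℂ) * Complex.I := by fun_prop
  have h1 := h.tendsto 0
  rw [Complex.ofReal_zero, zero_mul, add_zero] at h1
  exact h1.mono_left nhdsWithin_le_nhds

/-- The lower bound for `q_{m-1,n}` on a full punctured disc. -/
theorem exists_lower_bound_last (hm : 0 < m) : ∃ (L N n₁ : ℕ) (c : ℝ), 0 < c ∧
    ∀ᶠ z in 𝓝[≠] t, ∀ n ≥ n₁, c * ‖z - t‖ ^ L / (n : ℝ) ^ N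
      ≤ ‖z - t‖ ^ n * ‖value (derivCoeff q n (lastIdx D.a₀)) z‖ / n.factorial := by
  obtain ⟨L, N, n₁, c, δ, hc, hδ, hδr, h⟩ := D.exists_lower_bound_last_slitDisc hm
  refine ⟨L, N, n₁, c, hc, ?_⟩
  filter_upwards [nhdsWithin_le_nhds (Metric.ball_mem_nhds t hδ), self_mem_nhdsWithin]
    with z hz hzt n hn
  by_cases hsl : z - t ∈ Complex.slitPlane
  · exact h n hn z ⟨hz, hsl⟩
  -- The estimate extends to the slit, since both sides are continuous there.
  have him : (z - t).im = 0 := by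
    by_contra h0
    exact hsl (Complex.mem_slitPlane_iff.2 (Or.inr h0))
  have hlim := tendsto_add_mul_I z
  have hev : ∀ᶠ η : ℝ in 𝓝[>] 0, z + (η : ℂ) * Complex.I ∈ slitDisc t δ := by
    filter_upwards [hlim.eventually (Metric.isOpen_ball.mem_nhds hz), self_mem_nhdsWithin]
      with η h1 h2
    refine ⟨h1, Complex.mem_slitPlane_iff.2 (Or.inr ?_)⟩
    rw [add_sub_right_comm, Complex.add_im, him, zero_add, Complex.im_ofReal_mul, Complex.I_im,
      mul_one]
    exact ne_of_gt h2
  have hzS := D.frame.notMem (Metric.ball_subset_ball hδr hz) hzt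
  have hn1 : ContinuousAt (fun w : ℂ => ‖w - t‖) z := by fun_prop
  have hv : ContinuousAt (fun w => ‖value (derivCoeff q n (lastIdx D.a₀)) w‖) z :=
    (analyticAt_value (not_isPole_derivCoeff hzS n _)).continuousAt.norm
  exact le_of_tendsto_of_tendsto
    ((((hn1.pow L).const_mul c).div_const ((n : ℝ) ^ N)).tendsto.comp hlim)
    ((((hn1.pow n).mul hv).div_const (n.factorial : ℝ)).tendsto.comp hlim)
    (hev.mono fun η hη => h n hn _ hη)

end SingularData

end

section

variable {m : ℕ} {q : Fin m → RatFunc ℂ} {t : ℂ}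

/-- Near the singular point `t`, a solution whose germ at `t` is holomorphic with a finite radius
of convergence is dominated by `q_{m-1,n}`, even after multiplication with a power of the
distance to `t`. -/
theorem SingularData.exists_decay_last (D : SingularData q t) (hm : 0 < m) (μ : ℕ) :
    ∃ n₁ : ℕ, (∀ᶠ z in 𝓝[≠] t, ∀ n ≥ n₁, value (derivCoeff q n (lastIdx D.a₀)) z ≠ 0) ∧
      ∀ (y : ℂ → ℂ) (ρ : ℝ), 0 < ρ → ExtendsToBall y t ρ →
        ∃ (ε : ℕ → ℝ) (n₂ : ℕ), (∀ n, 0 ≤ ε n) ∧ Tendsto ε atTop (𝓝 0) ∧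
          ∀ᶠ z in 𝓝[≠] t, ∀ n ≥ n₂, ‖iteratedDeriv n y z‖
            ≤ ε n * (‖z - t‖ ^ μ * ‖value (derivCoeff q n (lastIdx D.a₀)) z‖) := by
  obtain ⟨L, N, n₁, c, hc, hlow⟩ := D.exists_lower_bound_last hm
  refine ⟨max n₁ 1, ?_, fun y ρ' hρ' hy => ?_⟩
  · filter_upwards [hlow, self_mem_nhdsWithin] with z hz hzt n hn h0
    have h1 := hz n ((le_max_left _ _).trans hn)
    have hu0 : 0 < ‖z - t‖ := norm_pos_iff.2 (sub_ne_zero.2 hzt)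
    have hn0 : 0 < (n : ℝ) := by
      have : 1 ≤ n := (le_max_right _ _).trans hn
      exact_mod_cast this
    rw [h0, norm_zero, mul_zero, zero_div] at h1
    have h2 : 0 < c * ‖z - t‖ ^ L / (n : ℝ) ^ N := by positivity
    linarith
  · obtain ⟨ρ, hρ0, hρρ'⟩ : ∃ ρ, 0 < ρ ∧ ρ < ρ' := ⟨ρ' / 2, half_pos hρ', half_lt_self hρ'⟩
    obtain ⟨C, hup⟩ := hy.exists_upper_bound hρ0 hρρ'
    refine ⟨fun n => |C| * (2 / ρ) ^ (L + μ) / c * ((n : ℝ) ^ N * (1 / 2) ^ n),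
      max (max n₁ (L + μ)) 1, fun n => by positivity, tendsto_const_mul_pow_mul_half_pow _ N, ?_⟩
    have hclose : ∀ᶠ z in 𝓝 t, z ∈ Metric.ball t (ρ / 2) :=
      Metric.ball_mem_nhds t (half_pos hρ0)
    filter_upwards [hlow, nhdsWithin_le_nhds hup, nhdsWithin_le_nhds hclose, self_mem_nhdsWithin]
      with z hz1 hz2 hz3 hzt n hn
    have hn1 : n₁ ≤ n := (le_max_left _ _).trans ((le_max_left _ _).trans hn)
    have hn2 : L + μ ≤ n := (le_max_right _ _).trans ((le_max_left _ _).trans hn)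
    have hn0 : 0 < (n : ℝ) := by
      have : 1 ≤ n := (le_max_right _ _).trans hn
      exact_mod_cast this
    have hf : (0 : ℝ) < n.factorial := by exact_mod_cast n.factorial_pos
    have h1 := hz1 n hn1
    have h2 := hz2 n
    rw [Metric.mem_ball, dist_eq_norm] at hz3
    have hu0 : 0 < ‖z - t‖ := norm_pos_iff.2 (sub_ne_zero.2 hzt)
    have h3 := pow_div_le_of_le_half hu0.le hρ0 hz3.le hn2
    generalize ‖z - t‖ = u at *
    generalize ‖value (derivCoeff q n (lastIdx D.a₀)) z‖ = Q at *
    generalize ‖iteratedDeriv n y z‖ = Y at *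
    have h4 : u ^ n * (Y / n.factorial) ≤ u ^ n * (|C| * (2 / ρ) ^ (L + μ) / c
        * ((n : ℝ) ^ N * (1 / 2) ^ n) * (u ^ μ * Q) / n.factorial) := by
      calc u ^ n * (Y / n.factorial) ≤ u ^ n * (|C| / ρ ^ n) := by
            refine mul_le_mul_of_nonneg_left (h2.trans ?_) (by positivity)
            gcongr
            exact le_abs_self C
        _ = |C| * (u / ρ) ^ n := by rw [div_pow]; ring
        _ ≤ |C| * (u ^ (L + μ) * ((2 / ρ) ^ (L + μ) * (1 / 2) ^ n)) := by gcongr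
        _ = |C| * (2 / ρ) ^ (L + μ) / c * ((n : ℝ) ^ N * (1 / 2) ^ n) * u ^ μ
            * (c * u ^ L / (n : ℝ) ^ N) := by
            rw [pow_add u]
            field_simp
        _ ≤ |C| * (2 / ρ) ^ (L + μ) / c * ((n : ℝ) ^ N * (1 / 2) ^ n) * u ^ μ
            * (u ^ n * Q / n.factorial) := by gcongr
        _ = _ := by ring
    have h5 := le_of_mul_le_mul_left h4 (by positivity)
    exact (div_le_div_iff_of_pos_right hf).1 h5

/-- At a singular point the leading term is `q_{m-1,n}` itself, with coefficients from the column
`a₀` of the inverse of the frame matrix. -/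
theorem isTameAt_of_mem (hF : IsFuchsian q) (hG : IsGeneric q) (hm : 0 < m)
    (ht : t ∉ bisectors q) (htS : t ∈ singularPoints q) : IsTameAt q t := by
  classical
  obtain ⟨D⟩ := nonempty_singularData hF hG hm htS
  obtain ⟨T, e, hT, hdec⟩ := exists_level_decomposition hF hG hm ht
  obtain ⟨n₀, hn₀⟩ := exists_forall_iteratedDeriv_eq_zero hF hm
  have htT : t ∉ T := fun h => (hT t h).2.1 rfl
  have htr := Metric.mem_ball_self (x := t) D.pos
  have hball : ∀ᶠ z in 𝓝[≠] t, z ∈ Metric.ball t D.r :=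
    nhdsWithin_le_nhds (Metric.ball_mem_nhds t D.pos)
  obtain ⟨k, -, F, hFan, hFk⟩ := exists_common_pole_order (ι := Fin m × Fin m)
    (f := fun x w => (frameMatrix D.g D.a₀ w)⁻¹ x.1 x.2)
    (fun x => D.frame.meromorphicAt_inv x.1 x.2) 0
  have hγ' : ∀ a, ∃ γ : ℂ → ℂ, a ≠ D.a₀ → ∀ ρ,
      ExtendsToBall (fun w => D.g a w - ∑ s ∈ T, γ s * e s w) t ρ := fun a => by
    by_cases ha : a = D.a₀
    · exact ⟨0, fun h => absurd ha h⟩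
    · obtain ⟨γ, hγ⟩ := hdec (D.g a) (D.frame.sol_g a ha t htr)
      exact ⟨γ, fun _ => hγ⟩
  choose γ hγ using hγ'
  have hgn : ∀ᶠ z in 𝓝 t, ∀ a, a ≠ D.a₀ → ∀ n ≥ n₀,
      iteratedDeriv n (D.g a) z = ∑ s ∈ T, γ a s * iteratedDeriv n (e s) z :=
    eventually_all.2 fun a => by
      by_cases ha : a = D.a₀
      · exact Eventually.of_forall fun z h => absurd ha h
      · exact (eventually_iteratedDeriv_eq_sum hn₀ (fun s hs => (hT s hs).2.2.1)
          (D.frame.sol_g a ha t htr) (hγ a ha)).mono fun z hz _ => hz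
  -- A column of an invertible matrix is not zero.
  have hF0 : ∃ j, ¬ ∀ᶠ z in 𝓝 t, F (j, D.a₀) z = 0 := by
    by_contra! h0
    have h0' : ∀ᶠ z in 𝓝[≠] t, ∀ j, F (j, D.a₀) z = 0 :=
      nhdsWithin_le_nhds (eventually_all.2 h0)
    obtain ⟨z, h1, h2, h3⟩ := (h0'.and
      (hball.and (self_mem_nhdsWithin : {t}ᶜ ∈ 𝓝[≠] t))).exists
    have h4 : frameMatrix D.g D.a₀ z * (frameMatrix D.g D.a₀ z)⁻¹ = 1 :=
      Matrix.mul_nonsing_inv _ (isUnit_iff_ne_zero.2 (D.det_ne z h2 h3))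
    have h5 := congrFun (congrFun h4 D.a₀) D.a₀
    rw [Matrix.mul_apply, Matrix.one_apply_eq, Finset.sum_eq_zero fun j _ => ?_] at h5
    · exact zero_ne_one h5
    · rw [hFk (j, D.a₀) z h3, h1 j, zero_div, mul_zero]
  obtain ⟨μ, u, hu, hu0, huF⟩ := exists_common_zero_order (fun j => hFan (j, D.a₀)) hF0
  obtain ⟨n₁, hlast, hdecl⟩ := D.exists_decay_last hm μ
  obtain ⟨ε₁, n₂, hε₁0, hε₁t, hne, hdecay⟩ := exists_uniform_decay hF hG hm ht hT
  have hε' : ∀ s, ∃ (ε : ℕ → ℝ) (n₂ : ℕ), (∀ n, 0 ≤ ε n) ∧ Tendsto ε atTop (𝓝 0) ∧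
      (s ∈ T → ∀ᶠ z in 𝓝[≠] t, ∀ n ≥ n₂, ‖iteratedDeriv n (e s) z‖
        ≤ ε n * (‖z - t‖ ^ μ * ‖value (derivCoeff q n (lastIdx D.a₀)) z‖)) := fun s => by
    by_cases hs : s ∈ T
    · obtain ⟨ε, n₂, h1, h2, h3⟩ := hdecl (e s) _ (dist_pos.2 (hT s hs).2.1) (hT s hs).2.2.2.1
      exact ⟨ε, n₂, h1, h2, fun _ => h3⟩
    · exact ⟨0, 0, fun n => le_rfl, tendsto_const_nhds, fun h => absurd h hs⟩
  choose ε₂ n₃ hε₂0 hε₂t hε₂ using hε'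
  set ε : ℕ → ℝ := fun n => ε₁ n + ∑ s ∈ T, ε₂ s n with hε
  have hsum0 : ∀ n, 0 ≤ ∑ s ∈ T, ε₂ s n := fun n => Finset.sum_nonneg fun s _ => hε₂0 s n
  have hεn : ∀ n, 0 ≤ ε n := fun n => add_nonneg (hε₁0 n) (hsum0 n)
  have hεt : Tendsto ε atTop (𝓝 0) := by
    have := hε₁t.add (tendsto_finsetSum T fun s _ => hε₂t s)
    simpa using this
  set n₄ := max (max n₀ n₁) (n₂ + ∑ s ∈ T, n₃ s) with hn₄
  set X : ℂ → ℕ → ℂ → ℂ := fun s n z =>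
    if s = t then value (derivCoeff q n (lastIdx D.a₀)) z else iteratedDeriv n (e s) z with hX
  have hXt : ∀ n z, X t n z = value (derivCoeff q n (lastIdx D.a₀)) z := fun n z => if_pos rfl
  have hXs : ∀ s ∈ T, ∀ n z, X s n z = iteratedDeriv n (e s) z := fun s hs n z =>
    if_neg fun h : s = t => htT (h ▸ hs)
  set b : ℂ → Fin m → ℂ → ℂ := fun s j z => if s = t then F (j, D.a₀) z
    else ∑ a ∈ Finset.univ.erase D.a₀, F (j, a) z * γ a s with hb
  have hbt : ∀ j z, b t j z = F (j, D.a₀) z := fun j z => if_pos rfl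
  have hbs : ∀ s ∈ T, ∀ j, b s j = fun z => ∑ a ∈ Finset.univ.erase D.a₀, F (j, a) z * γ a s :=
    fun s hs j => funext fun z => if_neg fun h : s = t => htT (h ▸ hs)
  have hlead : ∀ᶠ z in 𝓝[≠] t, ∀ n ≥ n₄, ∀ s ∈ T, ‖X s n z‖ ≤ ε n * (‖z - t‖ ^ μ * ‖X t n z‖) := by
    have h1 : ∀ᶠ z in 𝓝[≠] t, ∀ s ∈ T, ∀ n ≥ n₃ s, ‖iteratedDeriv n (e s) z‖
        ≤ ε₂ s n * (‖z - t‖ ^ μ * ‖value (derivCoeff q n (lastIdx D.a₀)) z‖) :=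
      (Finset.eventually_all T).2 fun s hs => hε₂ s hs
    filter_upwards [h1] with z hz n hn s hs
    rw [hXs s hs, hXt]
    have h2 : n₃ s ≤ n := (Finset.single_le_sum (fun s _ => Nat.zero_le (n₃ s)) hs).trans
      ((Nat.le_add_left _ _).trans ((le_max_right _ _).trans hn))
    refine (hz s hs n h2).trans (mul_le_mul_of_nonneg_right ?_ (by positivity))
    exact (Finset.single_le_sum (f := fun s => ε₂ s n) (fun s _ => hε₂0 s n) hs).trans
      (le_add_of_nonneg_left (hε₁0 n))
  have hd : ∀ s ∈ T, 0 < dist s t := fun s hs => dist_pos.2 (hT s hs).2.1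
  refine LocalExpansion.isTameAt (T := insert t T) (X := X) (b := b) (k := k) (n₀ := n₄) (ε := ε)
    (s₀ := t) (μ := μ) (u := u)
    { mem := Finset.mem_insert_self _ _
      min := fun s _ => by rw [dist_self]; exact dist_nonneg
      inj := ?_
      eps_nonneg := hεn
      tendsto_eps := hεt
      analytic := ?_
      eq := ?_
      ne := ?_
      decay := ?_
      decay_lead := ?_
      analytic_lead := hu
      lead_ne := hu0
      lead_eq := (huF.filter_mono nhdsWithin_le_nhds).mono fun z hz j => (hbt j z).trans (hz j) }
  · intro s hs s' hs' hss
    rcases Finset.mem_insert.1 hs with hst | hsT <;>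
      rcases Finset.mem_insert.1 hs' with hst' | hsT'
    · rw [hst, hst']
    · rw [hst, dist_self] at hss
      exact absurd hss (hd s' hsT').ne
    · rw [hst', dist_self] at hss
      exact absurd hss (hd s hsT).ne'
    · exact eq_of_dist_eq ht (hT s hsT).1 (hT s' hsT').1 hss
  · intro s hs j
    rcases Finset.mem_insert.1 hs with hst | hsT
    · rw [hst]
      exact (hFan (j, D.a₀)).congr (Eventually.of_forall fun z => (hbt j z).symm)
    · rw [hbs s hsT j]
      exact Finset.analyticAt_fun_sum _ fun a _ => (hFan (j, a)).mul analyticAt_const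
  · filter_upwards [hball, nhdsWithin_le_nhds hgn, self_mem_nhdsWithin] with z h1 h2 h3 n hn j
    have hn0 : n₀ ≤ n := (le_max_left _ _).trans ((le_max_left _ _).trans hn)
    have hzk : (z - t) ^ k ≠ 0 := pow_ne_zero _ (sub_ne_zero.2 h3)
    rw [eq_sum_inv_mul (D.det_ne z h1 h3) (D.sum_value_mul_frameMatrix hm h1 h3 n) j,
      Finset.sum_insert htT, ← Finset.add_sum_erase _ _ (Finset.mem_univ D.a₀), if_pos rfl,
      hXt, hbt, hFk (j, D.a₀) z h3, add_mul]
    congr 1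
    · field_simp
    · have h4 : ∀ s ∈ T, X s n z * b s j z = ∑ a ∈ Finset.univ.erase D.a₀,
          F (j, a) z * (γ a s * iteratedDeriv n (e s) z) := fun s hs => by
        rw [hXs s hs, hbs s hs, Finset.mul_sum]
        exact Finset.sum_congr rfl fun a _ => by ring
      rw [Finset.sum_congr rfl h4, Finset.sum_comm, Finset.sum_mul]
      refine Finset.sum_congr rfl fun a ha => ?_
      have ha' := Finset.ne_of_mem_erase ha
      rw [if_neg ha', h2 a ha' n hn0, ← Finset.mul_sum, hFk (j, a) z h3]
      field_simp
  · filter_upwards [hlast, nhdsWithin_le_nhds hne] with z h1 h2 n hn s hs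
    rcases Finset.mem_insert.1 hs with hst | hsT
    · rw [hst, hXt]
      exact h1 n ((le_max_right _ _).trans ((le_max_left _ _).trans hn))
    · rw [hXs s hsT]
      exact h2 n ((Nat.le_add_right _ _).trans ((le_max_right _ _).trans hn)) s hsT
  · filter_upwards [hlead, nhdsWithin_le_nhds hdecay,
      nhdsWithin_le_nhds (Metric.ball_mem_nhds t one_pos)] with z h1 h2 h3 n hn s hs s' hs' hss
    rcases Finset.mem_insert.1 hs' with hst' | hsT'
    · rw [hst', dist_self] at hss
      exact absurd hss (not_lt.2 dist_nonneg)
    rcases Finset.mem_insert.1 hs with hst | hsT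
    · rw [Metric.mem_ball, dist_eq_norm] at h3
      rw [hst]
      refine (h1 n hn s' hsT').trans (mul_le_mul_of_nonneg_left ?_ (hεn n))
      exact mul_le_of_le_one_left (norm_nonneg _) (pow_le_one₀ (norm_nonneg _) h3.le)
    · rw [hXs s hsT, hXs s' hsT']
      refine (h2 n ((Nat.le_add_right _ _).trans ((le_max_right _ _).trans hn)) s hsT s' hsT'
        hss).trans (mul_le_mul_of_nonneg_right (le_add_of_nonneg_right (hsum0 n)) (norm_nonneg _))
  · filter_upwards [hlead] with z h1 n hn s hs hst
    exact h1 n hn s ((Finset.mem_insert.1 hs).resolve_left hst)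

theorem isTameAt_of_notMem_bisectors (hS : (singularPoints q).Nonempty) (hF : IsFuchsian q)
    (hG : IsGeneric q) (hm : 0 < m) {z₀ : ℂ} (hz₀ : z₀ ∉ bisectors q) : IsTameAt q z₀ := by
  by_cases h : z₀ ∈ singularPoints q
  · exact isTameAt_of_mem hF hG hm hz₀ h
  · exact isTameAt_of_notMem hS hF hG hm hz₀ h

end

/-! ### From local to global convergence -/

section

variable {m : ℕ} {q : Fin m → RatFunc ℂ}

theorem isOpen_setOf_eventually_punctured {P : ℂ → Prop} (hP : ∀ z, P z → ∀ᶠ p in 𝓝 z, P p) :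
    IsOpen {z | ∀ᶠ p in 𝓝[≠] z, P p} := by
  refine isOpen_iff_mem_nhds.2 fun z (hz : ∀ᶠ p in 𝓝[≠] z, P p) => ?_
  filter_upwards [eventually_nhdsWithin_iff.1 hz] with p hp
  by_cases hpz : p = z
  · rw [hpz]
    exact hz
  · exact nhdsWithin_le_nhds (hP p (hp hpz))

/-- On a connected set, the type of the limit does not change. -/
theorem IsPreconnected.convergesAt_or_divergesAt {F : ℕ → RatFunc ℂ} {U : Set ℂ}
    (hU : IsPreconnected U) (h : ∀ z ∈ U, (∀ᶠ p in 𝓝[≠] z, ConvergesAt F p) ∨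
      ∀ᶠ p in 𝓝[≠] z, DivergesAt F p) :
    (∀ z ∈ U, ∀ᶠ p in 𝓝[≠] z, ConvergesAt F p) ∨ ∀ z ∈ U, ∀ᶠ p in 𝓝[≠] z, DivergesAt F p := by
  refine isPreconnected_iff_subset_of_disjoint.1 hU _ _
    (isOpen_setOf_eventually_punctured fun z hz => ConvergesAt.eventually hz)
    (isOpen_setOf_eventually_punctured fun z hz => DivergesAt.eventually hz) h ?_
  refine Set.eq_empty_of_forall_notMem fun z ⟨_, h1, h2⟩ => ?_
  obtain ⟨p, h3, h4⟩ := (Filter.Eventually.and (f := 𝓝[≠] z) h1 h2).exists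
  exact h3.not_divergesAt h4

theorem convergesOnCompacts_of_forall_convergesAt {F : ℕ → RatFunc ℂ} {V : Set ℂ}
    (h : ∀ p ∈ V, ConvergesAt F p) : ConvergesOnCompacts F V := by
  set f : ℂ → ℂ := fun p => limUnder atTop fun n => value (F n) p with hf
  refine ⟨f, fun K hKV hK => ?_⟩
  have key : (∀ᶠ n in atTop, ∀ z ∈ K, ¬ IsPole (F n) z) ∧
      ∀ ε > 0, ∀ᶠ n in atTop, ∀ z ∈ K, dist (f z) (value (F n) z) < ε := by
    refine hK.induction_on (p := fun A => (∀ᶠ n in atTop, ∀ z ∈ A, ¬ IsPole (F n) z) ∧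
      ∀ ε > 0, ∀ᶠ n in atTop, ∀ z ∈ A, dist (f z) (value (F n) z) < ε) ?_ ?_ ?_ ?_
    · exact ⟨Eventually.of_forall fun n z hz => hz.elim,
        fun ε _ => Eventually.of_forall fun n z hz => hz.elim⟩
    · exact fun A B hAB hB => ⟨hB.1.mono fun n hn z hz => hn z (hAB hz),
        fun ε hε => (hB.2 ε hε).mono fun n hn z hz => hn z (hAB hz)⟩
    · refine fun A B hA hB => ⟨?_, fun ε hε => ?_⟩
      · filter_upwards [hA.1, hB.1] with n h1 h2 z hz using hz.elim (h1 z) (h2 z)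
      · filter_upwards [hA.2 ε hε, hB.2 ε hε] with n h1 h2 z hz using hz.elim (h1 z) (h2 z)
    · intro p hp
      obtain ⟨W, hW, g, hpole, hg⟩ := h p (hKV hp)
      have hfg : ∀ z ∈ W, f z = g z := fun z hz => (hg.tendsto_at hz).limUnder_eq
      refine ⟨W, nhdsWithin_le_nhds hW, hpole, fun ε hε => ?_⟩
      filter_upwards [Metric.tendstoUniformlyOn_iff.1 hg ε hε] with n hn z hz
      rw [hfg z hz]
      exact hn z hz
  exact ⟨key.1, Metric.tendstoUniformlyOn_iff.2 key.2⟩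

theorem divergesToInftyOnCompacts_of_forall_divergesAt {F : ℕ → RatFunc ℂ} {V : Set ℂ}
    (h : ∀ p ∈ V, DivergesAt F p) : DivergesToInftyOnCompacts F V := by
  intro K hKV hK
  refine hK.induction_on (p := fun A => ∀ C : ℝ,
    ∀ᶠ n in atTop, ∀ z ∈ A, IsPole (F n) z ∨ C ≤ ‖value (F n) z‖) ?_ ?_ ?_ ?_
  · exact fun C => Eventually.of_forall fun n z hz => hz.elim
  · exact fun A B hAB hB C => (hB C).mono fun n hn z hz => hn z (hAB hz)
  · intro A B hA hB C
    filter_upwards [hA C, hB C] with n h1 h2 z hz using hz.elim (h1 z) (h2 z)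
  · intro p hp
    obtain ⟨W, hW, hd⟩ := h p (hKV hp)
    exact ⟨W, nhdsWithin_le_nhds hW, hd⟩

/-- A set without accumulation points in a compact set has finitely many points there. -/
theorem finite_inter_of_forall_eventually_punctured {E K : Set ℂ} (hK : IsCompact K)
    (h : ∀ z ∈ K, ∀ᶠ p in 𝓝[≠] z, p ∉ E) : (E ∩ K).Finite := by
  refine hK.induction_on (p := fun A => (E ∩ A).Finite) (by simp)
    (fun A B hAB hB => hB.subset (Set.inter_subset_inter_right E hAB))
    (fun A B hA hB => by rw [Set.inter_union_distrib_left]; exact hA.union hB) fun z hz => ?_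
  refine ⟨{p | p ≠ z → p ∉ E}, nhdsWithin_le_nhds (eventually_nhdsWithin_iff.1 (h z hz)),
    (Set.finite_singleton z).subset ?_⟩
  rintro p ⟨hpE, hp⟩
  by_contra hne
  exact hp hne hpE

/-- The points of `U` near which some quotient by the `j`-th coefficient has no uniform limit,
finite or infinite. The set is empty unless the `j`-th coefficient is nonzero for large `n`. -/
def exceptionalSet (q : Fin m → RatFunc ℂ) (U : Set ℂ) (j : Fin m) : Set ℂ :=
  {p | p ∈ U ∧ (∀ᶠ n in atTop, derivCoeff q n j ≠ 0) ∧
    ∃ i, ¬ ConvergesAt (fun n => derivCoeff q n i / derivCoeff q n j) p ∧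
      ¬ DivergesAt (fun n => derivCoeff q n i / derivCoeff q n j) p}

theorem IsTameAt.eventually_notMem_exceptionalSet {z : ℂ} (h : IsTameAt q z) (U : Set ℂ)
    (j : Fin m) : ∀ᶠ p in 𝓝[≠] z, p ∉ exceptionalSet q U j := by
  by_cases hj : ∀ᶠ n in atTop, derivCoeff q n j ≠ 0
  · have h1 : ∀ᶠ p in 𝓝[≠] z, ∀ i,
        ConvergesAt (fun n => derivCoeff q n i / derivCoeff q n j) p ∨
        DivergesAt (fun n => derivCoeff q n i / derivCoeff q n j) p := eventually_all.2 fun i =>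
      (h.punctured j hj i).elim (fun h => h.mono fun _ => Or.inl) fun h => h.mono fun _ => Or.inr
    filter_upwards [h1] with p hp ⟨_, _, i, h2, h3⟩
    exact (hp i).elim h2 h3
  · exact Eventually.of_forall fun p hp => hj hp.2.1

end

end FuchsianODE

end

theorem theorem3 (m : ℕ) (q : Fin m → RatFunc ℂ)
    (hS : (FuchsianODE.singularPoints q).Nonempty)
    (hF : FuchsianODE.IsFuchsian q)
    (hG : FuchsianODE.IsGeneric q)
    (U : Set ℂ)
    (hU : ∃ z₀ ∈ (FuchsianODE.bisectors q)ᶜ,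
      U = connectedComponentIn (FuchsianODE.bisectors q)ᶜ z₀) :
    ∃ E : Fin m → Set ℂ,
      (∀ j, E j ⊆ U ∧ ∀ K ⊆ U, IsCompact K → (E j ∩ K).Finite) ∧
      (∀ z ∈ U, ∃ j, (∃ᶠ n in Filter.atTop, FuchsianODE.derivCoeff q n j ≠ 0) ∧ z ∉ E j) ∧
      ∀ j k : Fin m, k ≠ j →
        (∃ᶠ n in Filter.atTop, FuchsianODE.derivCoeff q n j ≠ 0) →
        (∀ᶠ n in Filter.atTop, FuchsianODE.derivCoeff q n j ≠ 0) ∧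
        (FuchsianODE.ConvergesOnCompacts
            (fun n => FuchsianODE.derivCoeff q n k / FuchsianODE.derivCoeff q n j) (U \ E j) ∨
          FuchsianODE.DivergesToInftyOnCompacts
            (fun n => FuchsianODE.derivCoeff q n k / FuchsianODE.derivCoeff q n j) (U \ E j)) := by
  open FuchsianODE in
  have hm : 0 < m := by
    obtain ⟨_, i, _⟩ := hS
    exact i.pos
  obtain ⟨z₀, hz₀, rfl⟩ := hU
  set U := connectedComponentIn (bisectors q)ᶜ z₀ with hU
  have hUpre : IsPreconnected U := isPreconnected_connectedComponentIn
  have htame : ∀ z ∈ U, IsTameAt q z := fun z hz =>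
    isTameAt_of_notMem_bisectors hS hF hG hm (connectedComponentIn_subset _ _ hz)
  refine ⟨exceptionalSet q U, fun j => ⟨fun p hp => hp.1, fun K hK hKc => ?_⟩, fun z hz => ?_,
    fun j k _ hj => ?_⟩
  · exact finite_inter_of_forall_eventually_punctured hKc fun z hz =>
      (htame z (hK hz)).eventually_notMem_exceptionalSet U j
  · obtain ⟨j, hj, hconv⟩ := (htame z hz).self
    exact ⟨j, hj.frequently, fun ⟨_, _, i, h, _⟩ => h (hconv i)⟩
  · have hj' : ∀ᶠ n in atTop, derivCoeff q n j ≠ 0 :=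
      ((htame z₀ (mem_connectedComponentIn hz₀)).zero_or_ne j).resolve_left fun h =>
        hj (h.mono fun n hn h' => h' hn)
    have hlim : ∀ p ∈ U \ exceptionalSet q U j,
        ConvergesAt (fun n => derivCoeff q n k / derivCoeff q n j) p ∨
        DivergesAt (fun n => derivCoeff q n k / derivCoeff q n j) p := fun p hp => by
      by_contra! h
      exact hp.2 ⟨hp.1, hj', k, h⟩
    refine ⟨hj', (hUpre.convergesAt_or_divergesAt fun z hz =>
      (htame z hz).punctured j hj' k).imp (fun h => ?_) fun h => ?_⟩
    · refine convergesOnCompacts_of_forall_convergesAt fun p hp =>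
        (hlim p hp).resolve_right fun hd => ?_
      obtain ⟨w, h1, h2⟩ := ((h p hp.1).and (nhdsWithin_le_nhds hd.eventually)).exists
      exact h1.not_divergesAt h2
    · refine divergesToInftyOnCompacts_of_forall_divergesAt fun p hp =>
        (hlim p hp).resolve_left fun hd => ?_
      obtain ⟨w, h1, h2⟩ := ((h p hp.1).and (nhdsWithin_le_nhds hd.eventually)).exists
      exact ConvergesAt.not_divergesAt h2 h1
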